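/- **Setting.** Let $\Gamma$ be the Ginzburg dg algebra over $\mathbb{C}$ of the quiver of type $A_2$: the path algebra with vertices $1,2$ and arrows $a:1\to 2$ (degree $0$), $b:2\to 1$ (degree $-1$), loops $t_1$ at $1$ and $t_2$ at $2$ (degree $-2$), so that $a\in e_1\Gamma e_2$, with the differential of degree $+1$ given by $da=db=0$, $dt_1=ab$, $dt_2=-ba$. Let $\mathcal{D}$ be the full triangulated subcategory of the derived category of right dg $\Gamma$-modules consisting of the objects with finite-dimensional total cohomology. Let $S,T\in\mathcal{D}$ be the one-dimensional simple modules (in degree $0$) at the vertices $1$ and $2$, and let $\mathcal{A}^0\subset\mathcal{D}$ be the full subcategory of objects with cohomology concentrated in degree $0$. *Exchange graph.* A heart is the heart of a bounded t-structure on $\mathcal{D}$. If $X$ is a simple object of a heart $\mathcal{A}$ and $\langle X\rangle=\{X^{\oplus n}: n\ge 0\}$, then $\mathcal{A}'$ is a simple tilt of $\mathcal{A}$ at $X$ if either $(\mathcal{T},\mathcal{F})=(\langle X\rangle,\{Y\in\mathcal{A}:\operatorname{Hom}(X,Y)=0\})$ is a torsion pair in $\mathcal{A}$ and $\mathcal{A}'$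 is the left tilt (the extensions of objects of $\mathcal{T}[-1]$ by objects of $\mathcal{F}$), or $(\mathcal{T},\mathcal{F})=(\{Y\in\mathcal{A}:\operatorname{Hom}(Y,X)=0\},\langle X\rangle)$ is a torsion pair in $\mathcal{A}$ and $\mathcal{A}'$ is the right tilt (the extensions of objects of $\mathcal{T}$ by objects of $\mathcal{F}[1]$). The exchange graph $\mathrm{EG}(\mathcal{D})$ has the hearts of $\mathcal{D}$ as vertices, and an edge between two distinct hearts whenever one is a simple tilt of the other. *Autoequivalences.* $\operatorname{Aut}(\mathcal{D})$ is the group of exact $\mathbb{C}$-linear autoequivalences of $\mathcal{D}$ up to natural isomorphism; it acts on the set of hearts. For $X\in\{S,T\}$, a twist functor $\Phi_X$ is a functor with a natural transformation $\mathrm{id}\to\Phi_X$ exhibiting, for every $Y$, $\Phi_X(Y)$ as the cone of the evaluation $X\otimes\operatorname{Hom}^\bullet(X,Y)=\bigoplus_n X[n]\otimes\operatorname{Hom}(X[n],Y)\to Y$. **Proposition.** The standard heart $\mathcal{A}^0$ is a heart of $\mathcal{D}$, and there are classes in $\operatorname{Aut}(\mathcal{D})$ of twist functors $\Phi_S$,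 $\Phi_T$ and of the shift $[1]$. Let $\mathrm{EG}^0(\mathcal{D})$ be the connected component of $\mathrm{EG}(\mathcal{D})$ containing $\mathcal{A}^0$. 1. For any such $\Phi_S,\Phi_T$, every heart in $\mathrm{EG}^0(\mathcal{D})$ is of the form $g(\mathcal{A}^0)$ for some $g$ in the subgroup $\langle\Phi_S,\Phi_T,[1]\rangle$ of $\operatorname{Aut}(\mathcal{D})$. 2. Let $\operatorname{Aut}^0(\mathcal{D})$ be the quotient of the group of those elements of $\operatorname{Aut}(\mathcal{D})$ which preserve $\mathrm{EG}^0(\mathcal{D})$ by the normal subgroup of those which fix every vertex of $\mathrm{EG}^0(\mathcal{D})$. Then the set of vertices of $\mathrm{EG}^0(\mathcal{D})$ is a torsor for $\operatorname{Aut}^0(\mathcal{D})$: it is non-empty, and for any two vertices $\mathcal{A},\mathcal{B}$ there is exactly one $g\in\operatorname{Aut}^0(\mathcal{D})$ with $g(\mathcal{A})=\mathcal{B}$. -/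

import Mathlib

open CategoryTheory Limits Pretriangulated MulOpposite
open scoped DirectSum

/-- A differential graded algebra over `k`, with cohomological grading. -/
structure DGAlgebra (k : Type) [Field k] where
  carrier : Type
  [ring : Ring carrier]
  [algebra : Algebra k carrier]
  /-- the homogeneous components -/
  gr : ℤ → Submodule k carrier
  [graded : GradedAlgebra gr]
  /-- the differential -/
  d : carrier →ₗ[k] carrier
  d_mem : ∀ {n : ℤ} {a : carrier}, a ∈ gr n → d a ∈ gr (n + 1)
  d_d : ∀ a : carrier, d (d a) = 0
  leibniz : ∀ {n : ℤ} {a : carrier} (b : carrier), a ∈ gr n →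
    d (a * b) = d a * b + n.negOnePow • (a * d b)

attribute [instance] DGAlgebra.ring DGAlgebra.algebra DGAlgebra.graded

/-- A differential graded right module over the dg algebra `A`. -/
structure DGModule {k : Type} [Field k] (A : DGAlgebra k) where
  carrier : Type
  [addCommGroup : AddCommGroup carrier]
  [module : Module k carrier]
  /-- the right action: `op a • m` is `m a` -/
  [rightModule : Module A.carrierᵐᵒᵖ carrier]
  [isScalarTower : IsScalarTower k A.carrierᵐᵒᵖ carrier]
  /-- the homogeneous components -/
  gr : ℤ → Submodule k carrier
  isInternal : DirectSum.IsInternal gr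
  smul_mem : ∀ {i j : ℤ} {a : A.carrier} {m : carrier}, m ∈ gr i → a ∈ A.gr j →
    op a • m ∈ gr (i + j)
  /-- the differential -/
  d : carrier →ₗ[k] carrier
  d_mem : ∀ {n : ℤ} {m : carrier}, m ∈ gr n → d m ∈ gr (n + 1)
  d_d : ∀ m : carrier, d (d m) = 0
  leibniz : ∀ {n : ℤ} {m : carrier} (a : A.carrier), m ∈ gr n →
    d (op a • m) = op a • d m + n.negOnePow • (op (A.d a) • m)

attribute [instance] DGModule.addCommGroup DGModule.module DGModule.rightModule
  DGModule.isScalarTower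

namespace DGModule

variable {k : Type} [Field k] {A : DGAlgebra k}

/-- Morphisms of dg modules: `A`-linear maps of degree `0` commuting with the differentials. -/
@[ext]
structure Hom (M N : DGModule A) where
  lin : M.carrier →ₗ[A.carrierᵐᵒᵖ] N.carrier
  map_mem : ∀ {n : ℤ} {m : M.carrier}, m ∈ M.gr n → lin m ∈ N.gr n
  comm : ∀ m : M.carrier, lin (M.d m) = N.d (lin m)

instance : Category (DGModule A) where
  Hom := Hom
  id M := ⟨LinearMap.id, fun h => h, fun _ => rfl⟩
  comp f g := ⟨g.lin.comp f.lin, fun h => g.map_mem (f.map_mem h), fun m => by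
    simp [f.comm, g.comm]⟩

variable {M N P : DGModule A}

lemma hom_ext {f g : M ⟶ N} (h : ∀ m, f.lin m = g.lin m) : f = g :=
  Hom.ext (LinearMap.ext h)

@[simp] lemma id_lin (m : M.carrier) : Hom.lin (𝟙 M) m = m := rfl

@[simp] lemma comp_lin (f : M ⟶ N) (g : N ⟶ P) (m : M.carrier) :
    (f ≫ g).lin m = g.lin (f.lin m) := rfl

/-- The scalars of `k` act through the algebra `A`. -/
lemma map_k_smul {V W : Type} [AddCommGroup V] [Module k V] [Module A.carrierᵐᵒᵖ V]
    [IsScalarTower k A.carrierᵐᵒᵖ V] [AddCommGroup W] [Module k W] [Module A.carrierᵐᵒᵖ W]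
    [IsScalarTower k A.carrierᵐᵒᵖ W] (f : V →ₗ[A.carrierᵐᵒᵖ] W) (c : k) (v : V) :
    f (c • v) = c • f v := by
  rw [← one_smul A.carrierᵐᵒᵖ v, ← smul_assoc, map_smul, smul_assoc, one_smul, one_smul]

instance (M : DGModule A) : SMulCommClass A.carrierᵐᵒᵖ k M.carrier :=
  IsScalarTower.to_smulCommClass'

@[simp] lemma d_units_smul (u : ℤˣ) (m : M.carrier) : M.d (u • m) = u • M.d m := by
  simp [Units.smul_def]

@[simp] lemma lin_units_smul (f : M ⟶ N) (u : ℤˣ) (m : M.carrier) :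
    f.lin (u • m) = u • f.lin m := by
  simp [Units.smul_def]

lemma units_smul_mem {V : Type} [AddCommGroup V] [Module k V] (S : Submodule k V) (u : ℤˣ)
    {v : V} (h : v ∈ S) : u • v ∈ S := by
  rcases Int.units_eq_one_or u with rfl | rfl
  · simpa using h
  · simpa using h

instance : Zero (M ⟶ N) := ⟨⟨0, fun _ => by simp, fun _ => by simp⟩⟩
instance : Add (M ⟶ N) := ⟨fun f g => ⟨f.lin + g.lin,
  fun h => (N.gr _).add_mem (f.map_mem h) (g.map_mem h), fun m => by simp [f.comm, g.comm]⟩⟩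
instance : Neg (M ⟶ N) := ⟨fun f => ⟨-f.lin,
  fun h => (N.gr _).neg_mem (f.map_mem h), fun m => by simp [f.comm]⟩⟩
instance : SMul k (M ⟶ N) := ⟨fun c f => ⟨c • f.lin,
  fun h => (N.gr _).smul_mem c (f.map_mem h), fun m => by simp [f.comm]⟩⟩

@[simp] lemma zero_lin (m : M.carrier) : Hom.lin (0 : M ⟶ N) m = 0 := rfl
@[simp] lemma add_lin (f g : M ⟶ N) (m : M.carrier) : (f + g).lin m = f.lin m + g.lin m := rfl
@[simp] lemma neg_lin (f : M ⟶ N) (m : M.carrier) : Hom.lin (-f) m = -f.lin m := rfl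
@[simp] lemma smul_lin (c : k) (f : M ⟶ N) (m : M.carrier) :
    Hom.lin (c • f) m = c • f.lin m := rfl

instance : AddCommGroup (M ⟶ N) where
  add_assoc f g h := hom_ext fun m => by simp [add_assoc]
  zero_add f := hom_ext fun m => by simp
  add_zero f := hom_ext fun m => by simp
  add_comm f g := hom_ext fun m => by simp [add_comm]
  neg_add_cancel f := hom_ext fun m => by simp
  nsmul := nsmulRec
  zsmul := zsmulRec

@[simp] lemma sub_lin (f g : M ⟶ N) (m : M.carrier) :
    Hom.lin (f - g) m = f.lin m - g.lin m := by
  rw [sub_eq_add_neg, sub_eq_add_neg]; rfl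

instance : Preadditive (DGModule A) where
  add_comp _ _ _ f f' g := hom_ext fun m => by simp
  comp_add _ _ _ f g g' := hom_ext fun m => by simp

instance : Module k (M ⟶ N) where
  one_smul f := hom_ext fun m => by simp
  mul_smul c c' f := hom_ext fun m => by simp [mul_smul]
  smul_zero c := hom_ext fun m => by simp
  smul_add c f g := hom_ext fun m => by simp
  add_smul c c' f := hom_ext fun m => by simp [add_smul]
  zero_smul f := hom_ext fun m => by simp

instance : Linear k (DGModule A) where
  smul_comp _ _ _ c f g := hom_ext fun m => by simp
  comp_smul _ _ _ f c g := hom_ext fun m => by simp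

/-! ### Shifts -/

lemma isInternal_add (M : DGModule A) (n : ℤ) : DirectSum.IsInternal fun i => M.gr (i + n) := by
  have h := (DirectSum.isInternal_submodule_iff_iSupIndep_and_iSup_eq_top _).1 M.isInternal
  refine (DirectSum.isInternal_submodule_iff_iSupIndep_and_iSup_eq_top _).2
    ⟨h.1.comp (add_left_injective n), ?_⟩
  rw [← h.2]
  exact (Equiv.addRight n).iSup_comp (g := M.gr)

/-- The shift `M[n]` of a dg module: `M[n]^i = M^{i+n}`, with differential `(-1)^n d` and the
same right action. -/
@[reducible]
def shift (M : DGModule A) (n : ℤ) : DGModule A where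
  carrier := M.carrier
  gr i := M.gr (i + n)
  isInternal := M.isInternal_add n
  smul_mem {i j a m} hm ha := by
    have := M.smul_mem hm ha
    rwa [add_right_comm] at this
  d := n.negOnePow • M.d
  d_mem {i m} hm := by
    have := M.d_mem hm
    rw [add_right_comm] at this
    exact units_smul_mem _ _ this
  d_d m := by simp [M.d_d]
  leibniz {i m} a hm := by
    have := M.leibniz a hm
    simp only [LinearMap.smul_apply, this, smul_add, smul_comm n.negOnePow (op a)]
    rw [smul_smul, ← Int.negOnePow_add, show n + (i + n) = i + 2 * n by ring, Int.negOnePow_add,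
      Int.negOnePow_even (2 * n) (even_two_mul n), mul_one]

/-- The morphism with the same underlying linear map. -/
def shiftMap (f : M ⟶ N) (n : ℤ) : M.shift n ⟶ N.shift n where
  lin := f.lin
  map_mem h := f.map_mem h
  comm m := by
    simp [f.comm]

/-- The shift by `n` as a functor. -/
@[reducible]
def shiftFunctor' (n : ℤ) : DGModule A ⥤ DGModule A where
  obj M := M.shift n
  map f := shiftMap f n

/-- The identity map `M[m] ⟶ M[n]` for `m = n`. -/
def shiftCongr (M : DGModule A) {m n : ℤ} (h : m = n) : M.shift m ⟶ M.shift n where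
  lin := (LinearMap.id : M.carrier →ₗ[A.carrierᵐᵒᵖ] M.carrier)
  map_mem h' := by subst h; exact h'
  comm x := by subst h; rfl

lemma eqToHom_shift (M : DGModule A) {m n : ℤ} (h : m = n) (h' : M.shift m = M.shift n) :
    eqToHom h' = M.shiftCongr h := by
  subst h; rfl

/-- The isomorphism `M[0] ≅ M`. -/
def shiftZero (M : DGModule A) : M.shift 0 ≅ M where
  hom :=
    { lin := (LinearMap.id : M.carrier →ₗ[A.carrierᵐᵒᵖ] M.carrier)
      map_mem := fun {n m} h => by
        have h' : m ∈ M.gr (n + 0) := h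
        rwa [add_zero] at h'
      comm := fun m => by
        change (0 : ℤ).negOnePow • M.d m = M.d m
        simp }
  inv :=
    { lin := (LinearMap.id : M.carrier →ₗ[A.carrierᵐᵒᵖ] M.carrier)
      map_mem := fun {n m} h => by
        change m ∈ M.gr (n + 0)
        rwa [add_zero]
      comm := fun m => by
        change M.d m = (0 : ℤ).negOnePow • M.d m
        simp }
  hom_inv_id := rfl
  inv_hom_id := rfl

/-- The isomorphism `M[m + n] ≅ M[m][n]`. -/
def shiftAdd (M : DGModule A) (m n : ℤ) : M.shift (m + n) ≅ (M.shift m).shift n where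
  hom :=
    { lin := (LinearMap.id : M.carrier →ₗ[A.carrierᵐᵒᵖ] M.carrier)
      map_mem := fun {i x} h => by
        have h' : x ∈ M.gr (i + (m + n)) := h
        change x ∈ M.gr (i + n + m)
        rwa [add_assoc, add_comm n m]
      comm := fun x => by
        change (m + n).negOnePow • M.d x = n.negOnePow • (m.negOnePow • M.d x)
        rw [smul_smul, ← Int.negOnePow_add, add_comm] }
  inv :=
    { lin := (LinearMap.id : M.carrier →ₗ[A.carrierᵐᵒᵖ] M.carrier)
      map_mem := fun {i x} h => by
        have h' : x ∈ M.gr (i + n + m) := h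
        change x ∈ M.gr (i + (m + n))
        rwa [add_comm m n, ← add_assoc]
      comm := fun x => by
        change n.negOnePow • (m.negOnePow • M.d x) = (m + n).negOnePow • M.d x
        rw [smul_smul, ← Int.negOnePow_add, add_comm] }
  hom_inv_id := rfl
  inv_hom_id := rfl

variable (A) in
/-- The coherence data for the shift. -/
@[reducible]
def shiftMkCore : ShiftMkCore (DGModule A) ℤ where
  F := shiftFunctor'
  zero := NatIso.ofComponents (fun M => M.shiftZero) (fun _ => rfl)
  add m n := NatIso.ofComponents (fun M => M.shiftAdd m n) (fun _ => rfl)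
  assoc_hom_app m₁ m₂ m₃ X := by
    rw [eqToHom_shift X (add_assoc m₁ m₂ m₃)]; rfl
  zero_add_hom_app n X := by
    rw [eqToHom_shift X (zero_add n)]; rfl
  add_zero_hom_app n X := by
    rw [eqToHom_shift X (add_zero n)]; rfl

instance : HasShift (DGModule A) ℤ := hasShiftMk _ _ (shiftMkCore A)

instance (n : ℤ) : (shiftFunctor (DGModule A) n).Additive where
  map_add := rfl

instance (n : ℤ) : (shiftFunctor (DGModule A) n).Linear k where
  map_smul _ _ := rfl

end DGModule

namespace DGModule

variable {k : Type} [Field k] {A : DGAlgebra k} {M N P : DGModule A}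

@[simp] lemma shift_map_lin (f : M ⟶ N) (n : ℤ) (m : M.carrier) :
    ((shiftFunctor (DGModule A) n).map f).lin m = f.lin m := rfl

lemma shiftFunctorComm_lin (M : DGModule A) (i j : ℤ) (m : M.carrier) :
    ((shiftFunctorComm (DGModule A) i j).hom.app M).lin m = m := by
  have h : (shiftFunctorComm (DGModule A) i j).hom.app M =
      (M.shiftAdd i j).inv ≫ M.shiftCongr (add_comm i j) ≫ (M.shiftAdd j i).hom := by
    rw [← eqToHom_shift M (add_comm i j) (by rw [add_comm])]
    simp only [shiftFunctorComm, shiftFunctorAdd', Iso.trans_hom, NatTrans.comp_app,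
      eqToIso.hom, eqToHom_app, Iso.symm_hom]
    rfl
  rw [h]; rfl

/-! ### Homotopies -/

/-- Two morphisms of dg modules are homotopic if their difference is `d h + h d` for some
`A`-linear map `h` of degree `-1`. -/
def Homotopic : HomRel (DGModule A) := fun M N f g =>
  ∃ h : M.carrier →ₗ[A.carrierᵐᵒᵖ] N.carrier,
    (∀ (n : ℤ) (m : M.carrier), m ∈ M.gr (n + 1) → h m ∈ N.gr n) ∧
    ∀ m, f.lin m = g.lin m + N.d (h m) + h (M.d m)

instance : Congruence (Homotopic (A := A)) where
  comp_left := by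
    rintro M N P f g g' ⟨h, hh, e⟩
    exact ⟨h.comp f.lin, fun n m hm => hh _ _ (f.map_mem hm), fun m => by
      simp [e, f.comm]⟩
  comp_right := by
    rintro M N P f f' g ⟨h, hh, e⟩
    exact ⟨g.lin.comp h, fun n m hm => g.map_mem (hh _ _ hm), fun m => by
      simp [e, g.comm]⟩
  equivalence :=
    { refl := fun f => ⟨0, fun _ _ _ => Submodule.zero_mem _, fun m => by simp⟩
      symm := by
        rintro f g ⟨h, hh, e⟩
        exact ⟨-h, fun n m hm => Submodule.neg_mem _ (hh _ _ hm), fun m => by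
          simp only [e, LinearMap.neg_apply, map_neg]; abel⟩
      trans := by
        rintro f g g' ⟨h, hh, e⟩ ⟨h', hh', e'⟩
        exact ⟨h + h', fun n m hm => Submodule.add_mem _ (hh _ _ hm) (hh' _ _ hm), fun m => by
          simp only [e, e', LinearMap.add_apply, map_add]; abel⟩ }

lemma Homotopic.add ⦃M N : DGModule A⦄ (f f' g g' : M ⟶ N) (h : Homotopic f f')
    (h' : Homotopic g g') : Homotopic (f + g) (f' + g') := by
  obtain ⟨h, hh, e⟩ := h
  obtain ⟨h', hh', e'⟩ := h'
  exact ⟨h + h', fun n m hm => Submodule.add_mem _ (hh _ _ hm) (hh' _ _ hm), fun m => by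
    simp only [e, e', add_lin, LinearMap.add_apply, map_add]; abel⟩

lemma Homotopic.smul (c : k) ⦃M N : DGModule A⦄ (f f' : M ⟶ N) (h : Homotopic f f') :
    Homotopic (c • f) (c • f') := by
  obtain ⟨h, hh, e⟩ := h
  exact ⟨c • h, fun n m hm => Submodule.smul_mem _ _ (hh _ _ hm), fun m => by simp [e]⟩

instance : (Homotopic (A := A)).IsCompatibleWithShift ℤ where
  condition n M N f g := by
    rintro ⟨h, hh, e⟩
    refine ⟨n.negOnePow • h, fun i m hm => ?_, fun m => ?_⟩
    · exact units_smul_mem _ _ (hh _ _ (by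
        have hm' : m ∈ M.gr (i + 1 + n) := hm
        rwa [add_right_comm] at hm'))
    · have h1 : N.d (n.negOnePow • n.negOnePow • h m) = N.d (h m) := by
        rw [smul_smul, Int.units_mul_self, one_smul]
      have h2 : n.negOnePow • h (n.negOnePow • M.d m) = h (M.d m) := by
        have : h (n.negOnePow • M.d m) = n.negOnePow • h (M.d m) := by
          simp [Units.smul_def]
        rw [this, smul_smul, Int.units_mul_self, one_smul]
      have h3 : n.negOnePow • N.d (n.negOnePow • h m) = N.d (h m) := by
        rw [← d_units_smul, h1]
      exact (e m).trans (by rw [← h3, ← h2]; rfl)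

end DGModule

/-- The homotopy category of dg modules over `A`. -/
def DGHomotopyCategory {k : Type} [Field k] (A : DGAlgebra k) : Type 1 :=
  Quotient (DGModule.Homotopic (A := A))

namespace DGHomotopyCategory

open DGModule

variable {k : Type} [Field k] (A : DGAlgebra k)

instance : Category (DGHomotopyCategory A) :=
  inferInstanceAs (Category (Quotient (Homotopic (A := A))))

instance : Preadditive (DGHomotopyCategory A) :=
  Quotient.preadditive (Homotopic (A := A)) Homotopic.add

/-- The quotient functor from dg modules to the homotopy category. -/
def q : DGModule A ⥤ DGHomotopyCategory A := Quotient.functor _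

instance : (q A).Full := inferInstanceAs (Quotient.functor _).Full
instance : (q A).EssSurj := inferInstanceAs (Quotient.functor _).EssSurj
instance : (q A).Additive where
  map_add := rfl

instance : Linear k (DGHomotopyCategory A) :=
  letI : Preadditive (Quotient (Homotopic (A := A))) :=
    inferInstanceAs (Preadditive (DGHomotopyCategory A))
  letI : (Quotient.functor (Homotopic (A := A))).Additive := inferInstanceAs (q A).Additive
  Quotient.linear k (Homotopic (A := A)) Homotopic.smul

instance : (q A).Linear k where
  map_smul _ _ := rfl

noncomputable instance : HasShift (DGHomotopyCategory A) ℤ :=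
  inferInstanceAs (HasShift (Quotient (Homotopic (A := A))) ℤ)

noncomputable instance : (q A).CommShift ℤ :=
  inferInstanceAs ((Quotient.functor (Homotopic (A := A))).CommShift ℤ)

variable {A}

lemma q_map_eq {M N : DGModule A} {f g : M ⟶ N} (h : Homotopic f g) :
    (q A).map f = (q A).map g := CategoryTheory.Quotient.sound _ h

lemma q_map_eq_iff {M N : DGModule A} {f g : M ⟶ N} :
    (q A).map f = (q A).map g ↔ Homotopic f g := CategoryTheory.Quotient.functor_map_eq_iff _ f g

variable (A)

instance (n : ℤ) : (shiftFunctor (DGHomotopyCategory A) n).Additive where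
  map_add := by
    rintro M N f g
    obtain ⟨M, rfl⟩ : ∃ M', M = (q A).obj M' := ⟨M.as, rfl⟩
    obtain ⟨N, rfl⟩ : ∃ N', N = (q A).obj N' := ⟨N.as, rfl⟩
    obtain ⟨f, rfl⟩ := (q A).map_surjective f
    obtain ⟨g, rfl⟩ := (q A).map_surjective g
    rw [← cancel_mono (((q A).commShiftIso n).inv.app N), ← (q A).map_add,
      Preadditive.add_comp]
    simp only [Functor.commShiftIso_inv_naturality]
    rw [Functor.map_add, Functor.map_add, Preadditive.comp_add]

instance (n : ℤ) : (shiftFunctor (DGHomotopyCategory A) n).Linear k where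
  map_smul := by
    rintro M N f c
    obtain ⟨M, rfl⟩ : ∃ M', M = (q A).obj M' := ⟨M.as, rfl⟩
    obtain ⟨N, rfl⟩ : ∃ N', N = (q A).obj N' := ⟨N.as, rfl⟩
    obtain ⟨f, rfl⟩ := (q A).map_surjective f
    rw [← cancel_mono (((q A).commShiftIso n).inv.app N), ← (q A).map_smul,
      Linear.smul_comp]
    simp only [Functor.commShiftIso_inv_naturality]
    rw [Functor.map_smul, Functor.map_smul, Linear.comp_smul]

end DGHomotopyCategory

namespace DGModule

variable {k : Type} [Field k] {A : DGAlgebra k} {M N P : DGModule A}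

/-! ### Cones -/

lemma isInternal_prod {V W : Type} [AddCommGroup V] [AddCommGroup W] [Module k V] [Module k W]
    {𝒱 : ℤ → Submodule k V} {𝒲 : ℤ → Submodule k W} (hV : DirectSum.IsInternal 𝒱)
    (hW : DirectSum.IsInternal 𝒲) : DirectSum.IsInternal fun i => (𝒱 i).prod (𝒲 i) := by
  rw [DirectSum.isInternal_submodule_iff_iSupIndep_and_iSup_eq_top] at *
  constructor
  · intro i
    rw [Submodule.disjoint_def]
    rintro ⟨v, w⟩ h h'
    have hv := Submodule.disjoint_def.1 (hV.1 i) v h.1 (by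
      have := Submodule.mem_map_of_mem (f := LinearMap.fst k V W) h'
      simp only [Submodule.map_iSup] at this
      refine SetLike.le_def.1 (iSup₂_mono fun j _ => ?_) this
      rintro _ ⟨x, hx, rfl⟩
      exact hx.1)
    have hw := Submodule.disjoint_def.1 (hW.1 i) w h.2 (by
      have := Submodule.mem_map_of_mem (f := LinearMap.snd k V W) h'
      simp only [Submodule.map_iSup] at this
      refine SetLike.le_def.1 (iSup₂_mono fun j _ => ?_) this
      rintro _ ⟨x, hx, rfl⟩
      exact hx.2)
    rw [hv, hw]; rfl
  · rw [eq_top_iff]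
    rintro ⟨v, w⟩ -
    have hv : (v, (0 : W)) ∈ ⨆ i, (𝒱 i).prod (𝒲 i) := by
      have : v ∈ ⨆ i, 𝒱 i := by rw [hV.2]; trivial
      have := Submodule.mem_map_of_mem (f := LinearMap.inl k V W) this
      simp only [Submodule.map_iSup] at this
      refine SetLike.le_def.1 (iSup_mono fun j => ?_) this
      rintro _ ⟨x, hx, rfl⟩
      exact ⟨hx, Submodule.zero_mem _⟩
    have hw : ((0 : V), w) ∈ ⨆ i, (𝒱 i).prod (𝒲 i) := by
      have : w ∈ ⨆ i, 𝒲 i := by rw [hW.2]; trivial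
      have := Submodule.mem_map_of_mem (f := LinearMap.inr k V W) this
      simp only [Submodule.map_iSup] at this
      refine SetLike.le_def.1 (iSup_mono fun j => ?_) this
      rintro _ ⟨x, hx, rfl⟩
      exact ⟨Submodule.zero_mem _, hx⟩
    simpa using Submodule.add_mem _ hv hw

/-- The cone of `f : M ⟶ N`: the module `M[1] ⊕ N` with differential
`(m, n) ↦ (-d m, f m + d n)`. -/
@[reducible]
def cone (f : M ⟶ N) : DGModule A where
  carrier := M.carrier × N.carrier
  gr i := (M.gr (i + 1)).prod (N.gr i)
  isInternal := isInternal_prod (M.isInternal_add 1) N.isInternal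
  smul_mem {i j a x} hx ha := by
    refine ⟨?_, N.smul_mem hx.2 ha⟩
    have := M.smul_mem hx.1 ha
    rwa [add_right_comm] at this
  d := LinearMap.prod (-(M.d ∘ₗ LinearMap.fst k M.carrier N.carrier))
    ((f.lin.restrictScalars k) ∘ₗ LinearMap.fst k M.carrier N.carrier +
      N.d ∘ₗ LinearMap.snd k M.carrier N.carrier)
  d_mem {i x} hx := ⟨Submodule.neg_mem _ (M.d_mem hx.1),
    Submodule.add_mem _ (f.map_mem hx.1) (N.d_mem hx.2)⟩
  d_d x := by
    ext
    · simp [M.d_d]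
    · simp [N.d_d, f.comm]
  leibniz {i x} a hx := by
    have h1 := M.leibniz a hx.1
    have h2 := N.leibniz a hx.2
    ext
    · simp [h1, Int.negOnePow_succ]; abel
    · simp [h2]; abel

/-- The inclusion `N ⟶ cone f`. -/
def coneInr (f : M ⟶ N) : N ⟶ cone f where
  lin := LinearMap.inr _ _ _
  map_mem h := ⟨Submodule.zero_mem _, h⟩
  comm m := by
    change ((0 : M.carrier), N.d m) = (-M.d 0, f.lin 0 + N.d m)
    simp

/-- The projection `cone f ⟶ M[1]`. -/
def coneFst (f : M ⟶ N) : cone f ⟶ M⟦(1 : ℤ)⟧ where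
  lin := (LinearMap.fst _ _ _ : M.carrier × N.carrier →ₗ[A.carrierᵐᵒᵖ] M.carrier)
  map_mem h := h.1
  comm m := by
    change -M.d m.1 = (1 : ℤ).negOnePow • M.d m.1
    simp

@[simp] lemma coneInr_lin (f : M ⟶ N) (n : N.carrier) : (coneInr f).lin n = (0, n) := rfl
@[simp] lemma coneFst_lin (f : M ⟶ N) (x : M.carrier × N.carrier) : (coneFst f).lin x = x.1 := rfl

/-- The standard triangle `M ⟶ N ⟶ cone f ⟶ M[1]`. -/
abbrev coneTriangle (f : M ⟶ N) : Triangle (DGModule A) :=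
  Triangle.mk f (coneInr f) (coneFst f)

/-- The map of cones attached to a square which commutes up to a homotopy. -/
def coneMap {M' N' : DGModule A} (f : M ⟶ N) (f' : M' ⟶ N') (a : M ⟶ M') (b : N ⟶ N')
    (h : M.carrier →ₗ[A.carrierᵐᵒᵖ] N'.carrier)
    (hh : ∀ (n : ℤ) (m : M.carrier), m ∈ M.gr (n + 1) → h m ∈ N'.gr n)
    (e : ∀ m, b.lin (f.lin m) = f'.lin (a.lin m) + N'.d (h m) + h (M.d m)) :
    cone f ⟶ cone f' where
  lin := LinearMap.prod (a.lin ∘ₗ LinearMap.fst _ M.carrier N.carrier)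
    (h ∘ₗ LinearMap.fst _ M.carrier N.carrier + b.lin ∘ₗ LinearMap.snd _ M.carrier N.carrier)
  map_mem hx := ⟨a.map_mem hx.1, Submodule.add_mem _ (hh _ _ hx.1) (b.map_mem hx.2)⟩
  comm x := by
    change (a.lin (-M.d x.1), h (-M.d x.1) + b.lin (f.lin x.1 + N.d x.2)) =
      (-M'.d (a.lin x.1), f'.lin (a.lin x.1) + N'.d (h x.1 + b.lin x.2))
    ext
    · simp [a.comm]
    · simp only [map_neg, map_add, e, b.comm]; abel

lemma Homotopic.of_eq {f g : M ⟶ N} (h : f = g) : Homotopic f g :=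
  h ▸ Congruence.equivalence.refl _

/-- The identity of the cone of an identity is null-homotopic. -/
lemma homotopic_cone_id (M : DGModule A) : Homotopic (𝟙 (cone (𝟙 M))) 0 :=
  ⟨LinearMap.prod (LinearMap.snd _ _ _) 0, fun _ _ h => ⟨h.2, Submodule.zero_mem _⟩, fun x => by
    change x = 0 + (-M.d x.2, x.2 + M.d 0) + (x.1 + M.d x.2, (0 : M.carrier))
    ext
    · simp
    · simp⟩

/-- The map `M[1] ⟶ cone (coneInr f)`, a homotopy equivalence. -/
def rotateHom (f : M ⟶ N) : M⟦(1 : ℤ)⟧ ⟶ cone (coneInr f) where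
  lin := (LinearMap.prod (-f.lin) (LinearMap.inl _ _ _) :
    M.carrier →ₗ[A.carrierᵐᵒᵖ] N.carrier × (M.carrier × N.carrier))
  map_mem h := ⟨Submodule.neg_mem _ (f.map_mem h), h, Submodule.zero_mem _⟩
  comm m := by
    have : (M⟦(1 : ℤ)⟧).d m = -M.d m := by
      change (1 : ℤ).negOnePow • M.d m = _
      simp
    rw [this]
    change (-f.lin (-M.d m), (-M.d m, (0 : N.carrier))) =
      (-N.d (-f.lin m), (0, -f.lin m) + (-M.d m, f.lin m + N.d 0))
    simp [f.comm]

/-- The homotopy inverse of `rotateHom`. -/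
def rotateInv (f : M ⟶ N) : cone (coneInr f) ⟶ M⟦(1 : ℤ)⟧ where
  lin := (LinearMap.fst _ _ _ ∘ₗ LinearMap.snd _ _ _ :
    N.carrier × (M.carrier × N.carrier) →ₗ[A.carrierᵐᵒᵖ] M.carrier)
  map_mem h := h.2.1
  comm m := by
    change (0 : M.carrier) + -M.d m.2.1 = (1 : ℤ).negOnePow • M.d m.2.1
    simp

lemma rotateHom_inv (f : M ⟶ N) : rotateHom f ≫ rotateInv f = 𝟙 _ := rfl

lemma rotateInv_hom (f : M ⟶ N) : Homotopic (rotateInv f ≫ rotateHom f) (𝟙 _) :=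
  ⟨(LinearMap.inl _ _ _ ∘ₗ (-LinearMap.snd _ _ _) ∘ₗ LinearMap.snd _ _ _ :
    N.carrier × (M.carrier × N.carrier) →ₗ[A.carrierᵐᵒᵖ] N.carrier × (M.carrier × N.carrier)),
    fun n m h => ⟨Submodule.neg_mem _ h.2.2, Submodule.zero_mem _⟩,
    fun x => by
      change (-f.lin x.2.1, (x.2.1, (0 : N.carrier))) =
        x + (-N.d (-x.2.2), ((0, -x.2.2) : M.carrier × N.carrier) +
          (-M.d 0, f.lin 0 + N.d 0)) +
        (-(x.1 + (f.lin x.2.1 + N.d x.2.2)), (0 : M.carrier × N.carrier))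
      ext
      · simp; abel
      · simp
      · simp⟩

/-- The isomorphism `(cone f)[n] ≅ cone (f[n])`. -/
def coneShiftIso (f : M ⟶ N) (n : ℤ) : (cone f)⟦n⟧ ≅ cone (f⟦n⟧') where
  hom :=
    { lin := (LinearMap.prod (n.negOnePow • LinearMap.fst _ _ _) (LinearMap.snd _ _ _) :
        M.carrier × N.carrier →ₗ[A.carrierᵐᵒᵖ] M.carrier × N.carrier)
      map_mem := fun {i x} h => by
        have h1 : x.1 ∈ M.gr (i + n + 1) := h.1
        rw [add_right_comm] at h1
        exact ⟨units_smul_mem _ _ h1, h.2⟩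
      comm := fun x => by
        change (n.negOnePow • n.negOnePow • (-M.d x.1), n.negOnePow • (f.lin x.1 + N.d x.2)) =
          (-(n.negOnePow • M.d (n.negOnePow • x.1)),
            f.lin (n.negOnePow • x.1) + n.negOnePow • N.d x.2)
        simp }
  inv :=
    { lin := (LinearMap.prod (n.negOnePow • LinearMap.fst _ _ _) (LinearMap.snd _ _ _) :
        M.carrier × N.carrier →ₗ[A.carrierᵐᵒᵖ] M.carrier × N.carrier)
      map_mem := fun {i x} h => by
        have h1 : x.1 ∈ M.gr (i + 1 + n) := h.1
        rw [add_right_comm] at h1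
        exact ⟨units_smul_mem _ _ h1, h.2⟩
      comm := fun x => by
        change (n.negOnePow • -(n.negOnePow • M.d x.1), f.lin x.1 + n.negOnePow • N.d x.2) =
          n.negOnePow • ((-M.d (n.negOnePow • x.1),
            f.lin (n.negOnePow • x.1) + N.d x.2) : M.carrier × N.carrier)
        simp [smul_smul] }
  hom_inv_id := hom_ext fun x => by
    change ((n.negOnePow • n.negOnePow • x.1, x.2) : M.carrier × N.carrier) = x
    simp [smul_smul]
  inv_hom_id := hom_ext fun x => by
    change ((n.negOnePow • n.negOnePow • x.1, x.2) : M.carrier × N.carrier) = x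
    simp [smul_smul]

@[simp]
lemma units_smul_lin (u : ℤˣ) (f : M ⟶ N) (m : M.carrier) :
    Hom.lin (u • f) m = u • f.lin m := by
  rcases Int.units_eq_one_or u with rfl | rfl
  · simp
  · simp

/-- The isomorphism between the shift of a standard triangle and a standard triangle. -/
noncomputable def coneTriangleShiftIso (f : M ⟶ N) (n : ℤ) :
    (Triangle.shiftFunctor _ n).obj (coneTriangle f) ≅ coneTriangle (f⟦n⟧') :=
  Triangle.isoMk _ _ (Iso.refl _) (n.negOnePow • Iso.refl _) (coneShiftIso f n)
    (by
      change (n.negOnePow • f⟦n⟧') ≫ (n.negOnePow • 𝟙 (N⟦n⟧)) = 𝟙 _ ≫ f⟦n⟧'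
      rw [Linear.comp_units_smul, Linear.units_smul_comp, smul_smul, Int.units_mul_self, one_smul,
        Category.comp_id, Category.id_comp])
    (by
      change (n.negOnePow • (coneInr f)⟦n⟧') ≫ (coneShiftIso f n).hom =
        (n.negOnePow • 𝟙 (N⟦n⟧)) ≫ coneInr (f⟦n⟧')
      rw [Linear.units_smul_comp, Linear.units_smul_comp, Category.id_comp]
      congr 1
      refine hom_ext fun m => ?_
      change ((n.negOnePow • (0 : M.carrier), m) : M.carrier × N.carrier) = (0, m)
      simp)
    (by
      change (n.negOnePow • ((coneFst f)⟦n⟧' ≫ (shiftFunctorComm (DGModule A) 1 n).hom.app M)) ≫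
        (𝟙 (M⟦n⟧))⟦(1 : ℤ)⟧' = (coneShiftIso f n).hom ≫ coneFst (f⟦n⟧')
      refine (congrArg (fun φ => _ ≫ φ) (CategoryTheory.Functor.map_id _ _)).trans
        ((Category.comp_id _).trans ?_)
      refine hom_ext fun m => ?_
      rw [units_smul_lin, comp_lin, shiftFunctorComm_lin]
      rfl)

/-- The map of cones `cone f ⟶ cone (f ≫ g)` induced by `g`. -/
abbrev octaMap (f : M ⟶ N) (g : N ⟶ P) : cone f ⟶ cone (f ≫ g) :=
  coneMap f (f ≫ g) (𝟙 M) g 0 (fun _ _ _ => Submodule.zero_mem _) (fun m => by simp)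

/-- The map of cones `cone (f ≫ g) ⟶ cone g` induced by `f`. -/
abbrev octaMap' (f : M ⟶ N) (g : N ⟶ P) : cone (f ≫ g) ⟶ cone g :=
  coneMap (f ≫ g) g f (𝟙 P) 0 (fun _ _ _ => Submodule.zero_mem _) (fun m => by simp)

/-- The homotopy equivalence in the octahedron axiom. -/
def octaInv (f : M ⟶ N) (g : N ⟶ P) : cone (octaMap f g) ⟶ cone g where
  lin := (LinearMap.prod
      (LinearMap.snd A.carrierᵐᵒᵖ M.carrier N.carrier ∘ₗ
          LinearMap.fst A.carrierᵐᵒᵖ (M.carrier × N.carrier) (M.carrier × P.carrier) +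
        f.lin ∘ₗ LinearMap.fst A.carrierᵐᵒᵖ M.carrier P.carrier ∘ₗ
          LinearMap.snd A.carrierᵐᵒᵖ (M.carrier × N.carrier) (M.carrier × P.carrier))
      (LinearMap.snd A.carrierᵐᵒᵖ M.carrier P.carrier ∘ₗ
        LinearMap.snd A.carrierᵐᵒᵖ (M.carrier × N.carrier) (M.carrier × P.carrier)) :
    (M.carrier × N.carrier) × (M.carrier × P.carrier) →ₗ[A.carrierᵐᵒᵖ] N.carrier × P.carrier)
  map_mem h := ⟨Submodule.add_mem _ h.1.2 (f.map_mem h.2.1), h.2.2⟩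
  comm x := by
    change (-(f.lin x.1.1 + N.d x.1.2) + f.lin (x.1.1 + -M.d x.2.1),
        (0 + g.lin x.1.2) + (g.lin (f.lin x.2.1) + P.d x.2.2)) =
      (-N.d (x.1.2 + f.lin x.2.1), g.lin (x.1.2 + f.lin x.2.1) + P.d x.2.2)
    ext
    · simp only [map_neg, map_add, f.comm]; abel
    · simp only [map_add]; abel

/-- The homotopy inverse of `octaInv`. -/
def octaHom (f : M ⟶ N) (g : N ⟶ P) : cone g ⟶ cone (octaMap f g) where
  lin := (LinearMap.prod (LinearMap.inr _ _ _ ∘ₗ LinearMap.fst _ _ _)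
      (LinearMap.inr _ _ _ ∘ₗ LinearMap.snd _ _ _) :
    N.carrier × P.carrier →ₗ[A.carrierᵐᵒᵖ] (M.carrier × N.carrier) × (M.carrier × P.carrier))
  map_mem h := ⟨⟨Submodule.zero_mem _, h.1⟩, ⟨Submodule.zero_mem _, h.2⟩⟩
  comm x := by
    change (((0 : M.carrier), -N.d x.1), ((0 : M.carrier), g.lin x.1 + P.d x.2)) =
      ((-(-M.d 0), -(f.lin 0 + N.d x.1)),
        ((0 : M.carrier), 0 + g.lin x.1) + (-M.d 0, g.lin (f.lin 0) + P.d x.2))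
    simp

lemma octaHom_inv (f : M ⟶ N) (g : N ⟶ P) : octaHom f g ≫ octaInv f g = 𝟙 _ :=
  hom_ext fun x => by
    change (x.1 + f.lin 0, x.2) = x
    simp

lemma octaInv_hom (f : M ⟶ N) (g : N ⟶ P) : Homotopic (octaInv f g ≫ octaHom f g) (𝟙 _) :=
  ⟨(LinearMap.inl _ _ _ ∘ₗ LinearMap.inl _ _ _ ∘ₗ (-LinearMap.fst _ _ _) ∘ₗ LinearMap.snd _ _ _ :
    (M.carrier × N.carrier) × (M.carrier × P.carrier) →ₗ[A.carrierᵐᵒᵖ]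
      (M.carrier × N.carrier) × (M.carrier × P.carrier)),
    fun n m h => ⟨⟨Submodule.neg_mem _ h.2.1, Submodule.zero_mem _⟩, Submodule.zero_mem _⟩,
    fun x => by
      change (((0 : M.carrier), x.1.2 + f.lin x.2.1), ((0 : M.carrier), x.2.2)) =
        x + ((-(-M.d (-x.2.1)), -(f.lin (-x.2.1) + N.d 0)),
          (-x.2.1, 0 + g.lin 0) + (-M.d 0, g.lin (f.lin 0) + P.d 0)) +
        ((-(x.1.1 + -M.d x.2.1), (0 : N.carrier)), (0 : M.carrier × P.carrier))
      ext <;> simp⟩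

/-- A dg module whose underlying module is zero. -/
@[reducible]
def zeroModule (A : DGAlgebra k) : DGModule A where
  carrier := PUnit
  gr _ := ⊥
  isInternal := (DirectSum.isInternal_submodule_iff_iSupIndep_and_iSup_eq_top _).2
    ⟨fun _ => disjoint_bot_left, Subsingleton.elim _ _⟩
  smul_mem _ _ := Subsingleton.elim _ _
  d := 0
  d_mem _ := Subsingleton.elim _ _
  d_d _ := rfl
  leibniz _ _ := rfl

instance : HasZeroObject (DGModule A) :=
  ⟨⟨zeroModule A,
    fun M => ⟨⟨⟨0⟩, fun f => hom_ext fun m => by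
      rw [Subsingleton.elim m 0, map_zero, map_zero]⟩⟩,
    fun M => ⟨⟨⟨0⟩, fun f => hom_ext fun m => Subsingleton.elim (α := PUnit) _ _⟩⟩⟩⟩

end DGModule

namespace DGHomotopyCategory

open DGModule

variable {k : Type} [Field k] (A : DGAlgebra k)

instance : HasZeroObject (DGHomotopyCategory A) := (q A).hasZeroObject_of_additive

variable {A}

/-- The isomorphism in the homotopy category given by a homotopy equivalence. -/
@[simps]
def isoOfHomotopyEquiv {M N : DGModule A} (i : M ⟶ N) (p : N ⟶ M) (h : Homotopic (i ≫ p) (𝟙 M))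
    (h' : Homotopic (p ≫ i) (𝟙 N)) : (q A).obj M ≅ (q A).obj N where
  hom := (q A).map i
  inv := (q A).map p
  hom_inv_id := by rw [← Functor.map_comp, q_map_eq h, CategoryTheory.Functor.map_id]
  inv_hom_id := by rw [← Functor.map_comp, q_map_eq h', CategoryTheory.Functor.map_id]

/-- The standard triangle attached to a morphism of dg modules, in the homotopy category. -/
noncomputable abbrev coneTriangleh {M N : DGModule A} (f : M ⟶ N) :
    Triangle (DGHomotopyCategory A) :=
  (q A).mapTriangle.obj (coneTriangle f)

variable (A) in
/-- The distinguished triangles are the triangles isomorphic to a standard triangle. -/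
def distinguishedTriangles : Set (Triangle (DGHomotopyCategory A)) :=
  {T | ∃ (M N : DGModule A) (f : M ⟶ N), Nonempty (T ≅ coneTriangleh f)}

lemma isZero_cone_id (M : DGModule A) : IsZero ((q A).obj (cone (𝟙 M))) := by
  rw [IsZero.iff_id_eq_zero, ← CategoryTheory.Functor.map_id, q_map_eq (homotopic_cone_id M), Functor.map_zero]

lemma isomorphic_distinguished (T₁ : Triangle (DGHomotopyCategory A))
    (hT₁ : T₁ ∈ distinguishedTriangles A) (T₂ : Triangle (DGHomotopyCategory A))
    (e : T₂ ≅ T₁) : T₂ ∈ distinguishedTriangles A := by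
  obtain ⟨X, Y, f, ⟨e'⟩⟩ := hT₁
  exact ⟨X, Y, f, ⟨e ≪≫ e'⟩⟩

lemma contractible_distinguished (X : DGHomotopyCategory A) :
    contractibleTriangle X ∈ distinguishedTriangles A := by
  obtain ⟨M, rfl⟩ : ∃ M, X = (q A).obj M := ⟨X.as, rfl⟩
  have h := isZero_cone_id M
  refine ⟨_, _, 𝟙 M, ⟨?_⟩⟩
  refine Triangle.isoMk _ _ (Iso.refl _) (Iso.refl _) h.isoZero.symm ?_ ?_ ?_
  · exact ((Category.id_comp _).trans ((q A).map_id M).symm).trans (Category.id_comp _).symm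
  · exact h.eq_of_tgt _ _
  · exact (isZero_zero _).eq_of_src _ _

lemma distinguished_cocone_triangle {X Y : DGHomotopyCategory A} (f : X ⟶ Y) :
    ∃ (Z : DGHomotopyCategory A) (g : Y ⟶ Z) (h : Z ⟶ X⟦(1 : ℤ)⟧),
      Triangle.mk f g h ∈ distinguishedTriangles A := by
  obtain ⟨M, rfl⟩ : ∃ M, X = (q A).obj M := ⟨X.as, rfl⟩
  obtain ⟨N, rfl⟩ : ∃ M, Y = (q A).obj M := ⟨Y.as, rfl⟩
  obtain ⟨f, rfl⟩ := (q A).map_surjective f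
  exact ⟨_, _, _, ⟨_, _, f, ⟨Iso.refl _⟩⟩⟩

/-- The rotation of a standard triangle is isomorphic to a standard triangle. -/
noncomputable def rotateIso {M N : DGModule A} (f : M ⟶ N) :
    (coneTriangleh f).rotate ≅ coneTriangleh (coneInr f) :=
  Triangle.isoMk _ _ (Iso.refl _) (Iso.refl _)
    (((q A).commShiftIso (1 : ℤ)).symm.app M ≪≫
      isoOfHomotopyEquiv (rotateHom f) (rotateInv f)
        (Homotopic.of_eq (rotateHom_inv f)) (rotateInv_hom f))
    ((Category.comp_id _).trans (Category.id_comp _).symm)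
    (by
      change ((q A).map (coneFst f) ≫ ((q A).commShiftIso (1 : ℤ)).hom.app M) ≫
        ((q A).commShiftIso (1 : ℤ)).inv.app M ≫ (q A).map (rotateHom f) =
          𝟙 _ ≫ (q A).map (coneInr (coneInr f))
      rw [Category.assoc, Iso.hom_inv_id_app_assoc, Category.id_comp, ← Functor.map_comp]
      have : coneInr (coneInr f) ≫ rotateInv f = coneFst f := rfl
      rw [← this, Category.assoc, Functor.map_comp, q_map_eq (rotateInv_hom f), CategoryTheory.Functor.map_id,
        Category.comp_id])
    (by
      change (-((shiftFunctor (DGHomotopyCategory A) (1 : ℤ)).map ((q A).map f))) ≫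
          (shiftFunctor (DGHomotopyCategory A) (1 : ℤ)).map (𝟙 _) =
        (((q A).commShiftIso (1 : ℤ)).inv.app M ≫ (q A).map (rotateHom f)) ≫
          (q A).map (coneFst (coneInr f)) ≫ ((q A).commShiftIso (1 : ℤ)).hom.app N
      have h : rotateHom f ≫ coneFst (coneInr f) = -f⟦(1 : ℤ)⟧' := rfl
      rw [CategoryTheory.Functor.map_id, Category.comp_id, Category.assoc, ← Functor.map_comp_assoc, h,
        Functor.map_neg, Preadditive.neg_comp, Functor.commShiftIso_hom_naturality,
        Preadditive.comp_neg, Iso.inv_hom_id_app_assoc])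

lemma rotate_distinguished_triangle' (T : Triangle (DGHomotopyCategory A))
    (hT : T ∈ distinguishedTriangles A) : T.rotate ∈ distinguishedTriangles A := by
  obtain ⟨K, L, φ, ⟨e⟩⟩ := hT
  exact ⟨_, _, _, ⟨(rotate _).mapIso e ≪≫ rotateIso φ⟩⟩

lemma shift_distinguished_triangle (T : Triangle (DGHomotopyCategory A))
    (hT : T ∈ distinguishedTriangles A) (n : ℤ) :
    (Triangle.shiftFunctor _ n).obj T ∈ distinguishedTriangles A := by
  obtain ⟨K, L, φ, ⟨e⟩⟩ := hT
  exact ⟨_, _, _, ⟨Functor.mapIso _ e ≪≫ ((q A).mapTriangle.commShiftIso n).symm.app _ ≪≫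
    (q A).mapTriangle.mapIso (coneTriangleShiftIso φ n)⟩⟩

lemma invRotate_distinguished_triangle' (T : Triangle (DGHomotopyCategory A))
    (hT : T ∈ distinguishedTriangles A) : T.invRotate ∈ distinguishedTriangles A :=
  isomorphic_distinguished _
    (shift_distinguished_triangle _ (rotate_distinguished_triangle' _
      (rotate_distinguished_triangle' _ hT)) _) _
    ((invRotateIsoRotateRotateShiftFunctorNegOne _).app T)

lemma rotate_distinguished_triangle (T : Triangle (DGHomotopyCategory A)) :
    T ∈ distinguishedTriangles A ↔ T.rotate ∈ distinguishedTriangles A :=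
  ⟨rotate_distinguished_triangle' T, fun hT =>
    isomorphic_distinguished _ (invRotate_distinguished_triangle' T.rotate hT) _
      ((triangleRotation _).unitIso.app T)⟩

/-- The morphism of standard triangles attached to a square which commutes up to homotopy. -/
noncomputable def coneTrianglehMap {M N M' N' : DGModule A} (f : M ⟶ N) (f' : M' ⟶ N')
    (a : M ⟶ M') (b : N ⟶ N') (h : M.carrier →ₗ[A.carrierᵐᵒᵖ] N'.carrier)
    (hh : ∀ (n : ℤ) (m : M.carrier), m ∈ M.gr (n + 1) → h m ∈ N'.gr n)
    (e : ∀ m, b.lin (f.lin m) = f'.lin (a.lin m) + N'.d (h m) + h (M.d m)) :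
    coneTriangleh f ⟶ coneTriangleh f' where
  hom₁ := (q A).map a
  hom₂ := (q A).map b
  hom₃ := (q A).map (coneMap f f' a b h hh e)
  comm₁ := by
    change (q A).map f ≫ (q A).map b = (q A).map a ≫ (q A).map f'
    rw [← Functor.map_comp, ← Functor.map_comp]
    exact q_map_eq ⟨h, hh, e⟩
  comm₂ := by
    change (q A).map (coneInr f) ≫ (q A).map (coneMap f f' a b h hh e) =
      (q A).map b ≫ (q A).map (coneInr f')
    rw [← Functor.map_comp, ← Functor.map_comp]
    congr 1
    refine hom_ext fun m => ?_
    change (a.lin 0, h 0 + b.lin m) = (0, b.lin m)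
    simp
  comm₃ := by
    change ((q A).map (coneFst f) ≫ ((q A).commShiftIso (1 : ℤ)).hom.app M) ≫
        (shiftFunctor _ (1 : ℤ)).map ((q A).map a) =
      (q A).map (coneMap f f' a b h hh e) ≫
        (q A).map (coneFst f') ≫ ((q A).commShiftIso (1 : ℤ)).hom.app M'
    rw [Category.assoc, ← Functor.commShiftIso_hom_naturality, ← Functor.map_comp_assoc,
      ← Functor.map_comp_assoc]
    rfl

lemma comp_conj {C : Type*} [Category C] {X Y X' Y' : C} (r : X ⟶ Y) (i : Y ⟶ X) (a : X ⟶ X')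
    (j : X' ⟶ Y') (s : Y' ⟶ X') (h : r ≫ i = 𝟙 X) (h' : j ≫ s = 𝟙 X') :
    r ≫ (i ≫ a ≫ j) ≫ s = a := by
  rw [Category.assoc, Category.assoc, h', Category.comp_id, reassoc_of% h]

lemma complete_distinguished_triangle_morphism (T₁ T₂ : Triangle (DGHomotopyCategory A))
    (hT₁ : T₁ ∈ distinguishedTriangles A) (hT₂ : T₂ ∈ distinguishedTriangles A)
    (a : T₁.obj₁ ⟶ T₂.obj₁) (b : T₁.obj₂ ⟶ T₂.obj₂) (fac : T₁.mor₁ ≫ b = a ≫ T₂.mor₁) :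
    ∃ c : T₁.obj₃ ⟶ T₂.obj₃, T₁.mor₂ ≫ c = b ≫ T₂.mor₂ ∧
      T₁.mor₃ ≫ a⟦(1 : ℤ)⟧' = c ≫ T₂.mor₃ := by
  obtain ⟨K₁, L₁, φ₁, ⟨e₁⟩⟩ := hT₁
  obtain ⟨K₂, L₂, φ₂, ⟨e₂⟩⟩ := hT₂
  obtain ⟨i₁, hi₁⟩ : ∃ i : (q A).obj K₁ ⟶ T₁.obj₁, i = e₁.inv.hom₁ := ⟨_, rfl⟩
  obtain ⟨i₂, hi₂⟩ : ∃ i : (q A).obj L₁ ⟶ T₁.obj₂, i = e₁.inv.hom₂ := ⟨_, rfl⟩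
  obtain ⟨j₁, hj₁⟩ : ∃ j : T₂.obj₁ ⟶ (q A).obj K₂, j = e₂.hom.hom₁ := ⟨_, rfl⟩
  obtain ⟨j₂, hj₂⟩ : ∃ j : T₂.obj₂ ⟶ (q A).obj L₂, j = e₂.hom.hom₂ := ⟨_, rfl⟩
  obtain ⟨a', ha'⟩ := (q A).map_surjective (i₁ ≫ a ≫ j₁)
  obtain ⟨b', hb'⟩ := (q A).map_surjective (i₂ ≫ b ≫ j₂)
  have H : Homotopic (φ₁ ≫ b') (a' ≫ φ₂) := q_map_eq_iff.1 (by
    have c1 : (q A).map φ₁ ≫ i₂ = i₁ ≫ T₁.mor₁ := by rw [hi₁, hi₂]; exact e₁.inv.comm₁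
    have c2 : T₂.mor₁ ≫ j₂ = j₁ ≫ (q A).map φ₂ := by rw [hj₁, hj₂]; exact e₂.hom.comm₁
    rw [Functor.map_comp, Functor.map_comp, ha', hb', reassoc_of% c1, reassoc_of% fac, c2]
    simp only [Category.assoc])
  obtain ⟨h, hh, e⟩ := H
  let γ := e₁.hom ≫ coneTrianglehMap φ₁ φ₂ a' b' h hh e ≫ e₂.inv
  have h1 : γ.hom₁ = a := by
    have c1 : e₁.hom.hom₁ ≫ i₁ = 𝟙 _ := by rw [hi₁]; exact e₁.hom_inv_id_triangle_hom₁
    have c2 : j₁ ≫ e₂.inv.hom₁ = 𝟙 _ := by rw [hj₁]; exact e₂.hom_inv_id_triangle_hom₁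
    refine (congrArg (fun φ => e₁.hom.hom₁ ≫ φ ≫ e₂.inv.hom₁) ha').trans ?_
    exact comp_conj _ _ _ _ _ c1 c2
  have h2 : γ.hom₂ = b := by
    have c1 : e₁.hom.hom₂ ≫ i₂ = 𝟙 _ := by rw [hi₂]; exact e₁.hom_inv_id_triangle_hom₂
    have c2 : j₂ ≫ e₂.inv.hom₂ = 𝟙 _ := by rw [hj₂]; exact e₂.hom_inv_id_triangle_hom₂
    refine (congrArg (fun φ => e₁.hom.hom₂ ≫ φ ≫ e₂.inv.hom₂) hb').trans ?_
    exact comp_conj _ _ _ _ _ c1 c2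
  exact ⟨γ.hom₃, by rw [← h2]; exact γ.comm₂, by rw [← h1]; exact γ.comm₃⟩

noncomputable instance : Pretriangulated (DGHomotopyCategory A) where
  distinguishedTriangles := distinguishedTriangles A
  isomorphic_distinguished := isomorphic_distinguished
  contractible_distinguished := contractible_distinguished
  distinguished_cocone_triangle := distinguished_cocone_triangle
  rotate_distinguished_triangle := rotate_distinguished_triangle
  complete_distinguished_triangle_morphism := complete_distinguished_triangle_morphism

lemma coneTriangleh_distinguished {M N : DGModule A} (f : M ⟶ N) :
    coneTriangleh f ∈ distTriang (DGHomotopyCategory A) :=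
  ⟨_, _, f, ⟨Iso.refl _⟩⟩

instance : IsTriangulated (DGHomotopyCategory A) :=
  IsTriangulated.mk' (by
    intro X₁ X₂ X₃ u₁₂' u₂₃'
    obtain ⟨M, rfl⟩ : ∃ M, X₁ = (q A).obj M := ⟨X₁.as, rfl⟩
    obtain ⟨N, rfl⟩ : ∃ M, X₂ = (q A).obj M := ⟨X₂.as, rfl⟩
    obtain ⟨P, rfl⟩ : ∃ M, X₃ = (q A).obj M := ⟨X₃.as, rfl⟩
    obtain ⟨f, rfl⟩ := (q A).map_surjective u₁₂'
    obtain ⟨g, rfl⟩ := (q A).map_surjective u₂₃'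
    refine ⟨_, _, _, _, _, _, _, _, Iso.refl _, Iso.refl _, Iso.refl _,
        (Category.comp_id _).trans (Category.id_comp _).symm,
        (Category.comp_id _).trans (Category.id_comp _).symm,
        _, _, coneTriangleh_distinguished f,
        _, _, coneTriangleh_distinguished g,
        _, _, coneTriangleh_distinguished (f ≫ g), ⟨?_⟩⟩
    let α := coneTrianglehMap f (f ≫ g) (𝟙 M) g 0 (fun _ _ _ => Submodule.zero_mem _)
      (fun m => by simp)
    let β := coneTrianglehMap (f ≫ g) g f (𝟙 P) 0 (fun _ _ _ => Submodule.zero_mem _)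
      (fun m => by simp)
    refine Triangulated.Octahedron.mk α.hom₃ β.hom₃ α.comm₂ ?_ ?_ β.comm₃ ?_
    · refine α.comm₃.symm.trans ?_
      have h : (shiftFunctor (DGHomotopyCategory A) (1 : ℤ)).map α.hom₁ = 𝟙 _ :=
        (congrArg _ ((q A).map_id M)).trans (CategoryTheory.Functor.map_id _ _)
      exact (congrArg (fun φ => (coneTriangleh f).mor₃ ≫ φ) h).trans (Category.comp_id _)
    · refine β.comm₂.trans ?_
      have : β.hom₂ = 𝟙 _ := (q A).map_id P
      rw [this]
      exact Category.id_comp _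
    · refine isomorphic_distinguished _ (coneTriangleh_distinguished (octaMap f g)) _ ?_
      refine Triangle.isoMk _ _ (Iso.refl _) (Iso.refl _)
        (isoOfHomotopyEquiv (octaHom f g) (octaInv f g)
          (Homotopic.of_eq (octaHom_inv f g)) (octaInv_hom f g))
        ((Category.comp_id _).trans (Category.id_comp _).symm) ?_ ?_
      · change (q A).map (octaMap' f g) ≫ (q A).map (octaHom f g) =
          𝟙 _ ≫ (q A).map (coneInr (octaMap f g))
        have h : coneInr (octaMap f g) ≫ octaInv f g = octaMap' f g := hom_ext fun x => by
          change ((0 : N.carrier) + f.lin x.1, x.2) = (f.lin x.1, (0 : P.carrier) + x.2)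
          simp
        rw [← h, ← Functor.map_comp, Category.assoc, Functor.map_comp,
          q_map_eq (octaInv_hom f g), CategoryTheory.Functor.map_id, Category.comp_id, Category.id_comp]
      · change (((q A).map (coneFst g) ≫ ((q A).commShiftIso (1 : ℤ)).hom.app N) ≫
            (shiftFunctor _ (1 : ℤ)).map ((q A).map (coneInr f))) ≫
            (shiftFunctor _ (1 : ℤ)).map (𝟙 _) =
          (q A).map (octaHom f g) ≫ (q A).map (coneFst (octaMap f g)) ≫
            ((q A).commShiftIso (1 : ℤ)).hom.app (cone f)
        rw [CategoryTheory.Functor.map_id, Category.comp_id, Category.assoc,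
          ← Functor.commShiftIso_hom_naturality, ← Functor.map_comp_assoc,
          ← Functor.map_comp_assoc]
        rfl)

end DGHomotopyCategory

namespace DGModule

variable {k : Type} [Field k] {A : DGAlgebra k} {M N P : DGModule A}

/-! ### Cohomology -/

/-- The total cohomology `ker d / im d` of a dg module. -/
abbrev cohomology (M : DGModule A) : Type :=
  LinearMap.ker M.d ⧸ (LinearMap.range M.d).comap (LinearMap.ker M.d).subtype

/-- The map on total cohomology induced by a morphism. -/
def cohomologyMap (f : M ⟶ N) : M.cohomology →ₗ[k] N.cohomology :=
  Submodule.mapQ _ _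
    ((f.lin.restrictScalars k).restrict (p := LinearMap.ker M.d) (q := LinearMap.ker N.d)
      fun m hm => by
        rw [LinearMap.mem_ker] at hm ⊢
        rw [LinearMap.restrictScalars_apply, ← f.comm, hm, map_zero])
    (by
      rintro ⟨m, hm⟩ ⟨m', hm'⟩
      exact ⟨f.lin m', (f.comm m').symm.trans (congrArg _ hm')⟩)

variable (A) in
/-- Total cohomology as a functor on dg modules. -/
def cohomologyFunctor : DGModule A ⥤ ModuleCat.{0} k where
  obj M := ModuleCat.of k M.cohomology
  map f := ModuleCat.ofHom (cohomologyMap f)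
  map_id M := by
    refine ModuleCat.hom_ext (LinearMap.ext fun x => ?_)
    obtain ⟨x, rfl⟩ := Submodule.mkQ_surjective _ x
    rfl
  map_comp f g := by
    refine ModuleCat.hom_ext (LinearMap.ext fun x => ?_)
    obtain ⟨x, rfl⟩ := Submodule.mkQ_surjective _ x
    rfl

lemma cohomologyMap_eq_of_homotopic {f g : M ⟶ N} (h : Homotopic f g) :
    cohomologyMap f = cohomologyMap g := by
  obtain ⟨h, -, e⟩ := h
  refine LinearMap.ext fun x => ?_
  obtain ⟨⟨m, hm⟩, rfl⟩ := Submodule.mkQ_surjective _ x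
  refine (Submodule.Quotient.eq _).2 ⟨h m, ?_⟩
  change N.d (h m) = f.lin m - g.lin m
  rw [e, show M.d m = 0 from hm, map_zero]
  abel

end DGModule

namespace DGHomotopyCategory

open DGModule

variable {k : Type} [Field k] (A : DGAlgebra k)

/-- Total cohomology as a functor on the homotopy category. -/
def cohomologyFunctor : DGHomotopyCategory A ⥤ ModuleCat.{0} k :=
  CategoryTheory.Quotient.lift _ (DGModule.cohomologyFunctor A)
    fun _ _ _ _ h => congrArg ModuleCat.ofHom (cohomologyMap_eq_of_homotopic h)

instance : (cohomologyFunctor A).PreservesZeroMorphisms where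
  map_zero M N := by
    obtain ⟨M, rfl⟩ : ∃ M', M = (q A).obj M' := ⟨M.as, rfl⟩
    obtain ⟨N, rfl⟩ : ∃ N', N = (q A).obj N' := ⟨N.as, rfl⟩
    rw [← (q A).map_zero]
    refine ModuleCat.hom_ext (LinearMap.ext fun x => ?_)
    obtain ⟨x, rfl⟩ := Submodule.mkQ_surjective _ x
    rfl

instance : (cohomologyFunctor A).IsHomological :=
  Functor.IsHomological.mk' _ (by
    rintro T ⟨M, N, f, ⟨e⟩⟩
    refine ⟨_, e, ?_⟩
    rw [ShortComplex.moduleCat_exact_iff]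
    intro x hx
    obtain ⟨⟨n, hn⟩, rfl⟩ := Submodule.mkQ_surjective _ x
    obtain ⟨y, hy⟩ := (Submodule.Quotient.mk_eq_zero _).1 hx
    replace hy : (-M.d y.1, f.lin y.1 + N.d y.2) = ((0 : M.carrier), n) := hy
    have h1 : M.d y.1 = 0 := neg_eq_zero.1 (congrArg Prod.fst hy)
    have h2 : f.lin y.1 + N.d y.2 = n := congrArg Prod.snd hy
    refine ⟨Submodule.mkQ _ ⟨y.1, h1⟩, ?_⟩
    refine (Submodule.Quotient.eq _).2 ⟨-y.2, ?_⟩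
    have h3 : N.d (-y.2) = f.lin y.1 - (f.lin y.1 + N.d y.2) := by
      rw [map_neg]
      abel
    exact h3.trans (congrArg (f.lin y.1 - ·) h2))

/-- The acyclic dg modules (all whose shifts have vanishing cohomology), as objects of
the homotopy category. -/
abbrev acyclic : ObjectProperty (DGHomotopyCategory A) := (cohomologyFunctor A).homologicalKernel

lemma isIso_cohomology_of_trW : (acyclic A).trW.IsInvertedBy (cohomologyFunctor A) := by
  intro X Y f hf
  let := Functor.ShiftSequence.tautological (cohomologyFunctor A) ℤ
  have := ((cohomologyFunctor A).mem_homologicalKernel_trW_iff f).1 hf 0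
  exact (NatIso.isIso_map_iff ((cohomologyFunctor A).isoShiftZero ℤ) f).1 this

end DGHomotopyCategory

/-- The derived category of dg modules over `A`: the Verdier quotient of the homotopy category
by the acyclic dg modules. -/
def DGDerivedCategory {k : Type} [Field k] (A : DGAlgebra k) : Type 1 :=
  (DGHomotopyCategory.acyclic A).trW.Localization

namespace DGDerivedCategory

open DGHomotopyCategory

variable {k : Type} [Field k] (A : DGAlgebra k)

instance : Category.{1} (DGDerivedCategory A) :=
  inferInstanceAs (Category (acyclic A).trW.Localization)

/-- The localization functor from the homotopy category to the derived category. -/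
def Qh : DGHomotopyCategory A ⥤ DGDerivedCategory A := (acyclic A).trW.Q

instance : (Qh A).IsLocalization (acyclic A).trW :=
  inferInstanceAs ((acyclic A).trW.Q.IsLocalization (acyclic A).trW)

noncomputable instance : Preadditive (DGDerivedCategory A) :=
  Localization.preadditive (Qh A) (acyclic A).trW

instance : (Qh A).Additive := Localization.functor_additive (Qh A) (acyclic A).trW

noncomputable instance : Linear k (DGDerivedCategory A) :=
  Localization.linear k (Qh A) (acyclic A).trW

instance : (Qh A).Linear k := Localization.functor_linear k (Qh A) (acyclic A).trW

instance : HasZeroObject (DGDerivedCategory A) := (Qh A).hasZeroObject_of_additive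

noncomputable instance : HasShift (DGDerivedCategory A) ℤ :=
  HasShift.localized (Qh A) (acyclic A).trW ℤ

noncomputable instance : (Qh A).CommShift ℤ :=
  Functor.CommShift.localized (Qh A) (acyclic A).trW ℤ

instance (n : ℤ) : (shiftFunctor (DGDerivedCategory A) n).Additive := by
  rw [Localization.functor_additive_iff (Qh A) (acyclic A).trW]
  exact Functor.additive_of_iso ((Qh A).commShiftIso n)

noncomputable instance : Pretriangulated (DGDerivedCategory A) :=
  Triangulated.Localization.pretriangulated (Qh A) (acyclic A).trW

instance : (Qh A).IsTriangulated :=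
  Triangulated.Localization.isTriangulated_functor (Qh A) (acyclic A).trW

instance : IsTriangulated (DGDerivedCategory A) :=
  Triangulated.Localization.isTriangulated (Qh A) (acyclic A).trW

instance : (Qh A).mapArrow.EssSurj := Localization.essSurj_mapArrow _ (acyclic A).trW

/-- The functor from dg modules to the derived category. -/
def Q : DGModule A ⥤ DGDerivedCategory A := q A ⋙ Qh A

/-- Total cohomology as a functor on the derived category. -/
noncomputable def cohomologyFunctor : DGDerivedCategory A ⥤ ModuleCat.{0} k :=
  Localization.lift (DGHomotopyCategory.cohomologyFunctor A) (isIso_cohomology_of_trW A) (Qh A)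

/-- The cohomology of an object of the derived category represented by a dg module. -/
noncomputable def cohomologyFunctorFac :
    Qh A ⋙ cohomologyFunctor A ≅ DGHomotopyCategory.cohomologyFunctor A :=
  Localization.fac _ (isIso_cohomology_of_trW A) (Qh A)

instance : (cohomologyFunctor A).IsHomological :=
  Functor.isHomological_of_localization (Qh A) _ _ (cohomologyFunctorFac A)

/-- The objects whose total cohomology, and that of all their shifts, is finite dimensional. -/
def finiteDimensional : ObjectProperty (DGDerivedCategory A) :=
  fun X => ∀ n : ℤ, Module.Finite k ((cohomologyFunctor A).obj (X⟦n⟧))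

instance : (finiteDimensional A).IsClosedUnderIsomorphisms where
  of_iso e h n :=
    have := h n
    Module.Finite.equiv ((cohomologyFunctor A).mapIso
      ((shiftFunctor _ n).mapIso e)).toLinearEquiv

instance : (finiteDimensional A).IsTriangulated where
  exists_zero := by
    obtain ⟨Z, hZ⟩ := HasZeroObject.zero (C := DGDerivedCategory A)
    refine ⟨Z, hZ, fun n => ?_⟩
    have : Subsingleton ((cohomologyFunctor A).obj (Z⟦n⟧)) := ModuleCat.subsingleton_of_isZero
      ((shiftFunctor _ n ⋙ cohomologyFunctor A).map_isZero hZ)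
    infer_instance
  isStableUnderShiftBy a := ⟨fun X hX b =>
    have := hX (a + b)
    Module.Finite.equiv ((cohomologyFunctor A).mapIso
      ((shiftFunctorAdd (DGDerivedCategory A) a b).app X)).toLinearEquiv⟩
  toIsTriangulatedClosed₂ := ObjectProperty.IsTriangulatedClosed₂.mk' fun T hT h₁ h₃ n => by
    have ex := ((cohomologyFunctor A).map_distinguished_exact _
      (Triangle.shift_distinguished T hT n)).moduleCat_range_eq_ker
    have n1 := @isNoetherian_of_isNoetherianRing_of_finite k _ _ _ _ _ (h₁ n)
    have n3 := @isNoetherian_of_isNoetherianRing_of_finite k _ _ _ _ _ (h₃ n)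
    have n2 := @isNoetherian_of_range_eq_ker _ _ _ _ _ _ _ _ _ _ _ n1 n3 _ _ ex
    exact @Module.IsNoetherian.finite _ _ _ _ _ n2

end DGDerivedCategory

namespace Ginzburg

open Matrix

/-- The generators of the Ginzburg algebra of the quiver `1 → 2`: the idempotents `e₁`, `e₂`,
the arrow `a : 1 → 2`, the reversed arrow `b : 2 → 1` and the loops `t₁`, `t₂`. -/
inductive Gen
  | e₁ | e₂ | a | b | t₁ | t₂

/-- The degrees of the generators. -/
def Gen.deg : Gen → ℤ
  | e₁ => 0 | e₂ => 0 | a => 0 | b => -1 | t₁ => -2 | t₂ => -2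

open Gen in
/-- The relations of the path algebra of the graded quiver. -/
inductive Rel : FreeAlgebra ℂ Gen → FreeAlgebra ℂ Gen → Prop
  | e₁e₁ : Rel (FreeAlgebra.ι ℂ e₁ * FreeAlgebra.ι ℂ e₁) (FreeAlgebra.ι ℂ e₁)
  | e₂e₂ : Rel (FreeAlgebra.ι ℂ e₂ * FreeAlgebra.ι ℂ e₂) (FreeAlgebra.ι ℂ e₂)
  | e₁e₂ : Rel (FreeAlgebra.ι ℂ e₁ * FreeAlgebra.ι ℂ e₂) 0
  | e₂e₁ : Rel (FreeAlgebra.ι ℂ e₂ * FreeAlgebra.ι ℂ e₁) 0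
  | one : Rel (FreeAlgebra.ι ℂ e₁ + FreeAlgebra.ι ℂ e₂) 1
  | e₁a : Rel (FreeAlgebra.ι ℂ e₁ * FreeAlgebra.ι ℂ a) (FreeAlgebra.ι ℂ a)
  | ae₂ : Rel (FreeAlgebra.ι ℂ a * FreeAlgebra.ι ℂ e₂) (FreeAlgebra.ι ℂ a)
  | e₂b : Rel (FreeAlgebra.ι ℂ e₂ * FreeAlgebra.ι ℂ b) (FreeAlgebra.ι ℂ b)
  | be₁ : Rel (FreeAlgebra.ι ℂ b * FreeAlgebra.ι ℂ e₁) (FreeAlgebra.ι ℂ b)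
  | e₁t₁ : Rel (FreeAlgebra.ι ℂ e₁ * FreeAlgebra.ι ℂ t₁) (FreeAlgebra.ι ℂ t₁)
  | t₁e₁ : Rel (FreeAlgebra.ι ℂ t₁ * FreeAlgebra.ι ℂ e₁) (FreeAlgebra.ι ℂ t₁)
  | e₂t₂ : Rel (FreeAlgebra.ι ℂ e₂ * FreeAlgebra.ι ℂ t₂) (FreeAlgebra.ι ℂ t₂)
  | t₂e₂ : Rel (FreeAlgebra.ι ℂ t₂ * FreeAlgebra.ι ℂ e₂) (FreeAlgebra.ι ℂ t₂)

/-- The path algebra of the graded quiver with arrows `a`, `b`, `t₁`, `t₂`. -/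
def Alg : Type := RingQuot Rel

noncomputable instance : Ring Alg := inferInstanceAs (Ring (RingQuot Rel))

noncomputable instance : Algebra ℂ Alg := inferInstanceAs (Algebra ℂ (RingQuot Rel))

/-- The quotient map from the free algebra. -/
noncomputable def mk : FreeAlgebra ℂ Gen →ₐ[ℂ] Alg := RingQuot.mkAlgHom ℂ Rel

/-- The generators, as elements of the algebra. -/
noncomputable def ι (g : Gen) : Alg := mk (FreeAlgebra.ι ℂ g)

section relations

open Gen

lemma mk_rel {x y : FreeAlgebra ℂ Gen} (h : Rel x y) :
    mk x = mk y := RingQuot.mkAlgHom_rel ℂ h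

lemma e₁e₁ : ι e₁ * ι e₁ = ι e₁ := by simpa [ι] using mk_rel Rel.e₁e₁
lemma e₂e₂ : ι e₂ * ι e₂ = ι e₂ := by simpa [ι] using mk_rel Rel.e₂e₂
lemma e₁e₂ : ι e₁ * ι e₂ = 0 := by simpa [ι] using mk_rel Rel.e₁e₂
lemma e₂e₁ : ι e₂ * ι e₁ = 0 := by simpa [ι] using mk_rel Rel.e₂e₁
lemma e_add : ι e₁ + ι e₂ = 1 := by simpa [ι] using mk_rel Rel.one
lemma e₁a : ι e₁ * ι a = ι a := by simpa [ι] using mk_rel Rel.e₁a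
lemma ae₂ : ι a * ι e₂ = ι a := by simpa [ι] using mk_rel Rel.ae₂
lemma e₂b : ι e₂ * ι b = ι b := by simpa [ι] using mk_rel Rel.e₂b
lemma be₁ : ι b * ι e₁ = ι b := by simpa [ι] using mk_rel Rel.be₁
lemma e₁t₁ : ι e₁ * ι t₁ = ι t₁ := by simpa [ι] using mk_rel Rel.e₁t₁
lemma t₁e₁ : ι t₁ * ι e₁ = ι t₁ := by simpa [ι] using mk_rel Rel.t₁e₁
lemma e₂t₂ : ι e₂ * ι t₂ = ι t₂ := by simpa [ι] using mk_rel Rel.e₂t₂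
lemma t₂e₂ : ι t₂ * ι e₂ = ι t₂ := by simpa [ι] using mk_rel Rel.t₂e₂

end relations

/-- Elements of an algebra which satisfy the defining relations. -/
structure IsRep {B : Type*} [Semiring B] (v : Gen → B) : Prop where
  e₁e₁ : v .e₁ * v .e₁ = v .e₁
  e₂e₂ : v .e₂ * v .e₂ = v .e₂
  e₁e₂ : v .e₁ * v .e₂ = 0
  e₂e₁ : v .e₂ * v .e₁ = 0
  one : v .e₁ + v .e₂ = 1
  e₁a : v .e₁ * v .a = v .a
  ae₂ : v .a * v .e₂ = v .a
  e₂b : v .e₂ * v .b = v .b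
  be₁ : v .b * v .e₁ = v .b
  e₁t₁ : v .e₁ * v .t₁ = v .t₁
  t₁e₁ : v .t₁ * v .e₁ = v .t₁
  e₂t₂ : v .e₂ * v .t₂ = v .t₂
  t₂e₂ : v .t₂ * v .e₂ = v .t₂

/-- The universal property of the path algebra. -/
noncomputable def lift {B : Type*} [Semiring B] [Algebra ℂ B] (v : Gen → B) (h : IsRep v) :
    Alg →ₐ[ℂ] B :=
  RingQuot.liftAlgHom ℂ ⟨FreeAlgebra.lift ℂ v, by
    intro x y r
    cases r <;> simp [h.e₁e₁, h.e₂e₂, h.e₁e₂, h.e₂e₁, h.one, h.e₁a, h.ae₂, h.e₂b, h.be₁,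
      h.e₁t₁, h.t₁e₁, h.e₂t₂, h.t₂e₂]⟩

@[simp] lemma lift_ι {B : Type*} [Semiring B] [Algebra ℂ B] (v : Gen → B) (h : IsRep v) (g : Gen) :
    lift v h (ι g) = v g :=
  (RingQuot.liftAlgHom_mkAlgHom_apply ℂ _ _ _).trans (FreeAlgebra.lift_ι_apply v g)

/-- The product of a word in the generators. -/
noncomputable def mon (l : List Gen) : Alg := (l.map ι).prod

/-- The degree of a word. -/
def deg (l : List Gen) : ℤ := (l.map Gen.deg).sum

@[simp] lemma mon_nil : mon [] = 1 := rfl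
@[simp] lemma deg_nil : deg [] = 0 := rfl
@[simp] lemma mon_cons (g : Gen) (l : List Gen) : mon (g :: l) = ι g * mon l := by simp [mon]
@[simp] lemma deg_cons (g : Gen) (l : List Gen) : deg (g :: l) = g.deg + deg l := by simp [deg]
lemma mon_append (l m : List Gen) : mon (l ++ m) = mon l * mon m := by simp [mon]
lemma deg_append (l m : List Gen) : deg (l ++ m) = deg l + deg m := by simp [deg]

/-- The homogeneous component of degree `n`: the span of the words of degree `n`. -/
noncomputable def gr (n : ℤ) : Submodule ℂ Alg := Submodule.span ℂ (mon '' {l | deg l = n})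

lemma mon_mem (l : List Gen) : mon l ∈ gr (deg l) := Submodule.subset_span ⟨l, rfl, rfl⟩

lemma ι_mem (g : Gen) : ι g ∈ gr g.deg := by simpa using mon_mem [g]

instance : SetLike.GradedMonoid gr where
  one_mem := mon_mem []
  mul_mem := by
    intro i j x y hx hy
    have h := Submodule.mul_mem_mul hx hy
    rw [gr, gr, Submodule.span_mul_span] at h
    refine Submodule.span_mono ?_ h
    rintro _ ⟨_, ⟨l, rfl, rfl⟩, _, ⟨m, rfl, rfl⟩, rfl⟩
    exact ⟨l ++ m, deg_append l m, mon_append l m⟩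

lemma of_ext {i j : ℤ} {x y : Alg} (hx : x ∈ gr i) (hy : y ∈ gr j) (h : i = j) (h' : x = y) :
    DirectSum.of (fun i => gr i) i ⟨x, hx⟩ = DirectSum.of (fun i => gr i) j ⟨y, hy⟩ := by
  subst h h'; rfl

/-- The decomposition into homogeneous components. -/
noncomputable def decompose : Alg →ₐ[ℂ] ⨁ i, gr i :=
  lift (fun g => DirectSum.of (fun i => gr i) g.deg ⟨ι g, ι_mem g⟩) (by
    have h0 : ∀ g h g' : Gen, g.deg + h.deg = g'.deg → ι g * ι h = ι g' →
        DirectSum.of (fun i => gr i) g.deg ⟨ι g, ι_mem g⟩ *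
          DirectSum.of (fun i => gr i) h.deg ⟨ι h, ι_mem h⟩ =
          DirectSum.of (fun i => gr i) g'.deg ⟨ι g', ι_mem g'⟩ := by
      intro g h g' e e'
      rw [DirectSum.of_mul_of]
      exact of_ext _ _ e e'
    have h1 : ∀ g h : Gen, ι g * ι h = 0 →
        DirectSum.of (fun i => gr i) g.deg ⟨ι g, ι_mem g⟩ *
          DirectSum.of (fun i => gr i) h.deg ⟨ι h, ι_mem h⟩ = 0 := by
      intro g h e
      rw [DirectSum.of_mul_of]
      refine (of_ext _ (Submodule.zero_mem _) rfl e).trans (map_zero _)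
    constructor
    case one =>
      refine (map_add (DirectSum.of (fun i => gr i) 0) ⟨ι .e₁, ι_mem .e₁⟩
        ⟨ι .e₂, ι_mem .e₂⟩).symm.trans ?_
      exact of_ext _ _ rfl e_add
    case e₁e₂ => exact h1 _ _ e₁e₂
    case e₂e₁ => exact h1 _ _ e₂e₁
    all_goals refine h0 _ _ _ (by simp [Gen.deg]) ?_
    exacts [e₁e₁, e₂e₂, e₁a, ae₂, e₂b, be₁, e₁t₁, t₁e₁, e₂t₂, t₂e₂])

lemma algHom_ext {B : Type*} [Semiring B] [Algebra ℂ B] {f g : Alg →ₐ[ℂ] B}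
    (h : ∀ x, f (ι x) = g (ι x)) : f = g := by
  refine RingQuot.ringQuot_ext' _ _ _ (FreeAlgebra.hom_ext (funext h))

lemma decompose_mon (l : List Gen) :
    decompose (mon l) = DirectSum.of (fun i => gr i) (deg l) ⟨mon l, mon_mem l⟩ := by
  induction l with
  | nil => exact map_one _
  | cons g l ih =>
    refine (congrArg decompose (mon_cons g l)).trans ?_
    rw [map_mul, ih, decompose, lift_ι, DirectSum.of_mul_of]
    exact of_ext _ _ (deg_cons g l).symm (mon_cons g l).symm

noncomputable instance : GradedAlgebra gr :=
  GradedAlgebra.ofAlgHom gr decompose (algHom_ext fun x => by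
    rw [AlgHom.comp_apply, decompose, lift_ι]
    exact DirectSum.coeAlgHom_of gr _ _) (by
    rintro i ⟨x, hx⟩
    induction hx using Submodule.span_induction with
    | mem x h =>
      obtain ⟨l, rfl, rfl⟩ := h
      exact decompose_mon l
    | zero => exact (map_zero _).trans (map_zero _).symm
    | add x y hx hy ihx ihy =>
      refine (map_add decompose x y).trans ?_
      exact (congrArg₂ (· + ·) ihx ihy).trans
        (map_add (DirectSum.of (fun i => gr i) i) ⟨x, hx⟩ ⟨y, hy⟩).symm
    | smul c x hx ih =>
      refine (map_smul decompose c x).trans ?_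
      exact (congrArg (c • ·) ih).trans (map_smul (DirectSum.lof ℂ ℤ (fun i => gr i) i) c ⟨x, hx⟩).symm)

/-- The action of the parity automorphism `x ↦ (-1)^|x| x` on generators. -/
noncomputable def parityGen : Gen → Alg
  | .b => -ι .b
  | g => ι g

/-- The differential on generators: `d t₁ = a b`, `d t₂ = - b a` and the other generators
are closed. -/
noncomputable def dGen : Gen → Alg
  | .t₁ => ι .a * ι .b
  | .t₂ => -(ι .b * ι .a)
  | _ => 0

/-- The algebra morphism `x ↦ !![(-1)^|x| x, d x; 0, x]` encoding the derivation `d`. -/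
noncomputable def dHom : Alg →ₐ[ℂ] Matrix (Fin 2) (Fin 2) Alg :=
  lift (fun g => !![parityGen g, dGen g; 0, ι g]) (by
    have h1 : ι .e₁ * (ι .a * ι .b) = ι .a * ι .b := by rw [← mul_assoc, e₁a]
    have h2 : (ι .a * ι .b) * ι .e₁ = ι .a * ι .b := by rw [mul_assoc, be₁]
    have h3 : ι .e₂ * (ι .b * ι .a) = ι .b * ι .a := by rw [← mul_assoc, e₂b]
    have h4 : (ι .b * ι .a) * ι .e₂ = ι .b * ι .a := by rw [mul_assoc, ae₂]
    constructor <;> ext i j <;> fin_cases i <;> fin_cases j <;>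
      simp [parityGen, dGen, e₁e₁, e₂e₂, e₁e₂, e₂e₁, e_add, e₁a, ae₂, e₂b, be₁, e₁t₁, t₁e₁,
        e₂t₂, t₂e₂, h1, h2, h3, h4])

/-- The differential of the Ginzburg algebra. -/
noncomputable def d : Alg →ₗ[ℂ] Alg where
  toFun x := dHom x 0 1
  map_add' x y := by simp
  map_smul' c x := by simp

lemma parityGen_eq (g : Gen) : parityGen g = g.deg.negOnePow • ι g := by
  cases g <;> simp [parityGen, Gen.deg, Int.negOnePow_even _ (by decide : Even (-2 : ℤ))]

lemma dGen_mem (g : Gen) : dGen g ∈ gr (g.deg + 1) := by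
  cases g
  case t₁ =>
    have h := SetLike.mul_mem_graded (ι_mem .a) (ι_mem .b)
    rwa [show Gen.a.deg + Gen.b.deg = Gen.t₁.deg + 1 from rfl] at h
  case t₂ =>
    have h := Submodule.neg_mem _ (SetLike.mul_mem_graded (ι_mem .b) (ι_mem .a))
    rwa [show Gen.b.deg + Gen.a.deg = Gen.t₂.deg + 1 from rfl] at h
  all_goals exact Submodule.zero_mem _

lemma dHom_mon (l : List Gen) :
    dHom (mon l) = !![(deg l).negOnePow • mon l, d (mon l); 0, mon l] := by
  suffices h : dHom (mon l) 0 0 = (deg l).negOnePow • mon l ∧ dHom (mon l) 1 0 = 0 ∧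
      dHom (mon l) 1 1 = mon l by
    ext i j
    fin_cases i <;> fin_cases j
    · exact h.1
    · rfl
    · exact h.2.1
    · exact h.2.2
  induction l with
  | nil => simp
  | cons g l ih =>
    rw [mon_cons, map_mul, dHom, lift_ι, ← dHom]
    simp only [Matrix.mul_apply, Fin.sum_univ_two, ih]
    simp [parityGen_eq, Int.negOnePow_add, smul_mul_smul_comm]

lemma d_cons (g : Gen) (l : List Gen) :
    d (mon (g :: l)) = dGen g * mon l + g.deg.negOnePow • (ι g * d (mon l)) := by
  change dHom (mon (g :: l)) 0 1 = _
  rw [mon_cons, map_mul, dHom_mon, dHom, lift_ι]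
  simp [Matrix.mul_apply, parityGen_eq, add_comm, smul_mul_assoc]

lemma d_mon_mem (l : List Gen) : d (mon l) ∈ gr (deg l + 1) := by
  induction l with
  | nil =>
    have : d (mon []) = 0 := by simp [d]
    rw [this]
    exact Submodule.zero_mem _
  | cons g l ih =>
    rw [d_cons, deg_cons]
    refine Submodule.add_mem _ ?_ (DGModule.units_smul_mem _ _ ?_)
    · rw [add_right_comm]
      exact SetLike.mul_mem_graded (dGen_mem g) (mon_mem l)
    · rw [add_assoc]
      exact SetLike.mul_mem_graded (ι_mem g) ih

/-- A linear property which holds on words holds everywhere. -/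
lemma span_mon : Submodule.span ℂ (Set.range mon) = ⊤ := by
  rw [eq_top_iff]
  intro x _
  have h := DirectSum.Decomposition.isInternal gr
  have hx : x ∈ ⨆ i, gr i := by
    rw [h.submodule_iSup_eq_top]
    trivial
  refine SetLike.le_def.1 (iSup_le fun i => ?_) hx
  exact Submodule.span_mono (Set.image_subset_range _ _)

lemma d_mem {n : ℤ} {x : Alg} (hx : x ∈ gr n) : d x ∈ gr (n + 1) := by
  have : gr n ≤ (gr (n + 1)).comap d := by
    refine Submodule.span_le.2 ?_
    rintro _ ⟨l, rfl, rfl⟩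
    exact d_mon_mem l
  exact this hx

lemma d_mon_mul (l : List Gen) (y : Alg) :
    d (mon l * y) = d (mon l) * y + (deg l).negOnePow • (mon l * d y) := by
  have h : y ∈ Submodule.span ℂ (Set.range mon) := by
    rw [span_mon]
    trivial
  induction h using Submodule.span_induction with
  | mem y h =>
    obtain ⟨m, rfl⟩ := h
    change dHom (mon l * mon m) 0 1 = _
    rw [map_mul, dHom_mon, dHom_mon]
    simp [Matrix.mul_apply, add_comm, smul_mul_assoc]
  | zero => simp
  | add x y _ _ hx hy =>
    simp only [mul_add, map_add, hx, hy, smul_add]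
    abel
  | smul c x _ hx => simp only [mul_smul_comm, map_smul, hx, smul_add, smul_comm c]

lemma d_leibniz {n : ℤ} {x : Alg} (y : Alg) (hx : x ∈ gr n) :
    d (x * y) = d x * y + n.negOnePow • (x * d y) := by
  induction hx using Submodule.span_induction with
  | mem x h =>
    obtain ⟨l, rfl, rfl⟩ := h
    exact d_mon_mul l y
  | zero => simp
  | add x x' _ _ hx hx' =>
    simp only [add_mul, map_add, hx, hx', smul_add]
    abel
  | smul c x _ hx => simp only [smul_mul_assoc, map_smul, hx, smul_add, smul_comm c]

lemma d_ι (g : Gen) : d (ι g) = dGen g := by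
  have h := d_cons g []
  have h' : d (1 : Alg) = 0 := by simp [d]
  simpa [h'] using h

lemma d_dGen (g : Gen) : d (dGen g) = 0 := by
  cases g
  case t₁ => simp [dGen, d_leibniz _ (ι_mem .a), d_ι]
  case t₂ => simp [dGen, d_leibniz _ (ι_mem .b), d_ι]
  all_goals simp [dGen]

lemma d_d_mon (l : List Gen) : d (d (mon l)) = 0 := by
  induction l with
  | nil => simp [d]
  | cons g l ih =>
    have h := d_leibniz (d (mon l)) (ι_mem g)
    rw [d_cons, map_add, d_leibniz _ (dGen_mem g), d_dGen]
    have h' : d (g.deg.negOnePow • (ι g * d (mon l))) =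
        g.deg.negOnePow • d (ι g * d (mon l)) := by
      rw [Units.smul_def, map_zsmul, ← Units.smul_def]
    rw [h', h, ih, d_ι, Int.negOnePow_succ]
    simp

lemma d_d (x : Alg) : d (d x) = 0 := by
  have h : x ∈ Submodule.span ℂ (Set.range mon) := by
    rw [span_mon]
    trivial
  induction h using Submodule.span_induction with
  | mem y h =>
    obtain ⟨m, rfl⟩ := h
    exact d_d_mon m
  | zero => simp
  | add x y _ _ hx hy => simp [hx, hy]
  | smul c x _ hx => simp [hx]

/-- The Ginzburg dg algebra of the quiver of type `A₂`. -/
@[reducible]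
noncomputable def dgAlgebra : DGAlgebra ℂ where
  carrier := Alg
  gr := gr
  d := d
  d_mem := d_mem
  d_d := d_d
  leibniz := d_leibniz

end Ginzburg

namespace DGDerivedCategory

variable {k : Type} [Field k] {A : DGAlgebra k}

lemma finiteDimensional_Q (M : DGModule A) [Module.Finite k M.carrier] :
    finiteDimensional A ((Q A).obj M) := fun n => by
  have : Module.Finite k (M⟦n⟧).cohomology :=
    have : Module.Finite k (M⟦n⟧).carrier := inferInstanceAs (Module.Finite k M.carrier)
    inferInstance
  have e : (cohomologyFunctor A).obj (((Q A).obj M)⟦n⟧) ≅ ModuleCat.of k (M⟦n⟧).cohomology :=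
    (cohomologyFunctor A).mapIso
      (((Qh A).commShiftIso n).symm.app ((DGHomotopyCategory.q A).obj M) ≪≫
        (Qh A).mapIso (((DGHomotopyCategory.q A).commShiftIso n).symm.app M)) ≪≫
      (cohomologyFunctorFac A).app ((DGHomotopyCategory.q A).obj (M⟦n⟧))
  exact Module.Finite.equiv e.symm.toLinearEquiv

end DGDerivedCategory

namespace Ginzburg

/-- The values on the generators of the character attached to a vertex. -/
def charGen (i : Fin 2) : Gen → ℂ
  | .e₁ => if i = 0 then 1 else 0
  | .e₂ => if i = 1 then 1 else 0
  | _ => 0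

/-- The character sending the idempotent of the vertex `i` to `1` and all other generators
to `0` (the vertices `1`, `2` are numbered by `0`, `1`). -/
noncomputable def char (i : Fin 2) : Alg →ₐ[ℂ] ℂ :=
  lift (charGen i) (by
    constructor <;> fin_cases i <;> simp [charGen])

lemma char_mon (i : Fin 2) (l : List Gen) (hl : deg l ≠ 0) : char i (mon l) = 0 := by
  induction l with
  | nil => simp at hl
  | cons g l ih =>
    rw [mon_cons, map_mul]
    by_cases h : deg l = 0
    · have hg : g.deg ≠ 0 := by
        rw [deg_cons, h, add_zero] at hl
        exact hl
      have : char i (ι g) = 0 := by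
        rw [char, lift_ι]
        cases g <;> simp_all [charGen, Gen.deg]
      rw [this, zero_mul]
    · rw [ih h, mul_zero]

lemma char_eq_zero (i : Fin 2) {n : ℤ} (hn : n ≠ 0) {x : Alg} (hx : x ∈ gr n) :
    char i x = 0 := by
  have : gr n ≤ LinearMap.ker (char i).toLinearMap := by
    refine Submodule.span_le.2 ?_
    rintro _ ⟨l, rfl, rfl⟩
    exact char_mon i l hn
  exact this hx

lemma char_d (i : Fin 2) (x : Alg) : char i (d x) = 0 := by
  have h : x ∈ Submodule.span ℂ (Set.range mon) := by
    rw [span_mon]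
    trivial
  induction h using Submodule.span_induction with
  | mem y h =>
    obtain ⟨l, rfl⟩ := h
    induction l with
    | nil => simp [d]
    | cons g l ih =>
      have h1 : char i (dGen g) = 0 := by
        cases g <;> simp [dGen, char, charGen]
      rw [d_cons, map_add, map_mul, h1, Units.smul_def, map_zsmul, map_mul, ih]
      simp
  | zero => simp
  | add x y _ _ hx hy => simp [hx, hy]
  | smul c x _ hx => simp [hx]

/-- The right action on the simple module: `a` acts by multiplication by `char i a`. -/
@[reducible]
noncomputable def simpleAction (i : Fin 2) : Module Algᵐᵒᵖ ℂ :=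
  Module.compHom ℂ ((char i).toRingHom.fromOpposite fun _ _ => Commute.all _ _)

/-- The one-dimensional graded vector space in degree `0`. -/
def simpleGr (n : ℤ) : Submodule ℂ ℂ := if n = 0 then ⊤ else ⊥

lemma simpleGr_isInternal : DirectSum.IsInternal simpleGr := by
  rw [DirectSum.isInternal_submodule_iff_iSupIndep_and_iSup_eq_top]
  constructor
  · intro i
    by_cases h : i = 0
    · refine Disjoint.mono_right (iSup₂_le fun j hj => ?_) disjoint_bot_right
      rw [simpleGr, if_neg (h ▸ hj)]
    · rw [simpleGr, if_neg h]
      exact disjoint_bot_left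
  · rw [eq_top_iff]
    exact le_iSup_of_le 0 (by rw [simpleGr, if_pos rfl])

/-- The simple dg module at the vertex `i`: one-dimensional, in degree `0`. -/
@[reducible]
noncomputable def simpleModule (i : Fin 2) : DGModule dgAlgebra :=
  letI : Module Algᵐᵒᵖ ℂ := simpleAction i
  have smul_def : ∀ (a : Alg) (z : ℂ), op a • z = char i a * z := fun _ _ => rfl
  { carrier := ℂ
    isScalarTower := ⟨fun c a z => by
      obtain ⟨a, rfl⟩ := op_surjective a
      rw [← op_smul, smul_def, smul_def, map_smul, smul_mul_assoc]⟩
    gr := simpleGr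
    isInternal := simpleGr_isInternal
    smul_mem := fun {m n a z} hz ha => by
      rw [smul_def]
      by_cases hm : m = 0
      · subst hm
        by_cases hn : n = 0
        · subst hn
          rw [add_zero, simpleGr, if_pos rfl]
          trivial
        · rw [char_eq_zero i hn ha, zero_mul]
          exact Submodule.zero_mem _
      · rw [simpleGr, if_neg hm] at hz
        rw [(Submodule.mem_bot ℂ).1 hz, mul_zero]
        exact Submodule.zero_mem _
    d := 0
    d_mem := fun _ => Submodule.zero_mem _
    d_d := fun _ => rfl
    leibniz := fun {n z} a _ => by
      rw [smul_def]
      change 0 = op a • (0 : ℂ) + n.negOnePow • (char i (d a) * z)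
      rw [smul_def, char_d]
      simp }

/-- The category `D_fd` of the Ginzburg algebra of type `A₂`: dg modules with
finite-dimensional total cohomology. -/
abbrev Dfd : Type 1 := (DGDerivedCategory.finiteDimensional dgAlgebra).FullSubcategory

/-- The simple object of `D_fd` at the vertex `i`. -/
noncomputable def simple (i : Fin 2) : Dfd :=
  ⟨(DGDerivedCategory.Q dgAlgebra).obj (simpleModule i),
    have : Module.Finite ℂ (simpleModule i).carrier := inferInstanceAs (Module.Finite ℂ ℂ)
    DGDerivedCategory.finiteDimensional_Q _⟩

/-- The simple object `S`, at the source of the arrow. -/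
noncomputable abbrev S : Dfd := simple 0

/-- The simple object `T`, at the target of the arrow. -/
noncomputable abbrev T : Dfd := simple 1


/-- The standard heart: the objects represented by dg modules whose cohomology is concentrated
in degree `0`. -/
def standardHeart : ObjectProperty Dfd := fun X =>
  ∃ M : DGModule dgAlgebra, Nonempty (X.obj ≅ (DGDerivedCategory.Q dgAlgebra).obj M) ∧
    ∀ n : ℤ, n ≠ 0 → ∀ m ∈ M.gr n, M.d m = 0 → ∃ m' : M.carrier, M.d m' = m

end Ginzburg

section Triangulated

open Triangulated

variable {C : Type*} [Category C] [Preadditive C] [HasZeroObject C] [HasShift C ℤ]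
  [∀ n : ℤ, (shiftFunctor C n).Additive] [Pretriangulated C]

/-! ### Hearts and simple tilts -/

/-- `A` is the heart of a bounded t-structure. -/
def IsHeart (A : ObjectProperty C) : Prop :=
  ∃ t : TStructure C, (∀ X, t.bounded X) ∧ t.heart = A

variable (C) in
/-- The hearts of bounded t-structures on `C`. -/
@[ext]
structure Heart where
  prop : ObjectProperty C
  isHeart : IsHeart prop

/-- The objects isomorphic to a finite direct sum of copies of `S`. -/
def copies (S : C) : ObjectProperty C := fun X =>
  ∃ (n : ℕ) (b : Bicone fun _ : Fin n => S), Nonempty b.IsBilimit ∧ Nonempty (X ≅ b.pt)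

/-- `(𝒯, ℱ)` is a torsion pair in the heart `A`: there are no nonzero morphisms from `𝒯` to `ℱ`
and every object `X` of `A` sits in a short exact sequence `0 → T → X → F → 0` with `T` in `𝒯` and
`F` in `ℱ`. (The short exact sequences of a heart are its distinguished triangles.) -/
structure IsTorsionPair (A 𝒯 ℱ : ObjectProperty C) : Prop where
  le_left : 𝒯 ≤ A
  le_right : ℱ ≤ A
  hom_eq_zero : ∀ ⦃T F : C⦄, 𝒯 T → ℱ F → ∀ f : T ⟶ F, f = 0
  le_extension : A ≤ 𝒯.extensionProduct ℱ

/-- The left tilt with respect to `(𝒯, ℱ)`: extensions of an object of `𝒯[-1]` by an object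
of `ℱ`, i.e. objects `X` with `H⁰(X)` in `ℱ`, `H¹(X)` in `𝒯` and no other cohomology. -/
def leftTilt (𝒯 ℱ : ObjectProperty C) : ObjectProperty C :=
  ℱ.extensionProduct fun X => ∃ T, 𝒯 T ∧ Nonempty (X ≅ T⟦(-1 : ℤ)⟧)

/-- The right tilt with respect to `(𝒯, ℱ)`: extensions of an object of `𝒯` by an object
of `ℱ[1]`, i.e. objects `X` with `H⁻¹(X)` in `ℱ`, `H⁰(X)` in `𝒯` and no other cohomology. -/
def rightTilt (𝒯 ℱ : ObjectProperty C) : ObjectProperty C :=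
  ObjectProperty.extensionProduct (fun X => ∃ F, ℱ F ∧ Nonempty (X ≅ F⟦(1 : ℤ)⟧)) 𝒯

/-- `A'` is a simple tilt of the heart `A` at the simple object `S` of `A`. -/
def IsSimpleTiltAt (A A' : ObjectProperty C) (S : A.FullSubcategory) : Prop :=
  (IsTorsionPair A (copies S.obj) (fun X => A X ∧ ∀ f : S.obj ⟶ X, f = 0) ∧
    A' = leftTilt (copies S.obj) (fun X => A X ∧ ∀ f : S.obj ⟶ X, f = 0)) ∨
  (IsTorsionPair A (fun X => A X ∧ ∀ f : X ⟶ S.obj, f = 0) (copies S.obj) ∧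
    A' = rightTilt (fun X => A X ∧ ∀ f : X ⟶ S.obj, f = 0) (copies S.obj))

/-- `A'` is a simple tilt of `A` at some simple object of `A`. -/
def IsSimpleTilt (A A' : ObjectProperty C) : Prop :=
  ∃ S : A.FullSubcategory, Simple S ∧ IsSimpleTiltAt A A' S

variable (C) in
/-- The exchange graph: its vertices are the hearts, and two hearts are joined by an edge if one
is a simple tilt of the other. -/
def exchangeGraph : SimpleGraph (Heart C) :=
  SimpleGraph.fromRel fun A A' => IsSimpleTilt A.prop A'.prop

/-! ### Autoequivalences -/

/-- The functor `F` can be made into an exact functor of triangulated categories. -/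
def IsExact (F : C ⥤ C) : Prop := ∃ _ : F.CommShift ℤ, F.IsTriangulated

lemma IsExact.symm {e : C ≌ C} (h : IsExact e.functor) : IsExact e.inverse := by
  obtain ⟨h, h'⟩ := h
  let : e.inverse.CommShift ℤ := e.toAdjunction.rightAdjointCommShift ℤ
  have : e.toAdjunction.CommShift ℤ := e.toAdjunction.commShift_of_leftAdjoint ℤ
  exact ⟨inferInstance, e.toAdjunction.isTriangulated_rightAdjoint⟩

variable (C) in
/-- The exact `ℂ`-linear autoequivalences of `C`. -/
structure ExactAutoequivalence [Linear ℂ C] where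
  equiv : C ≌ C
  exact : IsExact equiv.functor
  linear : equiv.functor.Linear ℂ

variable (C) in
instance autSetoid [Linear ℂ C] : Setoid (ExactAutoequivalence C) where
  r e e' := Nonempty (e.equiv.functor ≅ e'.equiv.functor)
  iseqv := ⟨fun _ => ⟨Iso.refl _⟩, fun ⟨i⟩ => ⟨i.symm⟩, fun ⟨i⟩ ⟨j⟩ => ⟨i ≪≫ j⟩⟩

variable (C) in
/-- The group of exact `ℂ`-linear autoequivalences up to natural isomorphism. -/
def AutD [Linear ℂ C] : Type _ := _root_.Quotient (autSetoid C)

namespace ExactAutoequivalence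

variable [Linear ℂ C]

/-- The class of an autoequivalence. -/
def toAut (e : ExactAutoequivalence C) : AutD C := _root_.Quotient.mk _ e

/-- The identity. -/
@[simps]
def refl : ExactAutoequivalence C where
  equiv := CategoryTheory.Equivalence.refl
  exact := ⟨inferInstanceAs ((𝟭 C).CommShift ℤ), inferInstanceAs (𝟭 C).IsTriangulated⟩
  linear := inferInstanceAs ((𝟭 C).Linear ℂ)

/-- The composition: first `e'`, then `e`. -/
@[simps]
def comp (e e' : ExactAutoequivalence C) : ExactAutoequivalence C where
  equiv := e'.equiv.trans e.equiv
  exact := by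
    obtain ⟨_, _⟩ := e.exact
    obtain ⟨_, _⟩ := e'.exact
    exact ⟨inferInstanceAs ((e'.equiv.functor ⋙ e.equiv.functor).CommShift ℤ),
      inferInstanceAs (e'.equiv.functor ⋙ e.equiv.functor).IsTriangulated⟩
  linear :=
    have := e.linear
    have := e'.linear
    inferInstanceAs ((e'.equiv.functor ⋙ e.equiv.functor).Linear ℂ)

/-- The inverse. -/
@[simps]
def symm (e : ExactAutoequivalence C) : ExactAutoequivalence C where
  equiv := e.equiv.symm
  exact := e.exact.symm
  linear :=
    have := e.linear
    have : e.equiv.functor.Additive := by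
      obtain ⟨_, _⟩ := e.exact
      infer_instance
    e.equiv.inverseLinear ℂ

end ExactAutoequivalence

/-- Quasi-inverses of isomorphic equivalences are isomorphic. -/
def inverseIso {e e' : C ≌ C} (i : e.functor ≅ e'.functor) : e.inverse ≅ e'.inverse :=
  Iso.isoInverseOfIsoFunctor i

namespace AutD

variable [Linear ℂ C]

noncomputable instance : Group (AutD C) where
  one := ExactAutoequivalence.refl.toAut
  mul := _root_.Quotient.map₂ ExactAutoequivalence.comp
    fun _ _ ⟨i⟩ _ _ ⟨j⟩ => ⟨NatIso.hcomp j i⟩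
  inv := _root_.Quotient.map ExactAutoequivalence.symm fun _ _ ⟨i⟩ => ⟨inverseIso i⟩
  mul_assoc := by
    rintro ⟨a⟩ ⟨b⟩ ⟨c⟩
    exact _root_.Quotient.sound ⟨Iso.refl _⟩
  one_mul := by
    rintro ⟨a⟩
    exact _root_.Quotient.sound ⟨Functor.rightUnitor _⟩
  mul_one := by
    rintro ⟨a⟩
    exact _root_.Quotient.sound ⟨Functor.leftUnitor _⟩
  inv_mul_cancel := by
    rintro ⟨a⟩
    exact _root_.Quotient.sound ⟨a.equiv.unitIso.symm⟩

end AutD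

/-! ### The action on hearts -/

/-- The t-structure transported along an exact autoequivalence. -/
def transport (t : TStructure C) (e : C ≌ C) [e.functor.CommShift ℤ] [e.functor.IsTriangulated]
    [e.inverse.CommShift ℤ] [e.inverse.IsTriangulated] : TStructure C where
  le n := (t.le n).inverseImage e.inverse
  ge n := (t.ge n).inverseImage e.inverse
  le_shift n a n' h X hX := (t.le n').prop_of_iso ((e.inverse.commShiftIso a).symm.app X)
    (t.le_shift n a n' h _ hX)
  ge_shift n a n' h X hX := (t.ge n').prop_of_iso ((e.inverse.commShiftIso a).symm.app X)
    (t.ge_shift n a n' h _ hX)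
  zero' X Y f hX hY := e.inverse.map_injective (by
    rw [t.zero' (e.inverse.map f) hX hY, Functor.map_zero])
  le_zero_le X hX := t.le_zero_le _ hX
  ge_one_le X hX := t.ge_one_le _ hX
  exists_triangle_zero_one A := by
    obtain ⟨X, Y, hX, hY, f, g, h, mem⟩ := t.exists_triangle_zero_one (e.inverse.obj A)
    refine ⟨e.functor.obj X, e.functor.obj Y, (t.le 0).prop_of_iso (e.unitIso.app X) hX,
      (t.ge 1).prop_of_iso (e.unitIso.app Y) hY,
      e.functor.map f ≫ e.counitIso.hom.app A, e.counitIso.inv.app A ≫ e.functor.map g,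
      e.functor.map h ≫ (e.functor.commShiftIso (1 : ℤ)).hom.app X, ?_⟩
    refine isomorphic_distinguished _ (e.functor.map_distinguished _ mem) _ ?_
    refine Triangle.isoMk _ _ (Iso.refl _) (e.counitIso.symm.app A) (Iso.refl _) ?_ ?_ ?_
    · change (e.functor.map f ≫ e.counitIso.hom.app A) ≫ e.counitIso.inv.app A =
        𝟙 _ ≫ e.functor.map f
      simp
    · change (e.counitIso.inv.app A ≫ e.functor.map g) ≫ 𝟙 _ =
        e.counitIso.inv.app A ≫ e.functor.map g
      simp
    · change (e.functor.map h ≫ (e.functor.commShiftIso (1 : ℤ)).hom.app X) ≫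
          (shiftFunctor C (1 : ℤ)).map (𝟙 _) =
        𝟙 _ ≫ e.functor.map h ≫ (e.functor.commShiftIso (1 : ℤ)).hom.app X
      simp

lemma IsHeart.inverseImage {A : ObjectProperty C} (h : IsHeart A) {e : C ≌ C}
    (he : IsExact e.functor) : IsHeart (A.inverseImage e.inverse) := by
  obtain ⟨_, _⟩ := he.symm
  obtain ⟨_, _⟩ := he
  obtain ⟨t, ht, rfl⟩ := h
  refine ⟨transport t e, fun X => ?_, rfl⟩
  obtain ⟨⟨m, hm⟩, ⟨n, hn⟩⟩ := ht (e.inverse.obj X)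
  exact ⟨⟨m, ⟨hm.ge⟩⟩, ⟨n, ⟨hn.le⟩⟩⟩

lemma Heart.prop_of_iso (A : Heart C) {X Y : C} (i : X ≅ Y) (h : A.prop X) : A.prop Y := by
  obtain ⟨t, -, e⟩ := A.isHeart
  rw [← e] at h ⊢
  exact ⟨(t.le 0).prop_of_iso i h.1, (t.ge 0).prop_of_iso i h.2⟩

/-- The image of a heart under an autoequivalence: the objects `X` such that `Φ⁻¹ X` lies in
the heart. -/
@[simps]
def ExactAutoequivalence.mapHeart [Linear ℂ C] (e : ExactAutoequivalence C) (A : Heart C) :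
    Heart C where
  prop := A.prop.inverseImage e.equiv.inverse
  isHeart := A.isHeart.inverseImage e.exact

/-- The action of autoequivalences on hearts. -/
noncomputable instance [Linear ℂ C] : MulAction (AutD C) (Heart C) where
  smul g A := _root_.Quotient.lift (fun e : ExactAutoequivalence C => e.mapHeart A)
    (by
      rintro e e' ⟨i⟩
      refine Heart.ext (funext fun X => propext ⟨?_, ?_⟩)
      · exact A.prop_of_iso ((inverseIso i).app X)
      · exact A.prop_of_iso ((inverseIso i).symm.app X)) g
  one_smul A := rfl
  mul_smul := by
    rintro ⟨e⟩ ⟨e'⟩ A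
    rfl

/-! ### The connected component and its symmetry group -/

/-- The vertices of the connected component of the exchange graph containing `A₀`. -/
def EG0 (A₀ : Heart C) : Set (Heart C) := {A | (exchangeGraph C).Reachable A₀ A}

section

variable [Linear ℂ C] (A₀ : Heart C)

/-- The autoequivalences preserving the connected component of `A₀`. -/
def preserving : Subgroup (AutD C) where
  carrier := {g | ∀ A, g • A ∈ EG0 A₀ ↔ A ∈ EG0 A₀}
  one_mem' A := by rw [one_smul]
  mul_mem' {g h} hg hh A := by rw [mul_smul, hg, hh]
  inv_mem' {g} hg A := by rw [← hg, smul_inv_smul]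

noncomputable instance : MulAction (preserving A₀) (EG0 A₀) where
  smul g A := ⟨g.1 • A.1, (g.2 A.1).2 A.2⟩
  one_smul A := Subtype.ext (one_smul _ A.1)
  mul_smul g h A := Subtype.ext (mul_smul g.1 h.1 A.1)

/-- The group `Aut⁰`: the autoequivalences preserving the connected component of `A₀`, modulo
those which act trivially on it. -/
abbrev Aut0 : Type _ :=
  preserving A₀ ⧸ (MulAction.toPermHom (preserving A₀) (EG0 A₀)).ker

/-- The induced action of `Aut⁰` on the vertices of the connected component. -/
noncomputable instance : MulAction (Aut0 A₀) (EG0 A₀) :=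
  MulAction.compHom (EG0 A₀)
    (QuotientGroup.kerLift (MulAction.toPermHom (preserving A₀) (EG0 A₀)))

end

/-! ### Twist functors -/

/-- `Φ` is a twist functor along `X`: there is a natural transformation `Y ⟶ Φ Y` such that, for
all `Y`, the object `Φ Y` is a cone of the evaluation `X ⊗ Hom(X, Y) ⟶ Y`. Here `X ⊗ Hom(X, Y)` is
the direct sum of copies of the shifts `X[n]` indexed by bases of the spaces `Hom(X[n], Y)`, and
the evaluation is given by the basis vectors. -/
def IsTwist [Linear ℂ C] (X : C) (Φ : C ⥤ C) : Prop :=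
  ∃ η : 𝟭 C ⟶ Φ, ∀ Y : C,
    ∃ (ι : ℤ → Type) (b : ∀ n, Module.Basis (ι n) ℂ (X⟦n⟧ ⟶ Y))
      (c : Cofan fun p : Σ n, ι n => X⟦p.1⟧) (ev : c.pt ⟶ Y) (δ : Φ.obj Y ⟶ c.pt⟦(1 : ℤ)⟧),
      Nonempty (IsColimit c) ∧ (∀ p, c.inj p ≫ ev = b p.1 p.2) ∧
        Triangle.mk ev (η.app Y) δ ∈ distTriang C

/-- `g` is the class of a twist functor along `X`. -/
def AutD.IsTwist [Linear ℂ C] (X : C) (g : AutD C) : Prop :=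
  ∃ e : ExactAutoequivalence C, e.toAut = g ∧ _root_.IsTwist X e.equiv.functor

/-- `g` is the class of the shift functor `[1]`. -/
def AutD.IsShift [Linear ℂ C] (g : AutD C) : Prop :=
  ∃ e : ExactAutoequivalence C, e.toAut = g ∧
    Nonempty (e.equiv.functor ≅ shiftFunctor C (1 : ℤ))

end Triangulated

set_option linter.unusedSimpArgs false
set_option linter.unusedSectionVars false

/-! ### Graded vector spaces -/

section Graded

variable {k V W : Type} [Field k] [AddCommGroup V] [Module k V] [AddCommGroup W] [Module k W]
  {gr : ℤ → Submodule k V}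

/-- The operator multiplying the component of degree `n` by `φ n`. -/
noncomputable def gradeScale (h : DirectSum.IsInternal gr) (φ : ℤ → k) : V →ₗ[k] V :=
  (DirectSum.toModule k ℤ V fun n => φ n • (gr n).subtype) ∘ₗ
    (LinearEquiv.ofBijective (DirectSum.coeLinearMap gr) h).symm.toLinearMap

lemma gradeScale_apply (h : DirectSum.IsInternal gr) (φ : ℤ → k) {n : ℤ} {v : V}
    (hv : v ∈ gr n) : gradeScale h φ v = φ n • v := by
  have : (LinearEquiv.ofBijective (DirectSum.coeLinearMap gr) h).symm v =
      DirectSum.lof k ℤ (fun i => gr i) n ⟨v, hv⟩ := by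
    rw [LinearEquiv.symm_apply_eq]
    exact (DirectSum.coeLinearMap_lof gr n ⟨v, hv⟩).symm
  rw [gradeScale, LinearMap.comp_apply, LinearEquiv.coe_coe, this, DirectSum.toModule_lof]
  rfl

lemma graded_induction (h : DirectSum.IsInternal gr) {p : V → Prop} (v : V)
    (mem : ∀ n, ∀ v ∈ gr n, p v) (zero : p 0) (add : ∀ v w, p v → p w → p (v + w)) : p v := by
  have hv : v ∈ ⨆ i, gr i := by
    rw [h.submodule_iSup_eq_top]; trivial
  exact Submodule.iSup_induction gr (motive := p) hv mem zero add

lemma graded_ext (h : DirectSum.IsInternal gr) {f g : V →ₗ[k] W}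
    (e : ∀ n, ∀ v ∈ gr n, f v = g v) : f = g :=
  LinearMap.ext fun v => graded_induction h v e (by simp) fun v w hv hw => by
    rw [map_add, map_add, hv, hw]

/-- The projection to the component of degree `n`. -/
noncomputable abbrev gradeProj (h : DirectSum.IsInternal gr) (n : ℤ) : V →ₗ[k] V :=
  gradeScale h (Pi.single n 1)

lemma gradeProj_same (h : DirectSum.IsInternal gr) {n : ℤ} {v : V} (hv : v ∈ gr n) :
    gradeProj h n v = v := by
  rw [gradeProj, gradeScale_apply h _ hv, Pi.single_eq_same, one_smul]

lemma gradeProj_ne (h : DirectSum.IsInternal gr) {m n : ℤ} {v : V} (hv : v ∈ gr m)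
    (e : m ≠ n) : gradeProj h n v = 0 := by
  rw [gradeProj, gradeScale_apply h _ hv, Pi.single_eq_of_ne e, zero_smul]

lemma gradeProj_mem (h : DirectSum.IsInternal gr) (n : ℤ) (v : V) : gradeProj h n v ∈ gr n := by
  refine graded_induction h (p := fun v => gradeProj h n v ∈ gr n) v ?_ (by simp)
    fun v w hv hw => by rw [map_add]; exact Submodule.add_mem _ hv hw
  intro m v hv
  by_cases e : m = n
  · subst e; rwa [gradeProj_same h hv]
  · rw [gradeProj_ne h hv e]; exact Submodule.zero_mem _

lemma exists_sum_gradeProj (h : DirectSum.IsInternal gr) (v : V) :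
    ∃ s : Finset ℤ, ∀ t : Finset ℤ, s ⊆ t → ∑ n ∈ t, gradeProj h n v = v := by
  refine graded_induction h (p := fun v => ∃ s : Finset ℤ, ∀ t : Finset ℤ, s ⊆ t →
    ∑ n ∈ t, gradeProj h n v = v) v ?_ ⟨∅, by simp⟩ ?_
  · intro m v hv
    refine ⟨{m}, fun t ht => ?_⟩
    rw [Finset.sum_eq_single m (fun n _ hn => gradeProj_ne h hv (Ne.symm hn))
      (fun hm => absurd (ht (Finset.mem_singleton_self m)) hm), gradeProj_same h hv]
  · rintro v w ⟨s, hs⟩ ⟨s', hs'⟩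
    classical
    refine ⟨s ∪ s', fun t ht => ?_⟩
    simp only [map_add, Finset.sum_add_distrib]
    rw [hs t (Finset.union_subset_left ht), hs' t (Finset.union_subset_right ht)]

/-- A linear map of degree `c` commutes with the scaling operators up to a translation. -/
lemma map_gradeScale (h : DirectSum.IsInternal gr) {gr' : ℤ → Submodule k W}
    (h' : DirectSum.IsInternal gr') (f : V →ₗ[k] W) (c : ℤ)
    (hf : ∀ n, ∀ v ∈ gr n, f v ∈ gr' (n + c)) (φ ψ : ℤ → k) (e : ∀ n, φ n = ψ (n + c)) (v : V) :
    f (gradeScale h φ v) = gradeScale h' ψ (f v) := by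
  have : f ∘ₗ gradeScale h φ = gradeScale h' ψ ∘ₗ f := graded_ext h fun n v hv => by
    rw [LinearMap.comp_apply, LinearMap.comp_apply, gradeScale_apply h _ hv,
      gradeScale_apply h' _ (hf n v hv), map_smul, e]
  exact LinearMap.congr_fun this v

lemma map_gradeProj (h : DirectSum.IsInternal gr) {gr' : ℤ → Submodule k W}
    (h' : DirectSum.IsInternal gr') (f : V →ₗ[k] W) (c : ℤ)
    (hf : ∀ n, ∀ v ∈ gr n, f v ∈ gr' (n + c)) (n : ℤ) (v : V) :
    f (gradeProj h n v) = gradeProj h' (n + c) (f v) := by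
  refine map_gradeScale h h' f c hf _ _ (fun m => ?_) v
  by_cases e : m = n
  · subst e; simp
  · rw [Pi.single_eq_of_ne e, Pi.single_eq_of_ne (by omega)]

lemma isInternal_of_proj (π : ℤ → V →ₗ[k] V) (h₁ : ∀ n, ∀ v ∈ gr n, π n v = v)
    (h₂ : ∀ m n, m ≠ n → ∀ v ∈ gr m, π n v = 0) (h₃ : ∀ v, v ∈ ⨆ n, gr n) :
    DirectSum.IsInternal gr := by
  rw [DirectSum.isInternal_submodule_iff_iSupIndep_and_iSup_eq_top]
  refine ⟨fun i => Submodule.disjoint_def.2 fun v hv hv' => ?_, eq_top_iff.2 fun v _ => h₃ v⟩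
  rw [← h₁ i v hv]
  have : ⨆ j, ⨆ (_ : j ≠ i), gr j ≤ LinearMap.ker (π i) :=
    iSup₂_le fun j hj w hw => h₂ j i hj w hw
  exact this hv'

/-- A subspace stable under the projections is graded. -/
lemma isInternal_comap (h : DirectSum.IsInternal gr) (L : W →ₗ[k] V)
    (hL : Function.Injective L) (hs : ∀ n w, ∃ w', L w' = gradeProj h n (L w)) :
    DirectSum.IsInternal fun n => (gr n).comap L := by
  choose p hp using hs
  let π : ℤ → W →ₗ[k] W := fun n =>
    { toFun := p n
      map_add' := fun v w => hL (by simp only [hp, map_add])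
      map_smul' := fun c w => hL (by simp only [hp, map_smul, RingHom.id_apply]) }
  refine isInternal_of_proj π (fun n w hw => hL ((hp n w).trans (gradeProj_same h hw)))
    (fun m n e w hw => hL ((hp n w).trans ((gradeProj_ne h hw e).trans (map_zero L).symm)))
    fun w => ?_
  obtain ⟨s, hs⟩ := exists_sum_gradeProj h (L w)
  have : w = ∑ n ∈ s, p n w := hL (by rw [map_sum, ← hs s subset_rfl]; simp only [hp, hs s subset_rfl])
  rw [this]
  refine Submodule.sum_mem _ fun n _ => Submodule.mem_iSup_of_mem n ?_
  change L (p n w) ∈ gr n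
  rw [hp]
  exact gradeProj_mem h n _

/-- The quotient by a subspace stable under the projections is graded. -/
lemma isInternal_map (h : DirectSum.IsInternal gr) (L : V →ₗ[k] W)
    (hL : Function.Surjective L) (hs : ∀ n v, L v = 0 → L (gradeProj h n v) = 0) :
    DirectSum.IsInternal fun n => (gr n).map L := by
  have hk : ∀ n v w, L v = L w → L (gradeProj h n v) = L (gradeProj h n w) := fun n v w e => by
    rw [← sub_eq_zero, ← map_sub, ← map_sub]
    exact hs n _ (by rw [map_sub, e, sub_self])
  let r := Function.surjInv hL
  have hr : ∀ w, L (r w) = w := Function.surjInv_eq hL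
  let π : ℤ → W →ₗ[k] W := fun n =>
    { toFun := fun w => L (gradeProj h n (r w))
      map_add' := fun v w => by
        rw [← map_add, ← map_add]; exact hk n _ _ (by rw [map_add, hr, hr, hr])
      map_smul' := fun c w => by
        rw [← map_smul, ← map_smul]; exact hk n _ _ (by rw [map_smul, hr, hr]; rfl) }
  have hπ : ∀ n v, π n (L v) = L (gradeProj h n v) := fun n v => hk n _ _ (hr _)
  refine isInternal_of_proj π ?_ ?_ fun w => ?_
  · rintro n _ ⟨v, hv, rfl⟩
    rw [hπ, gradeProj_same h hv]
  · rintro m n e _ ⟨v, hv, rfl⟩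
    rw [hπ, gradeProj_ne h hv e, map_zero]
  · obtain ⟨v, rfl⟩ := hL w
    obtain ⟨s, hs⟩ := exists_sum_gradeProj h v
    rw [← hs s subset_rfl, map_sum]
    exact Submodule.sum_mem _ fun n _ => Submodule.mem_iSup_of_mem n
      (Submodule.mem_map_of_mem (gradeProj_mem h n v))

end Graded

namespace DGModule

variable {k : Type} [Field k] {A : DGAlgebra k} {M N P : DGModule A}

/-- The projection of a dg module to its component of degree `n`. -/
noncomputable abbrev proj (M : DGModule A) (n : ℤ) : M.carrier →ₗ[k] M.carrier :=
  gradeProj M.isInternal n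

lemma proj_mem (M : DGModule A) (n : ℤ) (m : M.carrier) : M.proj n m ∈ M.gr n :=
  gradeProj_mem _ _ _

lemma d_proj (M : DGModule A) (n : ℤ) (m : M.carrier) :
    M.d (M.proj n m) = M.proj (n + 1) (M.d m) :=
  map_gradeProj M.isInternal M.isInternal M.d 1 (fun _ _ h => M.d_mem h) n m

lemma lin_proj (f : M ⟶ N) (n : ℤ) (m : M.carrier) : f.lin (M.proj n m) = N.proj n (f.lin m) := by
  have := map_gradeProj M.isInternal N.isInternal (f.lin.restrictScalars k) 0
    (fun n v h => by rw [add_zero]; exact f.map_mem h) n m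
  rwa [add_zero] at this

lemma smul_proj (M : DGModule A) {j : ℤ} {a : A.carrier} (ha : a ∈ A.gr j) (n : ℤ)
    (m : M.carrier) : op a • M.proj n m = M.proj (n + j) (op a • m) :=
  map_gradeProj M.isInternal M.isInternal
    ({ toFun := fun m => op a • m, map_add' := smul_add _, map_smul' := fun c m => smul_comm _ c m } :
      M.carrier →ₗ[k] M.carrier) j (fun _ _ h => M.smul_mem h ha) n m

/-- The parity operator `m ↦ (-1)^|m| m`. -/
noncomputable def par (M : DGModule A) : M.carrier →ₗ[k] M.carrier :=
  gradeScale M.isInternal fun n => (n.negOnePow : ℤ)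

lemma par_apply {n : ℤ} {m : M.carrier} (h : m ∈ M.gr n) : M.par m = n.negOnePow • m := by
  rw [par, gradeScale_apply _ _ h, Units.smul_def, ← Int.cast_smul_eq_zsmul k]

lemma linearMap_ext {V : Type} [AddCommGroup V] [Module k V] {f g : M.carrier →ₗ[k] V}
    (h : ∀ n, ∀ m ∈ M.gr n, f m = g m) (m : M.carrier) : f m = g m :=
  LinearMap.congr_fun (graded_ext M.isInternal h) m

lemma par_par (m : M.carrier) : M.par (M.par m) = m :=
  linearMap_ext (f := M.par ∘ₗ M.par) (g := LinearMap.id) (fun n m h => by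
    rw [LinearMap.comp_apply, par_apply h, par_apply (units_smul_mem _ _ h), smul_smul,
      Int.units_mul_self, one_smul]; rfl) m

lemma d_par (m : M.carrier) : M.d (M.par m) = -M.par (M.d m) :=
  linearMap_ext (f := M.d ∘ₗ M.par) (g := -(M.par ∘ₗ M.d)) (fun n m h => by
    rw [LinearMap.comp_apply, LinearMap.neg_apply, LinearMap.comp_apply, par_apply h,
      par_apply (M.d_mem h), d_units_smul, Int.negOnePow_succ, Units.neg_smul, neg_neg]) m

lemma par_smul {j : ℤ} {a : A.carrier} (ha : a ∈ A.gr j) (m : M.carrier) :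
    M.par (op a • m) = j.negOnePow • (op a • M.par m) :=
  linearMap_ext
    (f := M.par ∘ₗ ({ toFun := fun m => op a • m, map_add' := smul_add _, map_smul' := fun c m => smul_comm _ c m } :
      M.carrier →ₗ[k] M.carrier))
    (g := j.negOnePow • (({ toFun := fun m => op a • m, map_add' := smul_add _, map_smul' := fun c m => smul_comm _ c m } :
      M.carrier →ₗ[k] M.carrier) ∘ₗ M.par)) (fun n m h => by
    change M.par (op a • m) = j.negOnePow • (op a • M.par m)
    rw [par_apply h, par_apply (M.smul_mem h ha), smul_comm (op a) n.negOnePow m, smul_smul,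
      Int.negOnePow_add, mul_comm]) m

lemma d_smul (a : A.carrier) (m : M.carrier) :
    M.d (op a • m) = op a • M.d m + op (A.d a) • M.par m :=
  linearMap_ext
    (f := M.d ∘ₗ ({ toFun := fun m => op a • m, map_add' := smul_add _, map_smul' := fun c m => smul_comm _ c m } :
      M.carrier →ₗ[k] M.carrier))
    (g := ({ toFun := fun m => op a • m, map_add' := smul_add _, map_smul' := fun c m => smul_comm _ c m } :
      M.carrier →ₗ[k] M.carrier) ∘ₗ M.d +
      ({ toFun := fun m => op (A.d a) • m, map_add' := smul_add _, map_smul' := fun c m => smul_comm _ c m } :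
      M.carrier →ₗ[k] M.carrier) ∘ₗ M.par) (fun n m h => by
    change M.d (op a • m) = op a • M.d m + op (A.d a) • M.par m
    rw [M.leibniz a h, par_apply h, smul_comm n.negOnePow]) m

lemma lin_par (f : M ⟶ N) (m : M.carrier) : f.lin (M.par m) = N.par (f.lin m) :=
  linearMap_ext (f := f.lin.restrictScalars k ∘ₗ M.par) (g := N.par ∘ₗ f.lin.restrictScalars k)
    (fun n m h => by
      change f.lin (M.par m) = N.par (f.lin m)
      rw [par_apply h, par_apply (f.map_mem h), lin_units_smul]) m

lemma par_shift (M : DGModule A) (n : ℤ) (m : M.carrier) :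
    (M.shift n).par m = n.negOnePow • M.par m :=
  linearMap_ext (M := M.shift n) (f := (M.shift n).par) (g := n.negOnePow • M.par) (fun i m h => by
    have h' : m ∈ M.gr (i + n) := h
    rw [par_apply h]
    change i.negOnePow • m = n.negOnePow • M.par m
    rw [par_apply h', smul_smul, add_comm i n, Int.negOnePow_add, ← mul_assoc, Int.units_mul_self,
      one_mul]) m

lemma par_cone (f : M ⟶ N) (x : M.carrier × N.carrier) :
    (cone f).par x = (-M.par x.1, N.par x.2) :=
  linearMap_ext (M := cone f) (f := (cone f).par)
    (g := (-(M.par ∘ₗ LinearMap.fst k M.carrier N.carrier)).prod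
      (N.par ∘ₗ LinearMap.snd k M.carrier N.carrier)) (fun i x h => by
    rw [par_apply h]
    change i.negOnePow • x = (-M.par x.1, N.par x.2)
    rw [par_apply h.1, par_apply h.2, Int.negOnePow_succ, Units.neg_smul, neg_neg]
    rfl) x

/-! ### Quasi-isomorphisms -/

/-- A morphism of dg modules inducing a bijection on cohomology. -/
structure IsQis (f : M ⟶ N) : Prop where
  inj : ∀ m n, M.d m = 0 → f.lin m = N.d n → ∃ m', m = M.d m'
  surj : ∀ n, N.d n = 0 → ∃ m n', M.d m = 0 ∧ n = f.lin m + N.d n'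

/-- A dg module with vanishing cohomology. -/
def Acyclic (M : DGModule A) : Prop := ∀ m, M.d m = 0 → ∃ m', m = M.d m'

/-- A dg module with vanishing cohomology in degree `n`. -/
def ExactAt (M : DGModule A) (n : ℤ) : Prop := ∀ m ∈ M.gr n, M.d m = 0 → ∃ m', M.d m' = m

lemma Acyclic.exactAt (h : M.Acyclic) (n : ℤ) : M.ExactAt n := fun m _ hm => by
  obtain ⟨m', rfl⟩ := h m hm
  exact ⟨m', rfl⟩

lemma ExactAt.proj {n : ℤ} (h : M.ExactAt n) {m : M.carrier} (hm : M.proj (n + 1) (M.d m) = 0) :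
    ∃ m' ∈ M.gr (n - 1), M.d m' = M.proj n m := by
  obtain ⟨m', e⟩ := h (M.proj n m) (M.proj_mem n m) (by rw [d_proj, hm])
  refine ⟨M.proj (n - 1) m', M.proj_mem _ _, ?_⟩
  rw [d_proj, sub_add_cancel, e, gradeProj_same _ (M.proj_mem n m)]

lemma acyclic_of_exactAt (h : ∀ n, M.ExactAt n) : M.Acyclic := fun m hm => by
  choose p hp hp' using fun n => (h n).proj (m := m) (by rw [hm, map_zero])
  obtain ⟨s, hs⟩ := exists_sum_gradeProj M.isInternal m
  refine ⟨∑ n ∈ s, p n, ?_⟩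
  rw [map_sum]
  exact ((Finset.sum_congr rfl fun n _ => hp' n).trans (hs s subset_rfl)).symm

lemma IsQis.acyclic_cone {f : M ⟶ N} (h : IsQis f) : (cone f).Acyclic := by
  rintro ⟨m, n⟩ e
  have e1 : -M.d m = 0 := congrArg Prod.fst e
  have e2 : f.lin m + N.d n = 0 := congrArg Prod.snd e
  obtain ⟨m', rfl⟩ := h.inj m (-n) (neg_eq_zero.1 e1) (by
    rw [map_neg]; exact eq_neg_of_add_eq_zero_left e2)
  obtain ⟨m'', n', h1, h2⟩ := h.surj (f.lin m' + n) (by rw [map_add, ← f.comm]; exact e2)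
  refine ⟨(-m' + m'', n'), ?_⟩
  change (M.d m', n) = (-M.d (-m' + m''), f.lin (-m' + m'') + N.d n')
  rw [map_add, h1, map_neg, add_zero, neg_neg, map_add, map_neg, add_assoc, ← h2]
  simp

lemma isQis_of_acyclic_cone {f : M ⟶ N} (h : (cone f).Acyclic) : IsQis f where
  inj m n hm e := by
    obtain ⟨⟨x, y⟩, e'⟩ := h (m, -n) (by
      change (-M.d m, f.lin m + N.d (-n)) = ((0 : M.carrier), (0 : N.carrier))
      rw [hm, e]; simp)
    have e1 : m = -M.d x := congrArg Prod.fst e'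
    exact ⟨-x, by rw [e1, map_neg]⟩
  surj n hn := by
    obtain ⟨⟨x, y⟩, e'⟩ := h (0, n) (by
      change (-M.d 0, f.lin 0 + N.d n) = ((0 : M.carrier), (0 : N.carrier))
      rw [hn]; simp)
    have e1 : 0 = -M.d x := congrArg Prod.fst e'
    have e2 : n = f.lin x + N.d y := congrArg Prod.snd e'
    exact ⟨x, y, neg_eq_zero.1 e1.symm, e2⟩

lemma isQis_of_bijective {f : M ⟶ N} (h : Function.Bijective (cohomologyMap f)) : IsQis f where
  inj m n hm e := by
    have := h.1 (a₁ := Submodule.mkQ _ ⟨m, hm⟩) (a₂ := 0) (by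
      rw [map_zero]
      exact (Submodule.Quotient.mk_eq_zero _).2 ⟨n, e.symm⟩)
    obtain ⟨m', hm'⟩ := (Submodule.Quotient.mk_eq_zero _).1 this
    exact ⟨m', hm'.symm⟩
  surj n hn := by
    obtain ⟨x, hx⟩ := h.2 (Submodule.mkQ _ ⟨n, hn⟩)
    obtain ⟨⟨m, hm⟩, rfl⟩ := Submodule.mkQ_surjective _ x
    obtain ⟨n', e⟩ := (Submodule.Quotient.eq _).1 hx
    replace e : N.d n' = f.lin m - n := e
    exact ⟨m, -n', hm, by rw [map_neg, e]; abel⟩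

lemma IsQis.exactAt_iff {f : M ⟶ N} (h : IsQis f) (n : ℤ) : M.ExactAt n ↔ N.ExactAt n := by
  constructor
  · intro hM y hy hdy
    obtain ⟨m, n', hm, e⟩ := h.surj y hdy
    obtain ⟨m', -, hm'⟩ := hM.proj (m := m) (by rw [hm, map_zero])
    refine ⟨f.lin m' + N.proj (n - 1) n', ?_⟩
    rw [map_add, ← f.comm, hm', lin_proj, d_proj, sub_add_cancel, ← map_add, ← e,
      gradeProj_same _ hy]
  · intro hN m hm hdm
    obtain ⟨y, hy⟩ := hN (f.lin m) (f.map_mem hm) (by rw [← f.comm, hdm, map_zero])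
    obtain ⟨m', rfl⟩ := h.inj m y hdm hy.symm
    exact ⟨m', rfl⟩

/-- A surjective morphism with acyclic kernel is a quasi-isomorphism. -/
lemma isQis_of_surjective {f : M ⟶ N} (hf : ∀ n, ∃ m, f.lin m = n)
    (hk : ∀ m, f.lin m = 0 → M.d m = 0 → ∃ m', f.lin m' = 0 ∧ m = M.d m') : IsQis f where
  inj m n hm e := by
    obtain ⟨x, rfl⟩ := hf n
    obtain ⟨m', -, h⟩ := hk (m - M.d x) (by rw [map_sub, f.comm, e, sub_self])
      (by rw [map_sub, hm, M.d_d, sub_zero])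
    exact ⟨m' + x, by rw [map_add, ← h]; abel⟩
  surj n hn := by
    obtain ⟨x, rfl⟩ := hf n
    obtain ⟨m', h1, h⟩ := hk (M.d x) (by rw [f.comm, hn]) (M.d_d x)
    exact ⟨x - m', 0, by rw [map_sub, ← h, sub_self], by rw [map_sub, h1, map_zero]; abel⟩

/-- An injective morphism with acyclic cokernel is a quasi-isomorphism. -/
lemma isQis_of_injective {f : M ⟶ N} (hf : ∀ m, f.lin m = 0 → m = 0)
    (hk : ∀ n m, N.d n = f.lin m → ∃ m' n', n = f.lin m' + N.d n') : IsQis f where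
  inj m n _ e := by
    obtain ⟨m', n', rfl⟩ := hk n m e.symm
    refine ⟨m', sub_eq_zero.1 (hf _ ?_)⟩
    rw [map_sub, e, map_add, N.d_d, f.comm]; abel
  surj n hn := by
    obtain ⟨m', n', rfl⟩ := hk n 0 (by rw [hn, map_zero])
    refine ⟨m', n', hf _ ?_, rfl⟩
    rw [map_add, N.d_d, add_zero, ← f.comm] at hn
    exact hn

end DGModule

namespace DGDerivedCategory

open DGModule DGHomotopyCategory

variable {k : Type} [Field k] {A : DGAlgebra k} {M N P : DGModule A}

instance : (Q A).Additive := inferInstanceAs (q A ⋙ Qh A).Additive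
instance : (Q A).Linear k := inferInstanceAs (Functor.Linear k (q A ⋙ Qh A))
noncomputable instance : (Q A).CommShift ℤ := inferInstanceAs ((q A ⋙ Qh A).CommShift ℤ)
instance : (Qh A).EssSurj := Localization.essSurj (Qh A) (acyclic A).trW
instance : (Q A).EssSurj := inferInstanceAs (q A ⋙ Qh A).EssSurj

lemma exists_iso_Q (X : DGDerivedCategory A) : ∃ M : DGModule A, Nonempty (X ≅ (Q A).obj M) :=
  ⟨_, ⟨((Q A).objObjPreimageIso X).symm⟩⟩

lemma acyclic_shift (h : M.Acyclic) (n : ℤ) : (M.shift n).Acyclic := fun m hm => by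
  replace hm : n.negOnePow • M.d m = 0 := hm
  obtain ⟨m', rfl⟩ := h m (by
    have := congrArg (fun x => n.negOnePow • x) hm
    simpa [smul_smul] using this)
  refine ⟨n.negOnePow • m', ?_⟩
  change M.d m' = n.negOnePow • M.d (n.negOnePow • m')
  rw [d_units_smul, smul_smul, Int.units_mul_self, one_smul]

lemma isZero_cohomology (h : M.Acyclic) : IsZero (ModuleCat.of k M.cohomology) := by
  have : Subsingleton M.cohomology := by
    refine ⟨fun x y => ?_⟩
    obtain ⟨⟨x, hx⟩, rfl⟩ := Submodule.mkQ_surjective _ x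
    obtain ⟨⟨y, hy⟩, rfl⟩ := Submodule.mkQ_surjective _ y
    obtain ⟨z, hz⟩ := h (x - y) (by rw [map_sub, show M.d x = 0 from hx, show M.d y = 0 from hy, sub_self])
    exact (Submodule.Quotient.eq _).2 ⟨z, hz.symm⟩
  exact ModuleCat.isZero_of_subsingleton _

lemma acyclic_q (h : M.Acyclic) : acyclic A ((q A).obj M) := fun n => by
  refine IsZero.of_iso (isZero_cohomology (acyclic_shift h n)) ?_
  exact (DGHomotopyCategory.cohomologyFunctor A).mapIso (((q A).commShiftIso n).symm.app M)

lemma trW_of_isQis {f : M ⟶ N} (h : IsQis f) : (acyclic A).trW ((q A).map f) :=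
  ⟨_, _, _, coneTriangleh_distinguished f, acyclic_q h.acyclic_cone⟩

lemma isIso_Q_of_isQis {f : M ⟶ N} (h : IsQis f) : IsIso ((Q A).map f) :=
  Localization.inverts (Qh A) (acyclic A).trW _ (trW_of_isQis h)

lemma isQis_of_isIso_cohomology {f : M ⟶ N}
    (h : IsIso ((DGHomotopyCategory.cohomologyFunctor A).map ((q A).map f))) : IsQis f :=
  isQis_of_bijective ((ConcreteCategory.isIso_iff_bijective
    (ModuleCat.ofHom (cohomologyMap f))).1 h)

lemma isQis_of_isIso_Q {f : M ⟶ N} (h : IsIso ((Q A).map f)) : IsQis f := by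
  refine isQis_of_isIso_cohomology ?_
  have h' : IsIso ((Qh A ⋙ cohomologyFunctor A).map ((q A).map f)) :=
    inferInstanceAs (IsIso ((cohomologyFunctor A).map ((Q A).map f)))
  exact (NatIso.isIso_map_iff (cohomologyFunctorFac A) _).1 h'

lemma isQis_of_trW {f : M ⟶ N} (h : (acyclic A).trW ((q A).map f)) : IsQis f :=
  isQis_of_isIso_cohomology (isIso_cohomology_of_trW A _ h)

/-- Every morphism of the derived category is a right fraction. -/
lemma exists_rightFraction {M N : DGModule A} (φ : (Q A).obj M ⟶ (Q A).obj N) :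
    ∃ (L : DGModule A) (s : L ⟶ M) (f : L ⟶ N), IsQis s ∧
      (Q A).map s ≫ φ = (Q A).map f := by
  obtain ⟨ψ, hψ⟩ := Localization.exists_rightFraction (Qh A) (acyclic A).trW φ
  obtain @⟨L, s, hs, f⟩ := ψ
  obtain ⟨L, rfl⟩ : ∃ L', L = (q A).obj L' := ⟨L.as, rfl⟩
  obtain ⟨s, rfl⟩ := (q A).map_surjective s
  obtain ⟨f, rfl⟩ := (q A).map_surjective f
  refine ⟨L, s, f, isQis_of_trW hs, ?_⟩
  rw [hψ]
  exact (MorphismProperty.RightFraction.mk ((q A).map s) hs ((q A).map f)).map_s_comp_map (Qh A) _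

lemma exists_qis_of_iso {M N : DGModule A} (e : (Q A).obj M ≅ (Q A).obj N) :
    ∃ (L : DGModule A) (s : L ⟶ M) (f : L ⟶ N), IsQis s ∧ IsQis f := by
  obtain ⟨L, s, f, hs, hf⟩ := exists_rightFraction e.hom
  refine ⟨L, s, f, hs, isQis_of_isIso_Q ?_⟩
  have := isIso_Q_of_isQis hs
  rw [← hf]
  infer_instance

lemma exactAt_iff_of_iso {M N : DGModule A} (e : (Q A).obj M ≅ (Q A).obj N) (n : ℤ) :
    M.ExactAt n ↔ N.ExactAt n := by
  obtain ⟨L, s, f, hs, hf⟩ := exists_qis_of_iso e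
  rw [← hs.exactAt_iff, hf.exactAt_iff]

end DGDerivedCategory

/-- Distinguished triangles are stable under isomorphisms. -/
lemma distinguished_of_iso {C : Type*} [Category C] [Preadditive C] [HasZeroObject C]
    [HasShift C ℤ] [∀ n : ℤ, (shiftFunctor C n).Additive] [Pretriangulated C]
    {X Y Z X' Y' Z' : C} {f : X ⟶ Y} {g : Y ⟶ Z} {h : Z ⟶ X⟦(1 : ℤ)⟧} {f' : X' ⟶ Y'}
    {g' : Y' ⟶ Z'} {h' : Z' ⟶ X'⟦(1 : ℤ)⟧} (H : Triangle.mk f g h ∈ distTriang C)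
    (e₁ : X ≅ X') (e₂ : Y ≅ Y') (e₃ : Z ≅ Z') (c₁ : f ≫ e₂.hom = e₁.hom ≫ f')
    (c₂ : g ≫ e₃.hom = e₂.hom ≫ g') (c₃ : h ≫ (shiftFunctor C (1 : ℤ)).map e₁.hom = e₃.hom ≫ h') :
    Triangle.mk f' g' h' ∈ distTriang C :=
  isomorphic_distinguished _ H _ (Triangle.isoMk _ _ e₁ e₂ e₃ c₁ c₂ c₃).symm

namespace DGModule

variable {k : Type} [Field k] {A : DGAlgebra k} {M N P : DGModule A}

/-! ### Submodules and quotients -/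

/-- A graded submodule of a dg module stable under the differential. -/
structure Sub (M : DGModule A) where
  sub : Submodule A.carrierᵐᵒᵖ M.carrier
  proj_mem : ∀ n, ∀ m ∈ sub, M.proj n m ∈ sub
  d_mem : ∀ m ∈ sub, M.d m ∈ sub

/-- A submodule as a dg module. -/
@[reducible]
noncomputable def Sub.toDG (S : Sub M) : DGModule A where
  carrier := S.sub
  gr n := (M.gr n).comap (S.sub.subtype.restrictScalars k)
  isInternal := isInternal_comap M.isInternal (S.sub.subtype.restrictScalars k)
    Subtype.val_injective fun n w => ⟨⟨_, S.proj_mem n w.1 w.2⟩, rfl⟩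
  smul_mem hm ha := M.smul_mem hm ha
  d := (M.d.restrict (p := S.sub.restrictScalars k) (q := S.sub.restrictScalars k) S.d_mem :)
  d_mem hm := M.d_mem hm
  d_d m := Subtype.ext (M.d_d m.1)
  leibniz {n m} a hm := Subtype.ext (by
    have h : ∀ (u : ℤˣ) (x : S.sub), ((u • x : S.sub) : M.carrier) = u • (x : M.carrier) :=
      fun u x => by rcases Int.units_eq_one_or u with rfl | rfl <;> simp
    refine (M.leibniz a hm).trans ?_
    refine Eq.trans ?_ (S.sub.coe_add _ _).symm
    rw [h]
    rfl)

/-- The inclusion of a submodule. -/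
noncomputable def Sub.ι (S : Sub M) : S.toDG ⟶ M where
  lin := S.sub.subtype
  map_mem h := h
  comm _ := rfl

/-- The differential of a quotient. -/
noncomputable def Sub.quotD (S : Sub M) : M.carrier ⧸ S.sub →ₗ[k] M.carrier ⧸ S.sub :=
  (Submodule.Quotient.restrictScalarsEquiv k S.sub).toLinearMap ∘ₗ
    Submodule.mapQ (S.sub.restrictScalars k) (S.sub.restrictScalars k) M.d S.d_mem ∘ₗ
      (Submodule.Quotient.restrictScalarsEquiv k S.sub).symm.toLinearMap

lemma Sub.quotD_mk (S : Sub M) (m : M.carrier) : S.quotD (S.sub.mkQ m) = S.sub.mkQ (M.d m) := rfl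

/-- The quotient by a submodule as a dg module. -/
@[reducible]
noncomputable def Sub.quot (S : Sub M) : DGModule A where
  carrier := M.carrier ⧸ S.sub
  gr n := (M.gr n).map (S.sub.mkQ.restrictScalars k)
  isInternal := isInternal_map M.isInternal (S.sub.mkQ.restrictScalars k)
    S.sub.mkQ_surjective fun n v hv =>
      (Submodule.Quotient.mk_eq_zero _).2 (S.proj_mem n v ((Submodule.Quotient.mk_eq_zero _).1 hv))
  smul_mem := by
    rintro i j a _ ⟨m, hm, rfl⟩ ha
    exact ⟨_, M.smul_mem hm ha, rfl⟩
  d := S.quotD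
  d_mem := by
    rintro n _ ⟨m, hm, rfl⟩
    exact ⟨_, M.d_mem hm, rfl⟩
  d_d m := by
    obtain ⟨m, rfl⟩ := S.sub.mkQ_surjective m
    rw [S.quotD_mk, S.quotD_mk, M.d_d, map_zero]
  leibniz := by
    rintro n _ a ⟨m, hm, rfl⟩
    have h : ∀ (u : ℤˣ) (x : M.carrier), S.sub.mkQ (u • x) = u • S.sub.mkQ x :=
      fun u x => by rcases Int.units_eq_one_or u with rfl | rfl <;> simp
    refine (congrArg S.sub.mkQ (M.leibniz a hm)).trans ?_
    rw [map_add, h]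
    rfl

/-- The projection to a quotient. -/
noncomputable def Sub.π (S : Sub M) : M ⟶ S.quot where
  lin := S.sub.mkQ
  map_mem h := ⟨_, h, rfl⟩
  comm _ := rfl

lemma Sub.π_surjective (S : Sub M) (n : S.quot.carrier) : ∃ m, S.π.lin m = n :=
  S.sub.mkQ_surjective n

lemma Sub.π_eq_zero (S : Sub M) {m : M.carrier} : S.π.lin m = 0 ↔ m ∈ S.sub :=
  Submodule.Quotient.mk_eq_zero _

/-! ### Short exact sequences -/

/-- The comparison of the cone of `f` with `P`, if `f ≫ g = 0`. -/
def coneDesc (f : M ⟶ N) (g : N ⟶ P) (h : f ≫ g = 0) : cone f ⟶ P where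
  lin := g.lin ∘ₗ LinearMap.snd _ M.carrier N.carrier
  map_mem hx := g.map_mem hx.2
  comm x := by
    change g.lin (f.lin x.1 + N.d x.2) = P.d (g.lin x.2)
    rw [map_add, g.comm, ← comp_lin f g, h, zero_lin, zero_add]

lemma isQis_coneDesc (f : M ⟶ N) (g : N ⟶ P) (h : f ≫ g = 0) (hf : ∀ m, f.lin m = 0 → m = 0)
    (hg : ∀ p, ∃ n, g.lin n = p) (hfg : ∀ n, g.lin n = 0 → ∃ m, f.lin m = n) :
    IsQis (coneDesc f g h) := by
  refine isQis_of_surjective (fun p => ?_) ?_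
  · obtain ⟨n, rfl⟩ := hg p
    exact ⟨(0, n), rfl⟩
  · rintro ⟨x, y⟩ h1 h2
    obtain ⟨m, rfl⟩ := hfg y h1
    have e : f.lin x + N.d (f.lin m) = 0 := congrArg Prod.snd h2
    have e' : x = -M.d m := by
      rw [eq_neg_iff_add_eq_zero]
      exact hf _ (by rw [map_add, f.comm, e])
    refine ⟨(m, 0), map_zero g.lin, ?_⟩
    change (x, f.lin m) = (-M.d m, f.lin m + N.d 0)
    rw [map_zero, add_zero, e']

end DGModule

namespace DGDerivedCategory

open DGModule DGHomotopyCategory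

variable {k : Type} [Field k] {A : DGAlgebra k} {M N P : DGModule A}

/-- A short exact sequence of dg modules gives a distinguished triangle. -/
lemma exists_triangle (f : M ⟶ N) (g : N ⟶ P) (h : f ≫ g = 0) (hf : ∀ m, f.lin m = 0 → m = 0)
    (hg : ∀ p, ∃ n, g.lin n = p) (hfg : ∀ n, g.lin n = 0 → ∃ m, f.lin m = n) :
    ∃ δ : (Q A).obj P ⟶ ((Q A).obj M)⟦(1 : ℤ)⟧,
      Triangle.mk ((Q A).map f) ((Q A).map g) δ ∈ distTriang (DGDerivedCategory A) := by
  have := isIso_Q_of_isQis (isQis_coneDesc f g h hf hg hfg)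
  let e := asIso ((Q A).map (coneDesc f g h))
  let T := (Qh A).mapTriangle.obj (coneTriangleh f)
  have hT : T ∈ distTriang _ := (Qh A).map_distinguished _ (coneTriangleh_distinguished f)
  refine ⟨e.inv ≫ T.mor₃, isomorphic_distinguished _ hT _ ?_⟩
  refine Triangle.isoMk _ _ (Iso.refl _) (Iso.refl _) e.symm ?_ ?_ ?_
  · exact (Category.comp_id _).trans (Category.id_comp _).symm
  · change (Q A).map g ≫ e.inv = 𝟙 _ ≫ (Q A).map (coneInr f)
    rw [Category.id_comp, Iso.comp_inv_eq]
    exact (Q A).map_comp (coneInr f) (coneDesc f g h)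
  · change (e.inv ≫ T.mor₃) ≫ (shiftFunctor _ (1 : ℤ)).map (𝟙 _) = e.inv ≫ T.mor₃
    rw [CategoryTheory.Functor.map_id, Category.comp_id]

lemma exists_triangle_sub (S : Sub M) :
    ∃ δ : (Q A).obj S.quot ⟶ ((Q A).obj S.toDG)⟦(1 : ℤ)⟧,
      Triangle.mk ((Q A).map S.ι) ((Q A).map S.π) δ ∈ distTriang (DGDerivedCategory A) :=
  DGDerivedCategory.exists_triangle S.ι S.π
    (hom_ext fun m => S.π_eq_zero.2 m.2) (fun _ h => Subtype.ext h) S.π_surjective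
    fun n h => ⟨⟨n, S.π_eq_zero.1 h⟩, rfl⟩

/-- The cohomology of the shifts of `Q M`. -/
noncomputable def cohomologyShiftIso (M : DGModule A) (n : ℤ) :
    (cohomologyFunctor A).obj (((Q A).obj M)⟦n⟧) ≅ ModuleCat.of k (M⟦n⟧).cohomology :=
  (cohomologyFunctor A).mapIso (((Q A).commShiftIso n).symm.app M) ≪≫
    (cohomologyFunctorFac A).app ((DGHomotopyCategory.q A).obj (M⟦n⟧))

end DGDerivedCategory

namespace DGModule

variable {k : Type} [Field k] {A : DGAlgebra k} {M N : DGModule A}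

/-! ### Truncations over nonpositively graded algebras -/

lemma algebra_induction (A : DGAlgebra k) {p : A.carrier → Prop} (a : A.carrier)
    (mem : ∀ n, ∀ a ∈ A.gr n, p a) (zero : p 0) (add : ∀ a b, p a → p b → p (a + b)) : p a :=
  graded_induction (DirectSum.Decomposition.isInternal A.gr) a mem zero add

/-- The truncation `τ^{≤ n} M`. -/
noncomputable def trunc (hA : ∀ n > 0, A.gr n = ⊥) (M : DGModule A) (n : ℤ) : Sub M where
  sub :=
    { carrier := {m | (∀ i > n, M.proj i m = 0) ∧ M.d (M.proj n m) = 0}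
      add_mem' := fun {x y} hx hy => ⟨fun i hi => by rw [map_add, hx.1 i hi, hy.1 i hi, add_zero],
        by rw [map_add, map_add, hx.2, hy.2, add_zero]⟩
      zero_mem' := ⟨fun _ _ => map_zero _, by rw [map_zero, map_zero]⟩
      smul_mem' := fun a m hm => by
        obtain ⟨a, rfl⟩ := op_surjective a
        refine algebra_induction A (p := fun a => (∀ i > n, M.proj i (op a • m) = 0) ∧
          M.d (M.proj n (op a • m)) = 0) a ?_ ?_ ?_
        · intro j a ha
          by_cases hj : j > 0
          · rw [hA j hj, Submodule.mem_bot] at ha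
            subst ha
            simp
          · have h1 : ∀ i, M.proj i (op a • m) = op a • M.proj (i - j) m := fun i => by
              rw [smul_proj M ha, sub_add_cancel]
            refine ⟨fun i hi => by rw [h1, hm.1 _ (by omega), smul_zero], ?_⟩
            rw [h1]
            rcases eq_or_ne j 0 with rfl | hj'
            · have h2 : A.d a = 0 := by
                have := A.d_mem ha
                rwa [hA _ (by omega), Submodule.mem_bot] at this
              rw [sub_zero, d_smul, hm.2, h2, smul_zero, MulOpposite.op_zero, zero_smul, add_zero]
            · rw [hm.1 _ (by omega), smul_zero, map_zero]
        · simp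
        · rintro a b ⟨h1, h2⟩ ⟨h3, h4⟩
          refine ⟨fun i hi => ?_, ?_⟩
          · rw [MulOpposite.op_add, add_smul, map_add, h1 i hi, h3 i hi, add_zero]
          · rw [MulOpposite.op_add, add_smul, map_add, map_add, h2, h4, add_zero] }
  proj_mem j m hm := by
    have key : ∀ i, M.proj i (M.proj j m) = if j = i then M.proj i m else 0 := fun i => by
      split_ifs with e
      · subst e; exact gradeProj_same _ (M.proj_mem _ _)
      · exact gradeProj_ne _ (M.proj_mem _ _) e
    refine ⟨fun i hi => ?_, ?_⟩
    · rw [key]; split_ifs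
      exacts [hm.1 i hi, rfl]
    · rw [key]; split_ifs
      exacts [hm.2, map_zero _]
  d_mem m hm := by
    have key : ∀ i, M.proj i (M.d m) = M.d (M.proj (i - 1) m) := fun i => by
      rw [d_proj, sub_add_cancel]
    refine ⟨fun i hi => ?_, by rw [key, M.d_d]⟩
    rw [key]
    rcases eq_or_ne i (n + 1) with rfl | hi'
    · rw [add_sub_cancel_right, hm.2]
    · rw [hm.1 _ (by omega), map_zero]

variable (hA : ∀ n > 0, A.gr n = ⊥)

lemma mem_trunc_of_lt {n i : ℤ} {m : M.carrier} (hm : m ∈ M.gr i) (hi : i < n) :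
    m ∈ (trunc hA M n).sub :=
  ⟨fun j hj => gradeProj_ne _ hm (by omega), by rw [gradeProj_ne _ hm (by omega), map_zero]⟩

lemma mem_trunc_of_eq {n : ℤ} {m : M.carrier} (hm : m ∈ M.gr n) (hd : M.d m = 0) :
    m ∈ (trunc hA M n).sub :=
  ⟨fun j hj => gradeProj_ne _ hm (by omega), by rw [gradeProj_same _ hm, hd]⟩

lemma map_mem_trunc (f : M ⟶ N) {n : ℤ} {m : M.carrier} (hm : m ∈ (trunc hA M n).sub) :
    f.lin m ∈ (trunc hA N n).sub :=
  ⟨fun i hi => by rw [← lin_proj, hm.1 i hi, map_zero], by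
    rw [← lin_proj, ← f.comm, hm.2, map_zero]⟩

lemma eq_zero_of_mem_gr_trunc {n i : ℤ} (hi : n < i) {m : M.carrier}
    (hm : m ∈ (trunc hA M n).sub) (h : m ∈ M.gr i) : m = 0 := by
  rw [← gradeProj_same M.isInternal h]
  exact hm.1 i hi

lemma exactAt_trunc_of_lt {n i : ℤ} (hi : n < i) : (trunc hA M n).toDG.ExactAt i := fun m hm _ =>
  ⟨0, Subtype.ext (by rw [map_zero]; exact (eq_zero_of_mem_gr_trunc hA hi m.2 hm).symm)⟩

lemma exactAt_trunc {n i : ℤ} (h : M.ExactAt i) : (trunc hA M n).toDG.ExactAt i := by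
  intro m hm hd
  by_cases hi : n < i
  · exact exactAt_trunc_of_lt hA hi m hm hd
  have hm' : m.1 ∈ M.gr i := hm
  obtain ⟨m', h1, h2⟩ := h.proj (m := m.1) (by
    rw [show M.d m.1 = 0 from congrArg Subtype.val hd, map_zero])
  exact ⟨⟨m', mem_trunc_of_lt hA h1 (by omega)⟩, Subtype.ext (h2.trans (gradeProj_same _ hm'))⟩

/-- Quasi-isomorphisms can be detected on homogeneous elements. -/
lemma isQis_of_graded {f : M ⟶ N}
    (inj : ∀ i, ∀ m ∈ M.gr i, M.d m = 0 → ∀ n ∈ N.gr (i - 1), f.lin m = N.d n → ∃ m', m = M.d m')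
    (surj : ∀ i, ∀ n ∈ N.gr i, N.d n = 0 → ∃ m n', M.d m = 0 ∧ n = f.lin m + N.d n') :
    IsQis f where
  inj m n hm e := by
    choose p hp using fun i => inj i (M.proj i m) (M.proj_mem _ _) (by rw [d_proj, hm, map_zero])
      (N.proj (i - 1) n) (N.proj_mem _ _) (by rw [lin_proj, e, d_proj, sub_add_cancel])
    obtain ⟨s, hs⟩ := exists_sum_gradeProj M.isInternal m
    refine ⟨∑ i ∈ s, p i, ?_⟩
    rw [map_sum]
    exact ((Finset.sum_congr rfl fun i _ => (hp i).symm).trans (hs s subset_rfl)).symm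
  surj n hn := by
    choose p q hp hq using fun i => surj i (N.proj i n) (N.proj_mem _ _)
      (by rw [d_proj, hn, map_zero])
    obtain ⟨s, hs⟩ := exists_sum_gradeProj N.isInternal n
    refine ⟨∑ i ∈ s, p i, ∑ i ∈ s, q i, ?_, ?_⟩
    · rw [map_sum]; exact Finset.sum_eq_zero fun i _ => hp i
    · rw [map_sum, map_sum, ← Finset.sum_add_distrib]
      exact ((Finset.sum_congr rfl fun i _ => (hq i).symm).trans (hs s subset_rfl)).symm

lemma trunc_ι_inj {n : ℤ} {m : (trunc hA M n).toDG.carrier} {y : M.carrier}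
    {i : ℤ} (hm : m.1 ∈ M.gr i) (hy : y ∈ M.gr (i - 1)) (e : m.1 = M.d y) :
    ∃ m', m = (trunc hA M n).toDG.d m' := by
  by_cases hi : n < i
  · exact ⟨0, Subtype.ext (by rw [map_zero]; exact eq_zero_of_mem_gr_trunc hA hi m.2 hm)⟩
  · exact ⟨⟨y, mem_trunc_of_lt hA hy (by omega)⟩, Subtype.ext e⟩

lemma isQis_trunc_ι {n : ℤ} (h : ∀ i > n, M.ExactAt i) : IsQis (trunc hA M n).ι := by
  refine isQis_of_graded (fun i m hm _ y hy e => trunc_ι_inj hA hm hy e) fun i y hy hd => ?_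
  by_cases hi : n < i
  · obtain ⟨y', rfl⟩ := h i hi y hy hd
    exact ⟨0, y', map_zero _, by rw [map_zero, zero_add]⟩
  · have hy' : y ∈ (trunc hA M n).sub := by
      rcases eq_or_ne i n with rfl | hi'
      · exact mem_trunc_of_eq hA hy hd
      · exact mem_trunc_of_lt hA hy (by omega)
    exact ⟨⟨y, hy'⟩, 0, Subtype.ext hd, by rw [map_zero, add_zero]; rfl⟩

lemma isQis_trunc_π {n : ℤ} (h : ∀ i ≤ n, M.ExactAt i) : IsQis (trunc hA M n).π := by
  refine isQis_of_surjective (trunc hA M n).π_surjective fun m hm hd => ?_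
  have : (trunc hA M n).toDG.Acyclic := acyclic_of_exactAt fun i => by
    by_cases hi : n < i
    · exact exactAt_trunc_of_lt hA hi
    · exact exactAt_trunc hA (h i (by omega))
  obtain ⟨m', e⟩ := this ⟨m, (trunc hA M n).π_eq_zero.1 hm⟩ (Subtype.ext hd)
  exact ⟨m'.1, (trunc hA M n).π_eq_zero.2 m'.2, congrArg Subtype.val e⟩

lemma exactAt_quot_trunc {n i : ℤ} (hi : i ≤ n) : (trunc hA M n).quot.ExactAt i := by
  rintro _ ⟨m, hm, rfl⟩ hd
  have hd' : M.d m ∈ (trunc hA M n).sub := (trunc hA M n).π_eq_zero.1 hd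
  refine ⟨0, ?_⟩
  rw [map_zero]
  refine ((trunc hA M n).π_eq_zero.2 ?_).symm
  rcases eq_or_ne i n with rfl | hi'
  · exact mem_trunc_of_eq hA hm (eq_zero_of_mem_gr_trunc hA (by omega) hd' (M.d_mem hm))
  · exact mem_trunc_of_lt hA hm (by omega)

/-! ### Finite dimensional cohomology -/

lemma finite_cohomology_shift (M : DGModule A) (n : ℤ) :
    Module.Finite k (M.shift n).cohomology ↔ Module.Finite k M.cohomology := by
  have hk : LinearMap.ker (n.negOnePow • M.d) = LinearMap.ker M.d := by
    rcases Int.units_eq_one_or n.negOnePow with h | h <;> rw [h]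
    · rw [one_smul]
    · rw [Units.neg_smul, one_smul]; ext; simp
  have hr : LinearMap.range (n.negOnePow • M.d) = LinearMap.range M.d := by
    rcases Int.units_eq_one_or n.negOnePow with h | h <;> rw [h]
    · rw [one_smul]
    · rw [Units.neg_smul, one_smul, LinearMap.range_neg]
  change Module.Finite k (LinearMap.ker (n.negOnePow • M.d) ⧸
    (LinearMap.range (n.negOnePow • M.d)).comap
      (LinearMap.ker (n.negOnePow • M.d)).subtype) ↔ _
  rw [hk, hr]

/-- A dg module with finite dimensional cohomology has bounded cohomology. -/
lemma exists_bound_exactAt (M : DGModule A) [Module.Finite k M.cohomology] :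
    ∃ s : Finset ℤ, ∀ n ∉ s, M.ExactAt n := by
  classical
  obtain ⟨r, c, hc⟩ := Module.Finite.exists_fin (R := k) (M := M.cohomology)
  choose z hz using fun l => Submodule.mkQ_surjective _ (c l)
  choose t ht using fun l => exists_sum_gradeProj M.isInternal (z l).1
  let s := Finset.univ.biUnion t
  let V : Submodule k M.cohomology :=
    { carrier := {x | ∃ z : LinearMap.ker M.d, Submodule.mkQ _ z = x ∧ ∀ n ∉ s, M.proj n z.1 = 0}
      add_mem' := by
        rintro _ _ ⟨z, rfl, hz⟩ ⟨w, rfl, hw⟩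
        refine ⟨z + w, map_add _ _ _, fun n hn => ?_⟩
        rw [Submodule.coe_add, map_add, hz n hn, hw n hn, add_zero]
      zero_mem' := ⟨0, map_zero _, fun n _ => map_zero _⟩
      smul_mem' := by
        rintro a _ ⟨z, rfl, hz⟩
        refine ⟨a • z, map_smul _ _ _, fun n hn => ?_⟩
        rw [Submodule.coe_smul, map_smul, hz n hn, smul_zero] }
  have hV : V = ⊤ := by
    rw [eq_top_iff, ← hc, Submodule.span_le]
    rintro _ ⟨l, rfl⟩
    refine ⟨z l, hz l, fun n hn => ?_⟩
    rw [← ht l (t l) subset_rfl, map_sum]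
    refine Finset.sum_eq_zero fun i hi => gradeProj_ne _ (M.proj_mem _ _) ?_
    rintro rfl
    exact hn (Finset.mem_biUnion.2 ⟨l, Finset.mem_univ _, hi⟩)
  refine ⟨s, fun n hn m hm hd => ?_⟩
  obtain ⟨w, hw, hw'⟩ : Submodule.mkQ _ ⟨m, hd⟩ ∈ V := by rw [hV]; trivial
  obtain ⟨y, hy⟩ := (Submodule.Quotient.eq _).1 hw
  replace hy : M.d y = w.1 - m := hy
  refine ⟨-M.proj (n - 1) y, ?_⟩
  rw [map_neg, d_proj, sub_add_cancel, hy, map_sub, hw' n hn, gradeProj_same _ hm]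
  abel

end DGModule

namespace DGDerivedCategory

open DGModule DGHomotopyCategory Triangulated

variable {k : Type} [Field k] {A : DGAlgebra k} {M N P : DGModule A}

lemma finiteDimensional_Q_iff (M : DGModule A) :
    finiteDimensional A ((Q A).obj M) ↔ Module.Finite k M.cohomology := by
  constructor
  · intro h
    have := h 0
    rw [← finite_cohomology_shift M 0]
    exact Module.Finite.equiv (cohomologyShiftIso M 0).toLinearEquiv
  · intro h n
    rw [← finite_cohomology_shift M n] at h
    have h' : Module.Finite k (ModuleCat.of k ((shiftFunctor (DGModule A) n).obj M).cohomology) := h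
    exact Module.Finite.equiv (cohomologyShiftIso M n).symm.toLinearEquiv

variable (hA : ∀ n > 0, A.gr n = ⊥)

lemma finiteDimensional_trunc (n : ℤ) (h : finiteDimensional A ((Q A).obj M)) :
    finiteDimensional A ((Q A).obj (trunc hA M n).toDG) := by
  rw [finiteDimensional_Q_iff] at h ⊢
  refine Module.Finite.of_injective (cohomologyMap (trunc hA M n).ι) ?_
  rw [injective_iff_map_eq_zero]
  intro x hx
  obtain ⟨⟨m, hm⟩, rfl⟩ := Submodule.mkQ_surjective _ x
  obtain ⟨y, hy⟩ := (Submodule.Quotient.mk_eq_zero _).1 hx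
  replace hy : M.d y = m.1 := hy
  choose p hp using fun i => trunc_ι_inj hA (m := (trunc hA M n).toDG.proj i m) (i := i)
    ((trunc hA M n).toDG.proj_mem i m) (M.proj_mem (i - 1) y) (by
      rw [d_proj, sub_add_cancel, hy]
      exact lin_proj (trunc hA M n).ι i m)
  obtain ⟨s, hs⟩ := exists_sum_gradeProj (trunc hA M n).toDG.isInternal m
  refine (Submodule.Quotient.mk_eq_zero _).2 ⟨∑ i ∈ s, p i, ?_⟩
  rw [map_sum]
  exact (Finset.sum_congr rfl fun i _ => (hp i).symm).trans (hs s subset_rfl)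

/-- The objects represented by dg modules with cohomology concentrated in the degrees in `I`. -/
def concentrated (A : DGAlgebra k) (I : Set ℤ) : ObjectProperty (DGDerivedCategory A) := fun X =>
  ∃ M : DGModule A, Nonempty (X ≅ (Q A).obj M) ∧ ∀ n ∉ I, M.ExactAt n

lemma concentrated_iff {X : DGDerivedCategory A} {M : DGModule A} (e : X ≅ (Q A).obj M)
    (I : Set ℤ) : concentrated A I X ↔ ∀ n ∉ I, M.ExactAt n := by
  constructor
  · rintro ⟨N, ⟨e'⟩, h⟩ n hn
    exact (exactAt_iff_of_iso (e.symm ≪≫ e') n).2 (h n hn)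
  · exact fun h => ⟨M, ⟨e⟩, h⟩

instance (I : Set ℤ) : (concentrated A I).IsClosedUnderIsomorphisms where
  of_iso := by
    rintro X Y e ⟨M, ⟨e'⟩, h⟩
    exact ⟨M, ⟨e.symm ≪≫ e'⟩, h⟩

lemma exactAt_shift {n : ℤ} (h : M.ExactAt n) (a : ℤ) : (M.shift a).ExactAt (n - a) := by
  intro m hm hd
  replace hd : a.negOnePow • M.d m = 0 := hd
  replace hm : m ∈ M.gr (n - a + a) := hm
  rw [sub_add_cancel] at hm
  obtain ⟨m', e⟩ := h m hm (by
    simpa [smul_smul] using congrArg (fun x => a.negOnePow • x) hd)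
  refine ⟨a.negOnePow • m', ?_⟩
  change a.negOnePow • M.d (a.negOnePow • m') = m
  rw [d_units_smul, smul_smul, Int.units_mul_self, one_smul, e]

lemma concentrated_shift {I J : Set ℤ} (a : ℤ) (h : ∀ n ∉ J, n + a ∉ I) {X : DGDerivedCategory A}
    (hX : concentrated A I X) : concentrated A J (X⟦a⟧) := by
  obtain ⟨M, ⟨e⟩, hM⟩ := hX
  refine ⟨M.shift a, ⟨(shiftFunctor _ a).mapIso e ≪≫ ((Q A).commShiftIso a).symm.app M⟩,
    fun n hn => ?_⟩
  have := exactAt_shift (hM _ (h n hn)) a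
  rwa [add_sub_cancel_right] at this

lemma concentrated_mono {I J : Set ℤ} (h : I ⊆ J) : concentrated A I ≤ concentrated A J :=
  fun _ ⟨M, e, hM⟩ => ⟨M, e, fun n hn => hM n fun hn' => hn (h hn')⟩

include hA in
lemma eq_zero_of_concentrated {X Y : DGDerivedCategory A} (f : X ⟶ Y)
    (hX : concentrated A (Set.Iic 0) X) (hY : concentrated A (Set.Ici 1) Y) : f = 0 := by
  obtain ⟨M, ⟨e⟩, hM⟩ := hX
  obtain ⟨N, ⟨e'⟩, hN⟩ := hY
  have h1 := isIso_Q_of_isQis (isQis_trunc_π hA (n := 0) fun i hi => hN i (by simp; omega))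
  obtain ⟨L, s, g, hs, hg⟩ := exists_rightFraction (e.inv ≫ f ≫ e'.hom)
  have h2 := isIso_Q_of_isQis hs
  have h3 := isIso_Q_of_isQis (isQis_trunc_ι hA (M := L) (n := 0) fun i hi =>
    (hs.exactAt_iff i).2 (hM i (by simp; omega)))
  have h4 : (trunc hA L 0).ι ≫ g ≫ (trunc hA N 0).π = 0 :=
    hom_ext fun m => (trunc hA N 0).π_eq_zero.2 (map_mem_trunc hA g m.2)
  have h5 : (Q A).map g = 0 := by
    rw [← cancel_epi ((Q A).map (trunc hA L 0).ι), ← cancel_mono ((Q A).map (trunc hA N 0).π),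
      Category.assoc, ← Functor.map_comp, ← Functor.map_comp, h4, Functor.map_zero, comp_zero,
      zero_comp]
  rw [h5] at hg
  rw [← cancel_epi e.inv, ← cancel_mono e'.hom, ← cancel_epi ((Q A).map s), Category.assoc, hg]
  simp

/-- The standard t-structure of the derived category of a nonpositively graded dg algebra. -/
noncomputable def standardTStructure : TStructure (DGDerivedCategory A) where
  le n := concentrated A (Set.Iic n)
  ge n := concentrated A (Set.Ici n)
  le_shift n a n' h X := concentrated_shift a fun i hi => by simp at hi ⊢; omega
  ge_shift n a n' h X := concentrated_shift a fun i hi => by simp at hi ⊢; omega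
  zero' _ _ f hX hY := eq_zero_of_concentrated hA f hX hY
  le_zero_le := concentrated_mono (Set.Iic_subset_Iic.2 zero_le_one)
  ge_one_le := concentrated_mono (Set.Ici_subset_Ici.2 zero_le_one)
  exists_triangle_zero_one X := by
    obtain ⟨M, ⟨e⟩⟩ := exists_iso_Q X
    obtain ⟨δ, h⟩ := exists_triangle_sub (trunc hA M 0)
    refine ⟨_, _, ⟨_, ⟨Iso.refl _⟩, fun n hn => exactAt_trunc_of_lt hA (n := 0) (M := M) ?_⟩,
      ⟨_, ⟨Iso.refl _⟩, fun n hn => exactAt_quot_trunc hA (n := 0) (M := M) ?_⟩,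
      (Q A).map (trunc hA M 0).ι ≫ e.inv, e.hom ≫ (Q A).map (trunc hA M 0).π, δ,
      distinguished_of_iso h (Iso.refl _) e.symm (Iso.refl _) (by simp) (by simp) (by simp)⟩
    · simpa using hn
    · simp at hn; omega

instance : (finiteDimensional A).HasInducedTStructure (standardTStructure hA) where
  exists_triangle_zero_one X hX := by
    obtain ⟨M, ⟨e⟩⟩ := exists_iso_Q X
    have hM := (finiteDimensional A).prop_of_iso e hX
    obtain ⟨δ, h⟩ := exists_triangle_sub (trunc hA M 0)
    have h1 := finiteDimensional_trunc hA 0 hM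
    refine ⟨_, _, ⟨⟨_, ⟨Iso.refl _⟩, fun n hn => exactAt_trunc_of_lt hA (n := 0) (M := M) ?_⟩⟩,
      ⟨⟨_, ⟨Iso.refl _⟩, fun n hn => exactAt_quot_trunc hA (n := 0) (M := M) ?_⟩⟩,
      (Q A).map (trunc hA M 0).ι ≫ e.inv, e.hom ≫ (Q A).map (trunc hA M 0).π, δ,
      distinguished_of_iso h (Iso.refl _) e.symm (Iso.refl _) (by simp) (by simp) (by simp), (finiteDimensional A).le_isoClosure _ h1,
      (finiteDimensional A).le_isoClosure _
        ((finiteDimensional A).ext_of_isTriangulatedClosed₃ _ h h1 hM)⟩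
    · simpa using hn
    · simp at hn; omega

lemma isHeart_finiteDimensional (hA : ∀ n > 0, A.gr n = ⊥) :
    IsHeart (C := (finiteDimensional A).FullSubcategory)
      fun X => concentrated A {0} X.obj := by
  refine ⟨(finiteDimensional A).tStructure (standardTStructure hA), fun X => ?_, ?_⟩
  · obtain ⟨M, ⟨e⟩⟩ := exists_iso_Q X.obj
    have := (finiteDimensional_Q_iff M).1 ((finiteDimensional A).prop_of_iso e X.property)
    obtain ⟨s, hs⟩ := exists_bound_exactAt M
    obtain ⟨a, ha⟩ := s.bddBelow
    obtain ⟨b, hb⟩ := s.bddAbove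
    exact ⟨⟨a, ⟨⟨M, ⟨e⟩, fun n hn => hs n fun h => hn (ha h)⟩⟩⟩,
      ⟨b, ⟨⟨M, ⟨e⟩, fun n hn => hs n fun h => hn (hb h)⟩⟩⟩⟩
  · ext X
    obtain ⟨M, ⟨e⟩⟩ := exists_iso_Q X.obj
    refine Iff.trans (and_congr (concentrated_iff e _) (concentrated_iff e _)) ?_
    rw [concentrated_iff e]
    refine ⟨fun h n hn => ?_, fun h => ⟨fun n hn => h n ?_, fun n hn => h n ?_⟩⟩
    · rcases lt_or_gt_of_ne hn with h' | h'
      · exact h.2 n (by simp; omega)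
      · exact h.1 n (by simp; omega)
    · rintro rfl; simp at hn
    · rintro rfl; simp at hn

end DGDerivedCategory

namespace Ginzburg

notation:73 m:73 " ◁ " x:74 => (MulOpposite.op x) • m

/-! ### The generators at a vertex -/

/-- The idempotent of a vertex. -/
def E (i : Fin 2) : Gen := if i = 0 then .e₁ else .e₂

/-- The arrow starting at a vertex. -/
def α (i : Fin 2) : Gen := if i = 0 then .a else .b

/-- The loop at a vertex. -/
def τ (i : Fin 2) : Gen := if i = 0 then .t₁ else .t₂

/-- The parity of the arrow starting at a vertex. -/
def sgn (i : Fin 2) : ℤˣ := (α i).deg.negOnePow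

/-- A function on generators, from its values at the generators attached to the vertices. -/
def assign {B : Type*} (e a t : Fin 2 → B) : Gen → B
  | .e₁ => e 0 | .e₂ => e 1 | .a => a 0 | .b => a 1 | .t₁ => t 0 | .t₂ => t 1

section

variable {B : Type*} (e a t : Fin 2 → B) (i : Fin 2)

@[simp] lemma assign_E : assign e a t (E i) = e i := by fin_cases i <;> rfl
@[simp] lemma assign_α : assign e a t (α i) = a i := by fin_cases i <;> rfl
@[simp] lemma assign_τ : assign e a t (τ i) = t i := by fin_cases i <;> rfl

end

lemma Gen.cases_vertex {i j : Fin 2} (h : i ≠ j) {p : Gen → Prop} (hEi : p (E i)) (hEj : p (E j))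
    (hαi : p (α i)) (hαj : p (α j)) (hτi : p (τ i)) (hτj : p (τ j)) (g : Gen) : p g := by
  fin_cases i <;> fin_cases j <;> first | exact absurd rfl h | (cases g <;> assumption)

lemma isRep_assign {i j : Fin 2} (h : i ≠ j) {B : Type*} [Semiring B] {e a t : Fin 2 → B}
    (h1 : e i * e i = e i) (h2 : e j * e j = e j) (h3 : e i * e j = 0) (h4 : e j * e i = 0)
    (h5 : e i + e j = 1) (h6 : e i * a i = a i) (h7 : a i * e j = a i) (h8 : e j * a j = a j)
    (h9 : a j * e i = a j) (h10 : e i * t i = t i) (h11 : t i * e i = t i)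
    (h12 : e j * t j = t j) (h13 : t j * e j = t j) : IsRep (assign e a t) := by
  fin_cases i <;> fin_cases j
  · exact absurd rfl h
  · constructor <;> assumption
  · constructor <;> first | assumption | exact (add_comm _ _).trans h5
  · exact absurd rfl h

section relations

variable (i : Fin 2) {j : Fin 2} (h : i ≠ j)

lemma E_E : ι (E i) * ι (E i) = ι (E i) := by
  fin_cases i; exacts [e₁e₁, e₂e₂]

lemma E_α : ι (E i) * ι (α i) = ι (α i) := by
  fin_cases i; exacts [e₁a, e₂b]

lemma E_τ : ι (E i) * ι (τ i) = ι (τ i) := by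
  fin_cases i; exacts [e₁t₁, e₂t₂]

lemma τ_E : ι (τ i) * ι (E i) = ι (τ i) := by
  fin_cases i; exacts [t₁e₁, t₂e₂]

include h

variable {i}

lemma E_E' : ι (E i) * ι (E j) = 0 := by
  fin_cases i <;> fin_cases j <;> first | exact absurd rfl h | exact e₁e₂ | exact e₂e₁

lemma α_E : ι (α i) * ι (E j) = ι (α i) := by
  fin_cases i <;> fin_cases j <;> first | exact absurd rfl h | exact ae₂ | exact be₁

lemma add_E : ι (E i) + ι (E j) = 1 := by
  fin_cases i <;> fin_cases j <;>
    first | exact absurd rfl h | exact e_add | exact (add_comm _ _).trans e_add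

lemma dGen_τ : dGen (τ i) = sgn i • (ι (α i) * ι (α j)) := by
  fin_cases i <;> fin_cases j <;> first | exact absurd rfl h | simp [τ, dGen, sgn, α, Gen.deg]

lemma deg_α_add : (α i).deg + (α j).deg = -1 := by
  fin_cases i <;> fin_cases j <;> first | exact absurd rfl h | rfl

lemma sgn_eq : sgn j = -sgn i := by
  fin_cases i <;> fin_cases j <;> first | exact absurd rfl h | simp [sgn, α, Gen.deg]

end relations

lemma deg_E (i : Fin 2) : (E i).deg = 0 := by fin_cases i <;> rfl
lemma deg_τ (i : Fin 2) : (τ i).deg = -2 := by fin_cases i <;> rfl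
lemma dGen_E (i : Fin 2) : dGen (E i) = 0 := by fin_cases i <;> rfl
lemma dGen_α (i : Fin 2) : dGen (α i) = 0 := by fin_cases i <;> rfl

@[simp] lemma char_E (i : Fin 2) : char i (ι (E i)) = 1 := by
  fin_cases i <;> simp [char, E, charGen]
lemma char_E' {i j : Fin 2} (h : i ≠ j) : char i (ι (E j)) = 0 := by
  fin_cases i <;> fin_cases j <;> first | exact absurd rfl h | simp [char, E, charGen]
@[simp] lemma char_α (i j : Fin 2) : char i (ι (α j)) = 0 := by
  fin_cases j <;> simp [char, α, charGen]
@[simp] lemma char_τ (i j : Fin 2) : char i (ι (τ j)) = 0 := by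
  fin_cases j <;> simp [char, τ, charGen]

lemma ι_E_mem (i : Fin 2) : ι (E i) ∈ gr 0 := by
  have := ι_mem (E i)
  rwa [deg_E] at this

lemma ι_τ_mem (i : Fin 2) : ι (τ i) ∈ gr (-2) := by
  have := ι_mem (τ i)
  rwa [deg_τ] at this

lemma d_E (i : Fin 2) : d (ι (E i)) = 0 := by rw [d_ι, dGen_E]
lemma d_α (i : Fin 2) : d (ι (α i)) = 0 := by rw [d_ι, dGen_α]
lemma d_τ {i j : Fin 2} (h : i ≠ j) : d (ι (τ i)) = sgn i • (ι (α i) * ι (α j)) := by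
  rw [d_ι, dGen_τ h]

/-- Induction on words. -/
lemma alg_induction {p : Alg → Prop} (x : Alg) (one : p 1) (gen : ∀ g y, p y → p (ι g * y))
    (zero : p 0) (add : ∀ x y, p x → p y → p (x + y)) (smul : ∀ (c : ℂ) x, p x → p (c • x)) :
    p x := by
  have h : x ∈ Submodule.span ℂ (Set.range mon) := by rw [span_mon]; trivial
  induction h using Submodule.span_induction with
  | mem y h =>
    obtain ⟨l, rfl⟩ := h
    induction l with
    | nil => exact one
    | cons g l ih => rw [mon_cons]; exact gen g _ ih
  | zero => exact zero
  | add x y _ _ hx hy => exact add x y hx hy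
  | smul c x _ hx => exact smul c x hx

lemma deg_nonpos (l : List Gen) : deg l ≤ 0 := by
  induction l with
  | nil => simp
  | cons g l ih =>
    have : g.deg ≤ 0 := by cases g <;> simp [Gen.deg]
    rw [deg_cons]; omega

lemma gr_eq_bot : ∀ n > 0, dgAlgebra.gr n = ⊥ := fun n hn => by
  change gr n = ⊥
  rw [gr, show {l | deg l = n} = ∅ from Set.eq_empty_of_forall_notMem fun l hl => by
    have := deg_nonpos l; rw [Set.mem_ofPred_eq] at hl; omega]
  simp

/-- The standard heart is a heart. -/
lemma isHeart_standardHeart : IsHeart standardHeart :=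
  DGDerivedCategory.isHeart_finiteDimensional gr_eq_bot

/-! ### The augmentation ideal of a vertex -/

section fox

variable {i j : Fin 2} (h : i ≠ j) {A T : Alg} (hA : A * ι (E j) = A) (hT : T * ι (E i) = T)

/-- The algebra morphism `x ↦ !![char x, ∂ x; 0, x]` encoding the derivation `∂` with values `A`
and `T` at the arrow and the loop starting at `i`. -/
noncomputable def foxHom : Alg →ₐ[ℂ] Matrix (Fin 2) (Fin 2) Alg :=
  lift (assign (fun k => !![algebraMap ℂ Alg (charGen i (E k)), 0; 0, ι (E k)])
    (fun k => !![0, if k = i then A else 0; 0, ι (α k)])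
    (fun k => !![0, if k = i then T else 0; 0, ι (τ k)])) (by
    have hi : charGen i (E i) = 1 := by fin_cases i <;> simp [E, charGen]
    have hj : charGen i (E j) = 0 := by
      fin_cases i <;> fin_cases j <;> first | exact absurd rfl h | simp [E, charGen]
    apply isRep_assign h <;> ext k l <;> fin_cases k <;> fin_cases l <;>
      simp [hi, hj, hA, hT, h.symm, E_E, E_α, E_τ, τ_E, α_E h, α_E h.symm, E_E' h, E_E' h.symm,
        add_E h])

/-- The derivation with respect to the character of `i` with values `A` and `T` at the arrow and
the loop starting at `i`. -/
noncomputable def fox : Alg →ₗ[ℂ] Alg where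
  toFun x := foxHom h hA hT x 0 1
  map_add' x y := by simp
  map_smul' c x := by simp

lemma fox_mul (g : Gen) (hg : charGen i g = 0) (y : Alg) :
    fox h hA hT (ι g * y) = fox h hA hT (ι g) * y := by
  have h1 : ∀ y, foxHom h hA hT y 1 1 = y := fun y => by
    refine alg_induction (p := fun y => foxHom h hA hT y 1 1 = y) y (by simp) ?_ (by simp)
      (fun x y hx hy => by simp [hx, hy]) fun c x hx => by simp [hx]
    intro g y hy
    have h3 : foxHom h hA hT (ι g) 1 0 = 0 ∧ foxHom h hA hT (ι g) 1 1 = ι g := by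
      refine Gen.cases_vertex (p := fun g => foxHom h hA hT (ι g) 1 0 = 0 ∧
        foxHom h hA hT (ι g) 1 1 = ι g) h ?_ ?_ ?_ ?_ ?_ ?_ g <;> simp [foxHom]
    rw [map_mul, Matrix.mul_apply, Fin.sum_univ_two, hy, h3.1, h3.2, zero_mul, zero_add]
  have h2 : foxHom h hA hT (ι g) 0 0 = 0 := by
    revert hg
    refine Gen.cases_vertex (p := fun g => charGen i g = 0 → foxHom h hA hT (ι g) 0 0 = 0)
      h ?_ ?_ ?_ ?_ ?_ ?_ g <;> intro hg <;> simp [foxHom, hg]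
  change foxHom h hA hT (ι g * y) 0 1 = foxHom h hA hT (ι g) 0 1 * y
  rw [map_mul, Matrix.mul_apply, Fin.sum_univ_two, h1, h2, zero_mul, zero_add]

@[simp] lemma fox_α (y : Alg) : fox h hA hT (ι (α i) * y) = A * y := by
  rw [fox_mul h hA hT (α i) (by fin_cases i <;> rfl)]
  simp [fox, foxHom]

@[simp] lemma fox_τ (y : Alg) : fox h hA hT (ι (τ i) * y) = T * y := by
  rw [fox_mul h hA hT (τ i) (by fin_cases i <;> rfl)]
  simp [fox, foxHom]

end fox

section free

variable {i j : Fin 2} (h : i ≠ j)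

include h

/-- The arrow and the loop starting at `i` generate a free right module. -/
lemma eq_zero_of_add_eq_zero {q r : Alg} (hq : ι (E j) * q = q) (hr : ι (E i) * r = r)
    (e : ι (α i) * q + ι (τ i) * r = 0) : q = 0 ∧ r = 0 := by
  constructor
  · have := congrArg (fox h (E_E j) (T := 0) (zero_mul _)) e
    simpa [hq] using this
  · have := congrArg (fox h (A := 0) (zero_mul _) (E_E i)) e
    simpa [hr] using this

/-- The augmentation ideal at the vertex `i` is generated by the arrow and the loop starting
at `i`. -/
lemma exists_eq_add (x : Alg) (hx : ι (E i) * x = x) : ∃ q r, ι (E j) * q = q ∧ ι (E i) * r = r ∧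
    x = char i x • ι (E i) + ι (α i) * q + ι (τ i) * r := by
  suffices H : ∃ (c : ℂ) (q r : Alg), ι (E i) * x = c • ι (E i) + ι (α i) * q + ι (τ i) * r by
    obtain ⟨c, q, r, e⟩ := H
    refine ⟨ι (E j) * q, ι (E i) * r, ?_, ?_, ?_⟩
    · rw [← mul_assoc, E_E]
    · rw [← mul_assoc, E_E]
    · rw [← mul_assoc, ← mul_assoc, α_E h, τ_E]
      rw [hx] at e
      have : char i x = c := by simpa using congrArg (char i) e
      rw [this, ← e]
  clear hx
  refine alg_induction (p := fun x => ∃ (c : ℂ) (q r : Alg),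
    ι (E i) * x = c • ι (E i) + ι (α i) * q + ι (τ i) * r) x ⟨1, 0, 0, by simp⟩ ?_
    ⟨0, 0, 0, by simp⟩ ?_ ?_
  · have h0 : ∀ (k : Gen), ι (E j) * ι k = ι k → ι (E i) * ι k = 0 := fun k hk => by
      rw [← hk, ← mul_assoc, E_E' h, zero_mul]
    refine Gen.cases_vertex h ?_ ?_ ?_ ?_ ?_ ?_ <;> rintro y ⟨c, q, r, e⟩
    · exact ⟨c, q, r, by rw [← mul_assoc, E_E, e]⟩
    · exact ⟨0, 0, 0, by rw [← mul_assoc, h0 _ (E_E j)]; simp⟩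
    · exact ⟨0, y, 0, by rw [← mul_assoc, E_α]; simp⟩
    · exact ⟨0, 0, 0, by rw [← mul_assoc, h0 _ (E_α j)]; simp⟩
    · exact ⟨0, 0, y, by rw [← mul_assoc, E_τ]; simp⟩
    · exact ⟨0, 0, 0, by rw [← mul_assoc, h0 _ (E_τ j)]; simp⟩
  · rintro x y ⟨c, q, r, e⟩ ⟨c', q', r', e'⟩
    exact ⟨c + c', q + q', r + r', by rw [mul_add, e, e']; simp only [add_smul, mul_add]; abel⟩
  · rintro c x ⟨c', q, r, e⟩
    exact ⟨c * c', c • q, c • r, by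
      rw [mul_smul_comm, e]; simp only [smul_add, mul_smul_comm, mul_smul]⟩

end free

end Ginzburg

namespace DGModule

variable {k : Type} [Field k] (A : DGAlgebra k)

/-- The algebra as a right module over itself. -/
@[reducible]
def regular : DGModule A where
  carrier := A.carrier
  gr := A.gr
  isInternal := DirectSum.Decomposition.isInternal A.gr
  smul_mem hm ha := SetLike.mul_mem_graded hm ha
  d := A.d
  d_mem := A.d_mem
  d_d := A.d_d
  leibniz a hm := A.leibniz a hm

end DGModule

namespace Ginzburg

open DGModule

lemma d_mul_left (g : Gen) (y : Alg) :
    d (ι g * y) = dGen g * y + g.deg.negOnePow • (ι g * d y) := by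
  rw [d_leibniz _ (ι_mem g), d_ι]

/-- The modules with basis `x`, `y`, `z` in the degrees `0`, `|α i| - 1`, `-3` and differential
`d y = x (α i)`, `d z = x (τ i) ± y (α j)`. -/
@[reducible]
noncomputable def freeResolution {i j : Fin 2} (h : i ≠ j) : DGModule dgAlgebra where
  carrier := Alg × Alg × Alg
  gr n := (gr n).prod ((gr (n + (1 - (α i).deg))).prod (gr (n + 3)))
  isInternal := isInternal_prod (regular dgAlgebra).isInternal
    (isInternal_prod ((regular dgAlgebra).isInternal_add _) ((regular dgAlgebra).isInternal_add 3))
  smul_mem {n m a x} hx ha := by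
    refine ⟨SetLike.mul_mem_graded hx.1 ha, ?_, ?_⟩
    · have := SetLike.mul_mem_graded hx.2.1 ha
      rwa [add_right_comm] at this
    · have := SetLike.mul_mem_graded hx.2.2 ha
      rwa [add_right_comm] at this
  d :=
    { toFun := fun x => (d x.1 + ι (α i) * x.2.1 + ι (τ i) * x.2.2,
        -(sgn i • (d x.2.1 + ι (α j) * x.2.2)), -d x.2.2)
      map_add' := fun x y => by
        ext <;> simp only [Prod.fst_add, Prod.snd_add, map_add, mul_add, smul_add] <;> abel
      map_smul' := fun c x => by
        ext <;> simp [smul_add, smul_comm c (sgn i)] }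
  d_mem {n x} hx := by
    refine ⟨Submodule.add_mem _ (Submodule.add_mem _ (d_mem hx.1) ?_) ?_,
      Submodule.neg_mem _ (units_smul_mem _ _ (Submodule.add_mem _ ?_ ?_)),
      Submodule.neg_mem _ ?_⟩
    · have := SetLike.mul_mem_graded (ι_mem (α i)) hx.2.1
      rwa [show (α i).deg + (n + (1 - (α i).deg)) = n + 1 by ring] at this
    · have := SetLike.mul_mem_graded (ι_τ_mem i) hx.2.2
      rwa [show -2 + (n + 3) = n + 1 by ring] at this
    · have := d_mem hx.2.1
      rwa [add_right_comm] at this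
    · have := SetLike.mul_mem_graded (ι_mem (α j)) hx.2.2
      rwa [show (α j).deg + (n + 3) = n + 1 + (1 - (α i).deg) by
        have := deg_α_add h; omega] at this
    · have := d_mem hx.2.2
      rwa [add_right_comm] at this
  d_d x := by
    have h1 : (α i).deg.negOnePow = sgn i := rfl
    have h2 : (α j).deg.negOnePow = -sgn i := sgn_eq h
    have h3 : (τ i).deg.negOnePow = 1 := by rw [deg_τ]; decide
    ext
    · simp only [LinearMap.coe_mk, AddHom.coe_mk, map_add, d_mul_left, dGen_α, dGen_τ h, d_d, h1,
        h3, zero_mul, mul_neg, mul_smul_comm, smul_mul_assoc, mul_add, mul_assoc, smul_add, one_smul,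
        Prod.fst_zero]
      abel
    · rcases Int.units_eq_one_or (sgn i) with e | e <;>
      simp [d_mul_left, dGen_α, d_d, h2, e]
    · simp [d_d]
  leibniz {n x} a hx := by
    have h1 : (n + (1 - (α i).deg)).negOnePow = -(sgn i * n.negOnePow) := by
      rw [Int.negOnePow_add, Int.negOnePow_sub, mul_comm]
      change -1 * sgn i * _ = _
      simp
    have h2 : (n + 3).negOnePow = -n.negOnePow := by
      rw [Int.negOnePow_add, show Int.negOnePow 3 = -1 by decide, mul_neg, mul_one]
    ext
    · change d (x.1 * a) + ι (α i) * (x.2.1 * a) + ι (τ i) * (x.2.2 * a) =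
        (d x.1 + ι (α i) * x.2.1 + ι (τ i) * x.2.2) * a + n.negOnePow • (x.1 * d a)
      rw [d_leibniz a hx.1]
      simp only [add_mul, mul_assoc]
      abel
    · change -(sgn i • (d (x.2.1 * a) + ι (α j) * (x.2.2 * a))) =
        (-(sgn i • (d x.2.1 + ι (α j) * x.2.2))) * a + n.negOnePow • (x.2.1 * d a)
      rw [d_leibniz a hx.2.1, h1]
      rcases Int.units_eq_one_or (sgn i) with e | e <;> simp only [e, one_smul, one_mul, neg_mul,
        Units.neg_smul, add_mul, mul_assoc, neg_neg, neg_add] <;> abel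
    · change -d (x.2.2 * a) = -d x.2.2 * a + n.negOnePow • (x.2.2 * d a)
      rw [d_leibniz a hx.2.2, h2, Units.neg_smul, neg_mul, neg_add, neg_neg]

end Ginzburg

namespace DGModule

variable {k : Type} [Field k] {A : DGAlgebra k}

/-- The elements fixed by an endomorphism. -/
@[reducible]
noncomputable def fix {M : DGModule A} (e : M ⟶ M) : Sub M where
  sub := LinearMap.eqLocus e.lin LinearMap.id
  proj_mem n m hm := by
    change e.lin (M.proj n m) = M.proj n m
    rw [lin_proj, show e.lin m = m from hm]
  d_mem m hm := by
    change e.lin (M.d m) = M.d m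
    rw [e.comm, show e.lin m = m from hm]

/-- Every morphism to an acyclic module is homotopic to zero. -/
def IsHomotopicallyProjective (P : DGModule A) : Prop :=
  ∀ N : DGModule A, N.Acyclic → ∀ f : P ⟶ N, Homotopic f 0

end DGModule

namespace DGDerivedCategory

open DGModule DGHomotopyCategory

variable {k : Type} [Field k] {A : DGAlgebra k} {P : DGModule A}

lemma acyclic_of_acyclic_q {N : DGModule A} (h : acyclic A ((q A).obj N)) : N.Acyclic := by
  have h1 : IsZero ((DGHomotopyCategory.cohomologyFunctor A).obj ((q A).obj N)) :=
    (h 0).of_iso ((DGHomotopyCategory.cohomologyFunctor A).mapIso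
      ((shiftFunctorZero (DGHomotopyCategory A) ℤ).symm.app _))
  have h2 : Subsingleton N.cohomology := ModuleCat.subsingleton_of_isZero h1
  intro m hm
  obtain ⟨m', h⟩ := (Submodule.Quotient.mk_eq_zero _).1
    (Subsingleton.elim (Submodule.mkQ _ (⟨m, hm⟩ : LinearMap.ker N.d) : N.cohomology) 0)
  exact ⟨m', h.symm⟩

lemma q_leftOrthogonal (hP : P.IsHomotopicallyProjective) :
    (acyclic A).leftOrthogonal ((q A).obj P) := fun N f hN => by
  obtain ⟨N, rfl⟩ : ∃ N', N = (q A).obj N' := ⟨N.as, rfl⟩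
  obtain ⟨f, rfl⟩ := (q A).map_surjective f
  rw [← (q A).map_zero]
  exact q_map_eq (hP N (acyclic_of_acyclic_q hN) f)

lemma exists_Q_map_eq (hP : P.IsHomotopicallyProjective) {M : DGModule A}
    (φ : (Q A).obj P ⟶ (Q A).obj M) : ∃ f, (Q A).map f = φ := by
  obtain ⟨f, rfl⟩ := ((q_leftOrthogonal hP).map_bijective_of_isTriangulated (Qh A)
    ((q A).obj M)).2 φ
  obtain ⟨f, rfl⟩ := (q A).map_surjective f
  exact ⟨f, rfl⟩

lemma Q_map_eq_zero (hP : P.IsHomotopicallyProjective) {M : DGModule A} {f : P ⟶ M} :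
    (Q A).map f = 0 ↔ Homotopic f 0 := by
  constructor
  · intro h
    have := ((q_leftOrthogonal hP).map_bijective_of_isTriangulated (Qh A) ((q A).obj M)).1
      (a₁ := (q A).map f) (a₂ := (q A).map 0) (by
        refine Eq.trans h ?_
        exact (Q A).map_zero _ _ |>.symm)
    exact q_map_eq_iff.1 this
  · intro h
    rw [← (Q A).map_zero]
    exact congrArg (Qh A).map (q_map_eq h)

end DGDerivedCategory

namespace Ginzburg

open DGModule DGDerivedCategory

instance (M : DGModule dgAlgebra) : Module Algᵐᵒᵖ M.carrier := M.rightModule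

instance (M : DGModule dgAlgebra) : IsScalarTower ℂ Algᵐᵒᵖ M.carrier := M.isScalarTower

instance (M : DGModule dgAlgebra) : SMulCommClass Algᵐᵒᵖ ℂ M.carrier :=
  inferInstanceAs (SMulCommClass dgAlgebra.carrierᵐᵒᵖ ℂ M.carrier)

lemma rsmul_rsmul (M : DGModule dgAlgebra) (m : M.carrier) (x y : Alg) :
    m ◁ x ◁ y = m ◁ (x * y) := by rw [smul_smul, op_mul]

section

variable (M : DGModule dgAlgebra) (m m' : M.carrier) (x y : Alg) (u : ℤˣ)

lemma rsmul_mul : m ◁ (x * y) = m ◁ x ◁ y := (rsmul_rsmul M m x y).symm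
lemma rsmul_add : m ◁ (x + y) = m ◁ x + m ◁ y := by rw [MulOpposite.op_add, add_smul]
lemma rsmul_neg : m ◁ (-x) = -(m ◁ x) := by rw [MulOpposite.op_neg, neg_smul]
lemma rsmul_zero : m ◁ (0 : Alg) = 0 := by rw [MulOpposite.op_zero, zero_smul]
lemma rsmul_one : m ◁ (1 : Alg) = m := by rw [MulOpposite.op_one, one_smul]
lemma rsmul_units_smul : m ◁ (u • x) = u • (m ◁ x) := by
  rcases Int.units_eq_one_or u with rfl | rfl <;> simp [rsmul_neg]
lemma units_smul_rsmul : (u • m) ◁ x = u • (m ◁ x) := by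
  rcases Int.units_eq_one_or u with rfl | rfl <;> simp
lemma d_rsmul : M.d (m ◁ x) = M.d m ◁ x + M.par m ◁ d x := DGModule.d_smul (A := dgAlgebra) x m

end

section resolution

variable {i j : Fin 2} (h : i ≠ j)

/-- The projection of the free resolution given by the idempotents. -/
noncomputable def freeIdem : freeResolution h ⟶ freeResolution h where
  lin :=
    { toFun := fun x => (ι (E i) * x.1, ι (E j) * x.2.1, ι (E i) * x.2.2)
      map_add' := fun x y => by ext <;> simp [mul_add]
      map_smul' := fun c x => by
        obtain ⟨c, rfl⟩ := op_surjective c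
        ext <;> exact (mul_assoc _ _ _).symm }
  map_mem {n m} hm := by
    have h0 : ∀ (k : Fin 2) (n : ℤ) (x : Alg), x ∈ gr n → ι (E k) * x ∈ gr n := fun k n x hx => by
      have := SetLike.mul_mem_graded (ι_E_mem k) hx
      rwa [zero_add] at this
    exact ⟨h0 _ _ _ hm.1, h0 _ _ _ hm.2.1, h0 _ _ _ hm.2.2⟩
  comm x := by
    have h0 : ∀ k x, d (ι (E k) * x) = ι (E k) * d x := fun k x => by
      rw [d_leibniz _ (ι_E_mem k), d_E]; simp
    have h1 : ∀ (k l : Fin 2) (g : Gen), ι (E k) * ι g = ι g → ι g * ι (E l) = ι g →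
        ∀ y : Alg, ι (E k) * (ι g * y) = ι g * (ι (E l) * y) := fun k l g h1 h2 y => by
      rw [← mul_assoc, h1, ← mul_assoc, h2]
    ext
    · change ι (E i) * (d x.1 + ι (α i) * x.2.1 + ι (τ i) * x.2.2) =
        d (ι (E i) * x.1) + ι (α i) * (ι (E j) * x.2.1) + ι (τ i) * (ι (E i) * x.2.2)
      rw [mul_add, mul_add, h0, h1 i j _ (E_α i) (α_E h), h1 i i _ (E_τ i) (τ_E i)]
    · change ι (E j) * (-(sgn i • (d x.2.1 + ι (α j) * x.2.2))) =
        -(sgn i • (d (ι (E j) * x.2.1) + ι (α j) * (ι (E i) * x.2.2)))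
      rw [h0, ← h1 j i _ (E_α j) (α_E h.symm), ← mul_add, mul_neg, mul_smul_comm]
    · change ι (E i) * -d x.2.2 = -d (ι (E i) * x.2.2)
      rw [h0, mul_neg]

/-- The semi-free resolution of a simple module. -/
@[reducible]
noncomputable def resolution : DGModule dgAlgebra := (fix (freeIdem h)).toDG

lemma mem_resolution {x : Alg × Alg × Alg} : x ∈ (fix (freeIdem h)).sub ↔
    ι (E i) * x.1 = x.1 ∧ ι (E j) * x.2.1 = x.2.1 ∧ ι (E i) * x.2.2 = x.2.2 := by
  rw [← Prod.mk.injEq, ← Prod.mk.injEq]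
  rfl

/-- The augmentation of the resolution. -/
noncomputable def augmentation : resolution h ⟶ simpleModule i :=
  letI : Module Algᵐᵒᵖ ℂ := simpleAction i
  (fix (freeIdem h)).ι ≫
  { lin :=
      { toFun := fun x : Alg × Alg × Alg => char i x.1
        map_add' := fun x y => by simp
        map_smul' := fun c x => by
          obtain ⟨c, rfl⟩ := op_surjective c
          change char i (x.1 * c) = char i c * char i x.1
          rw [map_mul, mul_comm] }
    map_mem := fun {n m} hm => by
      change char i m.1 ∈ simpleGr n
      rw [simpleGr]
      split_ifs with hn
      · trivial
      · exact char_eq_zero i hn hm.1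
    comm := fun x => by
      change char i (d x.1 + ι (α i) * x.2.1 + ι (τ i) * x.2.2) = 0
      simp [char_d] }

lemma augmentation_lin (x : (resolution h).carrier) : (augmentation h).lin x = char i x.1.1 := rfl

lemma resolution_d (x : (resolution h).carrier) : ((resolution h).d x).1 =
    (d x.1.1 + ι (α i) * x.1.2.1 + ι (τ i) * x.1.2.2,
      -(sgn i • (d x.1.2.1 + ι (α j) * x.1.2.2)), -d x.1.2.2) := rfl

lemma isQis_augmentation : IsQis (augmentation h) := by
  refine isQis_of_surjective (fun z => ?_) ?_
  · refine ⟨⟨(z • ι (E i), 0, 0), ?_⟩, ?_⟩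
    · rw [mem_resolution]
      simp [E_E]
    · change char i (z • ι (E i)) = z
      simp
  · rintro ⟨⟨p, q, r⟩, hx⟩ h0 hd
    obtain ⟨hp, hq, hr⟩ := (mem_resolution h).1 hx
    obtain ⟨q', r', hq', hr', e⟩ := exists_eq_add h p hp
    rw [show char i p = 0 from h0, zero_smul, zero_add] at e
    let y : (resolution h).carrier := ⟨(0, q', r'), (mem_resolution h).2 ⟨mul_zero _, hq', hr'⟩⟩
    refine ⟨y, ?_, ?_⟩
    · change char i 0 = 0
      rw [map_zero]
    · rw [← sub_eq_zero]
      set w := (⟨(p, q, r), hx⟩ : (resolution h).carrier) - (resolution h).d y with hw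
      have h1 : w.1.1 = 0 := by
        change p - (d 0 + ι (α i) * q' + ι (τ i) * r') = 0
        rw [map_zero, zero_add, e, sub_self]
      have h2 : (resolution h).d w = 0 := by
        rw [hw, map_sub, (resolution h).d_d, sub_zero]
        exact hd
      obtain ⟨-, h3, h4⟩ := (mem_resolution h).1 w.2
      have h5 := congrArg Prod.fst (congrArg Subtype.val h2)
      rw [resolution_d, h1, map_zero, zero_add] at h5
      obtain ⟨h6, h7⟩ := eq_zero_of_add_eq_zero h h3 h4 h5
      exact Subtype.ext (Prod.ext h1 (Prod.ext h6 h7))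

variable {M : DGModule dgAlgebra}

/-- The linear map from the resolution with given values on the generators. -/
noncomputable def resolutionLin (y y' y'' : M.carrier) :
    (resolution h).carrier →ₗ[Algᵐᵒᵖ] M.carrier where
  toFun x := y ◁ x.1.1 + y' ◁ x.1.2.1 + y'' ◁ x.1.2.2
  map_add' x x' := by
    change y ◁ (x.1.1 + x'.1.1) + y' ◁ (x.1.2.1 + x'.1.2.1) + y'' ◁ (x.1.2.2 + x'.1.2.2) = _
    rw [rsmul_add, rsmul_add, rsmul_add]
    abel
  map_smul' c x := by
    obtain ⟨c, rfl⟩ := op_surjective c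
    change y ◁ (x.1.1 * c) + y' ◁ (x.1.2.1 * c) + y'' ◁ (x.1.2.2 * c) = _
    simp only [op_mul, mul_smul, RingHom.id_apply, smul_add]

lemma resolutionLin_apply (y y' y'' : M.carrier) (x : (resolution h).carrier) :
    resolutionLin h y y' y'' x = y ◁ x.1.1 + y' ◁ x.1.2.1 + y'' ◁ x.1.2.2 := rfl

/-- The generators of the resolution. -/
noncomputable def gen₀ : (resolution h).carrier :=
  ⟨(ι (E i), 0, 0), (mem_resolution h).2 ⟨E_E i, mul_zero _, mul_zero _⟩⟩

noncomputable def gen₁ : (resolution h).carrier :=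
  ⟨(0, ι (E j), 0), (mem_resolution h).2 ⟨mul_zero _, E_E j, mul_zero _⟩⟩

noncomputable def gen₂ : (resolution h).carrier :=
  ⟨(0, 0, ι (E i)), (mem_resolution h).2 ⟨mul_zero _, mul_zero _, E_E i⟩⟩

lemma d_gen₀ : (resolution h).d (gen₀ h) = 0 := by
  apply Subtype.ext
  rw [resolution_d]
  simp [gen₀, d_E]

lemma d_gen₁ : (resolution h).d (gen₁ h) = gen₀ h ◁ ι (α i) := by
  apply Subtype.ext
  rw [resolution_d]
  refine Prod.ext ?_ (Prod.ext ?_ ?_)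
  · change d 0 + ι (α i) * ι (E j) + ι (τ i) * 0 = ι (E i) * ι (α i)
    rw [α_E h, E_α]; simp
  · change -(sgn i • (d (ι (E j)) + ι (α j) * 0)) = 0 * ι (α i)
    simp [d_E]
  · change -d 0 = 0 * ι (α i)
    simp

lemma d_gen₂ : (resolution h).d (gen₂ h) =
    gen₀ h ◁ ι (τ i) - sgn i • (gen₁ h ◁ ι (α j)) := by
  have h1 : (d (0 : Alg) + ι (α i) * 0 + ι (τ i) * ι (E i), -(d (0 : Alg) + ι (α j) * ι (E i)),
      -d (ι (E i))) = (ι (E i) * ι (τ i) - 0 * ι (α j), 0 * ι (τ i) - ι (E j) * ι (α j),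
      0 * ι (τ i) - 0 * ι (α j)) := by
    simp [τ_E, E_τ, α_E h.symm, E_α, d_E]
  have h2 : (d (0 : Alg) + ι (α i) * 0 + ι (τ i) * ι (E i), d (0 : Alg) + ι (α j) * ι (E i),
      -d (ι (E i))) = (ι (E i) * ι (τ i) + 0 * ι (α j), 0 * ι (τ i) + ι (E j) * ι (α j),
      0 * ι (τ i) + 0 * ι (α j)) := by
    simp [τ_E, E_τ, α_E h.symm, E_α, d_E]
  rcases Int.units_eq_one_or (sgn i) with e | e
  · rw [e, one_smul]
    apply Subtype.ext
    rw [resolution_d, e, one_smul]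
    exact h1
  · rw [e, Units.neg_smul, one_smul, sub_neg_eq_add]
    apply Subtype.ext
    rw [resolution_d, e, Units.neg_smul, one_smul, neg_neg]
    exact h2

lemma gen₀_mem : gen₀ h ∈ (resolution h).gr 0 :=
  ⟨ι_E_mem i, Submodule.zero_mem _, Submodule.zero_mem _⟩

lemma gen₁_mem : gen₁ h ∈ (resolution h).gr ((α i).deg - 1) :=
  ⟨Submodule.zero_mem _, by
    change ι (E j) ∈ gr ((α i).deg - 1 + (1 - (α i).deg))
    rw [sub_add_sub_cancel, sub_self]
    exact ι_E_mem j, Submodule.zero_mem _⟩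

lemma gen₂_mem : gen₂ h ∈ (resolution h).gr (-3) :=
  ⟨Submodule.zero_mem _, Submodule.zero_mem _, ι_E_mem i⟩

lemma eq_resolutionLin (f : (resolution h).carrier →ₗ[Algᵐᵒᵖ] M.carrier) :
    f = resolutionLin h (f (gen₀ h)) (f (gen₁ h)) (f (gen₂ h)) := by
  refine LinearMap.ext fun x => ?_
  obtain ⟨hp, hq, hr⟩ := (mem_resolution h).1 x.2
  rw [resolutionLin_apply, ← map_smul, ← map_smul, ← map_smul, ← map_add, ← map_add]
  congr 1
  apply Subtype.ext
  refine Prod.ext ?_ (Prod.ext ?_ ?_)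
  · change _ = ι (E i) * x.1.1 + 0 * x.1.2.1 + 0 * x.1.2.2
    simp [hp]
  · change _ = 0 * x.1.1 + ι (E j) * x.1.2.1 + 0 * x.1.2.2
    simp [hq]
  · change _ = 0 * x.1.1 + 0 * x.1.2.1 + ι (E i) * x.1.2.2
    simp [hr]

lemma resolutionLin_mem {y y' y'' : M.carrier} {m : ℤ} (hy : y ∈ M.gr m)
    (hy' : y' ∈ M.gr (m + ((α i).deg - 1))) (hy'' : y'' ∈ M.gr (m - 3)) {n l : ℤ}
    {x : (resolution h).carrier} (hx : x ∈ (resolution h).gr n) (hl : m + n = l) :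
    resolutionLin h y y' y'' x ∈ M.gr l := by
  subst hl
  rw [resolutionLin_apply]
  refine Submodule.add_mem _ (Submodule.add_mem _ (M.smul_mem hy hx.1) ?_) ?_
  · have := M.smul_mem hy' hx.2.1
    rwa [show m + ((α i).deg - 1) + (n + (1 - (α i).deg)) = m + n by ring] at this
  · have := M.smul_mem hy'' hx.2.2
    rwa [show m - 3 + (n + 3) = m + n by ring] at this

/-- The morphism from a shift of the resolution with given values on the generators. -/
noncomputable def resolutionHom (n : ℤ) (y y' y'' : M.carrier) (hy : y ∈ M.gr (-n))
    (hy' : y' ∈ M.gr (-n + ((α i).deg - 1))) (hy'' : y'' ∈ M.gr (-n - 3)) (h0 : M.d y = 0)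
    (h1 : M.d y' = n.negOnePow • (y ◁ ι (α i)))
    (h2 : M.d y'' = n.negOnePow • (y ◁ ι (τ i) - sgn i • (y' ◁ ι (α j)))) :
    (resolution h).shift n ⟶ M where
  lin := resolutionLin h y y' y''
  map_mem {m x} hx := resolutionLin_mem h hy hy' hy'' (x := x) (n := m + n) hx (by ring)
  comm x := by
    have hn : (-n).negOnePow = n.negOnePow := Int.negOnePow_neg n
    have hp : M.par y = n.negOnePow • y := by rw [par_apply hy, hn]
    have hp' : M.par y' = -(n.negOnePow • sgn i • y') := by
      rw [par_apply hy', Int.negOnePow_add, hn, Int.negOnePow_sub, mul_smul, mul_smul]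
      change n.negOnePow • sgn i • (-1 : ℤˣ) • y' = _
      simp
    have hp'' : M.par y'' = -(n.negOnePow • y'') := by
      rw [par_apply hy'', Int.negOnePow_sub, hn, show Int.negOnePow 3 = -1 by decide]
      simp
    change resolutionLin h y y' y'' (n.negOnePow • (resolution h).d x) =
      M.d (resolutionLin h y y' y'' x)
    have hu : resolutionLin h y y' y'' (n.negOnePow • (resolution h).d x) =
        n.negOnePow • resolutionLin h y y' y'' ((resolution h).d x) := by
      rw [Units.smul_def, map_zsmul, ← Units.smul_def]
    rw [hu, resolutionLin_apply, resolutionLin_apply, resolution_d, map_add, map_add,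
      d_rsmul, d_rsmul, d_rsmul, h0, h1, h2, hp, hp', hp'']
    simp only [rsmul_add, rsmul_mul, rsmul_neg, rsmul_units_smul, units_smul_rsmul, smul_neg,
      smul_add, smul_sub, smul_zero, zero_add, neg_smul, sub_smul]
    rcases Int.units_eq_one_or n.negOnePow with e | e <;>
    rcases Int.units_eq_one_or (sgn i) with e' | e' <;>
    simp only [e, e', one_smul, Units.neg_smul, neg_neg, smul_neg, neg_smul] <;> abel

/-- A morphism from a shift of the resolution is null-homotopic if its values on the generators
are boundaries in the complex of morphisms. -/
lemma homotopic_zero_iff {n : ℤ} (f : (resolution h).shift n ⟶ M) :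
    Homotopic f 0 ↔ ∃ z z' z'', z ∈ M.gr (-n - 1) ∧ z' ∈ M.gr (-n - 1 + ((α i).deg - 1)) ∧
      z'' ∈ M.gr (-n - 1 - 3) ∧ f.lin (gen₀ h) = M.d z ∧
      f.lin (gen₁ h) = M.d z' + n.negOnePow • (z ◁ ι (α i)) ∧
      f.lin (gen₂ h) = M.d z'' + n.negOnePow • (z ◁ ι (τ i) - sgn i • (z' ◁ ι (α j))) := by
  have key : ∀ (H : (resolution h).carrier →ₗ[Algᵐᵒᵖ] M.carrier) (u : ℤˣ) (x),
      H (u • x) = u • H x := fun H u x => by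
    rw [Units.smul_def, map_zsmul, ← Units.smul_def]
  constructor
  · rintro ⟨H, hH, e⟩
    replace e : ∀ m, f.lin m = 0 + M.d (H m) + H (n.negOnePow • (resolution h).d m) := e
    refine ⟨H (gen₀ h), H (gen₁ h), H (gen₂ h), hH _ _ ?_, hH _ _ ?_, hH _ _ ?_, ?_, ?_, ?_⟩
    · have := gen₀_mem h
      change _ ∈ (resolution h).gr (-n - 1 + 1 + n)
      rwa [show -n - 1 + 1 + n = 0 by ring]
    · have := gen₁_mem h
      change _ ∈ (resolution h).gr (-n - 1 + ((α i).deg - 1) + 1 + n)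
      rwa [show -n - 1 + ((α i).deg - 1) + 1 + n = (α i).deg - 1 by ring]
    · have := gen₂_mem h
      change _ ∈ (resolution h).gr (-n - 1 - 3 + 1 + n)
      rwa [show -n - 1 - 3 + 1 + n = -3 by ring]
    · rw [e, d_gen₀]; simp
    · rw [e, d_gen₁, key, zero_add]
      exact congrArg (fun z => M.d (H (gen₁ h)) + n.negOnePow • z) (map_smul H _ _)
    · rw [e, d_gen₂, key, zero_add, map_sub, key]
      exact congrArg₂ (fun z z' => M.d (H (gen₂ h)) + n.negOnePow • (z - sgn i • z'))
        (map_smul H _ _) (map_smul H _ _)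
  · rintro ⟨z, z', z'', hz, hz', hz'', e, e', e''⟩
    refine ⟨resolutionLin h z z' z'', fun m x hx =>
      resolutionLin_mem h hz hz' hz'' (x := x) (n := m + 1 + n) hx (by ring), fun x => ?_⟩
    change f.lin x = 0 + M.d (resolutionLin h z z' z'' x) +
      resolutionLin h z z' z'' (n.negOnePow • (resolution h).d x)
    have hf := eq_resolutionLin h (f.lin : (resolution h).carrier →ₗ[Algᵐᵒᵖ] M.carrier)
    have hn : (-n).negOnePow = n.negOnePow := Int.negOnePow_neg n
    have hp : M.par z = -(n.negOnePow • z) := by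
      rw [par_apply hz, Int.negOnePow_sub, hn]; simp
    have hp' : M.par z' = n.negOnePow • sgn i • z' := by
      rw [par_apply hz', Int.negOnePow_add, Int.negOnePow_sub, hn, Int.negOnePow_sub, mul_smul,
        mul_smul, mul_smul]
      change n.negOnePow • (-1 : ℤˣ) • sgn i • (-1 : ℤˣ) • z' = _
      simp
    have hp'' : M.par z'' = n.negOnePow • z'' := by
      rw [par_apply hz'', show -n - 1 - 3 = -n + -4 by ring, Int.negOnePow_add, hn,
        show Int.negOnePow (-4) = 1 by decide, mul_one]
    rw [key, zero_add]
    refine (LinearMap.congr_fun hf x).trans ?_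
    rw [e, e', e'', resolutionLin_apply, resolutionLin_apply, resolutionLin_apply, resolution_d,
      map_add, map_add, d_rsmul, d_rsmul, d_rsmul, hp, hp', hp'']
    simp only [rsmul_add, rsmul_mul, rsmul_neg, rsmul_units_smul, units_smul_rsmul, smul_neg,
      smul_add, smul_sub, smul_zero, zero_add, neg_smul, sub_smul, add_smul]
    rcases Int.units_eq_one_or n.negOnePow with e | e <;>
    rcases Int.units_eq_one_or (sgn i) with e' | e' <;>
    simp only [e, e', one_smul, Units.neg_smul, neg_neg, smul_neg, neg_smul] <;> abel

end resolution

end Ginzburg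

namespace Ginzburg

open DGModule DGDerivedCategory

section

variable {i j : Fin 2} (h : i ≠ j) {M : DGModule dgAlgebra} {n : ℤ}

lemma gen₀_E : gen₀ h ◁ ι (E i) = gen₀ h := by
  apply Subtype.ext
  change (ι (E i) * ι (E i), 0 * ι (E i), 0 * ι (E i)) = (ι (E i), 0, 0)
  rw [E_E, zero_mul]

lemma gen₁_E : gen₁ h ◁ ι (E j) = gen₁ h := by
  apply Subtype.ext
  change (0 * ι (E j), ι (E j) * ι (E j), 0 * ι (E j)) = (0, ι (E j), 0)
  rw [E_E, zero_mul]

lemma gen₂_E : gen₂ h ◁ ι (E i) = gen₂ h := by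
  apply Subtype.ext
  change (0 * ι (E i), 0 * ι (E i), ι (E i) * ι (E i)) = (0, 0, ι (E i))
  rw [E_E, zero_mul]

variable (f : (resolution h).shift n ⟶ M)

lemma hom_gen₀_E : f.lin (gen₀ h) ◁ ι (E i) = f.lin (gen₀ h) :=
  (map_smul f.lin _ _).symm.trans (congrArg f.lin (gen₀_E h))

lemma hom_gen₁_E : f.lin (gen₁ h) ◁ ι (E j) = f.lin (gen₁ h) :=
  (map_smul f.lin _ _).symm.trans (congrArg f.lin (gen₁_E h))

lemma hom_gen₂_E : f.lin (gen₂ h) ◁ ι (E i) = f.lin (gen₂ h) :=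
  (map_smul f.lin _ _).symm.trans (congrArg f.lin (gen₂_E h))

lemma hom_gen₀_mem : f.lin (gen₀ h) ∈ M.gr (-n) := f.map_mem (by
  change gen₀ h ∈ (resolution h).gr (-n + n)
  rw [neg_add_cancel]
  exact gen₀_mem h)

lemma hom_gen₁_mem : f.lin (gen₁ h) ∈ M.gr (-n + ((α i).deg - 1)) := f.map_mem (by
  change gen₁ h ∈ (resolution h).gr (-n + ((α i).deg - 1) + n)
  rw [show -n + ((α i).deg - 1) + n = (α i).deg - 1 by ring]
  exact gen₁_mem h)

lemma hom_gen₂_mem : f.lin (gen₂ h) ∈ M.gr (-n - 3) := f.map_mem (by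
  change gen₂ h ∈ (resolution h).gr (-n - 3 + n)
  rw [show -n - 3 + n = -3 by ring]
  exact gen₂_mem h)

lemma d_hom (x : (resolution h).carrier) :
    M.d (f.lin x) = n.negOnePow • f.lin ((resolution h).d x) :=
  (f.comm x).symm.trans (lin_units_smul f _ _)

lemma d_hom_gen₀ : M.d (f.lin (gen₀ h)) = 0 := by
  rw [d_hom, d_gen₀]
  exact (congrArg (n.negOnePow • ·) (map_zero f.lin)).trans (smul_zero _)

lemma d_hom_gen₁ : M.d (f.lin (gen₁ h)) = n.negOnePow • (f.lin (gen₀ h) ◁ ι (α i)) := by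
  rw [d_hom, d_gen₁]
  exact congrArg (n.negOnePow • ·) (map_smul f.lin _ _)

lemma d_hom_gen₂ : M.d (f.lin (gen₂ h)) = n.negOnePow • (f.lin (gen₀ h) ◁ ι (τ i) -
    sgn i • (f.lin (gen₁ h) ◁ ι (α j))) := by
  rw [d_hom, d_gen₂]
  refine congrArg (n.negOnePow • ·) ((map_sub f.lin _ _).trans ?_)
  refine congrArg₂ (· - ·) (map_smul f.lin _ _) ?_
  exact (lin_units_smul f _ _).trans (congrArg (sgn i • ·) (map_smul f.lin _ _))

lemma resolution_hom_ext {f g : (resolution h).shift n ⟶ M} (h0 : f.lin (gen₀ h) = g.lin (gen₀ h))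
    (h1 : f.lin (gen₁ h) = g.lin (gen₁ h)) (h2 : f.lin (gen₂ h) = g.lin (gen₂ h)) : f = g := by
  refine hom_ext fun x => ?_
  have hf := eq_resolutionLin h (f.lin : (resolution h).carrier →ₗ[Algᵐᵒᵖ] M.carrier)
  have hg := eq_resolutionLin h (g.lin : (resolution h).carrier →ₗ[Algᵐᵒᵖ] M.carrier)
  exact (LinearMap.congr_fun hf x).trans ((by rw [h0, h1, h2] : _ = _).trans
    (LinearMap.congr_fun hg x).symm)

lemma resolutionLin_gen₀ (y y' y'' : M.carrier) :
    resolutionLin h y y' y'' (gen₀ h) = y ◁ ι (E i) := by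
  rw [resolutionLin_apply]
  change y ◁ ι (E i) + y' ◁ 0 + y'' ◁ 0 = _
  rw [rsmul_zero, rsmul_zero, add_zero, add_zero]

lemma resolutionLin_gen₁ (y y' y'' : M.carrier) :
    resolutionLin h y y' y'' (gen₁ h) = y' ◁ ι (E j) := by
  rw [resolutionLin_apply]
  change y ◁ 0 + y' ◁ ι (E j) + y'' ◁ 0 = _
  rw [rsmul_zero, rsmul_zero, add_zero, zero_add]

lemma resolutionLin_gen₂ (y y' y'' : M.carrier) :
    resolutionLin h y y' y'' (gen₂ h) = y'' ◁ ι (E i) := by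
  rw [resolutionLin_apply]
  change y ◁ 0 + y' ◁ 0 + y'' ◁ ι (E i) = _
  rw [rsmul_zero, rsmul_zero, add_zero, zero_add]

lemma exists_d_eq_of_acyclic (hM : M.Acyclic) {m : M.carrier} {l : ℤ} (hm : m ∈ M.gr l)
    (hd : M.d m = 0) : ∃ z ∈ M.gr (l - 1), m = M.d z := by
  obtain ⟨z, hz, e⟩ := (hM.exactAt l).proj (m := m) (by rw [hd, map_zero])
  exact ⟨z, hz, by rw [e, gradeProj_same _ hm]⟩

lemma resolution_isHomotopicallyProjective :
    ((resolution h).shift n).IsHomotopicallyProjective := fun N hN f => by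
  rw [homotopic_zero_iff]
  obtain ⟨z, hz, e⟩ := exists_d_eq_of_acyclic hN (hom_gen₀_mem h f) (d_hom_gen₀ h f)
  have hα : z ◁ ι (α i) ∈ N.gr (-n + ((α i).deg - 1)) := by
    have := N.smul_mem hz (ι_mem (α i))
    rwa [show -n - 1 + (α i).deg = -n + ((α i).deg - 1) by ring] at this
  obtain ⟨z', hz', e'⟩ := exists_d_eq_of_acyclic hN
    (m := f.lin (gen₁ h) - n.negOnePow • (z ◁ ι (α i)))
    (Submodule.sub_mem _ (hom_gen₁_mem h f) (units_smul_mem _ _ hα)) (by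
      rw [map_sub, d_hom_gen₁, d_units_smul, d_rsmul, d_α, rsmul_zero, add_zero, ← e, sub_self])
  have hp : N.par z = -(n.negOnePow • z) := by
    rw [par_apply hz, Int.negOnePow_sub, Int.negOnePow_neg]; simp
  have hτ : z ◁ ι (τ i) ∈ N.gr (-n - 3) := by
    have := N.smul_mem hz (ι_τ_mem i)
    rwa [show -n - 1 + -2 = -n - 3 by ring] at this
  have hα' : z' ◁ ι (α j) ∈ N.gr (-n - 3) := by
    have := N.smul_mem hz' (ι_mem (α j))
    rwa [show -n + ((α i).deg - 1) - 1 + (α j).deg = -n - 3 by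
      have := deg_α_add h; omega] at this
  obtain ⟨z'', hz'', e''⟩ := exists_d_eq_of_acyclic hN
    (m := f.lin (gen₂ h) - n.negOnePow • (z ◁ ι (τ i) - sgn i • (z' ◁ ι (α j))))
    (Submodule.sub_mem _ (hom_gen₂_mem h f) (units_smul_mem _ _ (Submodule.sub_mem _ hτ
      (units_smul_mem _ _ hα')))) (by
      rw [map_sub, d_hom_gen₂, d_units_smul, map_sub, d_units_smul, d_rsmul, d_rsmul, d_α,
        d_τ h, ← e, ← e', hp]
      simp only [rsmul_zero, add_zero, rsmul_units_smul, rsmul_mul, smul_sub, smul_neg,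
        units_smul_rsmul]
      rcases Int.units_eq_one_or n.negOnePow with e | e <;>
      rcases Int.units_eq_one_or (sgn i) with e' | e' <;>
      simp only [e, e', one_smul, Units.neg_smul, neg_neg, smul_neg, neg_smul] <;> abel)
  refine ⟨z, z', z'', hz, ?_, ?_, e, ?_, ?_⟩
  · rwa [show -n - 1 + ((α i).deg - 1) = -n + ((α i).deg - 1) - 1 by ring]
  · rwa [show -n - 1 - 3 = -n - 3 - 1 by ring]
  · rw [← e', sub_add_cancel]
  · rw [← e'', sub_add_cancel]

end

/-! ### Morphisms between shifts of the simple objects -/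

/-- A dg module with zero differential supported at the vertex `k` on which the arrows and the
loops act by zero. -/
structure IsSemisimpleAt (k : Fin 2) (M : DGModule dgAlgebra) : Prop where
  d_eq : ∀ m, M.d m = 0
  E_eq : ∀ m : M.carrier, m ◁ ι (E k) = m
  α_eq : ∀ l, ∀ m : M.carrier, m ◁ ι (α l) = 0
  τ_eq : ∀ l, ∀ m : M.carrier, m ◁ ι (τ l) = 0

/-- A dg module isomorphic to the simple module at `k`. -/
structure IsSimpleAt (k : Fin 2) (M : DGModule dgAlgebra) (v : M.carrier) : Prop
    extends IsSemisimpleAt k M where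
  gr_zero : ∀ m, m ∈ M.gr 0
  gr_ne : ∀ n ≠ 0, ∀ m ∈ M.gr n, m = 0
  ne_zero : v ≠ 0
  exists_smul : ∀ m, ∃ c : ℂ, m = c • v

lemma isSimpleAt_simpleModule (k : Fin 2) :
    IsSimpleAt k (simpleModule k) (show (simpleModule k).carrier from (1 : ℂ)) where
  d_eq _ := rfl
  E_eq m := by
    change char k (ι (E k)) * m = m
    rw [char_E, one_mul]
  α_eq l m := by
    change char k (ι (α l)) * m = 0
    rw [char_α, zero_mul]
  τ_eq l m := by
    change char k (ι (τ l)) * m = 0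
    rw [char_τ, zero_mul]
  gr_zero m := by
    change m ∈ simpleGr 0
    rw [simpleGr, if_pos rfl]; trivial
  gr_ne n hn m hm := by
    change m ∈ simpleGr n at hm
    rwa [simpleGr, if_neg hn] at hm
  ne_zero := one_ne_zero (α := ℂ)
  exists_smul m := ⟨m, (mul_one (m : ℂ)).symm⟩

section

variable {i j : Fin 2} (h : i ≠ j) {n : ℤ} {k : Fin 2} {M : DGModule dgAlgebra}

lemma IsSemisimpleAt.E_eq' (hM : IsSemisimpleAt i M) (m : M.carrier) (h : i ≠ j) :
    m ◁ ι (E j) = 0 := by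
  rw [← hM.E_eq m, rsmul_rsmul, E_E' h, rsmul_zero]

/-- Morphisms to a semisimple module are determined by the values on the generators. -/
lemma IsSemisimpleAt.Q_map_eq_zero (hM : IsSemisimpleAt k M) (f : (resolution h).shift n ⟶ M) :
    (Q dgAlgebra).map f = 0 ↔ f = 0 := by
  refine ⟨fun e => ?_, fun e => by rw [e, Functor.map_zero]⟩
  rw [DGDerivedCategory.Q_map_eq_zero (resolution_isHomotopicallyProjective h),
    homotopic_zero_iff] at e
  obtain ⟨z, z', z'', -, -, -, e, e', e''⟩ := e
  refine resolution_hom_ext h ?_ ?_ ?_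
  · rw [e, hM.d_eq]; rfl
  · rw [e', hM.d_eq, hM.α_eq, smul_zero, add_zero]; rfl
  · rw [e'', hM.d_eq, hM.α_eq, hM.τ_eq, smul_zero, sub_zero, smul_zero, add_zero]; rfl

/-- The morphism with given values on the generators. -/
noncomputable def IsSemisimpleAt.hom (hM : IsSemisimpleAt k M) (y y' y'' : M.carrier)
    (hy : y ∈ M.gr (-n)) (hy' : y' ∈ M.gr (-n + ((α i).deg - 1))) (hy'' : y'' ∈ M.gr (-n - 3)) :
    (resolution h).shift n ⟶ M :=
  resolutionHom h n y y' y'' hy hy' hy'' (hM.d_eq _) (by rw [hM.d_eq, hM.α_eq, smul_zero])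
    (by rw [hM.d_eq, hM.α_eq, hM.τ_eq, smul_zero, sub_zero, smul_zero])

variable {v : M.carrier}

lemma finrank_hom_of_forall (f₀ : (resolution h).shift n ⟶ M) (hf₀ : (Q dgAlgebra).map f₀ ≠ 0)
    (hf : ∀ f : (resolution h).shift n ⟶ M, ∃ c : ℂ, f = c • f₀) :
    Module.finrank ℂ ((Q dgAlgebra).obj ((resolution h).shift n) ⟶ (Q dgAlgebra).obj M) = 1 := by
  refine finrank_eq_one _ hf₀ fun φ => ?_
  obtain ⟨f, rfl⟩ := exists_Q_map_eq (resolution_isHomotopicallyProjective h) φ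
  obtain ⟨c, rfl⟩ := hf f
  exact ⟨c, (Functor.map_smul _ _ _).symm⟩

lemma hom_eq_zero_of_forall (hf : ∀ f : (resolution h).shift n ⟶ M, f = 0)
    (φ : (Q dgAlgebra).obj ((resolution h).shift n) ⟶ (Q dgAlgebra).obj M) : φ = 0 := by
  obtain ⟨f, rfl⟩ := exists_Q_map_eq (resolution_isHomotopicallyProjective h) φ
  rw [hf f, Functor.map_zero]

lemma IsSimpleAt.finrank_zero (hM : IsSimpleAt i M v) :
    Module.finrank ℂ ((Q dgAlgebra).obj ((resolution h).shift 0) ⟶ (Q dgAlgebra).obj M) = 1 := by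
  let f₀ := hM.toIsSemisimpleAt.hom h (n := 0) v 0 0 (hM.gr_zero _) (Submodule.zero_mem _)
    (Submodule.zero_mem _)
  have e0 : f₀.lin (gen₀ h) = v := (resolutionLin_gen₀ h v 0 0).trans (hM.E_eq v)
  have e1 : f₀.lin (gen₁ h) = 0 := (resolutionLin_gen₁ h v 0 0).trans (smul_zero _)
  have e2 : f₀.lin (gen₂ h) = 0 := (resolutionLin_gen₂ h v 0 0).trans (smul_zero _)
  refine finrank_hom_of_forall h f₀ (fun e => hM.ne_zero ?_) fun f => ?_
  · rw [hM.toIsSemisimpleAt.Q_map_eq_zero h] at e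
    rw [← e0, e]; rfl
  · obtain ⟨c, hc⟩ := hM.exists_smul (f.lin (gen₀ h))
    refine ⟨c, resolution_hom_ext h (hc.trans (congrArg (c • ·) e0.symm)) ?_ ?_⟩
    · refine Eq.trans ?_ ((congrArg (c • ·) e1).trans (smul_zero c)).symm
      rw [← hom_gen₁_E, hM.E_eq' _ h]
    · refine Eq.trans ?_ ((congrArg (c • ·) e2).trans (smul_zero c)).symm
      exact hM.gr_ne _ (by norm_num) _ (hom_gen₂_mem h f)

lemma IsSimpleAt.finrank_neg_three (hM : IsSimpleAt i M v) :
    Module.finrank ℂ ((Q dgAlgebra).obj ((resolution h).shift (-3)) ⟶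
      (Q dgAlgebra).obj M) = 1 := by
  let f₀ := hM.toIsSemisimpleAt.hom h (n := -3) 0 0 v (Submodule.zero_mem _)
    (Submodule.zero_mem _) (hM.gr_zero _)
  have e0 : f₀.lin (gen₀ h) = 0 := (resolutionLin_gen₀ h 0 0 v).trans (smul_zero _)
  have e1 : f₀.lin (gen₁ h) = 0 := (resolutionLin_gen₁ h 0 0 v).trans (smul_zero _)
  have e2 : f₀.lin (gen₂ h) = v := (resolutionLin_gen₂ h 0 0 v).trans (hM.E_eq v)
  refine finrank_hom_of_forall h f₀ (fun e => hM.ne_zero ?_) fun f => ?_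
  · rw [hM.toIsSemisimpleAt.Q_map_eq_zero h] at e
    rw [← e2, e]; rfl
  · obtain ⟨c, hc⟩ := hM.exists_smul (f.lin (gen₂ h))
    refine ⟨c, resolution_hom_ext h ?_ ?_ (hc.trans (congrArg (c • ·) e2.symm))⟩
    · refine Eq.trans ?_ ((congrArg (c • ·) e0).trans (smul_zero c)).symm
      exact hM.gr_ne _ (by norm_num) _ (hom_gen₀_mem h f)
    · refine Eq.trans ?_ ((congrArg (c • ·) e1).trans (smul_zero c)).symm
      rw [← hom_gen₁_E, hM.E_eq' _ h]

lemma IsSimpleAt.finrank_deg (hM : IsSimpleAt j M v) :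
    Module.finrank ℂ ((Q dgAlgebra).obj ((resolution h).shift ((α i).deg - 1)) ⟶
      (Q dgAlgebra).obj M) = 1 := by
  let f₀ := hM.toIsSemisimpleAt.hom h (n := (α i).deg - 1) 0 v 0 (Submodule.zero_mem _)
    (by rw [neg_add_cancel]; exact hM.gr_zero _) (Submodule.zero_mem _)
  have e0 : f₀.lin (gen₀ h) = 0 := (resolutionLin_gen₀ h 0 v 0).trans (smul_zero _)
  have e1 : f₀.lin (gen₁ h) = v := (resolutionLin_gen₁ h 0 v 0).trans (hM.E_eq v)
  have e2 : f₀.lin (gen₂ h) = 0 := (resolutionLin_gen₂ h 0 v 0).trans (smul_zero _)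
  refine finrank_hom_of_forall h f₀ (fun e => hM.ne_zero ?_) fun f => ?_
  · rw [hM.toIsSemisimpleAt.Q_map_eq_zero h] at e
    rw [← e1, e]; rfl
  · obtain ⟨c, hc⟩ := hM.exists_smul (f.lin (gen₁ h))
    refine ⟨c, resolution_hom_ext h ?_ (hc.trans (congrArg (c • ·) e1.symm)) ?_⟩
    · refine Eq.trans ?_ ((congrArg (c • ·) e0).trans (smul_zero c)).symm
      rw [← hom_gen₀_E, hM.E_eq' _ h.symm]
    · refine Eq.trans ?_ ((congrArg (c • ·) e2).trans (smul_zero c)).symm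
      rw [← hom_gen₂_E, hM.E_eq' _ h.symm]

lemma IsSimpleAt.hom_eq_zero (hM : IsSimpleAt i M v) (h0 : n ≠ 0) (h3 : n ≠ -3)
    (φ : (Q dgAlgebra).obj ((resolution h).shift n) ⟶ (Q dgAlgebra).obj M) : φ = 0 := by
  refine hom_eq_zero_of_forall h (fun f => resolution_hom_ext h ?_ ?_ ?_) φ
  · exact hM.gr_ne _ (by omega) _ (hom_gen₀_mem h f)
  · rw [← hom_gen₁_E, hM.E_eq' _ h]; rfl
  · exact hM.gr_ne _ (by omega) _ (hom_gen₂_mem h f)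

lemma IsSimpleAt.hom_eq_zero' (hM : IsSimpleAt j M v) (hn : n ≠ (α i).deg - 1)
    (φ : (Q dgAlgebra).obj ((resolution h).shift n) ⟶ (Q dgAlgebra).obj M) : φ = 0 := by
  refine hom_eq_zero_of_forall h (fun f => resolution_hom_ext h ?_ ?_ ?_) φ
  · rw [← hom_gen₀_E, hM.E_eq' _ h.symm]; rfl
  · exact hM.gr_ne _ (by omega) _ (hom_gen₁_mem h f)
  · rw [← hom_gen₂_E, hM.E_eq' _ h.symm]; rfl

/-- The shifts of the simple objects are represented by those of the resolutions. -/
noncomputable def simpleShiftIso (n : ℤ) :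
    ((simple i)⟦n⟧).obj ≅ (Q dgAlgebra).obj ((resolution h).shift n) :=
  have := isIso_Q_of_isQis (isQis_augmentation h)
  ((finiteDimensional dgAlgebra).ι.commShiftIso n).app (simple i) ≪≫
    (shiftFunctor _ n).mapIso (asIso ((Q dgAlgebra).map (augmentation h))).symm ≪≫
    ((Q dgAlgebra).commShiftIso n).symm.app (resolution h)

/-- Morphisms from a shift of a simple object. -/
noncomputable def homSimpleEquiv (n : ℤ) {Y : Dfd} {N : DGDerivedCategory dgAlgebra}
    (e : Y.obj ≅ N) :
    ((simple i)⟦n⟧ ⟶ Y) ≃ₗ[ℂ] ((Q dgAlgebra).obj ((resolution h).shift n) ⟶ N) where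
  toFun f := (simpleShiftIso h n).inv ≫ f.hom ≫ e.hom
  map_add' f g := by
    change (simpleShiftIso h n).inv ≫ (f.hom + g.hom) ≫ e.hom = _
    rw [Preadditive.add_comp, Preadditive.comp_add]
  map_smul' c f := by
    change (simpleShiftIso h n).inv ≫ (c • f.hom) ≫ e.hom = _
    rw [Linear.smul_comp, Linear.comp_smul]; rfl
  invFun g := ObjectProperty.homMk ((simpleShiftIso h n).hom ≫ g ≫ e.inv)
  left_inv f := by
    ext
    simp
  right_inv g := by simp

lemma finrank_simple_self_zero (i : Fin 2) :
    Module.finrank ℂ ((simple i)⟦(0 : ℤ)⟧ ⟶ simple i) = 1 := by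
  obtain ⟨j, h⟩ := exists_ne i
  exact (homSimpleEquiv h.symm 0 (Iso.refl _)).finrank_eq.trans
    ((isSimpleAt_simpleModule i).finrank_zero h.symm)

lemma finrank_simple_self_neg_three (i : Fin 2) :
    Module.finrank ℂ ((simple i)⟦(-3 : ℤ)⟧ ⟶ simple i) = 1 := by
  obtain ⟨j, h⟩ := exists_ne i
  exact (homSimpleEquiv h.symm (-3) (Iso.refl _)).finrank_eq.trans
    ((isSimpleAt_simpleModule i).finrank_neg_three h.symm)

include h in
lemma finrank_simple :
    Module.finrank ℂ ((simple i)⟦(α i).deg - 1⟧ ⟶ simple j) = 1 :=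
  (homSimpleEquiv h _ (Iso.refl _)).finrank_eq.trans ((isSimpleAt_simpleModule j).finrank_deg h)

lemma simple_hom_eq_zero_self (i : Fin 2) {n : ℤ} (h0 : n ≠ 0) (h3 : n ≠ -3)
    (f : (simple i)⟦n⟧ ⟶ simple i) : f = 0 := by
  obtain ⟨j, h⟩ := exists_ne i
  exact (homSimpleEquiv h.symm n (Iso.refl _)).map_eq_zero_iff.1
    ((isSimpleAt_simpleModule i).hom_eq_zero h.symm h0 h3 _)

include h in
lemma simple_hom_eq_zero {n : ℤ} (hn : n ≠ (α i).deg - 1) (f : (simple i)⟦n⟧ ⟶ simple j) : f = 0 :=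
  (homSimpleEquiv h n (Iso.refl _)).map_eq_zero_iff.1
    ((isSimpleAt_simpleModule j).hom_eq_zero' h hn _)

end

end Ginzburg

namespace Ginzburg

open DGModule

/-- A finite presentation of a functor on dg modules: a module `Y` is sent to a sum of components
of `Y` at the vertices `vertex k`, with the action given by matrices over the algebra and a
twisted differential. -/
structure MatrixKernel where
  vertex : Fin 3 → Fin 2
  deg : Fin 3 → ℤ
  act : Gen → Matrix (Fin 3) (Fin 3) Alg
  diff : Matrix (Fin 3) (Fin 3) Alg
  isRep : IsRep act
  commute_act : ∀ g l k, ι (E (vertex l)) * act g l k = act g l k * ι (E (vertex k))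
  commute_diff : ∀ l k, ι (E (vertex l)) * diff l k = diff l k * ι (E (vertex k))
  act_mem : ∀ g l k, act g l k ∈ gr (g.deg + deg k - deg l)
  diff_mem : ∀ l k, diff l k ∈ gr (1 + deg k - deg l)
  target : Finset (Fin 3)
  diff_eq_zero : ∀ l k, (l ∈ target ∨ k ∉ target) → diff l k = 0
  d_diff : ∀ l k, d (diff l k) = 0
  leibniz : ∀ g l k, d (act g l k) +
    ∑ m, (g.deg + deg m - deg l).negOnePow • (act g l m * diff m k) =
      ∑ m, diff l m * act g m k + (deg l).negOnePow • lift act isRep (dGen g) l k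

namespace MatrixKernel

variable (K : MatrixKernel) (Y Z : DGModule dgAlgebra)

/-- The matrices by which the algebra acts. -/
noncomputable def rep : Alg →ₐ[ℂ] Matrix (Fin 3) (Fin 3) Alg := lift K.act K.isRep

lemma rep_ι (g : Gen) : K.rep (ι g) = K.act g := lift_ι _ _ g

lemma commute_rep (x : Alg) : ∀ l k,
    ι (E (K.vertex l)) * K.rep x l k = K.rep x l k * ι (E (K.vertex k)) := by
  refine alg_induction (p := fun x => ∀ l k,
    ι (E (K.vertex l)) * K.rep x l k = K.rep x l k * ι (E (K.vertex k))) x ?_ ?_ ?_ ?_ ?_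
  · intro l k
    rw [map_one, Matrix.one_apply]
    split_ifs with h
    · rw [h]; simp
    · simp
  · intro g y hy l k
    rw [map_mul, Matrix.mul_apply, Finset.mul_sum, Finset.sum_mul]
    refine Finset.sum_congr rfl fun m _ => ?_
    rw [rep_ι, ← mul_assoc, K.commute_act, mul_assoc, hy, mul_assoc]
  · intro l k; simp
  · intro x y hx hy l k
    rw [map_add, Matrix.add_apply, mul_add, add_mul, hx, hy]
  · intro c x hx l k
    rw [map_smul, Matrix.smul_apply, mul_smul_comm, smul_mul_assoc, hx]

lemma rep_mem (x : Alg) {n : ℤ} (hx : x ∈ gr n) : ∀ l k,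
    K.rep x l k ∈ gr (n + K.deg k - K.deg l) := by
  rw [gr] at hx
  induction hx using Submodule.span_induction with
  | mem x h =>
    obtain ⟨w, rfl, rfl⟩ := h
    induction w with
    | nil =>
      intro l k
      rw [mon_nil, map_one, Matrix.one_apply]
      split_ifs with h
      · rw [h, deg_nil, zero_add, sub_self]; exact SetLike.GradedOne.one_mem
      · exact Submodule.zero_mem _
    | cons g w ih =>
      intro l k
      rw [mon_cons, map_mul, rep_ι, Matrix.mul_apply, deg_cons]
      refine Submodule.sum_mem _ fun m _ => ?_
      have := SetLike.mul_mem_graded (K.act_mem g l m) (ih m k)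
      rwa [show g.deg + K.deg m - K.deg l + (Ginzburg.deg w + K.deg k - K.deg m) =
        g.deg + Ginzburg.deg w + K.deg k - K.deg l by ring] at this
  | zero => intro l k; simp
  | add x y _ _ hx hy =>
    intro l k; rw [map_add]; exact Submodule.add_mem _ (hx l k) (hy l k)
  | smul c x _ hx =>
    intro l k; rw [map_smul]; exact Submodule.smul_mem _ c (hx l k)

/-- The underlying space of the value of the functor. -/
def space : Submodule ℂ (Fin 3 → Y.carrier) where
  carrier := {v | ∀ k, v k ◁ ι (E (K.vertex k)) = v k}
  zero_mem' k := smul_zero _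
  add_mem' hv hw k := by rw [Pi.add_apply, smul_add, hv, hw]
  smul_mem' c v hv k := by rw [Pi.smul_apply, smul_comm, hv]

/-- The underlying space of the value of the functor. -/
def Slots : Type := K.space Y

noncomputable instance : AddCommGroup (K.Slots Y) := inferInstanceAs (AddCommGroup (K.space Y))
noncomputable instance : Module ℂ (K.Slots Y) := inferInstanceAs (Module ℂ (K.space Y))

variable {K Y}

lemma Slots.ext {v w : K.Slots Y} (h : ∀ k, v.1 k = w.1 k) : v = w := Subtype.ext (funext h)

lemma Slots.rsmul_E (v : K.Slots Y) (k : Fin 3) : v.1 k ◁ ι (E (K.vertex k)) = v.1 k := v.2 k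

lemma Slots.add_apply (v w : K.Slots Y) (k : Fin 3) : (v + w).1 k = v.1 k + w.1 k := rfl
lemma Slots.neg_apply (v : K.Slots Y) (k : Fin 3) : (-v).1 k = -v.1 k := rfl
lemma Slots.sub_apply (v w : K.Slots Y) (k : Fin 3) : (v - w).1 k = v.1 k - w.1 k := rfl
lemma Slots.zero_apply (k : Fin 3) : (0 : K.Slots Y).1 k = 0 := rfl
lemma Slots.smul_apply (c : ℂ) (v : K.Slots Y) (k : Fin 3) : (c • v).1 k = c • v.1 k := rfl
lemma Slots.units_smul_apply (u : ℤˣ) (v : K.Slots Y) (k : Fin 3) :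
    (u • v).1 k = u • v.1 k := by
  rcases Int.units_eq_one_or u with rfl | rfl <;> simp [Slots.neg_apply]

lemma rsmul_sum (m : Y.carrier) {s : Finset (Fin 3)} (f : Fin 3 → Alg) :
    m ◁ (∑ k ∈ s, f k) = ∑ k ∈ s, m ◁ f k := by
  rw [Finset.op_sum, Finset.sum_smul]

/-- The product of a row of elements with a matrix over the algebra. -/
noncomputable def mulMat (v : K.Slots Y) (X : Matrix (Fin 3) (Fin 3) Alg)
    (hX : ∀ l k, ι (E (K.vertex l)) * X l k = X l k * ι (E (K.vertex k))) : K.Slots Y :=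
  ⟨fun k => ∑ l, v.1 l ◁ X l k, fun k => by
    rw [Finset.smul_sum]
    refine Finset.sum_congr rfl fun l _ => ?_
    rw [rsmul_rsmul, ← hX, rsmul_mul, v.rsmul_E]⟩

noncomputable instance : SMul Algᵐᵒᵖ (K.Slots Y) where
  smul x v := mulMat v (K.rep x.unop) (K.commute_rep _)

lemma Slots.rsmul_apply (v : K.Slots Y) (x : Alg) (k : Fin 3) :
    (v ◁ x).1 k = ∑ l, v.1 l ◁ K.rep x l k := rfl

noncomputable instance : Module Algᵐᵒᵖ (K.Slots Y) where
  one_smul v := Slots.ext fun k => by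
    rw [← MulOpposite.op_one, Slots.rsmul_apply, map_one,
      Finset.sum_eq_single k (fun l _ h => by rw [Matrix.one_apply_ne h, rsmul_zero]) (by simp),
      Matrix.one_apply_eq, rsmul_one]
  mul_smul x y v := Slots.ext fun k => by
    obtain ⟨x, rfl⟩ := op_surjective x
    obtain ⟨y, rfl⟩ := op_surjective y
    rw [← op_mul, Slots.rsmul_apply, Slots.rsmul_apply, map_mul]
    simp only [Slots.rsmul_apply, Matrix.mul_apply, rsmul_sum, Finset.smul_sum, rsmul_mul]
    exact Finset.sum_comm
  smul_zero x := Slots.ext fun k => by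
    obtain ⟨x, rfl⟩ := op_surjective x
    simp [Slots.rsmul_apply, Slots.zero_apply]
  smul_add x v w := Slots.ext fun k => by
    obtain ⟨x, rfl⟩ := op_surjective x
    simp [Slots.rsmul_apply, Slots.add_apply, Finset.sum_add_distrib]
  add_smul x y v := Slots.ext fun k => by
    obtain ⟨x, rfl⟩ := op_surjective x
    obtain ⟨y, rfl⟩ := op_surjective y
    rw [← MulOpposite.op_add, Slots.rsmul_apply, Slots.add_apply, Slots.rsmul_apply,
      Slots.rsmul_apply, map_add, ← Finset.sum_add_distrib]
    exact Finset.sum_congr rfl fun l _ => rsmul_add _ _ _ _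
  zero_smul v := Slots.ext fun k => by
    rw [← MulOpposite.op_zero, Slots.rsmul_apply, map_zero]
    simp [Slots.zero_apply]

instance : IsScalarTower ℂ Algᵐᵒᵖ (K.Slots Y) where
  smul_assoc c x v := Slots.ext fun k => by
    obtain ⟨x, rfl⟩ := op_surjective x
    rw [← MulOpposite.op_smul, Slots.rsmul_apply, Slots.smul_apply, Slots.rsmul_apply, map_smul,
      Finset.smul_sum]
    exact Finset.sum_congr rfl fun l _ => by
      rw [Matrix.smul_apply, MulOpposite.op_smul, smul_assoc]

lemma par_rsmul {n : ℤ} {x : Alg} (hx : x ∈ gr n) (m : Y.carrier) :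
    Y.par (m ◁ x) = n.negOnePow • (Y.par m ◁ x) := par_smul (A := dgAlgebra) hx m

lemma par_rsmul_E (m : Y.carrier) (i : Fin 2) (h : m ◁ ι (E i) = m) :
    Y.par m ◁ ι (E i) = Y.par m := by
  have := par_rsmul (ι_E_mem i) m
  rw [h] at this
  simpa using this.symm

variable (K Y)

variable {K Y} in
/-- The differential of an element of the value of the functor. -/
noncomputable def dElem (v : K.Slots Y) : K.Slots Y :=
  ⟨fun k => Y.d (v.1 k) + ∑ l, Y.par (v.1 l) ◁ K.diff l k, fun k => by
    rw [smul_add, Finset.smul_sum]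
    congr 1
    · conv_rhs => rw [← v.rsmul_E k, d_rsmul, d_E, rsmul_zero, add_zero]
    · refine Finset.sum_congr rfl fun l _ => ?_
      rw [rsmul_rsmul, ← K.commute_diff, rsmul_mul, par_rsmul_E _ _ (v.rsmul_E l)]⟩

variable {K Y} in
lemma dElem_apply (v : K.Slots Y) (k : Fin 3) :
    (dElem v).1 k = Y.d (v.1 k) + ∑ l, Y.par (v.1 l) ◁ K.diff l k := rfl

/-- The differential of the value of the functor. -/
noncomputable def dSlots : K.Slots Y →ₗ[ℂ] K.Slots Y where
  toFun := dElem
  map_add' v w := Slots.ext fun k => by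
    simp only [dElem_apply, Slots.add_apply, map_add, smul_add, Finset.sum_add_distrib]; abel
  map_smul' c v := Slots.ext fun k => by
    simp only [dElem_apply, Slots.smul_apply, map_smul, smul_add, Finset.smul_sum,
      RingHom.id_apply]
    congr 1
    exact Finset.sum_congr rfl fun l _ => smul_comm _ _ _

lemma dSlots_apply (v : K.Slots Y) (k : Fin 3) :
    (K.dSlots Y v).1 k = Y.d (v.1 k) + ∑ l, Y.par (v.1 l) ◁ K.diff l k := rfl

lemma isInternal_slots : DirectSum.IsInternal fun n =>
    ({ carrier := {v | ∀ k, v.1 k ∈ Y.gr (n + K.deg k)}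
       zero_mem' := fun _ => Submodule.zero_mem _
       add_mem' := fun hv hw k => Submodule.add_mem _ (hv k) (hw k)
       smul_mem' := fun c _ hv k => Submodule.smul_mem _ c (hv k) } : Submodule ℂ (K.Slots Y)) := by
  classical
  refine isInternal_of_proj (fun n =>
    { toFun := fun v => ⟨fun k => Y.proj (n + K.deg k) (v.1 k), fun k => by
        have h := smul_proj Y (ι_E_mem (K.vertex k)) (n + K.deg k) (v.1 k)
        rw [add_zero] at h
        exact h.trans (congrArg _ (v.rsmul_E k))⟩
      map_add' := fun v w => Slots.ext fun k => map_add _ _ _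
      map_smul' := fun c v => Slots.ext fun k => map_smul _ _ _ })
    (fun n v hv => Slots.ext fun k => gradeProj_same _ (hv k))
    (fun m n e v hv => Slots.ext fun k => gradeProj_ne _ (hv k) (by omega)) fun v => ?_
  choose s hs using fun k => exists_sum_gradeProj Y.isInternal (v.1 k)
  let S : Finset ℤ := Finset.univ.biUnion fun k => (s k).image fun n => n - K.deg k
  let p : ℤ → K.Slots Y := fun n => ⟨fun k => Y.proj (n + K.deg k) (v.1 k), fun k => by
        have h := smul_proj Y (ι_E_mem (K.vertex k)) (n + K.deg k) (v.1 k)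
        rw [add_zero] at h
        exact h.trans (congrArg _ (v.rsmul_E k))⟩
  have : v = ∑ n ∈ S, p n := Slots.ext fun k => by
    have h1 : (∑ n ∈ S, p n).1 k = ∑ n ∈ S, Y.proj (n + K.deg k) (v.1 k) := by
      have := map_sum ((LinearMap.proj k : (Fin 3 → Y.carrier) →ₗ[ℂ] Y.carrier) ∘ₗ
        (K.space Y).subtype) p S
      exact this
    rw [h1]
    refine (hs k (S.image fun n => n + K.deg k) fun n hn => ?_).symm.trans
      (Finset.sum_image (fun a _ b _ h => by simpa using h))
    refine Finset.mem_image.2 ⟨n - K.deg k, Finset.mem_biUnion.2 ⟨k, Finset.mem_univ _,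
      Finset.mem_image.2 ⟨n, hn, rfl⟩⟩, by ring⟩
  rw [this]
  exact Submodule.sum_mem _ fun n _ => Submodule.mem_iSup_of_mem n fun k => proj_mem _ _ _

/-- The value of the functor. -/
@[reducible]
noncomputable def obj : DGModule dgAlgebra where
  carrier := K.Slots Y
  gr n :=
    { carrier := {v | ∀ k, v.1 k ∈ Y.gr (n + K.deg k)}
      zero_mem' := fun _ => Submodule.zero_mem _
      add_mem' := fun hv hw k => Submodule.add_mem _ (hv k) (hw k)
      smul_mem' := fun c _ hv k => Submodule.smul_mem _ c (hv k) }
  isInternal := K.isInternal_slots Y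
  smul_mem {i j a m} hm ha k := by
    refine (congrArg (· ∈ Y.gr (i + j + K.deg k)) (Slots.rsmul_apply m a k)).mpr
      (Submodule.sum_mem _ fun l _ => ?_)
    have := Y.smul_mem (hm l) (K.rep_mem a ha l k)
    rwa [show i + K.deg l + (j + K.deg k - K.deg l) = i + j + K.deg k by ring] at this
  d := K.dSlots Y
  d_mem {n m} hm k := by
    have h1 := Y.d_mem (hm k)
    rw [show n + K.deg k + 1 = n + 1 + K.deg k by ring] at h1
    refine Submodule.add_mem _ h1 (Submodule.sum_mem _ fun l _ => ?_)
    rw [par_apply (hm l)]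
    have := Y.smul_mem (units_smul_mem _ (n + K.deg l).negOnePow (hm l)) (K.diff_mem l k)
    rwa [show n + K.deg l + (1 + K.deg k - K.deg l) = n + 1 + K.deg k by ring] at this
  d_d v := Slots.ext fun k => by
    rw [dSlots_apply]
    simp only [dSlots_apply, map_add, Y.d_d, map_sum, d_rsmul, d_par, K.d_diff, rsmul_zero, smul_neg,
      zero_add, add_zero, smul_add, Finset.sum_add_distrib, Finset.sum_neg_distrib,
      par_rsmul (K.diff_mem _ _), par_par, Finset.smul_sum, neg_add_cancel_left]
    refine Finset.sum_eq_zero fun l _ => Finset.sum_eq_zero fun m _ => ?_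
    rw [smul_comm, rsmul_rsmul]
    by_cases h : l ∈ K.target
    · rw [K.diff_eq_zero l k (Or.inl h), mul_zero, rsmul_zero, smul_zero]
    · rw [K.diff_eq_zero m l (Or.inr h), zero_mul, rsmul_zero, smul_zero]
  leibniz {n v} x hv := by
    revert v n
    refine alg_induction (p := fun x => ∀ {n : ℤ} {v : K.Slots Y},
      (∀ k, v.1 k ∈ Y.gr (n + K.deg k)) → K.dSlots Y (v ◁ x) =
        K.dSlots Y v ◁ x + n.negOnePow • (v ◁ d x)) x ?_ ?_ ?_ ?_ ?_
    · intro n v _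
      have h1 : d (1 : Alg) = 0 := by rw [← add_E (show (0 : Fin 2) ≠ 1 by decide), map_add, d_E, d_E, add_zero]
      rw [h1, MulOpposite.op_one, MulOpposite.op_zero, one_smul, one_smul, zero_smul, smul_zero,
        add_zero]
    · intro g y ih n v hv
      have hg : K.dSlots Y (v ◁ ι g) = K.dSlots Y v ◁ ι g + n.negOnePow • (v ◁ dGen g) := by
        refine Slots.ext fun k => ?_
        simp only [dSlots_apply, Slots.add_apply, Slots.units_smul_apply, Slots.rsmul_apply,
          rep_ι, map_sum, d_rsmul, par_rsmul (K.act_mem _ _ _), smul_add, Finset.smul_sum,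
          Finset.sum_add_distrib]
        rw [add_assoc, add_assoc]
        congr 1
        have h1 : ∀ l, Y.par (v.1 l) ◁ d (K.act g l k) + ∑ m,
            (g.deg + K.deg m - K.deg l).negOnePow • (Y.par (v.1 l) ◁ (K.act g l m) ◁ K.diff m k) =
            ∑ m, Y.par (v.1 l) ◁ K.diff l m ◁ K.act g m k +
              n.negOnePow • (v.1 l ◁ K.rep (dGen g) l k) := fun l => by
          have := congrArg (fun x => Y.par (v.1 l) ◁ x) (K.leibniz g l k)
          simp only [rsmul_add, rsmul_sum, rsmul_units_smul, rsmul_mul] at this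
          rw [this, par_apply (hv l)]
          congr 1
          rw [units_smul_rsmul, smul_smul, ← Int.negOnePow_add,
            show K.deg l + (n + K.deg l) = n + 2 * K.deg l by ring, Int.negOnePow_add,
            Int.negOnePow_even (2 * _) (even_two_mul _), mul_one]
          rfl
        have h2 := Finset.sum_congr rfl fun l (_ : l ∈ Finset.univ) => h1 l
        simp only [Finset.sum_add_distrib] at h2
        refine Eq.trans ?_ (h2.trans ?_)
        · congr 1
          rw [Finset.sum_comm]
          refine Finset.sum_congr rfl fun l _ => Finset.sum_congr rfl fun m _ => ?_
          exact units_smul_rsmul _ _ _ _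
        · congr 1
          exact Finset.sum_comm
      have hv' : ∀ k, (v ◁ ι g).1 k ∈ Y.gr (n + g.deg + K.deg k) := fun k => by
        rw [Slots.rsmul_apply]
        refine Submodule.sum_mem _ fun l _ => ?_
        have := Y.smul_mem (hv l) (K.rep_mem _ (ι_mem g) l k)
        rwa [show n + K.deg l + (g.deg + K.deg k - K.deg l) = n + g.deg + K.deg k by ring] at this
      have h0 : ∀ (u : ℤˣ) (w : K.Slots Y) (z : Alg), (u • w) ◁ z = u • (w ◁ z) := fun u w z => by
        rcases Int.units_eq_one_or u with rfl | rfl <;> simp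
      have h0' : ∀ (u : ℤˣ) (w : K.Slots Y) (z : Alg), w ◁ (u • z) = u • (w ◁ z) := fun u w z => by
        rcases Int.units_eq_one_or u with rfl | rfl <;> simp
      have h1 : ∀ (w : K.Slots Y) (x z : Alg), w ◁ (x * z) = w ◁ x ◁ z := fun w x z => by
        rw [op_mul, mul_smul]
      rw [h1, ih hv', hg, d_mul_left, h1, smul_add, h0, MulOpposite.op_add, add_smul, h1, h0', h1,
        Int.negOnePow_add, mul_smul, smul_add]
      abel
    · intro n v _
      simp only [map_zero, MulOpposite.op_zero, zero_smul, smul_zero, add_zero]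
    · intro x y hx hy n v hv
      simp only [map_add, MulOpposite.op_add, add_smul, smul_add, hx hv, hy hv]
      abel
    · intro c x hx n v hv
      simp only [map_smul, MulOpposite.op_smul, smul_assoc, hx hv, smul_add,
        smul_comm c n.negOnePow]

lemma obj_d_apply (v : K.Slots Y) (k : Fin 3) :
    ((K.obj Y).d v).1 k = Y.d (v.1 k) + ∑ l, Y.par (v.1 l) ◁ K.diff l k := rfl

end MatrixKernel

end Ginzburg

namespace DGModule

variable {k : Type} [Field k] {A : DGAlgebra k}

open DGHomotopyCategory DGDerivedCategory

/-- Functors on dg modules which induce exact functors on the derived category. -/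
structure IsDerivable (T : DGModule A ⥤ DGModule A) [T.CommShift ℤ] : Prop where
  map_smul {M N : DGModule A} (c : k) (f : M ⟶ N) : T.map (c • f) = c • T.map f
  homotopic {M N : DGModule A} {f g : M ⟶ N} (h : Homotopic f g) : Homotopic (T.map f) (T.map g)
  cone {M N : DGModule A} (f : M ⟶ N) : ∃ e : T.obj (cone f) ≅ DGModule.cone (T.map f),
    T.map (coneInr f) ≫ e.hom = coneInr (T.map f) ∧
      e.hom ≫ coneFst (T.map f) = T.map (coneFst f) ≫ (T.commShiftIso (1 : ℤ)).hom.app M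
  map_acyclic {M : DGModule A} (h : M.Acyclic) : (T.obj M).Acyclic

namespace IsDerivable

variable {T T' : DGModule A ⥤ DGModule A} [T.CommShift ℤ] [T'.CommShift ℤ] (hT : IsDerivable T)
  (hT' : IsDerivable T')

include hT

lemma q_map ⦃M N : DGModule A⦄ (f g : M ⟶ N) (h : Homotopic f g) :
    (T ⋙ q A).map f = (T ⋙ q A).map g := DGHomotopyCategory.q_map_eq (hT.homotopic h)

/-- The functor on the homotopy category. -/
def hfunctor : DGHomotopyCategory A ⥤ DGHomotopyCategory A :=
  CategoryTheory.Quotient.lift _ (T ⋙ q A) hT.q_map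

/-- The functor on the homotopy category is induced by that on dg modules. -/
def hfac : q A ⋙ hT.hfunctor ≅ T ⋙ q A := CategoryTheory.Quotient.lift.isLift _ (T ⋙ q A) hT.q_map

noncomputable instance : hT.hfunctor.CommShift ℤ :=
  inferInstanceAs ((CategoryTheory.Quotient.lift _ (T ⋙ q A) hT.q_map).CommShift ℤ)

instance : NatTrans.CommShift hT.hfac.hom ℤ :=
  inferInstanceAs (NatTrans.CommShift (CategoryTheory.Quotient.lift.isLift _ (T ⋙ q A) hT.q_map).hom ℤ)

instance : hT.hfunctor.Linear k where
  map_smul := by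
    rintro M N f c
    obtain ⟨f, rfl⟩ := (q A).map_surjective (X := M.as) (Y := N.as) f
    exact congrArg (q A).map (hT.map_smul c f)

instance : hT.hfunctor.IsTriangulated where
  map_distinguished := by
    rintro t ⟨M, N, f, ⟨i⟩⟩
    obtain ⟨e, h1, h2⟩ := hT.cone f
    refine ⟨T.obj M, T.obj N, T.map f, ⟨hT.hfunctor.mapTriangle.mapIso i ≪≫
      (Functor.mapTriangleCompIso (q A) hT.hfunctor).symm.app (coneTriangle f) ≪≫
      (Functor.mapTriangleIso hT.hfac).app (coneTriangle f) ≪≫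
      (Functor.mapTriangleCompIso T (q A)).app (coneTriangle f) ≪≫
      (q A).mapTriangle.mapIso (Triangle.isoMk (T.mapTriangle.obj (coneTriangle f))
        (coneTriangle (T.map f)) (Iso.refl _) (Iso.refl _) e ?_ ?_ ?_)⟩⟩
    · change T.map f ≫ 𝟙 _ = 𝟙 _ ≫ T.map f
      rw [Category.comp_id, Category.id_comp]
    · change T.map (coneInr f) ≫ e.hom = 𝟙 _ ≫ coneInr (T.map f)
      rw [h1, Category.id_comp]
    · change (T.map (coneFst f) ≫ (T.commShiftIso (1 : ℤ)).hom.app M) ≫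
        (shiftFunctor (DGModule A) (1 : ℤ)).map (𝟙 (T.obj M)) = e.hom ≫ coneFst (T.map f)
      exact (congrArg _ (CategoryTheory.Functor.map_id _ _)).trans ((Category.comp_id _).trans h2.symm)

lemma isQis_map {M N : DGModule A} {f : M ⟶ N} (h : IsQis f) : IsQis (T.map f) := by
  obtain ⟨e, -, -⟩ := hT.cone f
  refine isQis_of_acyclic_cone fun m hm => ?_
  obtain ⟨x, hx⟩ := hT.map_acyclic h.acyclic_cone (e.inv.lin m) (by rw [← e.inv.comm, hm, map_zero])
  refine ⟨e.hom.lin x, ?_⟩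
  rw [← e.hom.comm, ← hx]
  exact (LinearMap.congr_fun (congrArg Hom.lin e.inv_hom_id) m).symm

lemma isInvertedBy : (acyclic A).trW.IsInvertedBy (hT.hfunctor ⋙ Qh A) := by
  rintro M N f hf
  obtain ⟨f, rfl⟩ := (q A).map_surjective (X := M.as) (Y := N.as) f
  exact isIso_Q_of_isQis (hT.isQis_map (isQis_of_trW hf))

/-- The functor on the derived category. -/
noncomputable def functor : DGDerivedCategory A ⥤ DGDerivedCategory A :=
  Localization.lift (hT.hfunctor ⋙ Qh A) hT.isInvertedBy (Qh A)

noncomputable instance : Localization.Lifting (Qh A) (acyclic A).trW (hT.hfunctor ⋙ Qh A)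
    hT.functor :=
  inferInstanceAs (Localization.Lifting (Qh A) (acyclic A).trW (hT.hfunctor ⋙ Qh A)
    (Localization.lift (hT.hfunctor ⋙ Qh A) hT.isInvertedBy (Qh A)))

/-- The functor on the derived category is induced by that on the homotopy category. -/
noncomputable def functorFac : Qh A ⋙ hT.functor ≅ hT.hfunctor ⋙ Qh A :=
  Localization.Lifting.iso (Qh A) (acyclic A).trW (hT.hfunctor ⋙ Qh A) hT.functor

noncomputable instance : hT.functor.CommShift ℤ :=
  Functor.commShiftOfLocalization (Qh A) (acyclic A).trW ℤ (hT.hfunctor ⋙ Qh A) hT.functor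

instance : NatTrans.CommShift hT.functorFac.hom ℤ :=
  inferInstanceAs (NatTrans.CommShift (Localization.Lifting.iso (Qh A) (acyclic A).trW
    (hT.hfunctor ⋙ Qh A) hT.functor).hom ℤ)

instance : hT.functor.IsTriangulated :=
  Functor.isTriangulated_of_precomp_iso hT.functorFac

instance : hT.functor.Linear k :=
  (Localization.functor_linear_iff (Qh A) (acyclic A).trW k (hT.hfunctor ⋙ Qh A) hT.functor).1
    inferInstance

end IsDerivable

end DGModule

namespace DGDerivedCategory

variable {k : Type} [Field k] {A : DGAlgebra k}

open DGHomotopyCategory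

section

variable {F G : DGModule A ⥤ DGModule A} {F' G' : DGDerivedCategory A ⥤ DGDerivedCategory A}
  (e : Q A ⋙ F' ≅ F ⋙ Q A) (e' : Q A ⋙ G' ≅ G ⋙ Q A) (τ : F ⟶ G)

lemma exists_natTrans : ∃ σ : F' ⟶ G', ∀ M, σ.app ((Q A).obj M) =
    e.hom.app M ≫ (Q A).map (τ.app M) ≫ e'.inv.app M := by
  let σ₀ : Q A ⋙ F' ⟶ Q A ⋙ G' := e.hom ≫ Functor.whiskerRight τ (Q A) ≫ e'.inv
  let σ₁ : Qh A ⋙ F' ⟶ Qh A ⋙ G' :=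
    CategoryTheory.Quotient.natTransLift (F := Qh A ⋙ F') (G := Qh A ⋙ G') _ σ₀
  refine ⟨((Functor.FullyFaithful.ofFullyFaithful
    (Localization.whiskeringLeftFunctor' (Qh A) (acyclic A).trW
      (DGDerivedCategory A))).preimage σ₁ :), fun M => ?_⟩
  exact congr_app (((Functor.FullyFaithful.ofFullyFaithful
    (Localization.whiskeringLeftFunctor' (Qh A) (acyclic A).trW
      (DGDerivedCategory A)))).map_preimage σ₁) ((q A).obj M)

include e e' in
lemma nonempty_natIso (h : ∀ M, DGModule.IsQis (τ.app M)) : Nonempty (F' ≅ G') := by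
  obtain ⟨σ, hσ⟩ := exists_natTrans e e' τ
  have : ∀ X, IsIso (σ.app X) := fun X => by
    obtain ⟨M, ⟨i⟩⟩ := exists_iso_Q X
    have h1 : IsIso (σ.app ((Q A).obj M)) := by
      have := isIso_Q_of_isQis (h M)
      rw [hσ]
      infer_instance
    rw [← NatTrans.naturality_2 σ i]
    infer_instance
  have := NatIso.isIso_of_isIso_app σ
  exact ⟨asIso σ⟩

end

end DGDerivedCategory

namespace DGModule.IsDerivable

variable {k : Type} [Field k] {A : DGAlgebra k} {T T' : DGModule A ⥤ DGModule A} [T.CommShift ℤ]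
  [T'.CommShift ℤ] (hT : IsDerivable T) (hT' : IsDerivable T')

open DGDerivedCategory DGHomotopyCategory

/-- The functor on the derived category is induced by that on dg modules. -/
noncomputable def fac : Q A ⋙ hT.functor ≅ T ⋙ Q A :=
  Functor.isoWhiskerLeft (q A) hT.functorFac ≪≫ Functor.isoWhiskerRight hT.hfac (Qh A)

/-- The composition of the functors on the derived category is induced by that on dg modules. -/
noncomputable def compFac : Q A ⋙ hT.functor ⋙ hT'.functor ≅ (T ⋙ T') ⋙ Q A :=
  Functor.isoWhiskerRight hT.fac hT'.functor ≪≫ Functor.isoWhiskerLeft T hT'.fac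

/-- Quasi-inverse functors on dg modules give an equivalence of derived categories. -/
lemma exists_equivalence (τ : T ⋙ T' ⟶ 𝟭 _) (τ' : 𝟭 _ ⟶ T' ⋙ T) (h : ∀ M, IsQis (τ.app M))
    (h' : ∀ M, IsQis (τ'.app M)) :
    Nonempty (hT.functor ⋙ hT'.functor ≅ 𝟭 _) ∧ Nonempty (𝟭 _ ≅ hT'.functor ⋙ hT.functor) :=
  ⟨nonempty_natIso (hT.compFac hT') (Functor.rightUnitor _ ≪≫ (Functor.leftUnitor _).symm) τ h,
    nonempty_natIso (Functor.rightUnitor _ ≪≫ (Functor.leftUnitor _).symm) (hT'.compFac hT) τ' h'⟩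

section

variable (h : ∀ M : DGModule A, Module.Finite k M.cohomology → Module.Finite k (T.obj M).cohomology)
  (h' : ∀ M : DGModule A, Module.Finite k M.cohomology → Module.Finite k (T'.obj M).cohomology)

include h

lemma finiteDimensional_functor (X : (finiteDimensional A).FullSubcategory) :
    finiteDimensional A (hT.functor.obj X.obj) := by
  obtain ⟨M, ⟨i⟩⟩ := exists_iso_Q X.obj
  refine (finiteDimensional A).prop_of_iso (hT.functor.mapIso i ≪≫ hT.fac.app M).symm
    ((finiteDimensional_Q_iff _).2 (h M ((finiteDimensional_Q_iff _).1
      ((finiteDimensional A).prop_of_iso i X.property))))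

/-- The restriction to the objects with finite dimensional cohomology. -/
noncomputable abbrev finiteFunctor :
    (finiteDimensional A).FullSubcategory ⥤ (finiteDimensional A).FullSubcategory :=
  (finiteDimensional A).lift ((finiteDimensional A).ι ⋙ hT.functor)
    (hT.finiteDimensional_functor h)

lemma isExact_finiteFunctor : IsExact (hT.finiteFunctor h) :=
  ⟨inferInstance, inferInstance⟩

instance : (hT.finiteFunctor h).Linear k where
  map_smul f c := InducedCategory.hom_ext (hT.functor.map_smul c f.hom)

/-- Quasi-inverse functors on dg modules give an equivalence of the categories of objects with
finite dimensional cohomology. -/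
noncomputable def finiteEquivalence (τ : T ⋙ T' ⟶ 𝟭 _) (τ' : 𝟭 _ ⟶ T' ⋙ T)
    (hτ : ∀ M, IsQis (τ.app M)) (hτ' : ∀ M, IsQis (τ'.app M)) :
    (finiteDimensional A).FullSubcategory ≌ (finiteDimensional A).FullSubcategory :=
  let e := (hT.exists_equivalence hT' τ τ' hτ hτ').1.some
  let e' := (hT.exists_equivalence hT' τ τ' hτ hτ').2.some
  CategoryTheory.Equivalence.mk (hT.finiteFunctor h) (hT'.finiteFunctor h')
    (NatIso.ofComponents (fun X => (finiteDimensional A).isoMk (e.symm.app X.obj))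
      fun f => InducedCategory.hom_ext (e.inv.naturality f.hom))
    (NatIso.ofComponents (fun X => (finiteDimensional A).isoMk (e'.symm.app X.obj))
      fun f => InducedCategory.hom_ext (e'.inv.naturality f.hom))

end

end DGModule.IsDerivable

namespace Ginzburg

open DGModule

namespace MatrixKernel

variable (K : MatrixKernel) {Y Z W : DGModule dgAlgebra}

section

variable (f : Y.carrier →ₗ[Algᵐᵒᵖ] Z.carrier)

/-- The effect of the functor on linear maps. -/
noncomputable def mapLin : K.Slots Y →ₗ[Algᵐᵒᵖ] K.Slots Z where
  toFun v := ⟨fun k => f (v.1 k), fun k => by rw [← map_smul, v.rsmul_E]⟩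
  map_add' v w := Slots.ext fun k => map_add f _ _
  map_smul' x v := Slots.ext fun k => by
    obtain ⟨x, rfl⟩ := op_surjective x
    change f (∑ l, v.1 l ◁ K.rep x l k) = ∑ l, f (v.1 l) ◁ K.rep x l k
    exact (map_sum f _ _).trans (Finset.sum_congr rfl fun l _ => map_smul f _ _)

lemma mapLin_apply (v : K.Slots Y) (k : Fin 3) : (K.mapLin f v).1 k = f (v.1 k) := rfl

end

/-- The functor defined by a matrix kernel. -/
@[reducible]
noncomputable def functor : DGModule dgAlgebra ⥤ DGModule dgAlgebra where
  obj Y := K.obj Y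
  map {Y Z} f :=
    { lin := K.mapLin f.lin
      map_mem := fun h k => f.map_mem (h k)
      comm := fun v => Slots.ext fun k => by
        rw [mapLin_apply]
        change f.lin ((K.dSlots Y v).1 k) = (K.dSlots Z _).1 k
        rw [dSlots_apply, dSlots_apply, map_add, f.comm, map_sum]
        congr 1
        exact Finset.sum_congr rfl fun l _ => (map_smul f.lin _ _).trans (by rw [lin_par]; rfl) }

lemma functor_map_lin (f : Y ⟶ Z) (v : K.Slots Y) (k : Fin 3) :
    ((K.functor.map f).lin v).1 k = f.lin (v.1 k) := rfl

/-- The functor commutes with the shift. -/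
noncomputable def shiftIso (n : ℤ) (Y : DGModule dgAlgebra) :
    K.obj (Y.shift n) ≅ (K.obj Y).shift n where
  hom :=
    { lin :=
        { toFun := fun v => ⟨v.1, v.2⟩
          map_add' := fun _ _ => rfl
          map_smul' := fun _ _ => rfl }
      map_mem := fun {m v} h k => by
        have := h k
        change v.1 k ∈ Y.gr (m + n + K.deg k)
        rwa [show m + n + K.deg k = m + K.deg k + n by ring]
      comm := fun v => Slots.ext fun k => by
        refine Eq.trans ?_ (Slots.units_smul_apply _ _ _).symm
        rw [obj_d_apply, smul_add, Finset.smul_sum]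
        refine congrArg (n.negOnePow • Y.d (v.1 k) + ·) (Finset.sum_congr rfl fun l _ => ?_)
        rw [← units_smul_rsmul, ← par_shift]; rfl }
  inv :=
    { lin :=
        { toFun := fun v => ⟨v.1, v.2⟩
          map_add' := fun _ _ => rfl
          map_smul' := fun _ _ => rfl }
      map_mem := fun {m v} h k => by
        have : v.1 k ∈ Y.gr (m + n + K.deg k) := h k
        change v.1 k ∈ Y.gr (m + K.deg k + n)
        rwa [show m + K.deg k + n = m + n + K.deg k by ring]
      comm := fun v => Slots.ext fun k => by
        refine (Slots.units_smul_apply _ _ _).trans ?_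
        rw [obj_d_apply, smul_add, Finset.smul_sum]
        refine congrArg (n.negOnePow • Y.d (v.1 k) + ·) (Finset.sum_congr rfl fun l _ => ?_)
        rw [← units_smul_rsmul, ← par_shift]; rfl }
  hom_inv_id := rfl
  inv_hom_id := rfl

noncomputable instance : K.functor.CommShift ℤ where
  commShiftIso n := NatIso.ofComponents (K.shiftIso n) fun f => rfl
  commShiftIso_zero := by
    ext Y
    rw [Functor.CommShift.isoZero_hom_app]
    rfl
  commShiftIso_add a b := by
    ext Y
    rw [Functor.CommShift.isoAdd_hom_app]
    rfl

/-- The functor commutes with cones. -/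
noncomputable def coneIso (f : Y ⟶ Z) : K.obj (cone f) ≅ cone (K.functor.map f) where
  hom :=
    { lin :=
        { toFun := fun v => ((⟨fun k => (v.1 k).1, fun k => congrArg Prod.fst (v.2 k)⟩ : K.Slots Y),
            (⟨fun k => (v.1 k).2, fun k => congrArg Prod.snd (v.2 k)⟩ : K.Slots Z))
          map_add' := fun _ _ => rfl
          map_smul' := fun x v => by
            obtain ⟨x, rfl⟩ := op_surjective x
            refine Prod.ext (Slots.ext fun k => ?_) (Slots.ext fun k => ?_)
            · exact Prod.fst_sum
            · exact Prod.snd_sum }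
      map_mem := fun {m v} h => ⟨fun k => by
          have := (h k).1
          change (v.1 k).1 ∈ Y.gr (m + 1 + K.deg k)
          rwa [add_right_comm], fun k => (h k).2⟩
      comm := fun v => by
        refine Prod.ext (Slots.ext fun k => ?_) (Slots.ext fun k => ?_)
        · change (((K.obj (cone f)).d v).1 k).1 = -((K.obj Y).d _).1 k
          rw [obj_d_apply, obj_d_apply, neg_add, Prod.fst_add, Prod.fst_sum,
            ← Finset.sum_neg_distrib]
          refine congrArg (-Y.d (v.1 k).1 + ·) (Finset.sum_congr rfl fun l _ => ?_)
          rw [par_cone]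
          exact smul_neg _ _
        · change (((K.obj (cone f)).d v).1 k).2 = f.lin (v.1 k).1 + ((K.obj Z).d _).1 k
          rw [obj_d_apply, obj_d_apply, Prod.snd_add, Prod.snd_sum, ← add_assoc]
          refine congrArg (f.lin (v.1 k).1 + Z.d (v.1 k).2 + ·)
            (Finset.sum_congr rfl fun l _ => ?_)
          rw [par_cone]
          rfl }
  inv :=
    { lin :=
        { toFun := fun v => ⟨fun k => (v.1.1 k, v.2.1 k), fun k => Prod.ext (v.1.2 k) (v.2.2 k)⟩
          map_add' := fun _ _ => rfl
          map_smul' := fun x v => by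
            obtain ⟨x, rfl⟩ := op_surjective x
            refine Slots.ext fun k => Prod.ext ?_ ?_
            · exact (Prod.fst_sum (s := Finset.univ) (f := fun l =>
                ((v.1.1 l, v.2.1 l) : Y.carrier × Z.carrier) ◁ K.rep x l k)).symm
            · exact (Prod.snd_sum (s := Finset.univ) (f := fun l =>
                ((v.1.1 l, v.2.1 l) : Y.carrier × Z.carrier) ◁ K.rep x l k)).symm }
      map_mem := fun {m v} h k => ⟨by
          have : v.1.1 k ∈ Y.gr (m + 1 + K.deg k) := h.1 k
          change v.1.1 k ∈ Y.gr (m + K.deg k + 1)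
          rwa [add_right_comm], h.2 k⟩
      comm := fun v => by
        refine Slots.ext fun k => Prod.ext ?_ ?_
        · refine Eq.trans (b := -((K.obj Y).d v.1).1 k) rfl ?_
          rw [obj_d_apply, obj_d_apply, neg_add, Prod.fst_add, Prod.fst_sum,
            ← Finset.sum_neg_distrib]
          refine congrArg (-Y.d (v.1.1 k) + ·) (Finset.sum_congr rfl fun l _ => ?_)
          rw [par_cone]
          exact (smul_neg _ _).symm
        · refine Eq.trans (b := f.lin (v.1.1 k) + ((K.obj Z).d v.2).1 k) rfl ?_
          rw [obj_d_apply, obj_d_apply, Prod.snd_add, Prod.snd_sum, ← add_assoc]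
          refine congrArg (f.lin (v.1.1 k) + Z.d (v.2.1 k) + ·)
            (Finset.sum_congr rfl fun l _ => ?_)
          rw [par_cone]
          rfl }
  hom_inv_id := rfl
  inv_hom_id := rfl

/-- An element with at most the given components. -/
noncomputable def Slots.mk (v : Fin 3 → Y.carrier) : K.Slots Y :=
  ⟨fun k => v k ◁ ι (E (K.vertex k)), fun k => by rw [rsmul_rsmul, E_E]⟩

variable {K}

lemma d_rsmul_E (m : Y.carrier) (i : Fin 2) : Y.d (m ◁ ι (E i)) = Y.d m ◁ ι (E i) := by
  rw [d_rsmul, d_E, rsmul_zero, add_zero]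

lemma obj_d_apply_of_notMem (v : K.Slots Y) {k : Fin 3} (hk : k ∉ K.target) :
    ((K.obj Y).d v).1 k = Y.d (v.1 k) := by
  rw [obj_d_apply, Finset.sum_eq_zero fun l _ => by
    rw [K.diff_eq_zero l k (Or.inr hk), rsmul_zero], add_zero]

lemma obj_d_apply_of_eq_zero (v : K.Slots Y) (hv : ∀ l ∉ K.target, v.1 l = 0) (k : Fin 3) :
    ((K.obj Y).d v).1 k = Y.d (v.1 k) := by
  rw [obj_d_apply, Finset.sum_eq_zero fun l _ => by
    by_cases hl : l ∈ K.target
    · rw [K.diff_eq_zero l k (Or.inl hl), rsmul_zero]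
    · rw [hv l hl, map_zero, smul_zero], add_zero]

/-- Solving `d x = v` away from the target slots, and then in the target slots. -/
lemma exists_sub_d {v : K.Slots Y} (hv : (K.obj Y).d v = 0) {P : Fin 3 → Y.carrier → Prop}
    (hP : ∀ k, ∀ m, Y.d m = 0 → m ◁ ι (E (K.vertex k)) = m → ∃ x, P k (m - Y.d (x ◁ ι (E (K.vertex k))))) :
    ∃ x, ∀ l ∉ K.target, P l ((v - (K.obj Y).d x).1 l) := by
  classical
  have h1 : ∀ l, ∃ x, l ∉ K.target → P l (v.1 l - Y.d (x ◁ ι (E (K.vertex l)))) := fun l => by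
    by_cases hl : l ∈ K.target
    · exact ⟨0, fun h => absurd hl h⟩
    · obtain ⟨x, hx⟩ := hP l (v.1 l) (by
        rw [← obj_d_apply_of_notMem v hl, hv]; rfl) (v.2 l)
      exact ⟨x, fun _ => hx⟩
  choose x hx using h1
  refine ⟨Slots.mk K x, fun l hl => ?_⟩
  rw [Slots.sub_apply, obj_d_apply_of_notMem _ hl]
  exact hx l hl

variable (K) in
lemma obj_acyclic (hY : Y.Acyclic) : (K.obj Y).Acyclic := fun v hv => by
  classical
  obtain ⟨x, hx⟩ := exists_sub_d (P := fun _ m => m = 0) hv fun k m hm hm' => by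
    obtain ⟨x, rfl⟩ := hY m hm
    exact ⟨x, by rw [d_rsmul_E, hm', sub_self]⟩
  set w := v - (K.obj Y).d x with hw
  have hdw : (K.obj Y).d w = 0 := by rw [hw, map_sub, hv, (K.obj Y).d_d, sub_self]
  have h1 : ∀ k, Y.d (w.1 k) = 0 := fun k => by
    rw [← obj_d_apply_of_eq_zero w hx, hdw]; rfl
  choose y hy using fun k => hY (w.1 k) (h1 k)
  let z : K.Slots Y := Slots.mk K fun k => if k ∈ K.target then y k else 0
  have hz : ∀ l ∉ K.target, z.1 l = 0 := fun l hl => by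
    change (if l ∈ K.target then y l else 0) ◁ _ = _
    rw [if_neg hl, smul_zero]
  refine ⟨z + x, ?_⟩
  rw [map_add, ← sub_eq_iff_eq_add]
  refine Slots.ext fun k => ?_
  rw [obj_d_apply_of_eq_zero z hz]
  change w.1 k = Y.d ((if k ∈ K.target then y k else 0) ◁ _)
  split_ifs with hk
  · rw [d_rsmul_E, ← hy, w.rsmul_E]
  · rw [smul_zero, map_zero, hx k hk]

variable (K) in
lemma isDerivable : IsDerivable K.functor where
  map_smul c f := hom_ext fun v => rfl
  homotopic {M N f g} := by
    rintro ⟨h, hd, e⟩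
    have hp : ∀ m, N.par (h m) = -h (M.par m) :=
      linearMap_ext (f := N.par ∘ₗ h.restrictScalars ℂ) (g := -(h.restrictScalars ℂ ∘ₗ M.par))
        fun n m hm => by
          change N.par (h m) = -h (M.par m)
          have hm' : h m ∈ N.gr (n - 1) := hd _ _ (by rwa [sub_add_cancel])
          rw [par_apply hm, par_apply hm', Int.negOnePow_sub, Int.negOnePow_one]
          rcases Int.units_eq_one_or n.negOnePow with e | e <;> simp [e]
    refine ⟨K.mapLin h, fun n v hv k => ?_, fun v => Slots.ext fun k => ?_⟩
    · exact hd _ _ (by rw [add_right_comm]; exact hv k)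
    · refine (e (v.1 k)).trans ?_
      change _ = g.lin (v.1 k) + (N.d (h (v.1 k)) + ∑ l, N.par (h (v.1 l)) ◁ K.diff l k) +
        h (M.d (v.1 k) + ∑ l, M.par (v.1 l) ◁ K.diff l k)
      rw [map_add, map_sum, add_assoc, add_assoc, add_assoc]
      congr 2
      rw [add_left_comm, ← Finset.sum_add_distrib, Finset.sum_eq_zero, add_zero]
      intro l _
      rw [hp, smul_neg]
      exact (congrArg _ (map_smul h _ _)).trans (neg_add_cancel _)
  cone f := ⟨K.coneIso f, rfl, rfl⟩
  map_acyclic := K.obj_acyclic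

end MatrixKernel

end Ginzburg

namespace DGModule

variable {k : Type} [Field k] {A : DGAlgebra k} {M : DGModule A}

lemma finite_cohomology_iff : Module.Finite k M.cohomology ↔
    ∃ W : Submodule k M.carrier, W.FG ∧ LinearMap.ker M.d ≤ W ⊔ LinearMap.range M.d := by
  constructor
  · intro h
    obtain ⟨n, s, hs⟩ := Module.Finite.exists_fin (R := k) (M := M.cohomology)
    choose m hm using fun i => Submodule.mkQ_surjective _ (s i)
    refine ⟨Submodule.span k (Set.range fun i => (m i).1),
      Submodule.fg_span (Set.finite_range _), fun z hz => ?_⟩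
    obtain ⟨c, hc⟩ := (Submodule.mem_span_range_iff_exists_fun k).1
      (hs.ge (Submodule.mem_top (x := Submodule.mkQ _ (⟨z, hz⟩ : LinearMap.ker M.d))))
    have h0 : Submodule.mkQ ((LinearMap.range M.d).comap (LinearMap.ker M.d).subtype)
        (⟨z, hz⟩ - ∑ i, c i • m i) = 0 := by
      rw [map_sub, map_sum, ← hc, sub_eq_zero]
      exact Finset.sum_congr rfl fun i _ => by rw [map_smul, hm]
    have h1 : z - ∑ i, c i • (m i).1 ∈ LinearMap.range M.d := by
      have := (Submodule.Quotient.mk_eq_zero _).1 h0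
      rw [Submodule.mem_comap] at this
      simpa using this
    have h2 := Submodule.add_mem_sup (Submodule.sum_mem (Submodule.span k
      (Set.range fun i => (m i).1)) fun i (_ : i ∈ Finset.univ) =>
        Submodule.smul_mem _ (c i) (Submodule.subset_span ⟨i, rfl⟩)) h1
    rwa [add_sub_cancel] at h2
  · rintro ⟨W, hW, h⟩
    have : Module.Finite k W := Module.Finite.iff_fg.2 hW
    have : Module.Finite k (W ⊓ LinearMap.ker M.d : Submodule k M.carrier) :=
      Submodule.finiteDimensional_inf_left _ _
    refine Module.Finite.of_surjective ((Submodule.mkQ _).comp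
      (Submodule.inclusion (inf_le_right : W ⊓ LinearMap.ker M.d ≤ LinearMap.ker M.d)) :
        _ →ₗ[k] M.cohomology) fun x => ?_
    obtain ⟨⟨z, hz⟩, rfl⟩ := Submodule.mkQ_surjective _ x
    obtain ⟨w, hw, _, ⟨y, rfl⟩, rfl⟩ := Submodule.mem_sup.1 (h hz)
    have hw' : w ∈ LinearMap.ker M.d := by
      rw [LinearMap.mem_ker] at hz ⊢
      rwa [map_add, M.d_d, add_zero] at hz
    refine ⟨⟨w, hw, hw'⟩, (Submodule.Quotient.eq _).2 ⟨-y, ?_⟩⟩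
    change M.d (-y) = w - (w + M.d y)
    rw [map_neg]; abel

end DGModule

namespace Ginzburg

open DGModule

namespace MatrixKernel

variable {K : MatrixKernel} {Y : DGModule dgAlgebra}

/-- Multiplication by an idempotent. -/
noncomputable def mulE (Y : DGModule dgAlgebra) (i : Fin 2) : Y.carrier →ₗ[ℂ] Y.carrier where
  toFun m := m ◁ ι (E i)
  map_add' := smul_add _
  map_smul' c m := smul_comm _ c m

variable (K) in
lemma finite_obj (h : Module.Finite ℂ Y.cohomology) : Module.Finite ℂ (K.obj Y).cohomology := by
  classical
  rw [finite_cohomology_iff] at h ⊢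
  obtain ⟨W, hW, h⟩ := h
  let W' : Fin 3 → Submodule ℂ Y.carrier := fun l => W.map (mulE Y (K.vertex l))
  have hW' : ∀ l, Module.Finite ℂ (W' l) := fun l => Module.Finite.iff_fg.2 (hW.map _)
  have h1 : ∀ l m, Y.d m = 0 → m ◁ ι (E (K.vertex l)) = m →
      ∃ x, m - Y.d (x ◁ ι (E (K.vertex l))) ∈ W' l := fun l m hm hm' => by
    obtain ⟨w, hw, _, ⟨y, rfl⟩, e⟩ := Submodule.mem_sup.1 (h hm)
    refine ⟨y, w, hw, ?_⟩
    rw [← hm', ← e, d_rsmul_E, smul_add, add_sub_cancel_right]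
    rfl
  let B : Submodule ℂ (K.obj Y).carrier :=
    { carrier := {v | ∀ l, v.1 l ∈ W' l}
      zero_mem' := fun l => Submodule.zero_mem _
      add_mem' := fun hv hw l => Submodule.add_mem _ (hv l) (hw l)
      smul_mem' := fun c v hv l => Submodule.smul_mem _ c (hv l) }
  have hB : B.FG := by
    refine Module.Finite.iff_fg.1 (Module.Finite.of_injective
      ({ toFun := fun v l => ⟨v.1.1 l, v.2 l⟩
         map_add' := fun _ _ => rfl
         map_smul' := fun _ _ => rfl } : B →ₗ[ℂ] ∀ l, W' l) fun v w e => ?_)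
    exact Subtype.ext (Slots.ext fun l => congrArg Subtype.val (congrFun e l))
  let U : Submodule ℂ (K.obj Y).carrier :=
    { carrier := {v | (K.obj Y).d v = 0 ∧ ∀ l ∉ K.target, v.1 l ∈ W' l}
      zero_mem' := ⟨map_zero _, fun l _ => Submodule.zero_mem _⟩
      add_mem' := fun hv hw => ⟨by rw [map_add, hv.1, hw.1, add_zero],
        fun l hl => Submodule.add_mem _ (hv.2 l hl) (hw.2 l hl)⟩
      smul_mem' := fun c v hv => ⟨by rw [map_smul, hv.1, smul_zero],
        fun l hl => Submodule.smul_mem _ c (hv.2 l hl)⟩ }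
  let f : U →ₗ[ℂ] ∀ l, W' l :=
    { toFun := fun v l => if hl : l ∉ K.target then ⟨v.1.1 l, v.2.2 l hl⟩ else 0
      map_add' := fun v w => by
        funext l
        by_cases hl : l ∈ K.target
        · simp [hl]
        · simp only [hl, not_false_eq_true, dite_true, Pi.add_apply]; rfl
      map_smul' := fun c v => by
        funext l
        by_cases hl : l ∈ K.target
        · simp [hl]
        · simp only [hl, not_false_eq_true, dite_true, Pi.smul_apply]; rfl }
  obtain ⟨s, hs⟩ := f.rangeRestrict.exists_rightInverse_of_surjective f.range_rangeRestrict
  refine ⟨B ⊔ LinearMap.range (U.subtype ∘ₗ s), hB.sup (Module.Finite.iff_fg.1 inferInstance), ?_⟩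
  intro v hv
  obtain ⟨x, hx⟩ := exists_sub_d (P := fun l m => m ∈ W' l) hv h1
  set u : U := ⟨v - (K.obj Y).d x, by
    rw [map_sub, show (K.obj Y).d v = 0 from hv, (K.obj Y).d_d, sub_self], hx⟩ with hu
  set r := u - s (f.rangeRestrict u) with hr
  have hfr : f r = 0 := by
    rw [hr, map_sub, sub_eq_zero]
    exact congrArg Subtype.val (LinearMap.congr_fun hs (f.rangeRestrict u)).symm
  have hr0 : ∀ l ∉ K.target, r.1.1 l = 0 := fun l hl => by
    have := congrArg Subtype.val (congrFun hfr l)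
    simpa [f, hl] using this
  have hdr : ∀ l, Y.d (r.1.1 l) = 0 := fun l => by
    rw [← obj_d_apply_of_eq_zero r.1 hr0, r.2.1]; rfl
  choose y hy using fun l => h1 l (r.1.1 l) (hdr l) (r.1.2 l)
  let z : K.Slots Y := Slots.mk K fun l => if l ∈ K.target then y l else 0
  have hz : ∀ l ∉ K.target, z.1 l = 0 := fun l hl => by
    change (if l ∈ K.target then y l else 0) ◁ _ = _
    rw [if_neg hl, smul_zero]
  have h2 : r.1 - (K.obj Y).d z ∈ B := fun l => by
    rw [Slots.sub_apply, obj_d_apply_of_eq_zero z hz]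
    change r.1.1 l - Y.d ((if l ∈ K.target then y l else 0) ◁ _) ∈ _
    split_ifs with hl
    · exact hy l
    · rw [smul_zero, map_zero, hr0 l hl, sub_zero]; exact Submodule.zero_mem _
  have h3 : v = (r.1 - (K.obj Y).d z + (U.subtype ∘ₗ s) (f.rangeRestrict u)) +
      (K.obj Y).d (z + x) := by
    have : r.1 = v - (K.obj Y).d x - (s (f.rangeRestrict u)).1 := rfl
    rw [this, map_add, LinearMap.comp_apply, Submodule.subtype_apply]
    abel
  rw [h3]
  exact Submodule.add_mem_sup (Submodule.add_mem_sup h2 ⟨_, rfl⟩) ⟨_, rfl⟩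

end MatrixKernel

end Ginzburg

namespace Ginzburg

open DGModule

section kernels

variable {i j : Fin 2} (h : i ≠ j)

lemma d_one : d (1 : Alg) = 0 := by
  rw [← add_E (show (0 : Fin 2) ≠ 1 by decide), map_add, d_E, d_E, add_zero]

lemma negOnePow_deg_α : (α i).deg.negOnePow = sgn i := rfl

lemma forall_fin_three {p : Fin 3 → Fin 3 → Prop} (h00 : p 0 0) (h01 : p 0 1) (h02 : p 0 2)
    (h10 : p 1 0) (h11 : p 1 1) (h12 : p 1 2) (h20 : p 2 0) (h21 : p 2 1) (h22 : p 2 2) :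
    ∀ l k, p l k := by
  intro l k
  fin_cases l <;> fin_cases k <;> assumption

/-- A function on the vertices, from its values. -/
def atVertex {B : Type*} (i : Fin 2) (x y : B) (k : Fin 2) : B := if k = i then x else y

@[simp] lemma atVertex_same {B : Type*} (i : Fin 2) (x y : B) : atVertex i x y i = x := if_pos rfl

include h in
lemma atVertex_ne {B : Type*} (x y : B) : atVertex i x y j = y := if_neg h.symm

lemma vec_zero_three : (![0, 0, 0] : Fin 3 → Alg) = 0 := by
  ext k; fin_cases k <;> rfl

lemma of_zero_three : (Matrix.of ![0, 0, 0] : Matrix (Fin 3) (Fin 3) Alg) = 0 := by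
  ext l k; fin_cases l <;> rfl

/-- The matrices of the twist functor. -/
noncomputable def twistAct (i j : Fin 2) : Gen → Matrix (Fin 3) (Fin 3) Alg :=
  assign (atVertex i !![0, 0, 0; 0, 1, 0; 0, 0, 1] !![1, 0, 0; 0, 0, 0; 0, 0, 0])
    (atVertex i !![0, 0, 0; 1, 0, 0; 0, 0, 0]
      !![0, ι (α j) * ι (α i), ι (α j) * ι (τ i); 0, 0, 0; 0, 0, 0])
    (atVertex i !![0, 0, 0; 0, 0, 0; 0, ι (α i), ι (τ i)] !![ι (τ j), 0, 0; 0, 0, 0; 0, 0, 0])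

section

lemma twistAct_E (i j : Fin 2) : twistAct i j (E i) = !![0, 0, 0; 0, 1, 0; 0, 0, 1] := by
  simp [twistAct]
lemma twistAct_α (i j : Fin 2) : twistAct i j (α i) = !![0, 0, 0; 1, 0, 0; 0, 0, 0] := by
  simp [twistAct]
lemma twistAct_τ (i j : Fin 2) :
    twistAct i j (τ i) = !![0, 0, 0; 0, 0, 0; 0, ι (α i), ι (τ i)] := by simp [twistAct]
include h
lemma twistAct_E' : twistAct i j (E j) = !![1, 0, 0; 0, 0, 0; 0, 0, 0] := by
  simp [twistAct, atVertex_ne h]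
lemma twistAct_α' : twistAct i j (α j) =
    !![0, ι (α j) * ι (α i), ι (α j) * ι (τ i); 0, 0, 0; 0, 0, 0] := by
  simp [twistAct, atVertex_ne h]
lemma twistAct_τ' : twistAct i j (τ j) = !![ι (τ j), 0, 0; 0, 0, 0; 0, 0, 0] := by
  simp [twistAct, atVertex_ne h]

lemma isRep_twistAct : IsRep (twistAct i j) := by
    apply isRep_assign h <;> simp [atVertex_ne h, Matrix.one_fin_three, vec_zero_three, of_zero_three]

end

set_option maxHeartbeats 1000000 in
/-- The kernel of the twist functor at the vertex `i`. -/
noncomputable def twistKernel : MatrixKernel where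
  vertex := ![j, j, i]
  deg := ![0, (α i).deg, -2]
  act := twistAct i j
  diff := !![0, 0, 0; 0, 0, -ι (α j); 0, 0, 0]
  isRep := isRep_twistAct h
  commute_act := by
    refine Gen.cases_vertex h ?_ ?_ ?_ ?_ ?_ ?_ <;> apply forall_fin_three <;>
      simp [twistAct_E, twistAct_E' h, twistAct_α, twistAct_α' h, twistAct_τ, twistAct_τ' h,
        E_α, E_τ, τ_E, α_E h, α_E h.symm, mul_assoc, ← mul_assoc (ι (E j))]
  commute_diff := by
    apply forall_fin_three <;> simp [E_α, α_E h.symm]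
  act_mem := by
    have h1 := deg_α_add h
    have hz : ∀ n, (0 : Alg) ∈ gr n := fun n => Submodule.zero_mem _
    have ho : (1 : Alg) ∈ gr 0 := SetLike.GradedOne.one_mem
    have hp := SetLike.mul_mem_graded (ι_mem (α j)) (ι_mem (α i))
    have hq := SetLike.mul_mem_graded (ι_mem (α j)) (ι_τ_mem i)
    refine Gen.cases_vertex h ?_ ?_ ?_ ?_ ?_ ?_ <;> apply forall_fin_three <;>
      simp [twistAct_E, twistAct_E' h, twistAct_α, twistAct_α' h, twistAct_τ, twistAct_τ' h,
        hz, ho, hp, hq, ι_mem, deg_E, deg_τ, ι_τ_mem, ← sub_eq_add_neg]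
    exact hq
  diff_mem := by
    have h1 := deg_α_add h
    have hz : ∀ n, (0 : Alg) ∈ gr n := fun n => Submodule.zero_mem _
    apply forall_fin_three <;> simp [hz]
    rw [show (-1 : ℤ) - (α i).deg = (α j).deg by omega]
    exact ι_mem _
  target := {2}
  diff_eq_zero := by
    apply forall_fin_three <;> simp
  d_diff := by
    apply forall_fin_three <;> simp [d_α]
  leibniz := by
    refine Gen.cases_vertex h ?_ ?_ ?_ ?_ ?_ ?_ <;> apply forall_fin_three <;>
      simp [twistAct_E, twistAct_E' h, twistAct_α, twistAct_α' h, twistAct_τ, twistAct_τ' h,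
        Fin.sum_univ_three, dGen_E, dGen_α, dGen_τ h, dGen_τ h.symm, d_one, d_α, d_τ h,
        d_τ h.symm, deg_E, deg_τ, d_mul_left, negOnePow_deg_α, sgn_eq h]
    all_goals rcases Int.units_eq_one_or (sgn i) with e | e <;> simp [e, mul_assoc, deg_α_add h.symm]

/-- The matrices of the quasi-inverse of the twist functor. -/
noncomputable def untwistAct (i j : Fin 2) : Gen → Matrix (Fin 3) (Fin 3) Alg :=
  assign (atVertex i !![0, 0, 0; 0, 1, 0; 0, 0, 1] !![1, 0, 0; 0, 0, 0; 0, 0, 0])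
    (atVertex i !![0, 0, 0; ι (α j) * ι (α i), 0, 0; ι (τ i) * ι (α i), 0, 0]
      !![0, 1, 0; 0, 0, 0; 0, 0, 0])
    (atVertex i !![0, 0, 0; 0, 0, ι (α j); 0, 0, ι (τ i)] !![ι (τ j), 0, 0; 0, 0, 0; 0, 0, 0])

section

lemma untwistAct_E (i j : Fin 2) : untwistAct i j (E i) = !![0, 0, 0; 0, 1, 0; 0, 0, 1] := by
  simp [untwistAct]
lemma untwistAct_α (i j : Fin 2) : untwistAct i j (α i) =
    !![0, 0, 0; ι (α j) * ι (α i), 0, 0; ι (τ i) * ι (α i), 0, 0] := by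
  simp [untwistAct]
lemma untwistAct_τ (i j : Fin 2) :
    untwistAct i j (τ i) = !![0, 0, 0; 0, 0, ι (α j); 0, 0, ι (τ i)] := by simp [untwistAct]
include h
lemma untwistAct_E' : untwistAct i j (E j) = !![1, 0, 0; 0, 0, 0; 0, 0, 0] := by
  simp [untwistAct, atVertex_ne h]
lemma untwistAct_α' : untwistAct i j (α j) = !![0, 1, 0; 0, 0, 0; 0, 0, 0] := by
  simp [untwistAct, atVertex_ne h]
lemma untwistAct_τ' : untwistAct i j (τ j) = !![ι (τ j), 0, 0; 0, 0, 0; 0, 0, 0] := by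
  simp [untwistAct, atVertex_ne h]

lemma isRep_untwistAct : IsRep (untwistAct i j) := by
  apply isRep_assign h <;>
    simp [atVertex_ne h, Matrix.one_fin_three, vec_zero_three, of_zero_three]

end

set_option maxHeartbeats 1000000 in
/-- The kernel of the quasi-inverse of the twist functor at the vertex `i`. -/
noncomputable def untwistKernel : MatrixKernel where
  vertex := ![j, j, i]
  deg := ![0, -(α j).deg, 2]
  act := untwistAct i j
  diff := !![0, 0, 0; 0, 0, 0; 0, sgn i • ι (α i), 0]
  isRep := isRep_untwistAct h
  commute_act := by
    refine Gen.cases_vertex h ?_ ?_ ?_ ?_ ?_ ?_ <;> apply forall_fin_three <;>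
      simp [untwistAct_E, untwistAct_E' h, untwistAct_α, untwistAct_α' h, untwistAct_τ,
        untwistAct_τ' h, E_α, E_τ, τ_E, α_E h, α_E h.symm, mul_assoc, ← mul_assoc (ι (E j)),
        ← mul_assoc (ι (E i))]
  commute_diff := by
    apply forall_fin_three <;> simp [E_α, α_E h, mul_smul_comm, smul_mul_assoc]
  act_mem := by
    have h1 := deg_α_add h
    have hz : ∀ n, (0 : Alg) ∈ gr n := fun n => Submodule.zero_mem _
    have ho : (1 : Alg) ∈ gr 0 := SetLike.GradedOne.one_mem
    have hp := SetLike.mul_mem_graded (ι_mem (α j)) (ι_mem (α i))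
    have hq := SetLike.mul_mem_graded (ι_τ_mem i) (ι_mem (α i))
    rw [add_comm] at hp
    refine Gen.cases_vertex h ?_ ?_ ?_ ?_ ?_ ?_ <;> apply forall_fin_three <;>
      simp [untwistAct_E, untwistAct_E' h, untwistAct_α, untwistAct_α' h, untwistAct_τ,
        untwistAct_τ' h, hz, ho, hp, hq, ι_mem, deg_E, deg_τ, ι_τ_mem, ← sub_eq_add_neg]
    rwa [sub_eq_add_neg, add_comm]
  diff_mem := by
    have h1 := deg_α_add h
    have hz : ∀ n, (0 : Alg) ∈ gr n := fun n => Submodule.zero_mem _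
    apply forall_fin_three <;> simp [hz]
    rw [show (1 : ℤ) + -(α j).deg - 2 = (α i).deg by omega]
    exact ι_mem _
  target := {1}
  diff_eq_zero := by
    apply forall_fin_three <;> simp
  d_diff := by
    apply forall_fin_three <;> simp [d_α]
  leibniz := by
    have h1 := deg_α_add h
    have h2 : (α j).deg.negOnePow = -sgn i := sgn_eq h
    refine Gen.cases_vertex h ?_ ?_ ?_ ?_ ?_ ?_ <;> apply forall_fin_three <;>
      simp [untwistAct_E, untwistAct_E' h, untwistAct_α, untwistAct_α' h, untwistAct_τ,
        untwistAct_τ' h, Fin.sum_univ_three, dGen_E, dGen_α, dGen_τ h, dGen_τ h.symm, d_one, d_α,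
        d_τ h, d_τ h.symm, deg_E, deg_τ, d_mul_left, negOnePow_deg_α, sgn_eq h]
    all_goals rcases Int.units_eq_one_or (sgn i) with e | e <;> simp [e, mul_assoc]

end kernels

end Ginzburg

namespace Ginzburg

open DGModule MatrixKernel

/-- Linear maps commuting with the action of the generators. -/
def linearOfGen {V W : Type} [AddCommGroup V] [AddCommGroup W] [Module ℂ V] [Module ℂ W]
    [Module Algᵐᵒᵖ V] [Module Algᵐᵒᵖ W] [IsScalarTower ℂ Algᵐᵒᵖ V] [IsScalarTower ℂ Algᵐᵒᵖ W]
    (f : V →ₗ[ℂ] W) (hf : ∀ g v, f (v ◁ ι g) = f v ◁ ι g) : V →ₗ[Algᵐᵒᵖ] W where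
  toFun := f
  map_add' := map_add f
  map_smul' x v := by
    obtain ⟨x, rfl⟩ := op_surjective x
    revert v
    refine alg_induction (p := fun x => ∀ v, f (v ◁ x) = f v ◁ x) x ?_ ?_ ?_ ?_ ?_
    · intro v; rw [MulOpposite.op_one, one_smul, one_smul]
    · intro g y hy v; rw [op_mul, mul_smul, hy, hf, mul_smul]
    · intro v; rw [MulOpposite.op_zero, zero_smul, zero_smul, map_zero]
    · intro x y hx hy v; rw [MulOpposite.op_add, add_smul, map_add, hx, hy, add_smul]
    · intro c x hx v; rw [MulOpposite.op_smul, smul_assoc, map_smul, hx, smul_assoc]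

lemma MatrixKernel.obj_par_apply {K : MatrixKernel} {Y : DGModule dgAlgebra} (v : K.Slots Y)
    (k : Fin 3) : ((K.obj Y).par v : K.Slots Y).1 k = (K.deg k).negOnePow • Y.par (v.1 k) :=
  linearMap_ext (M := K.obj Y)
    (f := (LinearMap.proj k ∘ₗ (K.space Y).subtype : K.Slots Y →ₗ[ℂ] Y.carrier) ∘ₗ (K.obj Y).par)
    (g := (K.deg k).negOnePow • (Y.par ∘ₗ
      (LinearMap.proj k ∘ₗ (K.space Y).subtype : K.Slots Y →ₗ[ℂ] Y.carrier))) (fun n v hv => by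
    rw [LinearMap.comp_apply, par_apply hv]
    refine (Slots.units_smul_apply _ _ _).trans ?_
    change n.negOnePow • v.1 k = (K.deg k).negOnePow • Y.par (v.1 k)
    rw [par_apply (hv k), smul_smul, Int.negOnePow_add, mul_left_comm, Int.units_mul_self,
      mul_one]) v

section

variable {i j : Fin 2} (h : i ≠ j) (Y : DGModule dgAlgebra)

section

include h

variable {Y}

lemma rsmul_E_of {m : Y.carrier} (hm : m ◁ ι (E i) = m) : m ◁ ι (E j) = 0 := by
  rw [← hm, rsmul_rsmul, E_E' h, rsmul_zero]

lemma rsmul_α_of {m : Y.carrier} (hm : m ◁ ι (E i) = m) : m ◁ ι (α j) = 0 := by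
  rw [← hm, rsmul_rsmul, ← E_α j, ← mul_assoc, E_E' h, zero_mul, rsmul_zero]

lemma rsmul_α_E (m : Y.carrier) : m ◁ ι (α i) ◁ ι (E j) = m ◁ ι (α i) := by
  rw [rsmul_rsmul, α_E h]

lemma rsmul_τ_of {m : Y.carrier} (hm : m ◁ ι (E i) = m) : m ◁ ι (τ j) = 0 := by
  rw [← hm, rsmul_rsmul, ← E_τ j, ← mul_assoc, E_E' h, zero_mul, rsmul_zero]

end

section

variable {Y} (v : (twistKernel h).Slots Y)

lemma twist_rsmul (g : Gen) (k : Fin 3) : (v ◁ ι g).1 k =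
    v.1 0 ◁ twistAct i j g 0 k + v.1 1 ◁ twistAct i j g 1 k + v.1 2 ◁ twistAct i j g 2 k := by
  rw [Slots.rsmul_apply, Fin.sum_univ_three, rep_ι]
  rfl

lemma twist_d₀ : ((twistKernel h).dSlots Y v).1 0 = Y.d (v.1 0) := by
  rw [dSlots_apply, Fin.sum_univ_three]
  simp [twistKernel]

lemma twist_d₁ : ((twistKernel h).dSlots Y v).1 1 = Y.d (v.1 1) := by
  rw [dSlots_apply, Fin.sum_univ_three]
  simp [twistKernel]

lemma twist_d₂ : ((twistKernel h).dSlots Y v).1 2 = Y.d (v.1 2) - Y.par (v.1 1) ◁ ι (α j) := by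
  rw [dSlots_apply, Fin.sum_univ_three]
  simp [twistKernel, rsmul_neg, sub_eq_add_neg]

lemma twist_E₀ : v.1 0 ◁ ι (E j) = v.1 0 := v.2 0
lemma twist_E₁ : v.1 1 ◁ ι (E j) = v.1 1 := v.2 1
lemma twist_E₂ : v.1 2 ◁ ι (E i) = v.1 2 := v.2 2

/-- The element with the given components. -/
noncomputable def twistMk (a b c : Y.carrier) (ha : a ◁ ι (E j) = a) (hb : b ◁ ι (E j) = b)
    (hc : c ◁ ι (E i) = c) : (twistKernel h).Slots Y :=
  ⟨![a, b, c], fun k => by fin_cases k <;> assumption⟩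

section

variable {a b c : Y.carrier} {ha : a ◁ ι (E j) = a} {hb : b ◁ ι (E j) = b} {hc : c ◁ ι (E i) = c}

lemma twistMk_zero : (twistMk h a b c ha hb hc).1 0 = a := rfl
lemma twistMk_one : (twistMk h a b c ha hb hc).1 1 = b := rfl
lemma twistMk_two : (twistMk h a b c ha hb hc).1 2 = c := rfl

end

lemma twist_ext {v w : (twistKernel h).Slots Y} (h0 : v.1 0 = w.1 0) (h1 : v.1 1 = w.1 1)
    (h2 : v.1 2 = w.1 2) : v = w :=
  Slots.ext fun k => by fin_cases k <;> assumption

lemma twistMk_E (b c : Y.carrier) (hb : b ◁ ι (E j) = b) (hc : c ◁ ι (E i) = c) :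
    twistMk h 0 b c (smul_zero _) hb hc ◁ ι (E i) = twistMk h 0 b c (smul_zero _) hb hc := by
  apply twist_ext <;> rw [twist_rsmul] <;> simp [twistAct_E, twistMk]

lemma twistMk_E' (a : Y.carrier) (ha : a ◁ ι (E j) = a) :
    twistMk h a 0 0 ha (smul_zero _) (smul_zero _) ◁ ι (E j) =
      twistMk h a 0 0 ha (smul_zero _) (smul_zero _) := by
  apply twist_ext <;> rw [twist_rsmul] <;> simp [twistAct_E' h, twistMk]

variable {v} in
lemma twist_of_E (hv : v ◁ ι (E i) = v) : v.1 0 = 0 := by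
  rw [← hv, twist_rsmul]; simp [twistAct_E]

variable {v} in
lemma twist_of_E' (hv : v ◁ ι (E j) = v) : v.1 1 = 0 ∧ v.1 2 = 0 := by
  constructor <;> rw [← hv, twist_rsmul] <;> simp [twistAct_E' h]

end

section

variable {Y} (v : (untwistKernel h).Slots Y)

lemma untwist_rsmul (g : Gen) (k : Fin 3) : (v ◁ ι g).1 k =
    v.1 0 ◁ untwistAct i j g 0 k + v.1 1 ◁ untwistAct i j g 1 k +
      v.1 2 ◁ untwistAct i j g 2 k := by
  rw [Slots.rsmul_apply, Fin.sum_univ_three, rep_ι]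
  rfl

lemma untwist_d₀ : ((untwistKernel h).dSlots Y v).1 0 = Y.d (v.1 0) := by
  rw [dSlots_apply, Fin.sum_univ_three]
  simp [untwistKernel]

lemma untwist_d₁ : ((untwistKernel h).dSlots Y v).1 1 =
    Y.d (v.1 1) + sgn i • (Y.par (v.1 2) ◁ ι (α i)) := by
  rw [dSlots_apply, Fin.sum_univ_three]
  simp [untwistKernel]

lemma untwist_d₂ : ((untwistKernel h).dSlots Y v).1 2 = Y.d (v.1 2) := by
  rw [dSlots_apply, Fin.sum_univ_three]
  simp [untwistKernel]

lemma untwist_E₀ : v.1 0 ◁ ι (E j) = v.1 0 := v.2 0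
lemma untwist_E₁ : v.1 1 ◁ ι (E j) = v.1 1 := v.2 1
lemma untwist_E₂ : v.1 2 ◁ ι (E i) = v.1 2 := v.2 2

/-- The element with the given components. -/
noncomputable def untwistMk (a b c : Y.carrier) (ha : a ◁ ι (E j) = a) (hb : b ◁ ι (E j) = b)
    (hc : c ◁ ι (E i) = c) : (untwistKernel h).Slots Y :=
  ⟨![a, b, c], fun k => by fin_cases k <;> assumption⟩

section

variable {a b c : Y.carrier} {ha : a ◁ ι (E j) = a} {hb : b ◁ ι (E j) = b} {hc : c ◁ ι (E i) = c}

lemma untwistMk_zero : (untwistMk h a b c ha hb hc).1 0 = a := rfl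
lemma untwistMk_one : (untwistMk h a b c ha hb hc).1 1 = b := rfl
lemma untwistMk_two : (untwistMk h a b c ha hb hc).1 2 = c := rfl

end

lemma untwist_ext {v w : (untwistKernel h).Slots Y} (h0 : v.1 0 = w.1 0) (h1 : v.1 1 = w.1 1)
    (h2 : v.1 2 = w.1 2) : v = w :=
  Slots.ext fun k => by fin_cases k <;> assumption

lemma untwistMk_E (b c : Y.carrier) (hb : b ◁ ι (E j) = b) (hc : c ◁ ι (E i) = c) :
    untwistMk h 0 b c (smul_zero _) hb hc ◁ ι (E i) = untwistMk h 0 b c (smul_zero _) hb hc := by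
  apply untwist_ext <;> rw [untwist_rsmul] <;> simp [untwistAct_E, untwistMk]

lemma untwistMk_E' (a : Y.carrier) (ha : a ◁ ι (E j) = a) :
    untwistMk h a 0 0 ha (smul_zero _) (smul_zero _) ◁ ι (E j) =
      untwistMk h a 0 0 ha (smul_zero _) (smul_zero _) := by
  apply untwist_ext <;> rw [untwist_rsmul] <;> simp [untwistAct_E' h, untwistMk]

variable {v} in
lemma untwist_of_E (hv : v ◁ ι (E i) = v) : v.1 0 = 0 := by
  rw [← hv, untwist_rsmul]; simp [untwistAct_E]

variable {v} in
lemma untwist_of_E' (hv : v ◁ ι (E j) = v) : v.1 1 = 0 ∧ v.1 2 = 0 := by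
  constructor <;> rw [← hv, untwist_rsmul] <;> simp [untwistAct_E' h]

end

/-! ### The counit -/

section counit

variable {Y} (V : (untwistKernel h).Slots ((twistKernel h).obj Y))

/-- The counit on elements. -/
noncomputable def counitFun : Y.carrier :=
  (V.1 0 : (twistKernel h).Slots Y).1 0 + (V.1 1 : (twistKernel h).Slots Y).1 0 ◁ ι (α j) + (V.1 2 : (twistKernel h).Slots Y).1 2

lemma counitFun_rsmul (g : Gen) : ∀ V : (untwistKernel h).Slots ((twistKernel h).obj Y),
    counitFun h (V ◁ ι g) = counitFun h V ◁ ι g := by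
  have h1 := fun V : (untwistKernel h).Slots ((twistKernel h).obj Y) =>
    twist_of_E' h (untwist_E₀ h V)
  have h2 := fun V : (untwistKernel h).Slots ((twistKernel h).obj Y) =>
    twist_of_E' h (untwist_E₁ h V)
  have h3 := fun V : (untwistKernel h).Slots ((twistKernel h).obj Y) =>
    twist_of_E h (untwist_E₂ h V)
  revert g
  refine Gen.cases_vertex h ?_ ?_ ?_ ?_ ?_ ?_ <;> intro V <;>
    simp [counitFun, untwist_rsmul, untwistAct_E, untwistAct_E' h, untwistAct_α, untwistAct_α' h,
      untwistAct_τ, untwistAct_τ' h, twist_rsmul, twistAct_E, twistAct_E' h, twistAct_α,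
      twistAct_α' h, twistAct_τ, twistAct_τ' h, Slots.add_apply, Slots.zero_apply, mul_smul,
      h1 V, h2 V, h3 V, twist_E₀ h (V.1 0), twist_E₂ h (V.1 2), rsmul_α_E h.symm,
      rsmul_E_of h.symm (twist_E₀ h (V.1 0)), rsmul_α_of h.symm (twist_E₀ h (V.1 0)),
      rsmul_τ_of h.symm (twist_E₀ h (V.1 0)), rsmul_E_of h (twist_E₂ h (V.1 2)),
      rsmul_α_of h (twist_E₂ h (V.1 2)), rsmul_τ_of h (twist_E₂ h (V.1 2)),
      rsmul_E_of h (rsmul_α_E h.symm _), rsmul_α_of h (rsmul_α_E h.symm _),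
      rsmul_τ_of h (rsmul_α_E h.symm _)]

lemma counitFun_d (V : (untwistKernel h).Slots ((twistKernel h).obj Y)) :
    counitFun h ((untwistKernel h).dSlots _ V) = Y.d (counitFun h V) := by
  have h3 := twist_of_E h (untwist_E₂ h V)
  have h4 := twist_of_E' h (untwist_E₁ h V)
  simp only [counitFun, untwist_d₀, untwist_d₁, untwist_d₂, twist_d₀, twist_d₂, Slots.add_apply,
    Slots.units_smul_apply, twist_rsmul, twistAct_α, map_add, d_rsmul, d_α]
  rw [obj_par_apply (K := twistKernel h) (V.1 2) 1,
    show ((twistKernel h).deg 1).negOnePow = sgn i from rfl]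
  rcases Int.units_eq_one_or (sgn i) with e | e <;> simp [e, rsmul_one, rsmul_zero] <;> abel

/-- The counit of the equivalence. -/
noncomputable def counit (Y : DGModule dgAlgebra) :
    (untwistKernel h).obj ((twistKernel h).obj Y) ⟶ Y where
  lin := linearOfGen
    { toFun := counitFun h
      map_add' := fun V W => by
        simp only [counitFun, Slots.add_apply, smul_add]; abel
      map_smul' := fun c V => by
        simp only [counitFun, Slots.smul_apply, smul_add, RingHom.id_apply, smul_comm c] }
    (counitFun_rsmul h)
  map_mem {n V} hV := by
    have h0 := hV 0 0
    have h1 := Y.smul_mem (hV 1 0) (ι_mem (α j))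
    have h2 := hV 2 2
    refine Submodule.add_mem _ (Submodule.add_mem _ ?_ ?_) ?_
    · simpa [twistKernel, untwistKernel] using h0
    · simpa [twistKernel, untwistKernel] using h1
    · simpa [twistKernel, untwistKernel] using h2
  comm := counitFun_d h

lemma isQis_counit : IsQis (counit h Y) := by
  refine isQis_of_surjective (fun y => ?_) fun V hV hd => ?_
  · have h1 : y ◁ ι (E j) ◁ ι (E j) = y ◁ ι (E j) := by rw [rsmul_rsmul, E_E]
    have h2 : y ◁ ι (E i) ◁ ι (E i) = y ◁ ι (E i) := by rw [rsmul_rsmul, E_E]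
    refine ⟨untwistMk h (Y := (twistKernel h).obj Y)
      (twistMk h (y ◁ ι (E j)) 0 0 h1 (smul_zero _) (smul_zero _)) 0
      (twistMk h 0 0 (y ◁ ι (E i)) (smul_zero _) (smul_zero _) h2)
      (twistMk_E' h _ _) (smul_zero _) (twistMk_E h _ _ _ _), ?_⟩
    change y ◁ ι (E j) + (0 : Y.carrier) ◁ ι (α j) + y ◁ ι (E i) = y
    rw [smul_zero, add_zero, ← rsmul_add, add_comm, add_E h, rsmul_one]
  · obtain ⟨V, rfl⟩ : ∃ W : (untwistKernel h).Slots ((twistKernel h).obj Y), W = V := ⟨V, rfl⟩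
    have h0 := twist_of_E' h (untwist_E₀ h V)
    have h1 := twist_of_E' h (untwist_E₁ h V)
    have h2 := twist_of_E h (untwist_E₂ h V)
    have e : counitFun h V = 0 := hV
    have e1 := congrArg (fun y => y ◁ ι (E j)) e
    have e2 := congrArg (fun y => y ◁ ι (E i)) e
    simp only [counitFun, smul_add, twist_E₀ h (V.1 0), twist_E₂ h (V.1 2), rsmul_α_E h.symm,
      rsmul_E_of h.symm (twist_E₀ h (V.1 0)), rsmul_E_of h (twist_E₂ h (V.1 2)),
      rsmul_E_of h (rsmul_α_E h.symm _), smul_zero, add_zero, zero_add] at e1 e2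
    have e3 : Y.d ((V.1 1 : (twistKernel h).Slots Y).1 0) =
        -Y.par ((V.1 2 : (twistKernel h).Slots Y).1 1) := by
      have := congrArg (fun W : (untwistKernel h).Slots ((twistKernel h).obj Y) =>
        (W.1 1 : (twistKernel h).Slots Y).1 0) hd
      simp only [untwist_d₁, Slots.add_apply, Slots.units_smul_apply, twist_rsmul, twistAct_α,
        twist_d₀] at this
      rw [obj_par_apply (K := twistKernel h) (V.1 2) 1,
        show ((twistKernel h).deg 1).negOnePow = sgn i from rfl] at this
      rw [eq_neg_iff_add_eq_zero]
      refine Eq.trans ?_ this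
      rcases Int.units_eq_one_or (sgn i) with e | e <;> simp [e, rsmul_one, rsmul_zero]
    have hp := par_rsmul_E _ _ (twist_E₀ h (V.1 1))
    refine ⟨untwistMk h (Y := (twistKernel h).obj Y) 0 0 (twistMk h 0
      (Y.par ((V.1 1 : (twistKernel h).Slots Y).1 0)) 0 (smul_zero _) hp (smul_zero _))
      (smul_zero _) (smul_zero _) (twistMk_E h _ _ _ _), ?_, ?_⟩
    · change (0 : Y.carrier) + (0 : Y.carrier) ◁ ι (α j) + 0 = 0
      simp
    · have hpar := obj_par_apply (K := twistKernel h) (twistMk h 0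
        (Y.par ((V.1 1 : (twistKernel h).Slots Y).1 0)) 0 (smul_zero _) hp (smul_zero _)) 1
      rw [show ((twistKernel h).deg 1).negOnePow = sgn i from rfl] at hpar
      have hpp := par_par (M := Y) ((V.1 1 : (twistKernel h).Slots Y).1 0)
      have hdp := d_par (M := Y) ((V.1 1 : (twistKernel h).Slots Y).1 0)
      rw [e3, map_neg, par_par, neg_neg] at hdp
      have h3 : (V.1 2 : (twistKernel h).Slots Y).1 2 =
        -((V.1 1 : (twistKernel h).Slots Y).1 0 ◁ ι (α j)) := eq_neg_of_add_eq_zero_right e2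
      apply untwist_ext <;> apply twist_ext <;>
        simp only [untwist_d₀, untwist_d₁, untwist_d₂, twist_d₀, twist_d₁, twist_d₂,
          Slots.add_apply, Slots.units_smul_apply, twist_rsmul, twistAct_α]
      all_goals rcases Int.units_eq_one_or (sgn i) with e | e <;>
        simp [e, untwistMk, twistMk, h0, h1, h2, e1, hdp, hpp, h3, rsmul_one, rsmul_zero,
          Slots.zero_apply] at hpar ⊢
      · exact hpar.symm
      · exact (neg_neg _).symm.trans (congrArg Neg.neg hpar.symm)

/-- The counit as a natural transformation. -/
noncomputable def counitTrans : (twistKernel h).functor ⋙ (untwistKernel h).functor ⟶ 𝟭 _ where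
  app := counit h
  naturality Y Z f := hom_ext fun V => by
    change counitFun h _ = f.lin (counitFun h V)
    simp only [counitFun, map_add, map_smul]
    rfl

end counit

/-! ### The unit -/

section unit

variable {Y} in
/-- The unit on elements. -/
noncomputable def unitFun (y : Y.carrier) : (twistKernel h).Slots ((untwistKernel h).obj Y) :=
  have h1 : y ◁ ι (E j) ◁ ι (E j) = y ◁ ι (E j) := by rw [rsmul_rsmul, E_E]
  have h2 : y ◁ ι (E i) ◁ ι (E i) = y ◁ ι (E i) := by rw [rsmul_rsmul, E_E]
  twistMk h (Y := (untwistKernel h).obj Y)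
    (untwistMk h (y ◁ ι (E j)) 0 0 h1 (smul_zero _) (smul_zero _))
    (untwistMk h (y ◁ ι (α i)) 0 0 (rsmul_α_E h y) (smul_zero _) (smul_zero _))
    (untwistMk h 0 0 (y ◁ ι (E i)) (smul_zero _) (smul_zero _) h2)
    (untwistMk_E' h _ _) (untwistMk_E' h _ _) (untwistMk_E h _ _ _ _)

variable {Y}

lemma unitFun_zero (y : Y.carrier) : (unitFun h y).1 0 = untwistMk h (y ◁ ι (E j)) 0 0
    (by rw [rsmul_rsmul, E_E]) (smul_zero _) (smul_zero _) := rfl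

lemma unitFun_one (y : Y.carrier) : (unitFun h y).1 1 = untwistMk h (y ◁ ι (α i)) 0 0
    (rsmul_α_E h y) (smul_zero _) (smul_zero _) := rfl

lemma unitFun_two (y : Y.carrier) : (unitFun h y).1 2 = untwistMk h 0 0 (y ◁ ι (E i))
    (smul_zero _) (smul_zero _) (by rw [rsmul_rsmul, E_E]) := rfl

variable (Y)

lemma unitFun_rsmul (g : Gen) : ∀ y : Y.carrier, unitFun h (y ◁ ι g) = unitFun h y ◁ ι g := by
  have hE : ∀ (y : Y.carrier) k, y ◁ ι (E k) ◁ ι (E k) = y ◁ ι (E k) := fun y k => by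
    rw [rsmul_rsmul, E_E]
  have hE' : ∀ y : Y.carrier, y ◁ ι (E i) ◁ ι (E j) = 0 := fun y => rsmul_E_of h (hE y i)
  have hE'' : ∀ y : Y.carrier, y ◁ ι (E j) ◁ ι (E i) = 0 := fun y => rsmul_E_of h.symm (hE y j)
  have hτ : ∀ (y : Y.carrier) k, y ◁ ι (τ k) ◁ ι (E k) = y ◁ ι (τ k) := fun y k => by
    rw [rsmul_rsmul, τ_E]
  have hτ' : ∀ (y : Y.carrier) k, y ◁ ι (E k) ◁ ι (τ k) = y ◁ ι (τ k) := fun y k => by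
    rw [rsmul_rsmul, E_τ]
  have hα : ∀ (y : Y.carrier) k, y ◁ ι (E k) ◁ ι (α k) = y ◁ ι (α k) := fun y k => by
    rw [rsmul_rsmul, E_α]
  revert g
  refine Gen.cases_vertex h ?_ ?_ ?_ ?_ ?_ ?_ <;> intro y <;> apply twist_ext <;>
    simp only [twist_rsmul, twistAct_E, twistAct_E' h, twistAct_α, twistAct_α' h, twistAct_τ,
      twistAct_τ' h, rsmul_one, rsmul_zero, unitFun_zero, unitFun_one, unitFun_two,
      MulOpposite.op_zero, MulOpposite.op_one, zero_smul, one_smul, add_zero, zero_add] <;>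
    apply untwist_ext <;>
    simp [untwistMk_zero, untwistMk_one, untwistMk_two, untwist_rsmul, untwistAct_E, untwistAct_E' h, untwistAct_α,
      untwistAct_α' h, untwistAct_τ, untwistAct_τ' h, Slots.add_apply, Slots.zero_apply, mul_smul,
      hE, hE', hE'', hτ, hτ', hα, rsmul_α_E h, rsmul_α_E h.symm, rsmul_α_of h (hE y i),
      rsmul_α_of h.symm (hE y j), rsmul_α_of h (rsmul_α_E h.symm y), rsmul_α_of h (hτ y i),
      rsmul_α_of h.symm (rsmul_α_E h y), rsmul_α_of h.symm (hτ y j),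
      rsmul_τ_of h (hE y i), rsmul_τ_of h.symm (hE y j), rsmul_E_of h (rsmul_α_E h.symm y),
      rsmul_E_of h (hτ y i), rsmul_E_of h.symm (rsmul_α_E h y), rsmul_E_of h.symm (hτ y j),
      rsmul_τ_of h (rsmul_α_E h.symm y), rsmul_τ_of h (hτ y i), rsmul_τ_of h.symm (rsmul_α_E h y),
      rsmul_τ_of h.symm (hτ y j)]

lemma unitFun_d (y : Y.carrier) :
    unitFun h (Y.d y) = (twistKernel h).dSlots ((untwistKernel h).obj Y) (unitFun h y) := by
  have hp (v : (untwistKernel h).Slots Y) (k : Fin 3) := obj_par_apply (K := untwistKernel h) v k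
  have h2 : ((untwistKernel h).deg 1).negOnePow = -sgn i := by
    rw [← sgn_eq h]; exact Int.negOnePow_neg _
  apply twist_ext <;>
    simp only [twist_d₀, twist_d₁, twist_d₂, unitFun_zero, unitFun_one, unitFun_two] <;>
    apply untwist_ext <;>
    simp only [Slots.sub_apply, untwist_d₀, untwist_d₁, untwist_d₂, untwist_rsmul, untwistMk_zero,
      untwistMk_one, untwistMk_two, untwistAct_α' h, hp, map_zero, d_rsmul, dGen_E, d_E, d_α]
  all_goals simp [untwistMk_zero, untwistMk_one, untwistMk_two, hp]
  have h0 : ((untwistKernel h).deg 0).negOnePow = 1 := Int.negOnePow_zero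
  rw [h0, one_smul, par_rsmul (ι_mem (α i)), par_rsmul (ι_E_mem i), Int.negOnePow_zero, one_smul,
    rsmul_rsmul, E_α]
  exact (sub_self _).symm

/-- The unit of the equivalence. -/
noncomputable def unit : Y ⟶ (twistKernel h).obj ((untwistKernel h).obj Y) where
  lin := linearOfGen
    { toFun := unitFun h
      map_add' := fun y z => by
        apply twist_ext <;> apply untwist_ext <;>
          simp [Slots.add_apply, unitFun_zero, unitFun_one, unitFun_two, untwistMk_zero,
            untwistMk_one, untwistMk_two, smul_add]
      map_smul' := fun c y => by
        apply twist_ext <;> apply untwist_ext <;>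
          simp [Slots.smul_apply, unitFun_zero, unitFun_one, unitFun_two, untwistMk_zero,
            untwistMk_one, untwistMk_two, smul_comm c] }
    (unitFun_rsmul h Y)
  map_mem {n y} hy := by
    have h1 (k) := Y.smul_mem hy (ι_E_mem k)
    have h2 := Y.smul_mem hy (ι_mem (α i))
    have hz n : (0 : Y.carrier) ∈ Y.gr n := Submodule.zero_mem _
    intro k
    fin_cases k <;> intro l <;> fin_cases l <;>
      simp [unitFun, twistMk, untwistMk, twistKernel, untwistKernel, hz]
    · exact add_zero n ▸ h1 j
    · exact hz _
    · exact hz _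
    · exact h2
    · exact hz _
    · exact hz _
    · exact hz _
    · exact hz _
    · exact add_zero n ▸ h1 i
  comm := unitFun_d h Y

lemma isQis_unit : IsQis (unit h Y) := by
  refine isQis_of_injective (fun y hy => ?_) fun V y hV => ?_
  · obtain ⟨y, rfl⟩ : ∃ z : Y.carrier, z = y := ⟨y, rfl⟩
    have e1 : y ◁ ι (E j) = 0 := congrArg (fun W : (twistKernel h).Slots
      ((untwistKernel h).obj Y) => (W.1 0 : (untwistKernel h).Slots Y).1 0) hy
    have e2 : y ◁ ι (E i) = 0 := congrArg (fun W : (twistKernel h).Slots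
      ((untwistKernel h).obj Y) => (W.1 2 : (untwistKernel h).Slots Y).1 2) hy
    rw [← rsmul_one Y y, ← add_E h, rsmul_add, e1, e2, add_zero]
  · obtain ⟨V, rfl⟩ : ∃ W : (twistKernel h).Slots ((untwistKernel h).obj Y), W = V := ⟨V, rfl⟩
    replace hV : (twistKernel h).dSlots _ V = unitFun h y := hV
    have h0 := untwist_of_E' h (twist_E₀ h V)
    have h1 := untwist_of_E' h (twist_E₁ h V)
    have h2 := untwist_of_E h (twist_E₂ h V)
    have hp (v : (untwistKernel h).Slots Y) (k : Fin 3) := obj_par_apply (K := untwistKernel h) v k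
    have g0 : ((untwistKernel h).deg 0).negOnePow = 1 := Int.negOnePow_zero
    have e0 := congrArg (fun W : (twistKernel h).Slots ((untwistKernel h).obj Y) =>
      (W.1 0 : (untwistKernel h).Slots Y).1 0) hV
    have e1 := congrArg (fun W : (twistKernel h).Slots ((untwistKernel h).obj Y) =>
      (W.1 1 : (untwistKernel h).Slots Y).1 0) hV
    have e2 := congrArg (fun W : (twistKernel h).Slots ((untwistKernel h).obj Y) =>
      (W.1 2 : (untwistKernel h).Slots Y).1 1) hV
    have e3 := congrArg (fun W : (twistKernel h).Slots ((untwistKernel h).obj Y) =>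
      (W.1 2 : (untwistKernel h).Slots Y).1 2) hV
    simp only [twist_d₀, twist_d₁, twist_d₂, unitFun_zero, unitFun_one, unitFun_two,
      Slots.sub_apply, untwist_d₀, untwist_d₁, untwist_d₂, untwist_rsmul, untwistMk_zero,
      untwistMk_one, untwistMk_two, untwistAct_α' h, hp, g0, one_smul] at e0 e1 e2 e3
    simp [rsmul_zero, rsmul_one, hp, g0, h0, h1, h2] at e2 e3
    have hE (k : Fin 2) (m : Y.carrier) (hm : m ◁ ι (E k) = m) :
        Y.par m ◁ ι (E k) = Y.par m := par_rsmul_E m k hm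
    have k0 := untwist_E₀ h (V.1 0)
    have k2 := untwist_E₂ h (V.1 2)
    have e4 : Y.d (Y.par ((V.1 2 : (untwistKernel h).Slots Y).1 1)) =
        (V.1 2 : (untwistKernel h).Slots Y).1 2 ◁ ι (α i) -
          (V.1 1 : (untwistKernel h).Slots Y).1 0 := by
      rw [d_par, eq_sub_of_add_eq (sub_eq_zero.1 e2), map_sub, par_par]
      have := par_rsmul (ι_mem (α i)) (Y.par ((V.1 2 : (untwistKernel h).Slots Y).1 2))
      rw [par_par, show (α i).deg.negOnePow = sgn i from rfl] at this
      rcases Int.units_eq_one_or (sgn i) with e | e <;> simp [e] at this ⊢ <;> simp [this, sub_eq_add_neg]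
    refine ⟨((V.1 0 : (untwistKernel h).Slots Y).1 0 + (V.1 2 : (untwistKernel h).Slots Y).1 2 :),
      twistMk h (Y := (untwistKernel h).obj Y) 0 (untwistMk h
        (-Y.par ((V.1 2 : (untwistKernel h).Slots Y).1 1)) 0 0 ?_ (smul_zero _) (smul_zero _)) 0
        (smul_zero _) (untwistMk_E' h _ _) (smul_zero _), ?_⟩
    · rw [smul_neg, hE _ _ (untwist_E₁ h (V.1 2))]
    · have key (m : (untwistKernel h).Slots Y) (k : Fin 3) :=
        (Slots.neg_apply (((untwistKernel h).obj Y).par m ◁ ι (α j) :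
          (untwistKernel h).Slots Y) k).trans
          (congrArg Neg.neg (untwist_rsmul h (((untwistKernel h).obj Y).par m) (α j) k))
      change V = unitFun h (Y := Y) _ + (twistKernel h).dSlots _ _
      apply twist_ext <;> apply untwist_ext <;>
        simp [Slots.add_apply, twist_d₀, twist_d₁, twist_d₂, unitFun_zero, unitFun_one, unitFun_two,
        Slots.sub_apply, untwist_d₀, untwist_d₁, untwist_d₂, untwist_rsmul, untwistMk_zero,
        untwistMk_one, untwistMk_two, untwistAct_α' h, hp, g0, h0, h1, h2, k0, k2,
        rsmul_E_of h k2, rsmul_E_of h.symm k0, rsmul_α_of h.symm k0, twistMk_zero, twistMk_one, twistMk_two, Slots.zero_apply, e4]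
      all_goals first
        | refine Eq.trans ?_ (key _ _).symm
        | refine (key _ _).trans ?_
      all_goals simp [untwistAct_α' h, hp, g0, untwistMk_zero, untwistMk_one, untwistMk_two,
        rsmul_one, rsmul_zero, par_par]

/-- The unit as a natural transformation. -/
noncomputable def unitTrans : 𝟭 _ ⟶ (untwistKernel h).functor ⋙ (twistKernel h).functor where
  app := unit h
  naturality Y Z f := hom_ext fun y => by
    change unitFun h (f.lin y) = ((twistKernel h).functor.map
      ((untwistKernel h).functor.map f)).lin (unitFun h y)
    apply twist_ext <;> apply untwist_ext <;> simp [functor_map_lin]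
    all_goals first | exact (map_smul f.lin _ _).symm | exact (map_zero f.lin).symm

end unit

/-- The natural map from a module to its twist, on elements. -/
noncomputable def coevFun {Y : DGModule dgAlgebra} (y : Y.carrier) : (twistKernel h).Slots Y :=
  twistMk h (y ◁ ι (E j)) (y ◁ ι (α i)) (y ◁ ι (τ i)) (by rw [rsmul_rsmul, E_E])
    (rsmul_α_E h y) (by rw [rsmul_rsmul, τ_E])

variable {Y} in
lemma coevFun_zero (y : Y.carrier) : (coevFun h y).1 0 = y ◁ ι (E j) := rfl
variable {Y} in
lemma coevFun_one (y : Y.carrier) : (coevFun h y).1 1 = y ◁ ι (α i) := rfl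
variable {Y} in
lemma coevFun_two (y : Y.carrier) : (coevFun h y).1 2 = y ◁ ι (τ i) := rfl

lemma coevFun_rsmul (g : Gen) : ∀ y : Y.carrier, coevFun h (y ◁ ι g) = coevFun h y ◁ ι g := by
  have h1 : ι (E j) * ι (α i) = 0 := by rw [← E_α i, ← mul_assoc, E_E' h.symm, zero_mul]
  have h2 : ι (α i) * ι (α i) = 0 := by
    nth_rw 1 [← α_E h]; rw [mul_assoc, h1, mul_zero]
  have h3 : ι (E j) * ι (τ i) = 0 := by rw [← E_τ i, ← mul_assoc, E_E' h.symm, zero_mul]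
  have h4 : ι (α i) * ι (τ i) = 0 := by
    nth_rw 1 [← α_E h]; rw [mul_assoc, h3, mul_zero]
  have h5 : ι (α j) * ι (E j) = 0 := by rw [← α_E h.symm, mul_assoc, E_E' h, mul_zero]
  have h6 : ι (τ i) * ι (E j) = 0 := by rw [← τ_E i, mul_assoc, E_E' h, mul_zero]
  have h7 : ι (τ j) * ι (α i) = 0 := by rw [← τ_E j, mul_assoc, h1, mul_zero]
  have h8 : ι (τ j) * ι (τ i) = 0 := by rw [← τ_E j, mul_assoc, h3, mul_zero]
  revert g
  refine Gen.cases_vertex h ?_ ?_ ?_ ?_ ?_ ?_ <;> intro y <;> apply twist_ext <;>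
    simp only [twist_rsmul, twistAct_E, twistAct_E' h, twistAct_α, twistAct_α' h, twistAct_τ,
      twistAct_τ' h, coevFun_zero, coevFun_one, coevFun_two]
  all_goals simp [-MulOpposite.op_mul, rsmul_rsmul, rsmul_one, rsmul_zero, ← mul_assoc, E_E,
    E_E' h, E_E' h.symm, E_α, E_τ, τ_E, α_E h, α_E h.symm, h1, h2, h3, h4, h5, h6, h7, h8]

lemma coevFun_d (y : Y.carrier) :
    coevFun h (Y.d y) = (twistKernel h).dSlots Y (coevFun h y) := by
  apply twist_ext <;>
    simp only [twist_d₀, twist_d₁, twist_d₂, coevFun_zero, coevFun_one, coevFun_two, d_rsmul,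
      d_E, d_α, d_τ h, par_rsmul (ι_mem (α i))]
  · rw [rsmul_zero, add_zero]
  · rw [rsmul_zero, add_zero]
  · rw [add_sub_assoc, left_eq_add, show (α i).deg.negOnePow = sgn i from rfl]
    rcases Int.units_eq_one_or (sgn i) with e | e <;>
      simp [-MulOpposite.op_mul, e, rsmul_rsmul, rsmul_neg]

/-- The natural map from a module to its twist. -/
noncomputable def coev : Y ⟶ (twistKernel h).obj Y where
  lin := linearOfGen
    { toFun := coevFun h
      map_add' := fun y z => by
        apply twist_ext <;>
          simp [Slots.add_apply, coevFun_zero, coevFun_one, coevFun_two, smul_add]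
      map_smul' := fun c y => by
        apply twist_ext <;>
          simp [Slots.smul_apply, coevFun_zero, coevFun_one, coevFun_two, smul_comm c] }
    (coevFun_rsmul h Y)
  map_mem {n y} hy := by
    intro k
    fin_cases k
    · exact Y.smul_mem hy (ι_E_mem j)
    · exact Y.smul_mem hy (ι_mem (α i))
    · exact Y.smul_mem hy (ι_τ_mem i)
  comm := coevFun_d h Y

/-- The natural map from a module to its twist as a natural transformation. -/
noncomputable def coevTrans : 𝟭 _ ⟶ (twistKernel h).functor where
  app := coev h
  naturality Y Z f := hom_ext fun y => by
    change coevFun h (f.lin y) = ((twistKernel h).functor.map f).lin (coevFun h y)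
    apply twist_ext <;> exact (map_smul f.lin _ _).symm

/-- The twist functor as an autoequivalence. -/
noncomputable def twist : ExactAutoequivalence Dfd where
  equiv := (twistKernel h).isDerivable.finiteEquivalence (untwistKernel h).isDerivable
    (fun _ => (twistKernel h).finite_obj) (fun _ => (untwistKernel h).finite_obj) (counitTrans h) (unitTrans h)
    (fun _ => isQis_counit h) (fun M => isQis_unit h M)
  exact := (twistKernel h).isDerivable.isExact_finiteFunctor fun _ => (twistKernel h).finite_obj
  linear := inferInstanceAs
    (((twistKernel h).isDerivable.finiteFunctor fun _ => (twistKernel h).finite_obj).Linear ℂ)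

end

end Ginzburg

namespace DGModule

variable {k : Type} [Field k] {A : DGAlgebra k} {M : DGModule A}

/-- The class of a cocycle. -/
def cohomologyClass (m : M.carrier)
    (hm : M.d m = 0) : M.cohomology :=
  Submodule.Quotient.mk ⟨m, hm⟩

lemma cohomologyClass_eq_iff
    {m m' : M.carrier} {hm : M.d m = 0} {hm' : M.d m' = 0} :
    cohomologyClass m hm = cohomologyClass m' hm' ↔ ∃ x, m = m' + M.d x := by
  refine (Submodule.Quotient.eq _).trans ⟨fun ⟨x, hx⟩ => ⟨x, ?_⟩, fun ⟨x, hx⟩ => ⟨x, ?_⟩⟩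
  · exact (sub_eq_iff_eq_add'.1 hx.symm)
  · exact (sub_eq_iff_eq_add'.2 hx).symm

end DGModule

namespace Ginzburg

open DGModule MatrixKernel DGDerivedCategory

variable {i j : Fin 2} (h : i ≠ j) {N : DGModule dgAlgebra}

section

variable {n : ℤ} (f : (resolution h).shift n ⟶ N)

/-- The component in the twist of the cocycle of the cone of the map from a module to its twist
which corresponds to a morphism from a shift of the resolution. -/
noncomputable def slotsCocycle : (twistKernel h).Slots N :=
  twistMk h 0 (-(n.negOnePow • f.lin (gen₁ h))) (-(n.negOnePow • f.lin (gen₂ h)))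
    (smul_zero _) (by rw [smul_neg, units_smul_rsmul, hom_gen₁_E])
    (by rw [smul_neg, units_smul_rsmul, hom_gen₂_E])

/-- The cocycle of the cone of the map from a module to its twist which corresponds to a morphism
from a shift of the resolution. -/
noncomputable def coneCocycle : (cone (coev h N)).carrier :=
  ((f.lin (gen₀ h), slotsCocycle h f) : N.carrier × (twistKernel h).Slots N)

lemma slotsCocycle_zero : (slotsCocycle h f).1 0 = 0 := rfl
lemma slotsCocycle_one : (slotsCocycle h f).1 1 = -(n.negOnePow • f.lin (gen₁ h)) := rfl
lemma slotsCocycle_two : (slotsCocycle h f).1 2 = -(n.negOnePow • f.lin (gen₂ h)) := rfl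

lemma cone_d (y : N.carrier) (v : (twistKernel h).Slots N) :
    (cone (coev h N)).d ((y, v) : N.carrier × (twistKernel h).Slots N) =
      ((-N.d y, coevFun h y + (twistKernel h).dSlots N v) :
        N.carrier × (twistKernel h).Slots N) := rfl

lemma cone_ext {z w : N.carrier × (twistKernel h).Slots N} (h1 : z.1 = w.1)
    (h2 : z.2.1 0 = w.2.1 0) (h3 : z.2.1 1 = w.2.1 1) (h4 : z.2.1 2 = w.2.1 2) : z = w :=
  Prod.ext h1 (twist_ext h h2 h3 h4)

lemma d_slotsCocycle : coevFun h (f.lin (gen₀ h)) +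
    (twistKernel h).dSlots N (slotsCocycle h f) = 0 := by
  have h0 := hom_gen₀_E h f
  have h1 := d_hom_gen₁ h f
  have h2 := d_hom_gen₂ h f
  have h3 : N.par (f.lin (gen₁ h)) = -(n.negOnePow • sgn i • f.lin (gen₁ h)) := by
    rw [par_apply (hom_gen₁_mem h f), Int.negOnePow_add, Int.negOnePow_neg, Int.negOnePow_sub,
      mul_smul, mul_smul]
    change n.negOnePow • sgn i • (-1 : ℤˣ) • f.lin (gen₁ h) = _
    simp
  apply twist_ext <;>
    simp only [Slots.add_apply, Slots.zero_apply, twist_d₀, twist_d₁, twist_d₂, coevFun_zero,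
      coevFun_one, coevFun_two, slotsCocycle_zero, slotsCocycle_one, slotsCocycle_two, map_neg,
      map_zero, h1, h2, d_units_smul, rsmul_E_of h h0, h3]
  · simp
  · simp [smul_smul]
  · rcases Int.units_eq_one_or n.negOnePow with e | e <;>
      rcases Int.units_eq_one_or (sgn i) with e' | e' <;> simp [e, e', h3]

lemma coevFun_gen₁ : coevFun h (f.lin (gen₁ h)) =
    (n + 1).negOnePow • (slotsCocycle h f ◁ ι (α i)) := by
  have h1 := hom_gen₁_E h f
  apply twist_ext <;>
    rw [Slots.units_smul_apply, twist_rsmul, Int.negOnePow_succ] <;>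
    simp [coevFun_zero, coevFun_one, coevFun_two, slotsCocycle_zero, slotsCocycle_one,
      slotsCocycle_two, h1, rsmul_α_of h.symm h1, rsmul_τ_of h.symm h1, twistAct_α, smul_smul]

lemma coevFun_gen₂ : coevFun h (f.lin (gen₂ h)) =
    (n + 1).negOnePow • (slotsCocycle h f ◁ ι (τ i)) := by
  have h2 := hom_gen₂_E h f
  apply twist_ext <;>
    rw [Slots.units_smul_apply, twist_rsmul, Int.negOnePow_succ] <;>
    rcases Int.units_eq_one_or n.negOnePow with e | e <;>
    simp [coevFun_zero, coevFun_one, coevFun_two, slotsCocycle_zero, slotsCocycle_one,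
      slotsCocycle_two, rsmul_E_of h h2, twistAct_τ, e]

lemma coneCocycle_mem : coneCocycle h f ∈ (cone (coev h N)).gr (-(n + 1)) := by
  have h0 := hom_gen₀_mem h f
  have h1 := Submodule.neg_mem _ (units_smul_mem _ n.negOnePow (hom_gen₁_mem h f))
  have h2 := Submodule.neg_mem _ (units_smul_mem _ n.negOnePow (hom_gen₂_mem h f))
  refine ⟨?_, fun k => ?_⟩
  · rw [show -(n + 1) + 1 = -n by ring]; exact h0
  · fin_cases k
    · exact Submodule.zero_mem _
    · rw [show -n + ((α i).deg - 1) = -(n + 1) + (α i).deg by ring] at h1; exact h1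
    · rw [show -n - 3 = -(n + 1) + -2 by ring] at h2; exact h2

lemma slotsCocycle_E : slotsCocycle h f ◁ ι (E i) = slotsCocycle h f := twistMk_E h _ _ _ _

lemma coneCocycle_E : coneCocycle h f ◁ ι (E i) = coneCocycle h f := by
  exact Prod.ext (hom_gen₀_E h f) (slotsCocycle_E h f)

lemma d_coneCocycle : (cone (coev h N)).d (coneCocycle h f) = 0 :=
  (cone_d h _ _).trans (Prod.ext ((congrArg Neg.neg (d_hom_gen₀ h f)).trans neg_zero)
    (d_slotsCocycle h f))

lemma d_coneCocycle₁ :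
    (cone (coev h N)).d ((f.lin (gen₁ h), 0) : N.carrier × (twistKernel h).Slots N) =
      (n + 1).negOnePow • (coneCocycle h f ◁ ι (α i)) := by
  refine (cone_d h _ _).trans (Prod.ext ?_ ?_)
  · refine (congrArg Neg.neg (d_hom_gen₁ h f)).trans ?_
    rw [← Units.neg_smul, ← Int.negOnePow_succ]; rfl
  · rw [map_zero, add_zero]; exact coevFun_gen₁ h f

lemma d_coneCocycle₂ :
    (cone (coev h N)).d ((f.lin (gen₂ h), 0) : N.carrier × (twistKernel h).Slots N) =
      (n + 1).negOnePow • (coneCocycle h f ◁ ι (τ i) - sgn i •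
        ((show (cone (coev h N)).carrier from
          ((f.lin (gen₁ h), 0) : N.carrier × (twistKernel h).Slots N)) ◁ ι (α j))) := by
  refine (cone_d h _ _).trans (Prod.ext ?_ ?_)
  · refine (congrArg Neg.neg (d_hom_gen₂ h f)).trans ?_
    rw [← Units.neg_smul, ← Int.negOnePow_succ]; rfl
  · rw [map_zero, add_zero]
    refine (coevFun_gen₂ h f).trans (congrArg _ ?_)
    refine (sub_zero _).symm.trans (congrArg₂ _ rfl ?_)
    refine (smul_zero (sgn i)).symm.trans (congrArg _ (smul_zero _).symm)

/-- The lift of a morphism from a shift of the resolution to the cone of the map from a module to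
its twist. -/
noncomputable def coneLift : (shiftFunctor _ (1 : ℤ)).obj ((resolution h).shift n) ⟶
    cone (coev h N) :=
  let g := resolutionHom h (M := cone (coev h N)) (n + 1) (coneCocycle h f)
    ((f.lin (gen₁ h), 0) : N.carrier × (twistKernel h).Slots N)
    ((f.lin (gen₂ h), 0) : N.carrier × (twistKernel h).Slots N) (coneCocycle_mem h f)
    ⟨by
      rw [show -(n + 1) + ((α i).deg - 1) + 1 = -n + ((α i).deg - 1) by ring]
      exact hom_gen₁_mem h f, Submodule.zero_mem _⟩
    ⟨by
      rw [show -(n + 1) - 3 + 1 = -n - 3 by ring]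
      exact hom_gen₂_mem h f, Submodule.zero_mem _⟩ (d_coneCocycle h f) (d_coneCocycle₁ h f)
    (d_coneCocycle₂ h f)
  { lin := g.lin
    map_mem := fun {m x} hx => g.map_mem (n := m) (by
      change x ∈ (resolution h).gr (m + (n + 1))
      rw [show m + (n + 1) = m + 1 + n by ring]
      exact hx)
    comm := fun x => by
      refine Eq.trans ?_ (g.comm x)
      refine congrArg g.lin ?_
      change (1 : ℤ).negOnePow • n.negOnePow • (resolution h).d x =
        (n + 1).negOnePow • (resolution h).d x
      rw [smul_smul, ← Int.negOnePow_add, add_comm] }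

lemma coneLift_gen₀ : (coneLift h f).lin (gen₀ h) = coneCocycle h f :=
  (resolutionLin_gen₀ h _ _ _).trans (coneCocycle_E h f)

lemma coneLift_gen₁ : (coneLift h f).lin (gen₁ h) =
    ((f.lin (gen₁ h), 0) : N.carrier × (twistKernel h).Slots N) :=
  (resolutionLin_gen₁ (M := cone (coev h N)) h _ _ _).trans
    (Prod.ext (hom_gen₁_E h f) (smul_zero _))

lemma coneLift_gen₂ : (coneLift h f).lin (gen₂ h) =
    ((f.lin (gen₂ h), 0) : N.carrier × (twistKernel h).Slots N) :=
  (resolutionLin_gen₂ (M := cone (coev h N)) h _ _ _).trans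
    (Prod.ext (hom_gen₂_E h f) (smul_zero _))

lemma coneLift_fst : coneLift h f ≫ coneFst (coev h N) = f⟦(1 : ℤ)⟧' := by
  refine hom_ext fun x => ?_
  have e1 := eq_resolutionLin (M := N) h (coneLift h f ≫ coneFst (coev h N)).lin
  have e2 := eq_resolutionLin (M := N) h f.lin
  have h0 : (coneLift h f ≫ coneFst (coev h N)).lin (gen₀ h) = f.lin (gen₀ h) :=
    congrArg Prod.fst (coneLift_gen₀ h f)
  have h1 : (coneLift h f ≫ coneFst (coev h N)).lin (gen₁ h) = f.lin (gen₁ h) :=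
    congrArg Prod.fst (coneLift_gen₁ h f)
  have h2 : (coneLift h f ≫ coneFst (coev h N)).lin (gen₂ h) = f.lin (gen₂ h) :=
    congrArg Prod.fst (coneLift_gen₂ h f)
  exact LinearMap.congr_fun (e1.trans ((by rw [h0, h1, h2] : _ = _).trans e2.symm)) x

lemma cone_slots {z : N.carrier × (twistKernel h).Slots N}
    (hz : (show (cone (coev h N)).carrier from z) ◁ ι (E i) = z) :
    z.1 ◁ ι (E i) = z.1 ∧ z.2.1 0 = 0 :=
  ⟨congrArg Prod.fst hz, twist_of_E h (congrArg Prod.snd hz)⟩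

lemma exists_coneCocycle_eq {z : N.carrier × (twistKernel h).Slots N}
    (hz : z ∈ (cone (coev h N)).gr (-(n + 1)))
    (hE : (show (cone (coev h N)).carrier from z) ◁ ι (E i) = z)
    (hd : (cone (coev h N)).d z = 0) :
    ∃ f : (resolution h).shift n ⟶ N, coneCocycle h f = z := by
  obtain ⟨y, v⟩ := z
  obtain ⟨hy, hv⟩ := cone_slots h hE
  rw [cone_d] at hd
  have hd1 : N.d y = 0 := neg_eq_zero.1 (congrArg Prod.fst hd)
  have hd2 : coevFun h y + (twistKernel h).dSlots N v = 0 := congrArg Prod.snd hd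
  have hm0 : y ∈ N.gr (-n) := by
    have := hz.1; rwa [show -(n + 1) + 1 = -n by ring] at this
  have hm1 : v.1 1 ∈ N.gr (-n + ((α i).deg - 1)) := by
    have : v.1 1 ∈ N.gr (-(n + 1) + (α i).deg) := hz.2 1
    rwa [show -(n + 1) + (α i).deg = -n + ((α i).deg - 1) by ring] at this
  have hm2 : v.1 2 ∈ N.gr (-n - 3) := by
    have : v.1 2 ∈ N.gr (-(n + 1) + -2) := hz.2 2
    rwa [show -(n + 1) + -2 = -n - 3 by ring] at this
  have e1 := congrArg (fun w : (twistKernel h).Slots N => w.1 1) hd2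
  have e2 := congrArg (fun w : (twistKernel h).Slots N => w.1 2) hd2
  have h3 : N.par (v.1 1) = -(n.negOnePow • sgn i • v.1 1) := by
    rw [par_apply hm1, Int.negOnePow_add, Int.negOnePow_neg, Int.negOnePow_sub,
      mul_smul, mul_smul]
    change n.negOnePow • sgn i • (-1 : ℤˣ) • v.1 1 = _
    simp
  simp only [Slots.add_apply, Slots.zero_apply, twist_d₁, twist_d₂, coevFun_one, coevFun_two,
    h3] at e1 e2
  let f := resolutionHom h n y (-(n.negOnePow • v.1 1)) (-(n.negOnePow • v.1 2)) hm0
    (Submodule.neg_mem _ (units_smul_mem _ _ hm1)) (Submodule.neg_mem _ (units_smul_mem _ _ hm2))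
    hd1 (by rw [map_neg, d_units_smul, eq_neg_of_add_eq_zero_right e1, smul_neg, neg_neg]) (by
      rw [map_neg, d_units_smul, show N.d (v.1 2) = -(y ◁ ι (τ i)) +
        (-(n.negOnePow • sgn i • v.1 1)) ◁ ι (α j) by
          rw [eq_neg_add_iff_add_eq, ← sub_eq_zero, ← e2]; abel]
      rcases Int.units_eq_one_or n.negOnePow with e | e <;>
        rcases Int.units_eq_one_or (sgn i) with e' | e' <;> simp [e, e'] <;> abel)
  have g0 : f.lin (gen₀ h) = y := (resolutionLin_gen₀ h _ _ _).trans hy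
  have g1 : f.lin (gen₁ h) = -(n.negOnePow • v.1 1) := (resolutionLin_gen₁ h _ _ _).trans (by
    rw [smul_neg, units_smul_rsmul, twist_E₁ h v])
  have g2 : f.lin (gen₂ h) = -(n.negOnePow • v.1 2) := (resolutionLin_gen₂ h _ _ _).trans (by
    rw [smul_neg, units_smul_rsmul, twist_E₂ h v])
  refine ⟨f, cone_ext h g0 hv.symm ?_ ?_⟩
  · change -(n.negOnePow • f.lin (gen₁ h)) = v.1 1
    rw [g1, smul_neg, smul_smul, Int.units_mul_self, one_smul, neg_neg]
  · change -(n.negOnePow • f.lin (gen₂ h)) = v.1 2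
    rw [g2, smul_neg, smul_smul, Int.units_mul_self, one_smul, neg_neg]

lemma homotopic_zero_of_coneCocycle_eq {x : N.carrier × (twistKernel h).Slots N}
    (hx : coneCocycle h f = (cone (coev h N)).d x) : Homotopic f 0 := by
  have key : ∃ x ∈ (cone (coev h N)).gr (-n - 2), x ◁ ι (E i) = x ∧
      coneCocycle h f = (cone (coev h N)).d x := by
    refine ⟨(cone (coev h N)).proj (-n - 2) x ◁ ι (E i), ?_, ?_, ?_⟩
    · have := (cone (coev h N)).smul_mem ((cone (coev h N)).proj_mem (-n - 2) x) (ι_E_mem i)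
      rwa [add_zero] at this
    · rw [rsmul_rsmul, E_E]
    · rw [d_rsmul, d_E, rsmul_zero, add_zero, d_proj, ← hx,
        show -n - 2 + 1 = -(n + 1) by ring]
      have := gradeProj_same (cone (coev h N)).isInternal (coneCocycle_mem h f)
      exact (coneCocycle_E h f).symm.trans (congrArg (· ◁ ι (E i)) this.symm)
  obtain ⟨⟨a, v⟩, hm, hE, e⟩ := key
  obtain ⟨ha, hv⟩ := cone_slots h hE
  rw [cone_d] at e
  have e0 : f.lin (gen₀ h) = -N.d a := congrArg Prod.fst e
  have e' : slotsCocycle h f = coevFun h a + (twistKernel h).dSlots N v := congrArg Prod.snd e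
  have e1 := congrArg (fun w : (twistKernel h).Slots N => w.1 1) e'
  have e2 := congrArg (fun w : (twistKernel h).Slots N => w.1 2) e'
  have hm0 : a ∈ N.gr (-n - 1) := by
    have := hm.1; rwa [show -n - 2 + 1 = -n - 1 by ring] at this
  have hm1 : v.1 1 ∈ N.gr (-n - 1 + ((α i).deg - 1)) := by
    have : v.1 1 ∈ N.gr (-n - 2 + (α i).deg) := hm.2 1
    rwa [show -n - 2 + (α i).deg = -n - 1 + ((α i).deg - 1) by ring] at this
  have hm2 : v.1 2 ∈ N.gr (-n - 1 - 3) := by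
    have : v.1 2 ∈ N.gr (-n - 2 + -2) := hm.2 2
    rwa [show -n - 2 + -2 = -n - 1 - 3 by ring] at this
  have h3 : N.par (v.1 1) = n.negOnePow • sgn i • v.1 1 := by
    rw [par_apply hm1, Int.negOnePow_add, Int.negOnePow_sub, Int.negOnePow_neg, Int.negOnePow_sub,
      mul_smul, mul_smul, mul_smul]
    change n.negOnePow • (-1 : ℤˣ) • sgn i • (-1 : ℤˣ) • v.1 1 = _
    simp
  simp only [Slots.add_apply, twist_d₁, twist_d₂, coevFun_one, coevFun_two, h3, slotsCocycle_one,
    slotsCocycle_two] at e1 e2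
  rw [homotopic_zero_iff]
  refine ⟨-a, -(n.negOnePow • v.1 1), -(n.negOnePow • v.1 2), Submodule.neg_mem _ hm0,
    Submodule.neg_mem _ (units_smul_mem _ _ hm1), Submodule.neg_mem _ (units_smul_mem _ _ hm2),
    by rw [e0, map_neg], ?_, ?_⟩
  · rw [map_neg, d_units_smul]
    rcases Int.units_eq_one_or n.negOnePow with e | e <;>
      (simp [e, neg_eq_iff_eq_neg] at e1 ⊢; rw [e1]; try abel)
  · rw [map_neg, d_units_smul]
    rcases Int.units_eq_one_or n.negOnePow with e | e <;>
      rcases Int.units_eq_one_or (sgn i) with e' | e' <;>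
      simp [e, e', neg_eq_iff_eq_neg] at e2 ⊢ <;> rw [e2] <;> abel

lemma exists_coneCocycle_eq_d (hf : Homotopic f 0) :
    ∃ x, coneCocycle h f = (cone (coev h N)).d x := by
  rw [homotopic_zero_iff] at hf
  obtain ⟨z, z', z'', -, hz', -, e0, e1, e2⟩ := hf
  have hE (k : Fin 2) (m : N.carrier) : m ◁ ι (E k) ◁ ι (E k) = m ◁ ι (E k) := by
    rw [rsmul_rsmul, E_E]
  refine ⟨((-(z ◁ ι (E i)), twistMk h 0 ((-(n.negOnePow • z')) ◁ ι (E j))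
    ((-(n.negOnePow • z'')) ◁ ι (E i)) (smul_zero _) (hE j _) (hE i _)) : N.carrier × (twistKernel h).Slots N), ?_⟩
  have h3 : N.par (z' ◁ ι (E j)) = n.negOnePow • sgn i • (z' ◁ ι (E j)) := by
    rw [par_rsmul (ι_E_mem j), par_apply hz', Int.negOnePow_add, Int.negOnePow_sub,
      Int.negOnePow_neg, Int.negOnePow_sub, mul_smul, mul_smul, mul_smul, Int.negOnePow_zero,
      one_smul]
    change (n.negOnePow • (-1 : ℤˣ) • sgn i • (-1 : ℤˣ) • z') ◁ ι (E j) = _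
    simp [units_smul_rsmul]
  have k0 := hom_gen₀_E h f
  have k1 := hom_gen₁_E h f
  have k2 := hom_gen₂_E h f
  rw [e0] at k0
  rw [e1, smul_add, units_smul_rsmul, rsmul_rsmul, α_E h, add_left_inj] at k1
  rw [e2, smul_add, units_smul_rsmul, smul_sub, units_smul_rsmul, rsmul_rsmul, rsmul_rsmul, τ_E,
    α_E h.symm, add_left_inj] at k2
  have hα : z ◁ ι (E i) ◁ ι (α i) = z ◁ ι (α i) := by rw [rsmul_rsmul, E_α]
  have hα' : z' ◁ ι (E j) ◁ ι (α j) = z' ◁ ι (α j) := by rw [rsmul_rsmul, E_α]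
  have hτ : z ◁ ι (E i) ◁ ι (τ i) = z ◁ ι (τ i) := by rw [rsmul_rsmul, E_τ]
  rw [cone_d]
  refine cone_ext h ?_ ?_ ?_ ?_
  · change f.lin (gen₀ h) = -N.d (-(z ◁ ι (E i)))
    rw [map_neg, neg_neg, d_rsmul, d_E, rsmul_zero, add_zero, e0, k0]
  all_goals
    change (slotsCocycle h f).1 _ = (coevFun h (-(z ◁ ι (E i))) + (twistKernel h).dSlots N _).1 _
    simp only [Slots.add_apply, twist_d₀, twist_d₁,
      twist_d₂, twistMk_zero, twistMk_one, twistMk_two, coevFun_zero, coevFun_one, coevFun_two,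
      slotsCocycle_zero, slotsCocycle_one, slotsCocycle_two, smul_neg, units_smul_rsmul, map_neg, map_zero, h3, d_units_smul, d_rsmul, d_E, rsmul_zero, add_zero, e1, e2]
  · simp [rsmul_E_of h (hE i z)]
  · rw [k1, hα, smul_add, smul_smul, Int.units_mul_self, one_smul]
    abel
  · rw [k2, hτ]
    rcases Int.units_eq_one_or n.negOnePow with e | e <;>
      rcases Int.units_eq_one_or (sgn i) with e' | e' <;> simp [e, e', hα', h3] <;> abel

lemma coneCocycle_add (f g : (resolution h).shift n ⟶ N) :
    coneCocycle h (f + g) = coneCocycle h f + coneCocycle h g := by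
  refine cone_ext h rfl (add_zero 0).symm ?_ ?_
  · change -(n.negOnePow • (f.lin (gen₁ h) + g.lin (gen₁ h))) =
      -(n.negOnePow • f.lin (gen₁ h)) + -(n.negOnePow • g.lin (gen₁ h))
    rw [smul_add, neg_add]
  · change -(n.negOnePow • (f.lin (gen₂ h) + g.lin (gen₂ h))) =
      -(n.negOnePow • f.lin (gen₂ h)) + -(n.negOnePow • g.lin (gen₂ h))
    rw [smul_add, neg_add]

lemma coneCocycle_smul (c : ℂ) (f : (resolution h).shift n ⟶ N) :
    coneCocycle h (c • f) = c • coneCocycle h f := by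
  refine cone_ext h rfl (smul_zero c).symm ?_ ?_
  · change -(n.negOnePow • c • f.lin (gen₁ h)) = c • -(n.negOnePow • f.lin (gen₁ h))
    rw [smul_neg, smul_comm]
  · change -(n.negOnePow • c • f.lin (gen₂ h)) = c • -(n.negOnePow • f.lin (gen₂ h))
    rw [smul_neg, smul_comm]

end

/-- The map from the morphisms from a shift of the resolution to the cohomology of the cone. -/
noncomputable def homToCohomology (n : ℤ) :
    ((Q dgAlgebra).obj ((resolution h).shift n) ⟶ (Q dgAlgebra).obj N) →ₗ[ℂ]
      (cone (coev h N)).cohomology :=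
  have hP := resolution_isHomotopicallyProjective h (n := n)
  have hc (φ : (Q dgAlgebra).obj ((resolution h).shift n) ⟶ (Q dgAlgebra).obj N) :=
    (exists_Q_map_eq hP φ).choose_spec
  have key (f g : (resolution h).shift n ⟶ N) (e : (Q dgAlgebra).map f = (Q dgAlgebra).map g) :
      ∃ x, coneCocycle h f = coneCocycle h g + (cone (coev h N)).d x := by
    obtain ⟨x, hx⟩ := exists_coneCocycle_eq_d h (f + (-1 : ℂ) • g)
      ((Q_map_eq_zero hP).1 (by rw [Functor.map_add, Functor.map_smul, e]; simp))
    refine ⟨x, ?_⟩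
    rw [← hx, coneCocycle_add, coneCocycle_smul]
    simp
  { toFun φ := cohomologyClass _ (d_coneCocycle h (exists_Q_map_eq hP φ).choose)
    map_add' φ ψ := by
      obtain ⟨x, hx⟩ := key (exists_Q_map_eq hP (φ + ψ)).choose
        ((exists_Q_map_eq hP φ).choose + (exists_Q_map_eq hP ψ).choose)
        (by rw [hc, Functor.map_add, hc, hc])
      exact cohomologyClass_eq_iff.2 ⟨x, hx.trans (by rw [coneCocycle_add])⟩
    map_smul' c φ := by
      obtain ⟨x, hx⟩ := key (exists_Q_map_eq hP (c • φ)).choose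
        (c • (exists_Q_map_eq hP φ).choose) (by rw [hc, Functor.map_smul, hc])
      exact cohomologyClass_eq_iff.2 ⟨x, hx.trans (by rw [coneCocycle_smul]; rfl)⟩ }

lemma homToCohomology_map {n : ℤ} (f : (resolution h).shift n ⟶ N) :
    homToCohomology h n ((Q dgAlgebra).map f) = cohomologyClass _ (d_coneCocycle h f) := by
  have hP := resolution_isHomotopicallyProjective h (n := n)
  obtain ⟨x, hx⟩ := exists_coneCocycle_eq_d h
    ((exists_Q_map_eq hP ((Q dgAlgebra).map f)).choose + (-1 : ℂ) • f)
    ((Q_map_eq_zero hP).1 (by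
      rw [Functor.map_add, Functor.map_smul, (exists_Q_map_eq hP ((Q dgAlgebra).map f)).choose_spec]
      simp))
  refine cohomologyClass_eq_iff.2 ⟨x, ?_⟩
  rw [← hx, coneCocycle_add, coneCocycle_smul]
  simp

lemma exists_sum_coneCocycle {z : N.carrier × (twistKernel h).Slots N}
    (hd : (cone (coev h N)).d z = 0) :
    ∃ (s : Finset ℤ) (f : ∀ n : ℤ, (resolution h).shift n ⟶ N) (x : (cone (coev h N)).carrier),
      z = ∑ n ∈ s, coneCocycle h (f n) + (cone (coev h N)).d x := by
  let Z := cone (coev h N)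
  let z' : Z.carrier := z
  have hjd : Z.d (z' ◁ ι (E j)) = 0 := by
    rw [d_rsmul, d_E, rsmul_zero, add_zero, show Z.d z' = 0 from hd, smul_zero]
  have hid : Z.d (z' ◁ ι (E i)) = 0 := by
    rw [d_rsmul, d_E, rsmul_zero, add_zero, show Z.d z' = 0 from hd, smul_zero]
  have hj : ∃ x, z' ◁ ι (E j) = Z.d x := by
    have hE : z' ◁ ι (E j) ◁ ι (E j) = z' ◁ ι (E j) := by rw [rsmul_rsmul, E_E]
    obtain ⟨⟨y, v⟩, e⟩ : ∃ w : N.carrier × (twistKernel h).Slots N, w = z' ◁ ι (E j) := ⟨_, rfl⟩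
    rw [← e] at hE hjd ⊢
    have hv := twist_of_E' h (v := v) (congrArg Prod.snd hE)
    have hy : y ◁ ι (E j) = y := congrArg Prod.fst hE
    have e0 := congrArg (fun w : N.carrier × (twistKernel h).Slots N => w.2.1 0) hjd
    replace e0 : (coevFun h y).1 0 + ((twistKernel h).dSlots N v).1 0 = 0 := e0
    rw [coevFun_zero, twist_d₀, hy] at e0
    refine ⟨((v.1 0, 0) : N.carrier × (twistKernel h).Slots N), Eq.trans ?_ (cone_d h _ _).symm⟩
    rw [map_zero, add_zero]
    refine cone_ext h (eq_neg_of_add_eq_zero_left e0) (twist_E₀ h v).symm ?_ ?_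
    · exact hv.1.trans (rsmul_α_of h.symm (twist_E₀ h v)).symm
    · exact hv.2.trans (rsmul_τ_of h.symm (twist_E₀ h v)).symm
  obtain ⟨s, hs⟩ := exists_sum_gradeProj Z.isInternal (z' ◁ ι (E i))
  have hf (n : ℤ) : ∃ f : (resolution h).shift n ⟶ N, coneCocycle h f =
      Z.proj (-(n + 1)) (z' ◁ ι (E i)) := by
    refine exists_coneCocycle_eq h (Z.proj_mem _ _) ?_ ?_
    · have := Z.smul_proj (ι_E_mem i) (-(n + 1)) (z' ◁ ι (E i))
      rw [add_zero, rsmul_rsmul, E_E] at this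
      exact this
    · rw [d_proj, hid, map_zero]
  choose f hf using hf
  obtain ⟨x, hx⟩ := hj
  refine ⟨s.map ⟨fun n => -(n + 1), fun a b e => by simpa using e⟩, f, x, ?_⟩
  rw [Finset.sum_map]
  change z' = _
  rw [← hx]
  have : ∑ n ∈ s, coneCocycle h (f (-(n + 1))) = z' ◁ ι (E i) := by
    rw [← hs s subset_rfl]
    refine Finset.sum_congr rfl fun n _ => ?_
    rw [hf, show -(-(n + 1) + 1) = n by ring]
  refine Eq.trans ?_ (congrArg (· + z' ◁ ι (E j)) this.symm)
  rw [← rsmul_add, add_E h, rsmul_one]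

lemma homToCohomology_bijective :
    Function.Bijective (DirectSum.toModule ℂ ℤ _ (fun n => homToCohomology h (N := N) n)) := by
  classical
  have hP (n : ℤ) := resolution_isHomotopicallyProjective h (n := n)
  have key (s : Finset ℤ) (f : ∀ n : ℤ, (resolution h).shift n ⟶ N) :
      DirectSum.toModule ℂ ℤ _ (fun n => homToCohomology h (N := N) n)
        (∑ n ∈ s, DirectSum.lof ℂ ℤ _ n ((Q dgAlgebra).map (f n))) =
      cohomologyClass (∑ n ∈ s, coneCocycle h (f n)) (by
        rw [map_sum]; exact Finset.sum_eq_zero fun n _ => d_coneCocycle h (f n)) := by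
    rw [map_sum]
    simp only [DirectSum.toModule_lof, homToCohomology_map]
    induction s using Finset.induction_on with
    | empty => rfl
    | insert n s hn ih =>
      rw [Finset.sum_insert hn, ih]
      refine cohomologyClass_eq_iff.2 ⟨0, ?_⟩
      rw [Finset.sum_insert hn, map_zero, add_zero]
  have hv (v : DirectSum ℤ fun n => ((Q dgAlgebra).obj ((resolution h).shift n) ⟶ (Q dgAlgebra).obj N)) :
      ∃ f : ∀ n : ℤ, (resolution h).shift n ⟶ N, (∀ n, (Q dgAlgebra).map (f n) = v n) ∧
        v = ∑ n ∈ DFinsupp.support v, DirectSum.lof ℂ ℤ _ n ((Q dgAlgebra).map (f n)) := by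
    choose f hf using fun n => exists_Q_map_eq (hP n) (v n)
    refine ⟨f, hf, ?_⟩
    simp only [hf]
    exact (DirectSum.sum_support_of v).symm
  constructor
  · rw [injective_iff_map_eq_zero]
    intro v e
    obtain ⟨f, hf, hs⟩ := hv v
    rw [hs, key] at e
    obtain ⟨x, hx⟩ := cohomologyClass_eq_iff.1 (e.trans (show 0 = cohomologyClass 0 (map_zero _) from rfl))
    rw [zero_add] at hx
    refine DFinsupp.ext fun n => ?_
    by_cases hn : n ∈ DFinsupp.support v
    swap
    · exact DFinsupp.notMem_support_iff.1 hn
    · refine (hf n).symm.trans ((Q_map_eq_zero (hP n)).2 (homotopic_zero_of_coneCocycle_eq h (f n)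
        (x := (cone (coev h N)).proj (-(n + 1) - 1) x) ?_))
      rw [d_proj, ← hx, map_sum, sub_add_cancel]
      refine ((Finset.sum_eq_single n (fun m _ hm => ?_) fun hn' => absurd hn hn').trans ?_).symm
      · exact gradeProj_ne _ (coneCocycle_mem h (f m)) (by omega)
      · exact gradeProj_same _ (coneCocycle_mem h (f n))
  · intro c
    obtain ⟨⟨z, hz⟩, rfl⟩ := Submodule.mkQ_surjective _ c
    obtain ⟨s, f, x, hx⟩ := exists_sum_coneCocycle h (z := z) hz
    exact ⟨_, (key s f).trans (cohomologyClass_eq_iff.2 ⟨-x, by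
      rw [map_neg, ← sub_eq_add_neg, eq_sub_iff_add_eq]; exact hx.symm⟩)⟩

end Ginzburg

section

variable {C : Type*} [Category C] [Preadditive C]

/-- A criterion for the bijectivity of a linear map on the value of an additive functor at a direct
sum. -/
lemma bijective_of_isBilimit {k : Type*} [Field k] (F : C ⥤ ModuleCat k) [F.Additive] {J : Type}
    [Finite J] {X : J → C} {b : Bicone X} (hb : b.IsBilimit) {N : Type*} [AddCommGroup N]
    [Module k N] (ψ : F.obj b.pt →ₗ[k] N) (γ : ∀ p, F.obj (X p))
    (hγ : ∀ p x, ∃ c : k, x = c • γ p) (B : Module.Basis J k N)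
    (hB : ∀ p, ψ (F.map (b.ι p) (γ p)) = B p) : Function.Bijective ψ := by
  have := Fintype.ofFinite J
  let e : N →ₗ[k] F.obj b.pt := B.constr k fun p => F.map (b.ι p) (γ p)
  have heB (p : J) : e (B p) = F.map (b.ι p) (γ p) := B.constr_basis k _ p
  have he (n : N) : ψ (e n) = n :=
    LinearMap.congr_fun (B.ext fun p => (by rw [LinearMap.comp_apply, heB, hB]; rfl :
      (ψ ∘ₗ e) (B p) = LinearMap.id (R := k) (B p))) n
  have hs (w : F.obj b.pt) : ∃ n, e n = w := by
    have h1 : ∑ p, F.map (b.ι p) (F.map (b.π p) w) = w := by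
      have := congrArg (fun φ => F.map φ w) (IsBilimit.total hb)
      simp only [CategoryTheory.Functor.map_id, Functor.map_sum] at this
      refine Eq.trans ?_ this
      simp
    choose c hc using fun p => hγ p (F.map (b.π p) w)
    refine ⟨∑ p, c p • B p, ?_⟩
    rw [map_sum, ← h1]
    refine Finset.sum_congr rfl fun p _ => ?_
    rw [hc p, map_smul, map_smul, heB]
  refine ⟨fun w w' h => ?_, fun n => ⟨e n, he n⟩⟩
  obtain ⟨n, rfl⟩ := hs w
  obtain ⟨n', rfl⟩ := hs w'
  rw [he, he] at h
  rw [h]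

variable [HasZeroObject C] [HasShift C ℤ] [∀ n : ℤ, (shiftFunctor C n).Additive]
  [Pretriangulated C]

omit [HasZeroObject C] [HasShift C ℤ] [∀ n : ℤ, (shiftFunctor C n).Additive]
  [Pretriangulated C] in
lemma bicone_ι_comp_sum {J : Type} [Fintype J] {X : J → C} {b : Bicone X} {Y : C}
    (ev : ∀ p, X p ⟶ Y) (p : J) : b.ι p ≫ ∑ q, b.π q ≫ ev q = ev p := by
  rw [Preadditive.comp_sum]
  refine (Finset.sum_eq_single p (fun q _ hq => ?_) fun hp => absurd (Finset.mem_univ p) hp).trans ?_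
  · rw [← Category.assoc, b.ι_π, dif_neg hq.symm, zero_comp]
  · rw [← Category.assoc, b.ι_π, dif_pos rfl, eqToHom_refl, Category.id_comp]

/-- A cone of a morphism from a direct sum. -/
lemma exists_triangle_of_bicone {Y Y' Z : C} {η : Y ⟶ Y'} {δ : Y' ⟶ Z} {ε : Z ⟶ Y⟦(1 : ℤ)⟧}
    (hT : Triangle.mk η δ ε ∈ distTriang C) {J : Type} [Fintype J] {X : J → C} {b : Bicone X}
    (ev : ∀ p, X p ⟶ Y) (ψ : ∀ p, (X p)⟦(1 : ℤ)⟧ ⟶ Z)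
    (hψ : ∀ p, ψ p ≫ ε = -(ev p)⟦(1 : ℤ)⟧')
    (hiso : IsIso (∑ p, (b.π p)⟦(1 : ℤ)⟧' ≫ ψ p)) :
    ∃ δ' : Y' ⟶ b.pt⟦(1 : ℤ)⟧, Triangle.mk (∑ p, b.π p ≫ ev p) η δ' ∈ distTriang C := by
  let e := asIso (∑ p, (b.π p)⟦(1 : ℤ)⟧' ≫ ψ p)
  refine ⟨δ ≫ e.inv, (rotate_distinguished_triangle _).2 (isomorphic_distinguished _ hT _ ?_)⟩
  refine Triangle.isoMk _ _ (Iso.refl _) (Iso.refl _) e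
    ((Category.comp_id η).trans (Category.id_comp η).symm) ?_ ?_
  · change (δ ≫ e.inv) ≫ e.hom = 𝟙 _ ≫ δ
    rw [Category.assoc, e.inv_hom_id, Category.comp_id, Category.id_comp]
  change (-(∑ p, b.π p ≫ ev p)⟦(1 : ℤ)⟧') ≫ (𝟙 Y)⟦(1 : ℤ)⟧' =
    (∑ p, (b.π p)⟦(1 : ℤ)⟧' ≫ ψ p) ≫ ε
  rw [CategoryTheory.Functor.map_id, Category.comp_id, Functor.map_sum, Preadditive.sum_comp,
    ← Finset.sum_neg_distrib]
  refine Finset.sum_congr rfl fun p _ => ?_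
  rw [Category.assoc, hψ, Functor.map_comp, Preadditive.comp_neg]

end

lemma dfinsupp_basis_apply {R ι : Type*} [Semiring R] [DecidableEq ι] {M : ι → Type*}
    [∀ n, AddCommMonoid (M n)] [∀ n, Module R (M n)] {η : ι → Type*}
    (b : ∀ n, Module.Basis (η n) R (M n)) (p : Σ n, η n) :
    DFinsupp.basis b p = DFinsupp.single p.1 (b p.1 p.2) := by
  rw [Module.Basis.apply_eq_iff, DFinsupp.basis]
  change (sigmaFinsuppLequivDFinsupp R).symm
    (DFinsupp.mapRange.linearEquiv (fun n => (b n).repr) _) = _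
  rw [LinearEquiv.symm_apply_eq]
  refine (DFinsupp.mapRange_single (hf := fun n => map_zero _)).trans ?_
  refine Eq.trans ?_ (sigmaFinsuppEquivDFinsupp_single p (1 : R)).symm
  simp

lemma units_smul_map {R V : Type*} [Ring R] [AddCommGroup V] [Module R V] (D : V →ₗ[R] V)
    (s t : ℤˣ) (z : V) : s • t • D (s • t • z) = D z := by
  rcases Int.units_eq_one_or s with rfl | rfl <;> rcases Int.units_eq_one_or t with rfl | rfl <;>
    simp

namespace DGDerivedCategory

open DGModule

variable {k : Type} [Field k] {A : DGAlgebra k}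

/-- The cohomology of `Q M`. -/
noncomputable def cohomologyIso (M : DGModule A) :
    (cohomologyFunctor A).obj ((Q A).obj M) ≅ ModuleCat.of k M.cohomology :=
  (cohomologyFunctorFac A).app ((DGHomotopyCategory.q A).obj M)

lemma cohomologyIso_naturality {M N : DGModule A} (f : M ⟶ N) :
    (cohomologyFunctor A).map ((Q A).map f) ≫ (cohomologyIso N).hom =
      (cohomologyIso M).hom ≫ ModuleCat.ofHom (cohomologyMap f) :=
  (cohomologyFunctorFac A).hom.naturality ((DGHomotopyCategory.q A).map f)

instance : (cohomologyFunctor A).ReflectsIsomorphisms where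
  reflects {X Y} φ hφ := by
    obtain ⟨M, ⟨e⟩⟩ := exists_iso_Q X
    obtain ⟨N, ⟨e'⟩⟩ := exists_iso_Q Y
    obtain ⟨L, s, f, hs, hf⟩ := exists_rightFraction (e.inv ≫ φ ≫ e'.hom)
    have h1 := isIso_Q_of_isQis hs
    have h2 : IsIso ((cohomologyFunctor A).map ((Q A).map f)) := by
      rw [← hf]
      simp only [Functor.map_comp]
      infer_instance
    have h3 : IsIso ((Q A).map f) := by
      refine isIso_Q_of_isQis (isQis_of_isIso_cohomology ?_)
      exact (NatIso.isIso_map_iff (cohomologyFunctorFac A) _).1 h2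
    have h4 : φ = e.hom ≫ inv ((Q A).map s) ≫ (Q A).map f ≫ e'.inv := by
      rw [← hf]; simp
    rw [h4]
    infer_instance

end DGDerivedCategory

namespace Ginzburg

open DGModule MatrixKernel DGDerivedCategory

variable {i j : Fin 2} (h : i ≠ j)

lemma exists_cohomologyClass_resolution (x : (resolution h).carrier)
    (hx : (resolution h).d x = 0) :
    ∃ (c : ℂ) (y : (resolution h).carrier), x = c • gen₀ h + (resolution h).d y := by
  let c : ℂ := (augmentation h).lin x
  obtain ⟨y, hy⟩ := (isQis_augmentation h).inj (x - c • gen₀ h) (0 : ℂ)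
    (by rw [map_sub, hx, map_smul, d_gen₀, smul_zero, sub_zero]) (by
      rw [map_zero, augmentation_lin]
      change char i (x.1.1 - c • ι (E i)) = 0
      rw [map_sub, map_smul, char_E, smul_eq_mul, mul_one]
      exact sub_self _)
  exact ⟨c, y, by rw [← hy]; abel⟩

/-- The morphisms to the cone of the map from a module to its twist. -/
lemma homToCohomology_injective {N : DGModule dgAlgebra} (n : ℤ) :
    Function.Injective (homToCohomology h (N := N) n) := fun φ ψ e => by
  refine DirectSum.of_injective (β := fun n =>
    ((Q dgAlgebra).obj ((resolution h).shift n) ⟶ (Q dgAlgebra).obj N)) n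
    ((homToCohomology_bijective h (N := N)).1 ?_)
  have key (χ) := DirectSum.toModule_lof (M := fun n =>
    ((Q dgAlgebra).obj ((resolution h).shift n) ⟶ (Q dgAlgebra).obj N))
    (φ := fun n => homToCohomology h (N := N) n) ℂ n χ
  exact (key φ).trans (e.trans (key ψ).symm)

/-- The shifts of the resolution represent those of the shifts of a simple object. -/
noncomputable def simpleShiftShiftIso (n : ℤ) :
    (((simple i)⟦n⟧)⟦(1 : ℤ)⟧).obj ≅
      (Q dgAlgebra).obj ((shiftFunctor _ (1 : ℤ)).obj ((resolution h).shift n)) :=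
  ((finiteDimensional dgAlgebra).ι.commShiftIso (1 : ℤ)).app ((simple i)⟦n⟧) ≪≫
    (shiftFunctor _ (1 : ℤ)).mapIso (simpleShiftIso h n) ≪≫
    ((Q dgAlgebra).commShiftIso (1 : ℤ)).symm.app ((resolution h).shift n)

/-- The image of the cone triangle in the derived category. -/
lemma _root_.DGDerivedCategory.coneTriangle_distinguished {k : Type} [Field k] {A : DGAlgebra k}
    {M N : DGModule A} (f : M ⟶ N) :
    Triangle.mk ((Q A).map f) ((Q A).map (coneInr f)) ((Q A).map (coneFst f) ≫
      ((Q A).commShiftIso (1 : ℤ)).hom.app M) ∈ distTriang (DGDerivedCategory A) := by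
  refine isomorphic_distinguished _ ((Qh A).map_distinguished _
    (DGHomotopyCategory.coneTriangleh_distinguished f)) _ (Triangle.isoMk _ _ (Iso.refl _)
    (Iso.refl _) (Iso.refl _) ?_ ?_ ?_)
  · exact (Category.comp_id _).trans (Category.id_comp _).symm
  · exact (Category.comp_id _).trans (Category.id_comp _).symm
  · refine Eq.trans ?_ (Category.id_comp _).symm
    refine (congrArg (fun φ => _ ≫ φ) (CategoryTheory.Functor.map_id _ _)).trans
      ((Category.comp_id _).trans ?_)
    refine (congrArg (fun φ => (Q A).map (coneFst f) ≫ φ)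
      (Functor.commShiftIso_comp_hom_app (DGHomotopyCategory.q A) (Qh A) (1 : ℤ) M)).trans ?_
    refine (Category.assoc _ _ _).symm.trans
      (congrArg (fun φ => φ ≫ ((Qh A).commShiftIso (1 : ℤ)).hom.app _) ?_)
    exact ((Qh A).map_comp _ _).symm

/-- The natural transformation from the identity functor to the twist functor. -/
lemma exists_twist_triangle : ∃ η : 𝟭 Dfd ⟶ (twist h).equiv.functor, ∀ (Y : Dfd)
    (N : DGModule dgAlgebra) (e : Y.obj ≅ (Q dgAlgebra).obj N), ∃ (Z : Dfd)
    (δ : (twist h).equiv.functor.obj Y ⟶ Z) (ε : Z ⟶ Y⟦(1 : ℤ)⟧)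
    (κ : Z.obj ≅ (Q dgAlgebra).obj (cone (coev h N))),
    Triangle.mk (η.app Y) δ ε ∈ distTriang Dfd ∧
      ε.hom ≫ ((finiteDimensional dgAlgebra).ι.commShiftIso (1 : ℤ)).hom.app Y ≫ e.hom⟦(1 : ℤ)⟧' =
        κ.hom ≫ (Q dgAlgebra).map (coneFst (coev h N)) ≫
          ((Q dgAlgebra).commShiftIso (1 : ℤ)).hom.app N := by
  obtain ⟨σ, hσ⟩ := exists_natTrans (Functor.rightUnitor (Q dgAlgebra) ≪≫
    (Functor.leftUnitor (Q dgAlgebra)).symm) (twistKernel h).isDerivable.fac (coevTrans h)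
  let η : 𝟭 Dfd ⟶ (twist h).equiv.functor :=
    { app := fun Y => ObjectProperty.homMk (σ.app Y.obj)
      naturality := fun Y Y' f => by
        ext
        exact σ.naturality f.hom }
  refine ⟨η, fun Y N e => ?_⟩
  obtain ⟨Z, δ, ε, hT⟩ := distinguished_cocone_triangle (η.app Y)
  let e' := (twistKernel h).isDerivable.functor.mapIso e ≪≫
    (twistKernel h).isDerivable.fac.app N
  obtain ⟨φ, h1, -⟩ := exists_iso_of_arrow_iso _ _
    ((finiteDimensional dgAlgebra).ι.map_distinguished _ hT)
    (coneTriangle_distinguished (coev h N)) (Arrow.isoMk e e' (by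
      have h1 := σ.naturality e.hom
      have h2 := hσ N
      have h3 : (twistKernel h).isDerivable.fac.inv.app N ≫
          (twistKernel h).isDerivable.fac.hom.app N = 𝟙 _ := Iso.inv_hom_id_app _ _
      have h4 : σ.app ((Q dgAlgebra).obj N) ≫ (twistKernel h).isDerivable.fac.hom.app N =
          (Q dgAlgebra).map (coev h N) := by
        rw [h2]
        simp only [Category.assoc, h3]
        refine (congrArg (fun φ => _ ≫ φ) (Category.comp_id _)).trans ?_
        refine (congrArg (fun φ => φ ≫ _) (Category.id_comp _)).trans (Category.id_comp _)
      refine (congrArg (fun φ => e.hom ≫ φ) h4).symm.trans ?_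
      refine (Category.assoc _ _ _).symm.trans ((congrArg (fun φ => φ ≫
        (twistKernel h).isDerivable.fac.hom.app N) h1).trans (Category.assoc _ _ _))))
  refine ⟨Z, δ, ε, Triangle.π₃.mapIso φ, hT, ?_⟩
  have h3 := φ.hom.comm₃
  rw [h1] at h3
  refine Eq.trans ?_ h3
  exact (Category.assoc _ _ _).symm

/-- The morphisms from the shifts of a simple object are finite dimensional. -/
lemma finite_simple_hom (n : ℤ) (Y : Dfd) : Module.Finite ℂ ((simple i)⟦n⟧ ⟶ Y) := by
  obtain ⟨j, h⟩ := exists_ne i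
  obtain ⟨η, hη⟩ := exists_twist_triangle h.symm
  obtain ⟨N, ⟨e⟩⟩ := exists_iso_Q Y.obj
  obtain ⟨Z, δ, ε, κ, -, -⟩ := hη Y N e
  have : Module.Finite ℂ (cone (coev h.symm N)).cohomology := (finiteDimensional_Q_iff _).1
    ((finiteDimensional dgAlgebra).prop_of_iso κ Z.property)
  have := Module.Finite.of_injective _ (homToCohomology_injective h.symm (N := N) n)
  exact Module.Finite.equiv (homSimpleEquiv h.symm n e).symm

/-- The twist functor is a twist functor. -/
theorem isTwist_twist : IsTwist (simple i) (twist h).equiv.functor := by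
  obtain ⟨η, hη⟩ := exists_twist_triangle h
  refine ⟨η, fun Y => ?_⟩
  obtain ⟨N, ⟨e⟩⟩ := exists_iso_Q Y.obj
  obtain ⟨Z, δ, ε, κ, hT, hκ⟩ := hη Y N e
  have hfin : Module.Finite ℂ (cone (coev h N)).cohomology := (finiteDimensional_Q_iff _).1
    ((finiteDimensional dgAlgebra).prop_of_iso κ Z.property)
  have hfin' (n : ℤ) := finite_simple_hom (i := i) n Y
  let b (n : ℤ) := Module.finBasis ℂ ((simple i)⟦n⟧ ⟶ Y)
  let b' (n : ℤ) := (b n).map ((homSimpleEquiv h n e).trans (LinearEquiv.neg ℂ))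
  let J := Σ n : ℤ, Fin (Module.finrank ℂ ((simple i)⟦n⟧ ⟶ Y))
  let B : Module.Basis J ℂ (cone (coev h N)).cohomology :=
    (DFinsupp.basis b').map (LinearEquiv.ofBijective _ (homToCohomology_bijective h (N := N)))
  have : Finite J := Module.Finite.finite_basis B
  have := Fintype.ofFinite J
  have hf (p : J) := exists_Q_map_eq (resolution_isHomotopicallyProjective h) (b' p.1 p.2)
  choose f hf using hf
  have hB (p : J) : B p = cohomologyClass _ (d_coneCocycle h (f p)) := by
    rw [← homToCohomology_map, hf]
    refine (Module.Basis.map_apply _ _ _).trans ?_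
    exact (congrArg _ (dfinsupp_basis_apply b' p)).trans (DirectSum.toModule_lof (M := fun n =>
      ((Q dgAlgebra).obj ((resolution h).shift n) ⟶ (Q dgAlgebra).obj N))
      (φ := fun n => homToCohomology h (N := N) n) ℂ p.1 (b' p.1 p.2))
  have : HasFiniteProducts Dfd := hasFiniteProducts_of_has_binary_and_terminal
  have : HasFiniteBiproducts Dfd := HasFiniteBiproducts.of_hasFiniteProducts
  let X (p : J) : Dfd := (simple i)⟦p.1⟧
  let bc := biproduct.bicone X
  let ψ (p : J) : (X p)⟦(1 : ℤ)⟧ ⟶ Z := ObjectProperty.homMk ((simpleShiftShiftIso h p.1).hom ≫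
    (Q dgAlgebra).map (coneLift h (f p)) ≫ κ.inv)
  have hψ (p : J) : ψ p ≫ ε = -(b p.1 p.2)⟦(1 : ℤ)⟧' := by
    have h1 : (Q dgAlgebra).map (f p) =
        -((simpleShiftIso h p.1).inv ≫ (b p.1 p.2).hom ≫ e.hom) :=
      (hf p).trans (Module.Basis.map_apply _ _ _)
    have h2 := ((finiteDimensional dgAlgebra).ι.commShiftIso (1 : ℤ)).hom.naturality (b p.1 p.2)
    have h3 := ((Q dgAlgebra).commShiftIso (1 : ℤ)).hom.naturality (f p)
    have h4 : (simpleShiftShiftIso h p.1).hom ≫ ((Q dgAlgebra).commShiftIso (1 : ℤ)).hom.app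
        ((resolution h).shift p.1) = ((finiteDimensional dgAlgebra).ι.commShiftIso (1 : ℤ)).hom.app
        (X p) ≫ (shiftFunctor _ (1 : ℤ)).map (simpleShiftIso h p.1).hom := by
      refine (Category.assoc _ _ _).trans (congrArg (fun φ => _ ≫ φ) ?_)
      refine (Category.assoc _ _ _).trans ((congrArg (fun φ => _ ≫ φ) ?_).trans
        (Category.comp_id _))
      exact ((Q dgAlgebra).commShiftIso (1 : ℤ)).inv_hom_id_app _
    ext
    refine (cancel_mono (((finiteDimensional dgAlgebra).ι.commShiftIso (1 : ℤ)).hom.app Y ≫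
      (shiftFunctor _ (1 : ℤ)).map e.hom)).1 ((Category.assoc _ _ _).trans ?_)
    calc (ψ p).hom ≫ ε.hom ≫ ((finiteDimensional dgAlgebra).ι.commShiftIso (1 : ℤ)).hom.app Y ≫
          (shiftFunctor _ (1 : ℤ)).map e.hom
        = (simpleShiftShiftIso h p.1).hom ≫ (Q dgAlgebra).map (coneLift h (f p)) ≫
          (Q dgAlgebra).map (coneFst (coev h N)) ≫
            ((Q dgAlgebra).commShiftIso (1 : ℤ)).hom.app N := by
          rw [hκ]; simp only [ψ, ObjectProperty.homMk_hom, Category.assoc, Iso.inv_hom_id_assoc]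
      _ = (simpleShiftShiftIso h p.1).hom ≫ ((Q dgAlgebra).commShiftIso (1 : ℤ)).hom.app
          ((resolution h).shift p.1) ≫ (shiftFunctor _ (1 : ℤ)).map ((Q dgAlgebra).map (f p)) := by
          rw [← Functor.map_comp_assoc, coneLift_fst]
          exact congrArg (fun φ => _ ≫ φ) h3
      _ = ((finiteDimensional dgAlgebra).ι.commShiftIso (1 : ℤ)).hom.app (X p) ≫
          (shiftFunctor _ (1 : ℤ)).map ((simpleShiftIso h p.1).hom ≫ (Q dgAlgebra).map (f p)) := by
          rw [Functor.map_comp, ← Category.assoc, h4, Category.assoc]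
      _ = -(((finiteDimensional dgAlgebra).ι.commShiftIso (1 : ℤ)).hom.app (X p) ≫
          (shiftFunctor _ (1 : ℤ)).map (b p.1 p.2).hom ≫ (shiftFunctor _ (1 : ℤ)).map e.hom) := by
          rw [h1, Preadditive.comp_neg, Iso.hom_inv_id_assoc, Functor.map_neg, Functor.map_comp,
            Preadditive.comp_neg]
      _ = _ := by
          refine congrArg Neg.neg ?_ |>.trans (Preadditive.neg_comp _ _).symm
          exact (Category.assoc _ _ _).symm.trans ((congrArg (fun φ => φ ≫ _) h2.symm).trans
            (Category.assoc _ _ _))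
  have hiso : IsIso (∑ p, (bc.π p)⟦(1 : ℤ)⟧' ≫ ψ p) := by
    let H := (finiteDimensional dgAlgebra).ι ⋙ DGDerivedCategory.cohomologyFunctor dgAlgebra
    let Ψ := ∑ p, (bc.π p)⟦(1 : ℤ)⟧' ≫ ψ p
    let θ : H.obj Z ≅ ModuleCat.of ℂ (cone (coev h N)).cohomology :=
      (DGDerivedCategory.cohomologyFunctor dgAlgebra).mapIso κ ≪≫ cohomologyIso _
    let ξ (p : J) := (DGDerivedCategory.cohomologyFunctor dgAlgebra).mapIso
      (simpleShiftShiftIso h p.1) ≪≫ cohomologyIso _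
    have h0 (p : J) : ((shiftFunctor _ (1 : ℤ)).obj ((resolution h).shift p.1)).d (gen₀ h) = 0 := by
      change (1 : ℤ).negOnePow • p.1.negOnePow • (resolution h).d (gen₀ h) = 0
      rw [d_gen₀, smul_zero, smul_zero]
    let γ (p : J) := (ξ p).inv (cohomologyClass (M := (shiftFunctor _ (1 : ℤ)).obj
          ((resolution h).shift p.1)) (gen₀ h) (h0 p))
    have hγ (p : J) (x) : ∃ c : ℂ, x = c • γ p := by
      obtain ⟨⟨y, hy⟩, hy'⟩ := Submodule.mkQ_surjective _ ((ξ p).hom x)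
      replace hy : (1 : ℤ).negOnePow • p.1.negOnePow • (resolution h).d y = 0 := hy
      rw [smul_eq_zero_iff_eq, smul_eq_zero_iff_eq] at hy
      obtain ⟨c, z, hz⟩ := exists_cohomologyClass_resolution h y hy
      refine ⟨c, ?_⟩
      have e1 : (ξ p).hom x = c • cohomologyClass (M := (shiftFunctor _ (1 : ℤ)).obj
          ((resolution h).shift p.1)) (gen₀ h) (h0 p) := by
        refine hy'.symm.trans ((cohomologyClass_eq_iff (M := (shiftFunctor _ (1 : ℤ)).obj
          ((resolution h).shift p.1)) (m' := c • gen₀ h)).2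
          ⟨(1 : ℤ).negOnePow • p.1.negOnePow • z, ?_⟩)
        exact hz.trans (congrArg (fun w => c • gen₀ h + w) (units_smul_map _ _ _ z).symm)
      calc x = (ξ p).inv ((ξ p).hom x) := (Iso.hom_inv_id_apply (ξ p) x).symm
        _ = _ := by rw [e1]; exact map_smul (ξ p).inv.hom c _
    have hB' (p : J) : (H.map Ψ ≫ θ.hom).hom ((shiftFunctor Dfd (1 : ℤ) ⋙ H).map (bc.ι p) (γ p)) =
        B p := by
      have e1 : (shiftFunctor Dfd (1 : ℤ)).map (bc.ι p) ≫ Ψ = ψ p := by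
        exact bicone_ι_comp_sum (b := (shiftFunctor Dfd (1 : ℤ)).mapBicone bc) ψ p
      have e2 : (shiftFunctor Dfd (1 : ℤ) ⋙ H).map (bc.ι p) ≫ H.map Ψ ≫ θ.hom = (ξ p).hom ≫
          ModuleCat.ofHom (cohomologyMap (coneLift h (f p))) := by
        refine (Category.assoc _ _ _).symm.trans ((congrArg (fun φ => φ ≫ _)
          (H.map_comp _ _).symm).trans ?_)
        refine (congrArg (fun φ => H.map φ ≫ _) e1).trans ?_
        change (DGDerivedCategory.cohomologyFunctor dgAlgebra).map ((simpleShiftShiftIso h p.1).hom ≫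
          (Q dgAlgebra).map (coneLift h (f p)) ≫ κ.inv) ≫
          (DGDerivedCategory.cohomologyFunctor dgAlgebra).map κ.hom ≫ (cohomologyIso _).hom = _
        rw [← Functor.map_comp_assoc, Category.assoc, Category.assoc, Iso.inv_hom_id,
          Category.comp_id, Functor.map_comp, Category.assoc, cohomologyIso_naturality]
        exact (Category.assoc _ _ _).symm
      refine (ConcreteCategory.congr_hom e2 (γ p)).trans ?_
      refine (congrArg (cohomologyMap (coneLift h (f p))) (Iso.inv_hom_id_apply (ξ p) _)).trans ?_
      refine Eq.trans ?_ (hB p).symm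
      exact cohomologyClass_eq_iff.2 ⟨0, by rw [map_zero, add_zero]; exact coneLift_gen₀ h (f p)⟩
    have := bijective_of_isBilimit (shiftFunctor Dfd (1 : ℤ) ⋙ H) (biproduct.isBilimit X)
      (H.map Ψ ≫ θ.hom).hom γ hγ B hB'
    have h1 : IsIso (H.map Ψ ≫ θ.hom) := (ConcreteCategory.isIso_iff_bijective _).2 this
    have h2 : IsIso (H.map Ψ) := IsIso.of_isIso_comp_right _ θ.hom
    exact isIso_of_reflects_iso Ψ H
  obtain ⟨δ', hδ'⟩ := exists_triangle_of_bicone hT (b := bc) (fun p => b p.1 p.2) ψ hψ hiso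
  refine ⟨fun n => Fin (Module.finrank ℂ ((simple i)⟦n⟧ ⟶ Y)), b, bc.toCocone, _, δ',
    ⟨(biproduct.isBilimit X).isColimit⟩, fun p => ?_, hδ'⟩
  exact bicone_ι_comp_sum _ _

end Ginzburg

namespace DGModule

variable {k : Type} [Field k] {A : DGAlgebra k} {M : DGModule A}

/-- The kernel of the map from a nonpositively graded dg module to its cohomology in degree `0`. -/
noncomputable def cohomologyKernel (hA : ∀ n > 0, A.gr n = ⊥) (hM : ∀ n > 0, M.gr n = ⊥) :
    Sub M where
  sub :=
    { carrier := {m | ∃ y, M.proj 0 m = M.d y}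
      add_mem' := by
        rintro m m' ⟨y, hy⟩ ⟨y', hy'⟩
        exact ⟨y + y', by rw [map_add, map_add, hy, hy']⟩
      zero_mem' := ⟨0, by rw [map_zero, map_zero]⟩
      smul_mem' := by
        rintro a m ⟨y, hy⟩
        obtain ⟨a, rfl⟩ := op_surjective a
        refine algebra_induction A (p := fun a => ∃ y, M.proj 0 (op a • m) = M.d y) a ?_ ?_ ?_
        · intro j a ha
          have h1 : M.proj 0 (op a • m) = op a • M.proj (-j) m := by
            rw [smul_proj M ha, neg_add_cancel]
          rcases lt_trichotomy j 0 with hj | rfl | hj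
          · have h2 := M.proj_mem (-j) m
            rw [hM _ (by omega), Submodule.mem_bot] at h2
            exact ⟨0, by rw [h1, h2, smul_zero, map_zero]⟩
          · have h2 : A.d a = 0 := by
              have := A.d_mem ha
              rwa [hA _ (by omega), Submodule.mem_bot] at this
            refine ⟨op a • y, ?_⟩
            rw [h1, neg_zero, hy, d_smul, h2, MulOpposite.op_zero, zero_smul, add_zero]
          · rw [hA j hj, Submodule.mem_bot] at ha
            subst ha
            exact ⟨0, by simp⟩
        · exact ⟨0, by simp⟩
        · rintro a b ⟨y, h1⟩ ⟨y', h2⟩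
          exact ⟨y + y', by rw [MulOpposite.op_add, add_smul, map_add, h1, h2, map_add]⟩ }
  proj_mem j m := by
    rintro ⟨y, hy⟩
    by_cases hj : j = 0
    · subst hj
      exact ⟨y, by rw [gradeProj_same _ (M.proj_mem _ _), hy]⟩
    · exact ⟨0, by rw [gradeProj_ne _ (M.proj_mem _ _) hj, map_zero]⟩
  d_mem m _ := ⟨M.proj (-1) m, by rw [d_proj, neg_add_cancel]⟩

variable (hA : ∀ n > 0, A.gr n = ⊥) (hM : ∀ n > 0, M.gr n = ⊥)

lemma isQis_cohomologyKernel_π (h : ∀ i ≠ 0, M.ExactAt i) :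
    IsQis (cohomologyKernel hA hM).π := by
  refine isQis_of_surjective (cohomologyKernel hA hM).π_surjective fun m hm hd => ?_
  have : (cohomologyKernel hA hM).toDG.Acyclic := acyclic_of_exactAt fun i m hm hd => by
    replace hm : m.1 ∈ M.gr i := hm
    by_cases hi : i = 0
    · subst hi
      obtain ⟨y, hy⟩ := m.2
      refine ⟨⟨M.proj (-1) y, 0, ?_⟩, Subtype.ext ?_⟩
      · rw [gradeProj_ne _ (M.proj_mem (-1) y) (by omega), map_zero]
      · change M.d (M.proj (-1) y) = m.1
        rw [d_proj, ← hy, neg_add_cancel, gradeProj_same _ (M.proj_mem _ _), gradeProj_same _ hm]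
    by_cases hi' : i > 0
    · rw [hM i hi', Submodule.mem_bot] at hm
      exact ⟨0, Subtype.ext ((congrArg Subtype.val (map_zero _)).trans hm.symm)⟩
    · obtain ⟨y, h1, h2⟩ := (h i hi).proj (m := m.1) (by
        rw [show M.d m.1 = 0 from congrArg Subtype.val hd, map_zero])
      refine ⟨⟨y, 0, ?_⟩, Subtype.ext (h2.trans (gradeProj_same _ hm))⟩
      rw [gradeProj_ne _ h1 (by omega), map_zero]
  obtain ⟨m', e⟩ := this ⟨m, (cohomologyKernel hA hM).π_eq_zero.1 hm⟩ (Subtype.ext hd)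
  exact ⟨m'.1, (cohomologyKernel hA hM).π_eq_zero.2 m'.2, congrArg Subtype.val e⟩

lemma gr_quot_cohomologyKernel {i : ℤ} (hi : i ≠ 0) :
    (cohomologyKernel hA hM).quot.gr i = ⊥ := by
  rw [eq_bot_iff]
  rintro _ ⟨m, hm, rfl⟩
  exact (cohomologyKernel hA hM).π_eq_zero.2 ⟨0, by rw [gradeProj_ne _ hm hi, map_zero]⟩

/-- Dg modules concentrated in degree `0`. -/
def InDegreeZero (M : DGModule A) : Prop := ∀ i ≠ 0, M.gr i = ⊥

lemma InDegreeZero.mem (h : M.InDegreeZero) (m : M.carrier) : m ∈ M.gr 0 := by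
  obtain ⟨s, hs⟩ := exists_sum_gradeProj M.isInternal m
  rw [← hs s subset_rfl]
  refine Submodule.sum_mem _ fun i _ => ?_
  by_cases hi : i = 0
  · subst hi; exact M.proj_mem _ _
  · have := M.proj_mem i m
    rw [h i hi, Submodule.mem_bot] at this
    rw [this]; exact Submodule.zero_mem _

lemma InDegreeZero.d_eq_zero (h : M.InDegreeZero) (m : M.carrier) : M.d m = 0 := by
  have := M.d_mem (h.mem m)
  rwa [h _ (by omega), Submodule.mem_bot] at this

lemma InDegreeZero.smul_eq_zero (h : M.InDegreeZero) (m : M.carrier) {a : A.carrier} {n : ℤ}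
    (ha : a ∈ A.gr n) (hn : n ≠ 0) : op a • m = 0 := by
  have := M.smul_mem (h.mem m) ha
  rwa [h _ (by omega), Submodule.mem_bot] at this

lemma InDegreeZero.finite (h : M.InDegreeZero) [Module.Finite k M.cohomology] :
    Module.Finite k M.carrier := by
  let f : M.carrier →ₗ[k] M.cohomology :=
    { toFun := fun m => cohomologyClass m (h.d_eq_zero m)
      map_add' := fun _ _ => rfl
      map_smul' := fun _ _ => rfl }
  refine Module.Finite.of_injective f fun m m' e => ?_
  obtain ⟨x, hx⟩ := cohomologyClass_eq_iff.1 e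
  rw [hx, h.d_eq_zero, add_zero]

end DGModule

namespace DGDerivedCategory

open DGModule

variable {k : Type} [Field k] {A : DGAlgebra k}

lemma exists_inDegreeZero (hA : ∀ n > 0, A.gr n = ⊥) {X : DGDerivedCategory A}
    (hX : concentrated A {0} X) : ∃ N : DGModule A, N.InDegreeZero ∧ Nonempty (X ≅ (Q A).obj N) := by
  obtain ⟨M, ⟨e⟩, hM⟩ := hX
  have h1 : IsQis (trunc hA M 0).ι :=
    isQis_trunc_ι hA fun i hi => hM i (by simp; omega)
  have h2 (i : ℤ) (hi : i > 0) : (trunc hA M 0).toDG.gr i = ⊥ := by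
    rw [eq_bot_iff]
    exact fun m hm => Subtype.ext (eq_zero_of_mem_gr_trunc hA hi m.2 hm)
  have h3 : IsQis (cohomologyKernel hA h2).π :=
    isQis_cohomologyKernel_π hA h2 fun i hi => (h1.exactAt_iff i).2 (hM i hi)
  have := isIso_Q_of_isQis h1
  have := isIso_Q_of_isQis h3
  exact ⟨_, fun i hi => gr_quot_cohomologyKernel hA h2 hi,
    ⟨e ≪≫ (asIso ((Q A).map (trunc hA M 0).ι)).symm ≪≫
      asIso ((Q A).map (cohomologyKernel hA h2).π)⟩⟩

end DGDerivedCategory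

namespace Ginzburg

open DGModule DGDerivedCategory

section

variable {V : DGModule dgAlgebra} (hV : V.InDegreeZero) {i : Fin 2}
  (hi : ∀ (a : Alg) (v : V.carrier), v ◁ a = char i a • v)

/-- The morphism from a simple module given by a vector. -/
noncomputable def ofSimple (v : V.carrier) : simpleModule i ⟶ V :=
  letI : Module Algᵐᵒᵖ ℂ := simpleAction i
  { lin :=
      { toFun := fun c : ℂ => c • v
        map_add' := fun c c' => add_smul c c' v
        map_smul' := fun a c => by
          obtain ⟨a, rfl⟩ := op_surjective a
          exact (mul_smul (char i a) c v).trans (hi a (c • v)).symm }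
    map_mem := fun {n c} hc => by
      by_cases hn : n = 0
      · subst hn; exact hV.mem _
      · replace hc : c ∈ simpleGr n := hc
        rw [simpleGr, if_neg hn, Submodule.mem_bot] at hc
        rw [hc, map_zero]; exact Submodule.zero_mem _
    comm := fun c => (zero_smul ℂ v).trans (hV.d_eq_zero _).symm }

/-- The morphism to a simple module given by a linear form. -/
noncomputable def toSimple (f : V.carrier →ₗ[ℂ] ℂ) : V ⟶ simpleModule i :=
  letI : Module Algᵐᵒᵖ ℂ := simpleAction i
  { lin :=
      { toFun := f
        map_add' := map_add f
        map_smul' := fun a v => by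
          obtain ⟨a, rfl⟩ := op_surjective a
          exact (congrArg f (hi a v)).trans (map_smul f _ _) }
    map_mem := fun {n v} hv => by
      change f v ∈ simpleGr n
      by_cases hn : n = 0
      · rw [simpleGr, if_pos hn]; trivial
      · rw [hV n hn, Submodule.mem_bot] at hv
        rw [hv, map_zero]; exact Submodule.zero_mem _
    comm := fun v => (congrArg f (hV.d_eq_zero v)).trans (map_zero f) }

include hV hi in
/-- Modules on which the algebra acts by a character are semisimple. -/
lemma copies_of_char [Module.Finite ℂ V.carrier] {X : Dfd} (e : X.obj ≅ (Q dgAlgebra).obj V) :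
    copies (simple i) X := by
  let b := Module.finBasis ℂ V.carrier
  let bc : Bicone fun _ : Fin (Module.finrank ℂ V.carrier) => simple i :=
    { pt := X
      π := fun p => ObjectProperty.homMk (e.hom ≫ (Q dgAlgebra).map (toSimple hV hi (b.coord p)))
      ι := fun p => ObjectProperty.homMk ((Q dgAlgebra).map (ofSimple hV hi (b p)) ≫ e.inv)
      ι_π := fun p q => by
        have h1 : ofSimple hV hi (b p) ≫ toSimple hV hi (b.coord q) =
            if p = q then 𝟙 _ else 0 := by
          refine hom_ext fun c => ?_
          change b.coord q ((show ℂ from c) • b p) = _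
          rw [map_smul, Module.Basis.coord_apply, Module.Basis.repr_self, Finsupp.single_apply]
          split_ifs
          · exact mul_one (show ℂ from c)
          · exact mul_zero (show ℂ from c)
        ext
        change ((Q dgAlgebra).map _ ≫ e.inv) ≫ e.hom ≫ (Q dgAlgebra).map _ = _
        rw [Category.assoc, Iso.inv_hom_id_assoc, ← Functor.map_comp, h1]
        split_ifs
        · exact (Q dgAlgebra).map_id _
        · exact (Q dgAlgebra).map_zero _ _ }
  refine ⟨_, bc, ⟨isBilimitOfTotal bc ?_⟩, ⟨Iso.refl _⟩⟩
  have h2 : ∑ p, toSimple hV hi (b.coord p) ≫ ofSimple hV hi (b p) = 𝟙 V := by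
    let ev (v : V.carrier) : (V ⟶ V) →+ V.carrier :=
      { toFun := fun f => f.lin v
        map_zero' := rfl
        map_add' := fun _ _ => rfl }
    refine hom_ext fun v => (map_sum (ev v) _ _).trans ?_
    exact b.sum_repr v
  ext
  change (ObjectProperty.ι _).map _ = _
  rw [Functor.map_sum]
  refine Eq.trans (b := ∑ p, e.hom ≫ (Q dgAlgebra).map (toSimple hV hi (b.coord p) ≫
    ofSimple hV hi (b p)) ≫ e.inv) (Finset.sum_congr rfl fun p _ => ?_) ?_
  · change (e.hom ≫ (Q dgAlgebra).map _) ≫ (Q dgAlgebra).map _ ≫ e.inv = _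
    rw [Functor.map_comp]
    simp only [Category.assoc]
  · rw [← Preadditive.comp_sum, ← Preadditive.sum_comp, ← Functor.map_sum, h2,
      CategoryTheory.Functor.map_id, Category.id_comp, Iso.hom_inv_id]
    rfl

end

lemma rsmul_eq_char {V : DGModule dgAlgebra} (hV : V.InDegreeZero) {i : Fin 2} {v : V.carrier}
    (hE : v ◁ ι (E i) = v) (hα : v ◁ ι (α 0) = 0) (a : Alg) : v ◁ a = char i a • v := by
  obtain ⟨j, h⟩ := exists_ne i
  have hα' (k : Fin 2) : v ◁ ι (α k) = 0 := by
    fin_cases k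
    · exact hα
    · exact hV.smul_eq_zero v (ι_mem (α 1)) (by decide)
  have hτ (k : Fin 2) : v ◁ ι (τ k) = 0 := hV.smul_eq_zero v (ι_τ_mem k) (by decide)
  refine alg_induction (p := fun a => v ◁ a = char i a • v) a ?_ ?_ ?_ ?_ ?_
  · rw [rsmul_one, map_one, one_smul]
  · intro g y hy
    refine (rsmul_mul _ _ _ _).trans (Eq.trans ?_ (congrArg (· • v) (map_mul (char i) _ _).symm))
    revert g
    refine Gen.cases_vertex h.symm ?_ ?_ ?_ ?_ ?_ ?_
    · rw [hE, char_E, one_mul, hy]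
    · have : v ◁ ι (E j) = 0 := by
        rw [← hE, ← rsmul_mul, E_E' h.symm, rsmul_zero]
      rw [this, smul_zero, char_E' h.symm, zero_mul, zero_smul]
    · rw [hα', smul_zero, char_α, zero_mul, zero_smul]
    · rw [hα', smul_zero, char_α, zero_mul, zero_smul]
    · rw [hτ, smul_zero, char_τ, zero_mul, zero_smul]
    · rw [hτ, smul_zero, char_τ, zero_mul, zero_smul]
  · rw [rsmul_zero, map_zero, zero_smul]
  · intro x y hx hy
    rw [rsmul_add, hx, hy, map_add, add_smul]
  · intro c x hx
    rw [MulOpposite.op_smul, smul_assoc, hx, map_smul, smul_smul, smul_eq_mul]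

/-- The part of a module concentrated in degree `0` at the target of the arrow. -/
noncomputable def socle {V : DGModule dgAlgebra} (hV : V.InDegreeZero) : Sub V where
  sub :=
    { carrier := {v | v ◁ ι (E 1) = v}
      add_mem' := fun {v w} hv hw => by
        change (v + w) ◁ ι (E 1) = v + w
        rw [smul_add, hv, hw]
      zero_mem' := smul_zero _
      smul_mem' := fun a v hv => by
        obtain ⟨a, rfl⟩ := op_surjective a
        replace hv : v ◁ ι (E 1) = v := hv
        have h1 : v ◁ ι (α 0) = 0 := by
          rw [← hv, ← rsmul_mul, ← E_α, ← mul_assoc, E_E' (by decide), zero_mul, rsmul_zero]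
        change (v ◁ a) ◁ ι (E 1) = v ◁ a
        rw [rsmul_eq_char hV hv h1, smul_comm, hv] }
  proj_mem n v hv := by
    by_cases hn : n = 0
    · subst hn
      rwa [gradeProj_same _ (hV.mem v)]
    · rw [gradeProj_ne _ (hV.mem v) (Ne.symm hn)]
      exact Submodule.zero_mem _
  d_mem v _ := by
    rw [hV.d_eq_zero]
    exact Submodule.zero_mem _

/-- The objects of the standard heart are extensions of sums of copies of the simple objects. -/
lemma standardHeart_le : standardHeart ≤ (copies T).extensionProduct (copies S) := by
  intro X hX
  obtain ⟨V, hV, ⟨e⟩⟩ := exists_inDegreeZero gr_eq_bot hX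
  have : Module.Finite ℂ V.cohomology := (finiteDimensional_Q_iff V).1
    ((finiteDimensional dgAlgebra).prop_of_iso e X.property)
  have := hV.finite
  have h1 : (socle hV).toDG.InDegreeZero := fun i hi => by
    rw [eq_bot_iff]
    intro m hm
    replace hm : m.1 ∈ V.gr i := hm
    rw [hV i hi, Submodule.mem_bot] at hm
    exact Subtype.ext hm
  have h2 : (socle hV).quot.InDegreeZero := fun i hi => by
    rw [eq_bot_iff]
    rintro _ ⟨m, hm, rfl⟩
    rw [hV i hi] at hm
    rw [(Submodule.mem_bot ℂ).1 hm, map_zero]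
    exact Submodule.zero_mem _
  have h3 (a : Alg) (v : (socle hV).toDG.carrier) : v ◁ a = char 1 a • v :=
    rsmul_eq_char h1 (Subtype.ext v.2) (Subtype.ext (by
      change v.1 ◁ ι (α 0) = 0
      rw [← show v.1 ◁ ι (E 1) = v.1 from v.2, ← rsmul_mul, ← E_α, ← mul_assoc,
        E_E' (by decide), zero_mul, rsmul_zero])) a
  have h5 (v : (socle hV).quot.carrier) : v ◁ ι (E 1) = 0 := by
    obtain ⟨v, rfl⟩ := (socle hV).π_surjective v
    refine ((socle hV).π.lin.map_smul _ _).symm.trans ((socle hV).π_eq_zero.2 ?_)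
    change (v ◁ ι (E 1)) ◁ ι (E 1) = v ◁ ι (E 1)
    rw [← rsmul_mul, E_E]
  have h4 (a : Alg) (v : (socle hV).quot.carrier) : v ◁ a = char 0 a • v :=
    rsmul_eq_char h2 (by
      have := rsmul_one _ v
      rwa [← add_E (i := 0) (j := 1) (by decide), rsmul_add, h5, add_zero] at this)
      (by rw [← α_E (i := 0) (j := 1) (by decide), rsmul_mul, h5]) a
  have f1 : Module.Finite ℂ (socle hV).toDG.carrier :=
    Module.Finite.of_injective ((socle hV).sub.subtype.restrictScalars ℂ) Subtype.val_injective
  have f2 : Module.Finite ℂ (socle hV).quot.carrier :=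
    Module.Finite.of_surjective ((socle hV).sub.mkQ.restrictScalars ℂ) (socle hV).π_surjective
  obtain ⟨δ, hT⟩ := exists_triangle_sub (socle hV)
  let Y : Dfd := ⟨_, finiteDimensional_Q (socle hV).toDG⟩
  let Z : Dfd := ⟨_, finiteDimensional_Q (socle hV).quot⟩
  let δ' : Z ⟶ Y⟦(1 : ℤ)⟧ := ObjectProperty.homMk
    (δ ≫ ((finiteDimensional dgAlgebra).ι.commShiftIso (1 : ℤ)).inv.app Y)
  let f : Y ⟶ X := ObjectProperty.homMk ((Q dgAlgebra).map (socle hV).ι ≫ e.inv)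
  let g : X ⟶ Z := ObjectProperty.homMk (e.hom ≫ (Q dgAlgebra).map (socle hV).π)
  refine ⟨Y, Z, f, g, δ', ?_, copies_of_char h1 h3 (Iso.refl _), copies_of_char h2 h4 (Iso.refl _)⟩
  change (finiteDimensional dgAlgebra).ι.mapTriangle.obj (Triangle.mk f g δ') ∈ distTriang _
  refine distinguished_of_iso hT (Iso.refl _) e.symm (Iso.refl _) (Category.id_comp _).symm ?_ ?_
  · exact (Category.comp_id _).trans (Iso.inv_hom_id_assoc e _).symm
  · refine (congrArg (fun φ => δ ≫ φ) (CategoryTheory.Functor.map_id _ _)).trans ?_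
    refine Eq.trans ?_ (Category.id_comp _).symm
    refine (congrArg (fun φ => δ ≫ φ)
      (((finiteDimensional dgAlgebra).ι.commShiftIso (1 : ℤ)).inv_hom_id_app Y).symm).trans ?_
    exact (Category.assoc _ _ _).symm

end Ginzburg

section

open Triangulated

variable {C : Type*} [Category C] [Preadditive C] [HasZeroObject C] [HasShift C ℤ]
  [∀ n : ℤ, (shiftFunctor C n).Additive] [Pretriangulated C]

/-! ### Hearts of bounded t-structures -/

lemma isLE_of_heart_le {t t' : TStructure C} (h : t.heart ≤ t'.heart) (n : ℕ) (X : C)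
    (h₁ : t.IsLE X 0) (h₂ : t.IsGE X (-n)) : t'.IsLE X 0 := by
  induction n generalizing X with
  | zero =>
    exact ((t'.mem_heart_iff X).1 (h X ((t.mem_heart_iff X).2 ⟨h₁, by simpa using h₂⟩))).1
  | succ n ih =>
    obtain ⟨Y, Z, hY, hZ, f, g, δ, hT⟩ := t.exists_triangle X (-1) 0 (by lia)
    have hY' : t.IsLE Y (-1) := ⟨hY⟩
    have hZ' : t.IsGE Z 0 := ⟨hZ⟩
    have h3 : t.IsGE Y (-(n + 1 : ℕ)) := t.isGE₂ _ (inv_rot_of_distTriang _ hT) _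
      (have := t.isGE_shift Z 0 (-1) 1
       t.isGE_of_ge (Z⟦(-1 : ℤ)⟧) (-(n + 1 : ℕ)) 1) h₂
    have h4 : t.IsLE Z 0 := t.isLE₂ _ (rot_of_distTriang _ hT) _ h₁
      (have := t.isLE_shift Y (-1) 1 (-2)
       t.isLE_of_le (Y⟦(1 : ℤ)⟧) (-2) 0)
    have h5 : t'.IsLE Z 0 :=
      ((t'.mem_heart_iff Z).1 (h Z ((t.mem_heart_iff Z).2 ⟨h4, hZ'⟩))).1
    have h6 := ih (Y⟦(-1 : ℤ)⟧) (t.isLE_shift Y (-1) (-1) 0)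
      (t.isGE_shift Y (-(n + 1 : ℕ)) (-1) (-n) (by push_cast; ring))
    have h7 : t'.IsLE Y (-1) := t'.isLE_of_shift Y (-1) (-1) 0
    exact t'.isLE₂ _ hT _ (t'.isLE_of_le Y (-1) 0) h5

lemma isGE_of_heart_le {t t' : TStructure C} (h : t.heart ≤ t'.heart) (n : ℕ) (X : C)
    (h₁ : t.IsGE X 0) (h₂ : t.IsLE X n) : t'.IsGE X 0 := by
  induction n generalizing X with
  | zero =>
    exact ((t'.mem_heart_iff X).1 (h X ((t.mem_heart_iff X).2 ⟨by simpa using h₂, h₁⟩))).2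
  | succ n ih =>
    obtain ⟨Y, Z, hY, hZ, f, g, δ, hT⟩ := t.exists_triangle X 0 1 (by lia)
    have hY' : t.IsLE Y 0 := ⟨hY⟩
    have hZ' : t.IsGE Z 1 := ⟨hZ⟩
    have h3 : t.IsLE Z (n + 1 : ℕ) := t.isLE₂ _ (rot_of_distTriang _ hT) _ h₂
      (have := t.isLE_shift Y 0 1 (-1)
       t.isLE_of_le (Y⟦(1 : ℤ)⟧) (-1) (n + 1 : ℕ))
    have h4 : t.IsGE Y 0 := t.isGE₂ _ (inv_rot_of_distTriang _ hT) _
      (have := t.isGE_shift Z 1 (-1) 2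
       t.isGE_of_ge (Z⟦(-1 : ℤ)⟧) 0 2) h₁
    have h5 : t'.IsGE Y 0 :=
      ((t'.mem_heart_iff Y).1 (h Y ((t.mem_heart_iff Y).2 ⟨hY', h4⟩))).2
    have h6 := ih (Z⟦(1 : ℤ)⟧) (t.isGE_shift Z 1 1 0)
      (t.isLE_shift Z (n + 1 : ℕ) 1 n (by push_cast; ring))
    have h7 : t'.IsGE Z 1 := t'.isGE_of_shift Z 1 1 0
    exact t'.isGE₂ _ hT _ h5 (t'.isGE_of_ge Z 0 1)

namespace Heart

variable (A B : Heart C) {X Y Z : C}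

lemma exists_tStructure : ∃ t : TStructure C, (∀ X, t.bounded X) ∧
    ∀ X, A.prop X ↔ t.IsLE X 0 ∧ t.IsGE X 0 := by
  obtain ⟨t, ht, e⟩ := A.isHeart
  exact ⟨t, ht, fun X => by rw [← e, t.mem_heart_iff]⟩

variable {A B} in
lemma eq_of_le (h : A.prop ≤ B.prop) : A = B := by
  obtain ⟨t, ht, e⟩ := A.isHeart
  obtain ⟨t', ht', e'⟩ := B.isHeart
  rw [← e, ← e'] at h
  have h1 (X : C) (hX : t.IsLE X 0) : t'.IsLE X 0 := by
    obtain ⟨m, hm⟩ := (ht X).1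
    exact isLE_of_heart_le h m.natAbs X hX (t.isGE_of_ge X _ m)
  have h2 (X : C) (hX : t.IsGE X 0) : t'.IsGE X 0 := by
    obtain ⟨m, hm⟩ := (ht X).2
    exact isGE_of_heart_le h m.natAbs X hX (t.isLE_of_le X m _)
  refine Heart.ext (le_antisymm (e ▸ e' ▸ h) ?_)
  rw [← e, ← e']
  intro X hX
  rw [t'.mem_heart_iff] at hX
  obtain ⟨hX1, hX2⟩ := hX
  refine (t.mem_heart_iff X).2 ⟨?_, ?_⟩
  · rw [t.isLE_iff_orthogonal 0 1 rfl]
    intro Y f hY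
    have := h2 (Y⟦(1 : ℤ)⟧) (t.isGE_shift Y 1 1 0)
    have : t'.IsGE Y 1 := t'.isGE_of_shift Y 1 1 0
    exact t'.zero f 0 1
  · rw [t.isGE_iff_orthogonal (-1) 0 rfl]
    intro Y f hY
    have := h1 (Y⟦(-1 : ℤ)⟧) (t.isLE_shift Y (-1) (-1) 0)
    have : t'.IsLE Y (-1) := t'.isLE_of_shift Y (-1) (-1) 0
    exact t'.zero f (-1) 0

variable {A}

lemma hom_eq_zero (hX : A.prop X) (hY : A.prop Y) {m n : ℤ} (h : n < m) (f : X⟦m⟧ ⟶ Y⟦n⟧) :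
    f = 0 := by
  obtain ⟨t, -, ht⟩ := A.exists_tStructure
  obtain ⟨h1, -⟩ := (ht X).1 hX
  obtain ⟨-, h2⟩ := (ht Y).1 hY
  have := t.isLE_shift X 0 m (-m)
  have := t.isGE_shift Y 0 n (-n)
  exact t.zero f (-m) (-n)

lemma hom_shift_eq_zero (hX : A.prop X) (hY : A.prop Y) {n : ℤ} (h : n < 0) (f : X ⟶ Y⟦n⟧) :
    f = 0 := by
  obtain ⟨t, -, ht⟩ := A.exists_tStructure
  obtain ⟨h1, -⟩ := (ht X).1 hX
  obtain ⟨-, h2⟩ := (ht Y).1 hY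
  have := t.isGE_shift Y 0 n (-n)
  exact t.zero f 0 (-n)

lemma shift_hom_eq_zero (hX : A.prop X) (hY : A.prop Y) {n : ℤ} (h : 0 < n) (f : X⟦n⟧ ⟶ Y) :
    f = 0 := by
  obtain ⟨t, -, ht⟩ := A.exists_tStructure
  obtain ⟨h1, -⟩ := (ht X).1 hX
  obtain ⟨-, h2⟩ := (ht Y).1 hY
  have := t.isLE_shift X 0 n (-n)
  exact t.zero f (-n) 0

variable (A) in
lemma prop_of_distTriang {T : Triangle C} (hT : T ∈ distTriang C) (h₁ : A.prop T.obj₁)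
    (h₃ : A.prop T.obj₃) : A.prop T.obj₂ := by
  obtain ⟨t, -, ht⟩ := A.exists_tStructure
  rw [ht] at h₁ h₃ ⊢
  exact ⟨t.isLE₂ T hT 0 h₁.1 h₃.1, t.isGE₂ T hT 0 h₁.2 h₃.2⟩

variable (A) in
lemma prop_of_isZero (h : IsZero X) : A.prop X := by
  obtain ⟨t, -, ht⟩ := A.exists_tStructure
  exact (ht X).2 ⟨(t.isLE_iff_orthogonal 0 1 rfl X).2 fun Y f _ => h.eq_of_src f 0,
    (t.isGE_iff_orthogonal (-1) 0 rfl X).2 fun Y f _ => h.eq_of_tgt f 0⟩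

/-- In a short exact sequence of a heart, the first morphism is a monomorphism. -/
lemma eq_zero_of_comp {T : Triangle C} (hT : T ∈ distTriang C) (h₃ : A.prop T.obj₃) {V : C}
    (hV : A.prop V) (g : V ⟶ T.obj₁) (hg : g ≫ T.mor₁ = 0) : g = 0 := by
  obtain ⟨g', rfl⟩ := Triangle.coyoneda_exact₂ _ (inv_rot_of_distTriang _ hT) g hg
  rw [hom_shift_eq_zero hV h₃ (by lia) g']
  exact zero_comp

end Heart

/-! ### Sums of copies of an object -/

section

variable {S X V : C}

lemma copies_hom_eq_zero (hX : copies S X) (h : ∀ f : S ⟶ V, f = 0) (f : X ⟶ V) : f = 0 := by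
  obtain ⟨n, b, ⟨hb⟩, ⟨e⟩⟩ := hX
  rw [← cancel_epi e.inv, comp_zero, ← Category.id_comp (e.inv ≫ f), ← IsBilimit.total hb,
    Preadditive.sum_comp]
  refine Finset.sum_eq_zero fun p _ => ?_
  rw [Category.assoc, h (b.ι p ≫ _), comp_zero]

lemma hom_copies_eq_zero (hX : copies S X) (h : ∀ f : V ⟶ S, f = 0) (f : V ⟶ X) : f = 0 := by
  obtain ⟨n, b, ⟨hb⟩, ⟨e⟩⟩ := hX
  rw [← cancel_mono e.hom, zero_comp, ← Category.comp_id (f ≫ e.hom), ← IsBilimit.total hb,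
    Preadditive.comp_sum]
  refine Finset.sum_eq_zero fun p _ => ?_
  rw [← Category.assoc, h ((f ≫ e.hom) ≫ b.π p), zero_comp]

lemma copies_cases (hX : copies S X) : IsZero X ∨ ∃ (i : S ⟶ X) (p : X ⟶ S), i ≫ p = 𝟙 S := by
  obtain ⟨n, b, ⟨hb⟩, ⟨e⟩⟩ := hX
  rcases n.eq_zero_or_pos with rfl | hn
  · left
    refine IsZero.of_iso ?_ e
    rw [IsZero.iff_id_eq_zero, ← IsBilimit.total hb]
    exact Finset.sum_empty
  · exact Or.inr ⟨b.ι ⟨0, hn⟩ ≫ e.inv, e.hom ≫ b.π ⟨0, hn⟩, by simp [b.ι_π]⟩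

variable (S) in
lemma copies_zero {Z : C} (h : IsZero Z) : copies S Z :=
  ⟨0, { pt := Z, π := fun p => p.elim0, ι := fun p => p.elim0, ι_π := fun p => p.elim0 },
    ⟨isBilimitOfTotal _ (h.eq_of_src _ _)⟩, ⟨Iso.refl _⟩⟩

variable (S) in
lemma copies_self : copies S S :=
  ⟨1, { pt := S, π := fun _ => 𝟙 S, ι := fun _ => 𝟙 S
        ι_π := fun p q => by obtain rfl := Subsingleton.elim p q; simp },
    ⟨isBilimitOfTotal _ (by simp)⟩, ⟨Iso.refl _⟩⟩

lemma Heart.prop_copies (A : Heart C) (hS : A.prop S) (hX : copies S X) : A.prop X := by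
  obtain ⟨t, -, ht⟩ := A.exists_tStructure
  obtain ⟨h1, h2⟩ := (ht S).1 hS
  exact (ht X).2 ⟨(t.isLE_iff_orthogonal 0 1 rfl X).2 fun Y f _ =>
    copies_hom_eq_zero hX (fun f => t.zero f 0 1) f,
    (t.isGE_iff_orthogonal (-1) 0 rfl X).2 fun Y f _ =>
      hom_copies_eq_zero hX (fun f => t.zero f (-1) 0) f⟩

/-- An indecomposable sum of copies of an object is isomorphic to it. -/
lemma nonempty_iso_of_copies (hX : copies S X) (hS : ¬ IsZero S) (hX' : ¬ IsZero X)
    (h : ∀ f : X ⟶ X, f = 0 ∨ IsIso f) : Nonempty (X ≅ S) := by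
  obtain h0 | ⟨i, p, e⟩ := copies_cases hX
  · exact absurd h0 hX'
  refine ⟨⟨p, i, ?_, e⟩⟩
  have h1 : (p ≫ i) ≫ p ≫ i = p ≫ i := by rw [Category.assoc, ← Category.assoc i, e, Category.id_comp]
  obtain h2 | h2 := h (p ≫ i)
  · refine absurd ?_ hS
    rw [IsZero.iff_id_eq_zero, ← e, ← Category.id_comp (i ≫ p), ← e, Category.assoc,
      ← Category.assoc p, h2]
    simp
  · rw [← cancel_epi (p ≫ i), h1, Category.comp_id]

end

end

section

open Triangulated

variable {C : Type*} [Category C] [Preadditive C] [HasZeroObject C] [HasShift C ℤ]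
  [∀ n : ℤ, (shiftFunctor C n).Additive] [Pretriangulated C]

/-- The simple objects `S` and `T` of a heart of type `A₂`, with a nontrivial extension of `S`
by `T`. -/
structure IsSimplePair (A : Heart C) (S T : C) : Prop where
  left : A.prop S
  right : A.prop T
  le : A.prop ≤ (copies T).extensionProduct (copies S)
  not_isZero_left : ¬ IsZero S
  not_isZero_right : ¬ IsZero T
  brick_left : ∀ f : S ⟶ S, f = 0 ∨ IsIso f
  brick_right : ∀ f : T ⟶ T, f = 0 ∨ IsIso f
  hom_left : ∀ f : S ⟶ T, f = 0
  hom_right : ∀ f : T ⟶ S, f = 0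
  exists_ext : ∃ f : S ⟶ T⟦(1 : ℤ)⟧, f ≠ 0
  ext_right : ∀ f : T ⟶ S⟦(1 : ℤ)⟧, f = 0

namespace IsSimplePair

variable {A : Heart C} {S T : C} (h : IsSimplePair A S T)

include h

lemma exists_mono {F : C} (hF : A.prop F) (hF' : ¬ IsZero F) :
    ∃ V, (V = S ∨ V = T) ∧ ∃ v : V ⟶ F, v ≠ 0 ∧ ∀ U, A.prop U → ∀ g : U ⟶ V, g ≫ v = 0 → g = 0 := by
  obtain ⟨Y, Z, f, g, δ, hT, hY, hZ⟩ := h.le F hF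
  have hZ' := A.prop_copies h.left hZ
  obtain h0 | ⟨i, p, e⟩ := copies_cases hY
  · have hg : IsIso g := (Triangle.isZero₁_iff_isIso₂ _ hT).1 h0
    obtain h1 | ⟨i, p, e⟩ := copies_cases hZ
    · exact absurd (h1.of_iso (asIso g)) hF'
    have key {U : C} (u : U ⟶ S) (hu : u ≫ i ≫ inv g = 0) : u = 0 := by
      have := congrArg (fun φ => φ ≫ g ≫ p) hu
      simpa [e] using this
    refine ⟨S, Or.inl rfl, i ≫ inv g, fun hi => ?_, fun U _ u hu => key u hu⟩
    refine h.not_isZero_left ((IsZero.iff_id_eq_zero _).2 (key _ ?_))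
    rw [hi, comp_zero]
  · have key {U : C} (hU : A.prop U) (u : U ⟶ T) (hu : u ≫ i ≫ f = 0) : u = 0 := by
      have h1 : u ≫ i = 0 := Heart.eq_zero_of_comp hT hZ' hU (u ≫ i)
        ((Category.assoc _ _ _).trans hu)
      rw [← Category.comp_id u, ← e, ← Category.assoc, h1, zero_comp]
    refine ⟨T, Or.inr rfl, i ≫ f, fun hi => ?_, fun U hU u hu => key hU u hu⟩
    refine h.not_isZero_right ((IsZero.iff_id_eq_zero _).2 (key h.right _ ?_))
    rw [hi, comp_zero]

lemma prop_of_eq {W : C} (hW : W = S ∨ W = T) : A.prop W := by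
  obtain rfl | rfl := hW
  exacts [h.left, h.right]

lemma not_isZero_of_eq {W : C} (hW : W = S ∨ W = T) : ¬ IsZero W := by
  obtain rfl | rfl := hW
  exacts [h.not_isZero_left, h.not_isZero_right]

lemma brick_of_eq {W : C} (hW : W = S ∨ W = T) (f : W ⟶ W) : f = 0 ∨ IsIso f := by
  obtain rfl | rfl := hW
  exacts [h.brick_left f, h.brick_right f]

lemma isIso_of_ne_zero {V W : C} (hV : V = S ∨ V = T) (hW : W = S ∨ W = T) (f : V ⟶ W)
    (hf : f ≠ 0) : IsIso f := by
  obtain rfl | rfl := hV <;> obtain rfl | rfl := hW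
  · exact (h.brick_left f).resolve_left hf
  · exact absurd (h.hom_left f) hf
  · exact absurd (h.hom_right f) hf
  · exact (h.brick_right f).resolve_left hf

/-- A nonzero monomorphism to a simple object is an isomorphism. -/
lemma isIso_of_mono {F W : C} (hF : A.prop F) (hW : W = S ∨ W = T) (f : F ⟶ W) (hf : f ≠ 0)
    (hm : ∀ U, A.prop U → ∀ g : U ⟶ F, g ≫ f = 0 → g = 0) : IsIso f := by
  have hF' : ¬ IsZero F := fun h0 => hf (h0.eq_of_src _ _)
  obtain ⟨V, hV, v, hv, -⟩ := h.exists_mono hF hF'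
  have := h.isIso_of_ne_zero hV hW (v ≫ f) fun h0 => hv (hm V (h.prop_of_eq hV) v h0)
  refine ⟨inv (v ≫ f) ≫ v, ?_, by rw [Category.assoc, IsIso.inv_hom_id]⟩
  rw [← sub_eq_zero]
  refine hm F hF _ ?_
  rw [Preadditive.sub_comp, Category.id_comp, Category.assoc, Category.assoc, IsIso.inv_hom_id,
    Category.comp_id, sub_self]

lemma isZero_or_isZero {T' : Triangle C} (hT : T' ∈ distTriang C) (h₁ : A.prop T'.obj₁)
    (h₃ : A.prop T'.obj₃) (h₂ : T'.obj₂ = S ∨ T'.obj₂ = T) :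
    IsZero T'.obj₁ ∨ IsZero T'.obj₃ := by
  by_cases hf : T'.mor₁ = 0
  · left
    rw [IsZero.iff_id_eq_zero]
    exact Heart.eq_zero_of_comp hT h₃ h₁ _ (by rw [hf, comp_zero])
  · right
    exact (Triangle.isZero₃_iff_isIso₁ _ hT).2 (h.isIso_of_mono h₁ h₂ _ hf fun U hU g hg =>
      Heart.eq_zero_of_comp hT h₃ hU g hg)

/-- The simple objects are simple. -/
lemma simple {W : A.prop.FullSubcategory} (hW : W.obj = S ∨ W.obj = T) : Simple W where
  mono_isIso_iff_nonzero {Y} f _ := by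
    constructor
    · intro hf h0
      refine h.not_isZero_of_eq hW ?_
      rw [IsZero.iff_id_eq_zero]
      have h1 : 𝟙 W = 0 := by
        rw [← IsIso.inv_hom_id f]
        exact (congrArg (fun φ => inv f ≫ φ) h0).trans comp_zero
      exact congrArg (fun φ => φ.hom) h1
    · intro hf
      have : IsIso (A.prop.ι.map f) := h.isIso_of_mono Y.property hW f.hom
        (fun h0 => hf (ObjectProperty.hom_ext _ h0)) fun U hU g hg => by
          have : (ObjectProperty.homMk g : (⟨U, hU⟩ : A.prop.FullSubcategory) ⟶ Y) = 0 := by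
            rw [← cancel_mono f, zero_comp]
            exact ObjectProperty.hom_ext _ hg
          exact congrArg (fun φ => φ.hom) this
      exact isIso_of_fully_faithful A.prop.ι f

lemma nonempty_iso_of_simple {X : A.prop.FullSubcategory} (hX : Simple X) :
    ∃ W, (W = S ∨ W = T) ∧ Nonempty (X.obj ≅ W) := by
  have hX' : ¬ IsZero X.obj := fun h0 => by
    have := (Simple.mono_isIso_iff_nonzero (𝟙 X)).1 inferInstance
    exact this (ObjectProperty.hom_ext _ (h0.eq_of_src _ _))
  obtain ⟨V, hV, v, hv, hm⟩ := h.exists_mono X.property hX'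
  let v' : (⟨V, h.prop_of_eq hV⟩ : A.prop.FullSubcategory) ⟶ X := ObjectProperty.homMk v
  have : Mono v' := by
    refine Preadditive.mono_of_cancel_zero _ fun {U} g hg => ObjectProperty.hom_ext _ ?_
    exact hm U.obj U.property g.hom (congrArg (fun φ => φ.hom) hg)
  have := (Simple.mono_isIso_iff_nonzero v').2 fun h0 => hv (congrArg (fun φ => φ.hom) h0)
  exact ⟨V, hV, ⟨(A.prop.ι.mapIso (asIso v')).symm⟩⟩

end IsSimplePair

/-- `B` contains the objects of the left tilt of the heart `A` at `Z`. -/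
structure ContainsLeftTilt (A B : Heart C) (Z : C) : Prop where
  shift : B.prop (Z⟦(-1 : ℤ)⟧)
  prop : ∀ Y, A.prop Y → (∀ f : Z ⟶ Y, f = 0) → B.prop Y

/-- `B` contains the objects of the right tilt of the heart `A` at `Z`. -/
structure ContainsRightTilt (A B : Heart C) (Z : C) : Prop where
  shift : B.prop (Z⟦(1 : ℤ)⟧)
  prop : ∀ Y, A.prop Y → (∀ f : Y ⟶ Z, f = 0) → B.prop Y

variable {A B : Heart C} {S T X : C}

lemma ContainsLeftTilt.of_iso {Z : C} (h : ContainsLeftTilt A B X) (e : X ≅ Z) :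
    ContainsLeftTilt A B Z :=
  ⟨B.prop_of_iso ((shiftFunctor C (-1 : ℤ)).mapIso e) h.shift, fun Y hY hf => h.prop Y hY fun f => by
    rw [← Iso.hom_inv_id_assoc e f, hf (e.inv ≫ f), comp_zero]⟩

lemma ContainsRightTilt.of_iso {Z : C} (h : ContainsRightTilt A B X) (e : X ≅ Z) :
    ContainsRightTilt A B Z :=
  ⟨B.prop_of_iso ((shiftFunctor C (1 : ℤ)).mapIso e) h.shift, fun Y hY hf => h.prop Y hY fun f => by
    rw [← Category.comp_id f, ← e.hom_inv_id, ← Category.assoc, hf (f ≫ e.hom), zero_comp]⟩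

instance (n : ℤ) : ObjectProperty.ContainsZero
    (fun Y : C => ∃ F, copies X F ∧ Nonempty (Y ≅ F⟦n⟧)) :=
  ⟨_, isZero_zero C, _, copies_zero X (isZero_zero C),
    ⟨(isZero_zero C).iso ((shiftFunctor C n).map_isZero (isZero_zero C))⟩⟩

instance : ObjectProperty.ContainsZero (fun Y : C => A.prop Y ∧ ∀ f : X ⟶ Y, f = 0) :=
  ⟨_, isZero_zero C, A.prop_of_isZero (isZero_zero C), fun _ => (isZero_zero C).eq_of_tgt _ _⟩

instance : ObjectProperty.ContainsZero (fun Y : C => A.prop Y ∧ ∀ f : Y ⟶ X, f = 0) :=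
  ⟨_, isZero_zero C, A.prop_of_isZero (isZero_zero C), fun _ => (isZero_zero C).eq_of_src _ _⟩

lemma containsLeftTilt_of_eq
    (hB : B.prop = leftTilt (copies X) (fun Y => A.prop Y ∧ ∀ f : X ⟶ Y, f = 0)) :
    ContainsLeftTilt A B X := by
  refine ⟨?_, fun Y hY hf => ?_⟩ <;> rw [hB]
  · exact ObjectProperty.le_extensionProduct_right _ _ ⟨X, copies_self X, ⟨Iso.refl _⟩⟩
  · exact ObjectProperty.le_extensionProduct_left _ _ ⟨hY, hf⟩

lemma containsRightTilt_of_eq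
    (hB : B.prop = rightTilt (fun Y => A.prop Y ∧ ∀ f : Y ⟶ X, f = 0) (copies X)) :
    ContainsRightTilt A B X := by
  refine ⟨?_, fun Y hY hf => ?_⟩ <;> rw [hB]
  · exact ObjectProperty.le_extensionProduct_left _ _ ⟨X, copies_self X, ⟨Iso.refl _⟩⟩
  · exact ObjectProperty.le_extensionProduct_right _ _ ⟨hY, hf⟩

lemma IsSimplePair.nonempty_iso_shift (h : IsSimplePair A S T) {W F : C} (hW : W = S ∨ W = T)
    (hX : ¬ IsZero X) (hF : copies X F) {m n : ℤ} (hmn : m + n = 0) (e : W ≅ F⟦m⟧) :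
    Nonempty (X ≅ W⟦n⟧) := by
  let e' : F ≅ W⟦n⟧ := ((shiftFunctorCompIsoId C m n hmn).app F).symm ≪≫
    (shiftFunctor C n).mapIso e.symm
  have hF' : ¬ IsZero F := fun h0 =>
    h.not_isZero_of_eq hW (((shiftFunctor C m).map_isZero h0).of_iso e)
  obtain ⟨i⟩ := nonempty_iso_of_copies hF hX hF' fun f => by
    obtain h0 | h0 := h.brick_of_eq hW (e.hom ≫ f⟦m⟧' ≫ e.inv)
    · left
      apply (shiftFunctor C m).map_injective
      rw [Functor.map_zero, ← cancel_mono e.inv, ← cancel_epi e.hom, h0, zero_comp, comp_zero]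
    · right
      have : IsIso (f⟦m⟧') := by
        have : f⟦m⟧' = e.inv ≫ (e.hom ≫ f⟦m⟧' ≫ e.inv) ≫ e.hom := by simp
        rw [this]
        infer_instance
      exact isIso_of_reflects_iso f (shiftFunctor C m)
  exact ⟨i.symm ≪≫ e'⟩

lemma IsSimplePair.exists_containsRightTilt (h : IsSimplePair A S T) (hX : ¬ IsZero X)
    (hX' : B.prop X)
    (hA : A.prop = leftTilt (copies X) (fun Y => B.prop Y ∧ ∀ f : X ⟶ Y, f = 0)) :
    ∃ W, (W = S ∨ W = T) ∧ ContainsRightTilt A B W := by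
  have h1 {F : C} (hF : copies X F) : B.prop F := B.prop_copies hX' hF
  have h2 {Y F G : C} {f : Y ⟶ F} {g : F ⟶ G} {δ} (hT : Triangle.mk f g δ ∈ distTriang C)
      (hg : g = 0) (hY : B.prop Y) (hG : ∃ F, copies X F ∧ Nonempty (G ≅ F⟦(-1 : ℤ)⟧)) :
      B.prop F := by
    obtain ⟨F', hF', ⟨e⟩⟩ := hG
    obtain ⟨r, hr⟩ : ∃ r : Y⟦(1 : ℤ)⟧ ⟶ G, 𝟙 G = δ ≫ r := Triangle.yoneda_exact₃ _ hT (𝟙 G) (by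
      change g ≫ 𝟙 G = 0
      rw [hg, zero_comp])
    have hr' : r ≫ e.hom = 0 := Heart.hom_eq_zero hY (h1 hF') (by lia) _
    have h0 : IsZero G := by
      rw [IsZero.iff_id_eq_zero, ← cancel_mono e.hom, hr, Category.assoc, hr', comp_zero, zero_comp]
    have : IsIso f := (Triangle.isZero₃_iff_isIso₁ _ hT).1 h0
    exact B.prop_of_iso (asIso f) hY
  have h3 (W : C) (hW : W = S ∨ W = T) :
      B.prop W ∨ Nonempty (X ≅ W⟦(1 : ℤ)⟧) := by
    have hW' := h.prop_of_eq hW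
    rw [hA] at hW'
    obtain ⟨Y, G, f, g, δ, hT, hY, hG⟩ := hW'
    have hYA : A.prop Y := by
      rw [hA]; exact ObjectProperty.le_extensionProduct_left _ _ hY
    have hGA : A.prop G := by
      rw [hA]; exact ObjectProperty.le_extensionProduct_right _ _ hG
    obtain h0 | h0 := h.isZero_or_isZero hT hYA hGA hW
    · right
      obtain ⟨F, hF, ⟨e⟩⟩ := hG
      have : IsIso g := (Triangle.isZero₁_iff_isIso₂ _ hT).1 h0
      exact h.nonempty_iso_shift hW hX hF (by lia) (asIso g ≪≫ e)
    · exact Or.inl (h2 hT (IsZero.eq_of_tgt h0 _ _) hY.1 hG)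
  have h4 : ∃ W, (W = S ∨ W = T) ∧ Nonempty (X ≅ W⟦(1 : ℤ)⟧) := by
    by_contra! hc
    have h5 (W : C) (hW : W = S ∨ W = T) (f : W ⟶ X⟦(-1 : ℤ)⟧) : f = 0 :=
      Heart.hom_shift_eq_zero ((h3 W hW).resolve_right (not_nonempty_iff.2 (hc W hW))) hX'
        (by lia) f
    have h6 : A.prop (X⟦(-1 : ℤ)⟧) := by
      rw [hA]
      exact ObjectProperty.le_extensionProduct_right _ _ ⟨X, copies_self X, ⟨Iso.refl _⟩⟩
    obtain ⟨Y, Z, f, g, δ, hT, hY, hZ⟩ := h.le _ h6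
    obtain ⟨r, hr⟩ : ∃ r : Z ⟶ _, 𝟙 (X⟦(-1 : ℤ)⟧) = g ≫ r := Triangle.yoneda_exact₂ _ hT (𝟙 _)
      (copies_hom_eq_zero hY (h5 T (Or.inr rfl)) _)
    refine hX ?_
    rw [IsZero.iff_id_eq_zero]
    apply (shiftFunctor C (-1 : ℤ)).map_injective
    rw [CategoryTheory.Functor.map_id, Functor.map_zero, hr,
      copies_hom_eq_zero hZ (h5 S (Or.inl rfl)) r, comp_zero]
  obtain ⟨W, hW, ⟨e⟩⟩ := h4
  refine ⟨W, hW, B.prop_of_iso e hX', fun Y hY hf => ?_⟩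
  rw [hA] at hY
  obtain ⟨Y', G, f, g, δ, hT, hY', hG⟩ := hY
  refine h2 hT ?_ hY'.1 hG
  obtain ⟨F, hF, ⟨i⟩⟩ := hG
  rw [← cancel_mono i.hom, zero_comp]
  apply (shiftFunctor C (1 : ℤ)).map_injective
  rw [Functor.map_zero]
  refine (cancel_mono ((shiftFunctorCompIsoId C (-1 : ℤ) 1 (by lia)).hom.app F)).1
    (Eq.trans ?_ zero_comp.symm)
  refine hom_copies_eq_zero hF (fun u => ?_) _
  obtain ⟨u', hu'⟩ := (shiftFunctor C (1 : ℤ)).map_surjective (u ≫ e.hom)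
  rw [← cancel_mono e.hom, zero_comp, ← hu', hf u', Functor.map_zero]

lemma IsSimplePair.exists_containsLeftTilt (h : IsSimplePair A S T) (hX : ¬ IsZero X)
    (hX' : B.prop X)
    (hA : A.prop = rightTilt (fun Y => B.prop Y ∧ ∀ f : Y ⟶ X, f = 0) (copies X)) :
    ∃ W, (W = S ∨ W = T) ∧ ContainsLeftTilt A B W := by
  have h1 {F : C} (hF : copies X F) : B.prop F := B.prop_copies hX' hF
  have h2 {G F Y : C} {f : G ⟶ F} {g : F ⟶ Y} {δ} (hT : Triangle.mk f g δ ∈ distTriang C)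
      (hf : f = 0) (hY : B.prop Y) (hG : ∃ F, copies X F ∧ Nonempty (G ≅ F⟦(1 : ℤ)⟧)) :
      B.prop F := by
    obtain ⟨F', hF', ⟨e⟩⟩ := hG
    obtain ⟨r, hr⟩ : ∃ r : G⟦(1 : ℤ)⟧ ⟶ Y, 𝟙 (G⟦(1 : ℤ)⟧) = r ≫ δ :=
      Triangle.coyoneda_exact₁ _ hT (𝟙 (G⟦(1 : ℤ)⟧)) (by
      change 𝟙 _ ≫ f⟦(1 : ℤ)⟧' = 0
      rw [hf, Functor.map_zero, comp_zero])
    let e' : G⟦(1 : ℤ)⟧ ≅ F'⟦(2 : ℤ)⟧ := (shiftFunctor C (1 : ℤ)).mapIso e ≪≫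
      ((shiftFunctorAdd' C (1 : ℤ) 1 2 (by lia)).app F').symm
    have hr' : e'.inv ≫ r = 0 := Heart.shift_hom_eq_zero (h1 hF') hY (by lia) _
    have h0 : IsZero G := by
      rw [IsZero.iff_id_eq_zero]
      apply (shiftFunctor C (1 : ℤ)).map_injective
      rw [CategoryTheory.Functor.map_id, Functor.map_zero, ← cancel_epi e'.inv, hr,
        ← Category.assoc, hr', comp_zero, zero_comp]
    have : IsIso g := (Triangle.isZero₁_iff_isIso₂ _ hT).1 h0
    exact B.prop_of_iso (asIso g).symm hY
  have h3 (W : C) (hW : W = S ∨ W = T) :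
      B.prop W ∨ Nonempty (X ≅ W⟦(-1 : ℤ)⟧) := by
    have hW' := h.prop_of_eq hW
    rw [hA] at hW'
    obtain ⟨G, Y, f, g, δ, hT, hG, hY⟩ := hW'
    have hYA : A.prop Y := by
      rw [hA]; exact ObjectProperty.le_extensionProduct_right _ _ hY
    have hGA : A.prop G := by
      rw [hA]; exact ObjectProperty.le_extensionProduct_left _ _ hG
    obtain h0 | h0 := h.isZero_or_isZero hT hGA hYA hW
    · exact Or.inl (h2 hT (IsZero.eq_of_src h0 _ _) hY.1 hG)
    · right
      obtain ⟨F, hF, ⟨e⟩⟩ := hG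
      have : IsIso f := (Triangle.isZero₃_iff_isIso₁ _ hT).1 h0
      exact h.nonempty_iso_shift hW hX hF (by lia) ((asIso f).symm ≪≫ e)
  have h4 : ∃ W, (W = S ∨ W = T) ∧ Nonempty (X ≅ W⟦(-1 : ℤ)⟧) := by
    by_contra! hc
    have h5 (W : C) (hW : W = S ∨ W = T) (f : X⟦(1 : ℤ)⟧ ⟶ W) : f = 0 :=
      Heart.shift_hom_eq_zero hX' ((h3 W hW).resolve_right (not_nonempty_iff.2 (hc W hW)))
        (by lia) f
    have h6 : A.prop (X⟦(1 : ℤ)⟧) := by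
      rw [hA]
      exact ObjectProperty.le_extensionProduct_left _ _ ⟨X, copies_self X, ⟨Iso.refl _⟩⟩
    obtain ⟨Y, Z, f, g, δ, hT, hY, hZ⟩ := h.le _ h6
    obtain ⟨r, hr⟩ : ∃ r : _ ⟶ Y, 𝟙 (X⟦(1 : ℤ)⟧) = r ≫ f := Triangle.coyoneda_exact₂ _ hT (𝟙 _)
      (hom_copies_eq_zero hZ (h5 S (Or.inl rfl)) _)
    refine hX ?_
    rw [IsZero.iff_id_eq_zero]
    apply (shiftFunctor C (1 : ℤ)).map_injective
    rw [CategoryTheory.Functor.map_id, Functor.map_zero, hr,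
      hom_copies_eq_zero hY (h5 T (Or.inr rfl)) r, zero_comp]
  obtain ⟨W, hW, ⟨e⟩⟩ := h4
  refine ⟨W, hW, B.prop_of_iso e hX', fun Y hY hf => ?_⟩
  rw [hA] at hY
  obtain ⟨G, Y', f, g, δ, hT, hG, hY'⟩ := hY
  refine h2 hT ?_ hY'.1 hG
  obtain ⟨F, hF, ⟨i⟩⟩ := hG
  rw [← cancel_epi i.inv, comp_zero]
  apply (shiftFunctor C (-1 : ℤ)).map_injective
  rw [Functor.map_zero]
  refine (cancel_epi ((shiftFunctorCompIsoId C (1 : ℤ) (-1) (by lia)).inv.app F)).1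
    (Eq.trans ?_ comp_zero.symm)
  refine copies_hom_eq_zero hF (fun u => ?_) _
  obtain ⟨u', hu'⟩ := (shiftFunctor C (-1 : ℤ)).map_surjective (e.inv ≫ u)
  rw [← cancel_epi e.inv, comp_zero, ← hu', hf u', Functor.map_zero]

lemma not_isZero_of_simple {X : A.prop.FullSubcategory} (hX : Simple X) : ¬ IsZero X.obj :=
  fun h0 => (Simple.mono_isIso_iff_nonzero (𝟙 X)).1 inferInstance
    (ObjectProperty.hom_ext _ (h0.eq_of_src _ _))

/-- The neighbours of a heart of type `A₂` in the exchange graph. -/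
lemma IsSimplePair.exists_containsTilt (h : IsSimplePair A S T) (hAB : (exchangeGraph C).Adj A B) :
    ∃ W, (W = S ∨ W = T) ∧ (ContainsLeftTilt A B W ∨ ContainsRightTilt A B W) := by
  obtain ⟨-, ⟨X, hX, h'⟩ | ⟨X, hX, h'⟩⟩ := (SimpleGraph.fromRel_adj _ _ _).1 hAB
  · obtain ⟨W, hW, ⟨e⟩⟩ := h.nonempty_iso_of_simple hX
    obtain ⟨-, h'⟩ | ⟨-, h'⟩ := h'
    · exact ⟨W, hW, Or.inl ((containsLeftTilt_of_eq h').of_iso e)⟩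
    · exact ⟨W, hW, Or.inr ((containsRightTilt_of_eq h').of_iso e)⟩
  · obtain ⟨-, h'⟩ | ⟨-, h'⟩ := h'
    · obtain ⟨W, hW, h''⟩ :=
        h.exists_containsRightTilt (not_isZero_of_simple hX) X.property h'
      exact ⟨W, hW, Or.inr h''⟩
    · obtain ⟨W, hW, h''⟩ :=
        h.exists_containsLeftTilt (not_isZero_of_simple hX) X.property h'
      exact ⟨W, hW, Or.inl h''⟩

end

section

open Triangulated

variable {C : Type*} [Category C] [Preadditive C] [HasZeroObject C] [HasShift C ℤ]
  [∀ n : ℤ, (shiftFunctor C n).Additive] [Pretriangulated C]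

lemma copies_of_iso {S S' X X' : C} (h : copies S X) (i : S ≅ S') (j : X ≅ X') :
    copies S' X' := by
  obtain ⟨n, b, ⟨hb⟩, ⟨e⟩⟩ := h
  refine ⟨n, { pt := b.pt, π := fun p => b.π p ≫ i.hom, ι := fun p => i.inv ≫ b.ι p, ι_π := ?_ },
    ⟨isBilimitOfTotal _ ?_⟩, ⟨j.symm ≪≫ e⟩⟩
  · intro p q
    rw [Category.assoc, ← Category.assoc (b.ι p), b.ι_π]
    split_ifs with hpq
    · subst hpq; simp
    · simp
  · have := IsBilimit.total hb
    simpa using this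

lemma copies_map {S X : C} (h : copies S X) (F : C ⥤ C) [F.Additive] :
    copies (F.obj S) (F.obj X) := by
  obtain ⟨n, b, ⟨hb⟩, ⟨e⟩⟩ := h
  exact ⟨n, F.mapBicone b, ⟨isBilimitOfPreserves F hb⟩, ⟨F.mapIso e⟩⟩

lemma additive_of_isExact {F : C ⥤ C} (hF : IsExact F) : F.Additive := by
  obtain ⟨_, _⟩ := hF
  infer_instance

lemma nonempty_map_shift {F : C ⥤ C} (hF : IsExact F) (n : ℤ) (X : C) :
    Nonempty (F.obj (X⟦n⟧) ≅ (F.obj X)⟦n⟧) := by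
  obtain ⟨_, _⟩ := hF
  exact ⟨(F.commShiftIso n).app X⟩

lemma extensionProduct_map {F : C ⥤ C} (hF : IsExact F) {P Q P' Q' : ObjectProperty C}
    (hP : ∀ X, P X → P' (F.obj X)) (hQ : ∀ X, Q X → Q' (F.obj X)) {X : C}
    (h : P.extensionProduct Q X) : P'.extensionProduct Q' (F.obj X) := by
  obtain ⟨_, _⟩ := hF
  obtain ⟨Y, Z, f, g, δ, hT, hY, hZ⟩ := h
  exact ⟨_, _, _, _, _, F.map_distinguished _ hT, hP _ hY, hQ _ hZ⟩

section

variable {e : C ≌ C} (he : IsExact e.functor)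

include he

lemma extensionProduct_inverseImage (P Q : ObjectProperty C) [P.IsClosedUnderIsomorphisms]
    [Q.IsClosedUnderIsomorphisms] :
    (P.extensionProduct Q).inverseImage e.inverse =
      (P.inverseImage e.inverse).extensionProduct (Q.inverseImage e.inverse) := by
  ext X
  constructor
  · intro h
    refine ObjectProperty.prop_of_iso _ (e.counitIso.app X)
      (extensionProduct_map he (fun Y hY => ?_) (fun Y hY => ?_) h)
    · exact P.prop_of_iso (e.unitIso.app Y) hY
    · exact Q.prop_of_iso (e.unitIso.app Y) hY
  · exact fun h => extensionProduct_map he.symm (fun _ h => h) (fun _ h => h) h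

lemma copies_inverseImage (S : C) :
    (copies S).inverseImage e.inverse = copies (e.functor.obj S) := by
  have := additive_of_isExact he
  have := additive_of_isExact he.symm
  ext X
  exact ⟨fun h => copies_of_iso (copies_map h e.functor) (Iso.refl _) (e.counitIso.app X),
    fun h => copies_of_iso (copies_map h e.inverse) (e.unitIso.app S).symm (Iso.refl _)⟩

lemma shift_inverseImage (P : ObjectProperty C) [P.IsClosedUnderIsomorphisms] (n : ℤ) :
    ObjectProperty.inverseImage (fun X => ∃ Y, P Y ∧ Nonempty (X ≅ Y⟦n⟧)) e.inverse =
      fun X => ∃ Y, P.inverseImage e.inverse Y ∧ Nonempty (X ≅ Y⟦n⟧) := by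
  ext X
  constructor
  · rintro ⟨Y, hY, ⟨i⟩⟩
    obtain ⟨j⟩ := nonempty_map_shift he n Y
    exact ⟨e.functor.obj Y, P.prop_of_iso (e.unitIso.app Y) hY,
      ⟨(e.counitIso.app X).symm ≪≫ e.functor.mapIso i ≪≫ j⟩⟩
  · rintro ⟨Y, hY, ⟨i⟩⟩
    obtain ⟨j⟩ := nonempty_map_shift he.symm n Y
    exact ⟨e.inverse.obj Y, hY, ⟨e.inverse.mapIso i ≪≫ j⟩⟩

lemma forall_from_eq_zero_iff (S X : C) :
    (∀ f : S ⟶ e.inverse.obj X, f = 0) ↔ ∀ f : e.functor.obj S ⟶ X, f = 0 := by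
  have := additive_of_isExact he
  have := additive_of_isExact he.symm
  constructor
  · intro h f
    apply e.inverse.map_injective
    rw [← cancel_epi (e.unitIso.hom.app S), h (e.unitIso.hom.app S ≫ e.inverse.map f),
      Functor.map_zero, comp_zero]
  · intro h f
    apply e.functor.map_injective
    rw [← cancel_mono (e.counitIso.hom.app X), h (e.functor.map f ≫ e.counitIso.hom.app X),
      Functor.map_zero, zero_comp]

lemma forall_to_eq_zero_iff (S X : C) :
    (∀ f : e.inverse.obj X ⟶ S, f = 0) ↔ ∀ f : X ⟶ e.functor.obj S, f = 0 := by
  have := additive_of_isExact he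
  have := additive_of_isExact he.symm
  constructor
  · intro h f
    apply e.inverse.map_injective
    rw [← cancel_mono (e.unitIso.inv.app S), h (e.inverse.map f ≫ e.unitIso.inv.app S),
      Functor.map_zero, zero_comp]
  · intro h f
    apply e.functor.map_injective
    rw [← cancel_epi (e.counitIso.inv.app X), h (e.counitIso.inv.app X ≫ e.functor.map f),
      Functor.map_zero, comp_zero]

lemma IsTorsionPair.inverseImage {A 𝒯 ℱ : ObjectProperty C} [𝒯.IsClosedUnderIsomorphisms]
    [ℱ.IsClosedUnderIsomorphisms] (h : IsTorsionPair A 𝒯 ℱ) :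
    IsTorsionPair (A.inverseImage e.inverse) (𝒯.inverseImage e.inverse)
      (ℱ.inverseImage e.inverse) where
  le_left _ hX := h.le_left _ hX
  le_right _ hX := h.le_right _ hX
  hom_eq_zero T F hT hF f := by
    have := additive_of_isExact he.symm
    apply e.inverse.map_injective
    rw [h.hom_eq_zero hT hF (e.inverse.map f), Functor.map_zero]
  le_extension := by
    rw [← extensionProduct_inverseImage he]
    exact fun X hX => h.le_extension _ hX

end

instance (S : C) : (copies S).IsClosedUnderIsomorphisms where
  of_iso i h := copies_of_iso h (Iso.refl _) i

instance (A : Heart C) (S : C) : ObjectProperty.IsClosedUnderIsomorphisms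
    (fun X => A.prop X ∧ ∀ f : S ⟶ X, f = 0) where
  of_iso i h := ⟨A.prop_of_iso i h.1, fun f => by
    rw [← Category.comp_id f, ← i.inv_hom_id, ← Category.assoc, h.2 (f ≫ i.inv), zero_comp]⟩

instance (A : Heart C) (S : C) : ObjectProperty.IsClosedUnderIsomorphisms
    (fun X => A.prop X ∧ ∀ f : X ⟶ S, f = 0) where
  of_iso i h := ⟨A.prop_of_iso i h.1, fun f => by
    rw [← Iso.inv_hom_id_assoc i f, h.2 (i.hom ≫ f), comp_zero]⟩

instance (P : ObjectProperty C) (n : ℤ) : ObjectProperty.IsClosedUnderIsomorphisms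
    (fun X : C => ∃ Y, P Y ∧ Nonempty (X ≅ Y⟦n⟧)) where
  of_iso i := fun ⟨Y, hY, ⟨j⟩⟩ => ⟨Y, hY, ⟨i.symm ≪≫ j⟩⟩

lemma simple_of_isEquivalence {A B : Type*} [Category A] [Category B] [HasZeroMorphisms A]
    [HasZeroMorphisms B] (G : A ⥤ B) [G.IsEquivalence] [G.PreservesZeroMorphisms] {X : A}
    (h : Simple (G.obj X)) : Simple X where
  mono_isIso_iff_nonzero f _ := by
    rw [← isIso_iff_of_reflects_iso f G, Simple.mono_isIso_iff_nonzero (G.map f), ne_eq, ne_eq,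
      ← G.map_zero, G.map_injective.eq_iff]

lemma simple_inverseImage {A : Heart C} {S : A.prop.FullSubcategory} (hS : Simple S) {e : C ≌ C}
    (he : IsExact e.functor) (hS' : A.prop.inverseImage e.inverse (e.functor.obj S.obj)) :
    Simple (⟨_, hS'⟩ : (A.prop.inverseImage e.inverse).FullSubcategory) := by
  have := additive_of_isExact he.symm
  let G : (A.prop.inverseImage e.inverse).FullSubcategory ⥤ A.prop.FullSubcategory :=
    A.prop.lift ((A.prop.inverseImage e.inverse).ι ⋙ e.inverse) fun X => X.property
  have : G.EssSurj := ⟨fun Y => ⟨⟨e.functor.obj Y.obj, A.prop_of_iso (e.unitIso.app Y.obj)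
    Y.property⟩, ⟨A.prop.isoMk (e.unitIso.app Y.obj).symm⟩⟩⟩
  have : G.Full :=
    have : ((A.prop.inverseImage e.inverse).ι ⋙ e.inverse).Full := Functor.Full.comp _ _
    Functor.Full.of_comp_faithful_iso (A.prop.liftCompιIso
      ((A.prop.inverseImage e.inverse).ι ⋙ e.inverse) fun X => X.property)
  have : G.Faithful :=
    have : ((A.prop.inverseImage e.inverse).ι ⋙ e.inverse).Faithful :=
      Functor.Faithful.comp _ _
    Functor.Faithful.of_comp_iso (A.prop.liftCompιIso
      ((A.prop.inverseImage e.inverse).ι ⋙ e.inverse) fun X => X.property)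
  have : G.IsEquivalence := { }
  have : G.PreservesZeroMorphisms := ⟨fun X Y => ObjectProperty.hom_ext _ (by
    exact e.inverse.map_zero _ _)⟩
  refine simple_of_isEquivalence G ?_
  exact Simple.of_iso (Y := S) (A.prop.isoMk (e.unitIso.app S.obj).symm)

lemma IsSimpleTilt.inverseImage {A A' : Heart C} (h : IsSimpleTilt A.prop A'.prop) {e : C ≌ C}
    (he : IsExact e.functor) :
    IsSimpleTilt (A.prop.inverseImage e.inverse) (A'.prop.inverseImage e.inverse) := by
  have := additive_of_isExact he.symm
  obtain ⟨S, hS, h⟩ := h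
  have hS' : A.prop.inverseImage e.inverse (e.functor.obj S.obj) :=
    A.prop_of_iso (e.unitIso.app S.obj) S.property
  refine ⟨⟨e.functor.obj S.obj, hS'⟩, ?_, ?_⟩
  · exact simple_inverseImage hS he hS'
  · have h1 : (ObjectProperty.inverseImage (fun X => A.prop X ∧ ∀ f : S.obj ⟶ X, f = 0) e.inverse) =
        fun X => A.prop.inverseImage e.inverse X ∧ ∀ f : e.functor.obj S.obj ⟶ X, f = 0 := by
      ext X
      exact and_congr_right fun _ => forall_from_eq_zero_iff he _ _
    have h2 : (ObjectProperty.inverseImage (fun X => A.prop X ∧ ∀ f : X ⟶ S.obj, f = 0) e.inverse) =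
        fun X => A.prop.inverseImage e.inverse X ∧ ∀ f : X ⟶ e.functor.obj S.obj, f = 0 := by
      ext X
      exact and_congr_right fun _ => forall_to_eq_zero_iff he _ _
    refine h.imp (fun h => ?_) fun h => ?_
    · have h3 := h.1.inverseImage he
      rw [h1, copies_inverseImage he] at h3
      refine ⟨h3, ?_⟩
      rw [h.2, leftTilt, extensionProduct_inverseImage he, shift_inverseImage he, h1,
        copies_inverseImage he]
      rfl
    · have h3 := h.1.inverseImage he
      rw [h2, copies_inverseImage he] at h3
      refine ⟨h3, ?_⟩
      rw [h.2, rightTilt, extensionProduct_inverseImage he, shift_inverseImage he, h2,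
        copies_inverseImage he]
      rfl

variable [Linear ℂ C]

lemma isSimpleTilt_smul (g : AutD C) {A A' : Heart C} (h : IsSimpleTilt A.prop A'.prop) :
    IsSimpleTilt (g • A).prop (g • A').prop := by
  obtain ⟨e⟩ := g
  exact h.inverseImage e.exact

lemma exchangeGraph_adj_smul (g : AutD C) {A B : Heart C} (h : (exchangeGraph C).Adj A B) :
    (exchangeGraph C).Adj (g • A) (g • B) := by
  rw [exchangeGraph, SimpleGraph.fromRel_adj] at h ⊢
  exact ⟨fun h0 => h.1 (MulAction.injective g h0),
    h.2.imp (isSimpleTilt_smul g) (isSimpleTilt_smul g)⟩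

lemma reachable_smul (g : AutD C) {A B : Heart C} (h : (exchangeGraph C).Reachable A B) :
    (exchangeGraph C).Reachable (g • A) (g • B) := by
  obtain ⟨w⟩ := h
  induction w with
  | nil => exact SimpleGraph.Reachable.refl _
  | cons h _ ih => exact (exchangeGraph_adj_smul g h).reachable.trans ih

end

section

open Triangulated

variable {C : Type*} [Category C] [Preadditive C] [HasZeroObject C] [HasShift C ℤ]
  [∀ n : ℤ, (shiftFunctor C n).Additive] [Pretriangulated C]

/-- A split sequence is a distinguished triangle. -/
lemma distinguished_of_split {Z P X : C} {φ : Z ⟶ P} {p : P ⟶ X} {r : P ⟶ Z} {s : X ⟶ P}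
    (h₁ : φ ≫ r = 𝟙 Z) (h₂ : s ≫ p = 𝟙 X) (h₃ : φ ≫ p = 0) (h₄ : s ≫ r = 0)
    (h₅ : p ≫ s + r ≫ φ = 𝟙 P) : Triangle.mk φ p (0 : X ⟶ Z⟦(1 : ℤ)⟧) ∈ distTriang C := by
  let e : P ≅ Z ⊞ X :=
    { hom := biprod.lift r p
      inv := biprod.desc φ s
      hom_inv_id := by rw [biprod.lift_desc, add_comm, h₅]
      inv_hom_id := by
        apply biprod.hom_ext' <;> apply biprod.hom_ext <;> simp [h₁, h₂, h₃, h₄] }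
  refine isomorphic_distinguished _ (binaryBiproductTriangle_distinguished Z X) _
    (Triangle.isoMk _ _ (Iso.refl _) e (Iso.refl _) ?_ ?_ ?_)
  · change φ ≫ e.hom = 𝟙 Z ≫ biprod.inl
    apply biprod.hom_ext <;> simp [e, h₁, h₃]
  · change p ≫ 𝟙 X = e.hom ≫ biprod.snd
    simp [e]
  · exact zero_comp.trans comp_zero.symm

/-- Two triangles whose first morphisms agree up to isomorphism and a shift have cones which agree
up to that shift. -/
lemma nonempty_iso_shift_of_distinguished {X Y Z X' Y' Z' : C} {f : X ⟶ Y} {g : Y ⟶ Z}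
    {δ : Z ⟶ X⟦(1 : ℤ)⟧} (hT : Triangle.mk f g δ ∈ distTriang C) {f' : X' ⟶ Y'} {g' : Y' ⟶ Z'}
    {δ' : Z' ⟶ X'⟦(1 : ℤ)⟧} (hT' : Triangle.mk f' g' δ' ∈ distTriang C) {n : ℤ} (i : X' ≅ X⟦n⟧)
    (j : Y' ≅ Y⟦n⟧) (hf' : f' ≠ 0)
    (hf : ∀ u : X ⟶ Y, u ≠ 0 → ∃ (a : X ≅ X) (b : Y ≅ Y), u ≫ b.hom = a.hom ≫ f) :
    Nonempty (Z' ≅ Z⟦n⟧) := by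
  obtain ⟨u, hu⟩ := (shiftFunctor C n).map_surjective (i.inv ≫ f' ≫ j.hom)
  obtain ⟨a, b, hab⟩ := hf u fun h0 => hf' (by
    rw [h0, Functor.map_zero] at hu
    rw [← cancel_mono j.hom, ← cancel_epi i.inv, ← hu, zero_comp, comp_zero])
  let j' : Y' ≅ Y⟦n⟧ := j ≪≫ (shiftFunctor C n).mapIso b
  let e : Y' ≅ Y⟦n⟧ :=
    { hom := n.negOnePow • j'.hom
      inv := n.negOnePow • j'.inv
      hom_inv_id := by
        rw [Linear.units_smul_comp, Linear.comp_units_smul, smul_smul, Int.units_mul_self, one_smul,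
          Iso.hom_inv_id]
      inv_hom_id := by
        rw [Linear.units_smul_comp, Linear.comp_units_smul, smul_smul, Int.units_mul_self, one_smul,
          Iso.inv_hom_id] }
  refine ⟨Triangle.π₃.mapIso (isoTriangleOfIso₁₂ _ _ hT' (Triangle.shift_distinguished _ hT n)
    (i ≪≫ (shiftFunctor C n).mapIso a) e ?_)⟩
  change f' ≫ (n.negOnePow • (j.hom ≫ b.hom⟦n⟧')) = (i.hom ≫ a.hom⟦n⟧') ≫ (n.negOnePow • f⟦n⟧')
  rw [Linear.comp_units_smul, Linear.comp_units_smul, Category.assoc, ← Functor.map_comp, ← hab,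
    Functor.map_comp, hu]
  simp

lemma nonempty_iso_shift_shift (X : C) {m n k : ℤ} (h : m + n = k) :
    Nonempty (X⟦m⟧⟦n⟧ ≅ X⟦k⟧) :=
  ⟨((shiftFunctorAdd' C m n k h).app X).symm⟩

variable [Linear ℂ C]

/-- The only nonzero morphisms from shifts of `X` to `Y` are the multiples of a morphism of
degree `m`. -/
structure IsHomLine (X Y : C) (m : ℤ) : Prop where
  eq_zero : ∀ n, n ≠ m → ∀ f : X⟦n⟧ ⟶ Y, f = 0
  finrank : Module.finrank ℂ (X⟦m⟧ ⟶ Y) = 1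

/-- `X` is a spherical object of dimension `3`. -/
structure IsSpherical (X : C) : Prop where
  eq_zero : ∀ n : ℤ, n ≠ 0 → n ≠ -3 → ∀ f : X⟦n⟧ ⟶ X, f = 0
  finrank_zero : Module.finrank ℂ (X⟦(0 : ℤ)⟧ ⟶ X) = 1
  finrank_neg_three : Module.finrank ℂ (X⟦(-3 : ℤ)⟧ ⟶ X) = 1

lemma exists_smul_eq {X Y : C} (h : Module.finrank ℂ (X ⟶ Y) = 1) {f : X ⟶ Y} (hf : f ≠ 0)
    (g : X ⟶ Y) : ∃ c : ℂ, c • f = g :=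
  (finrank_eq_one_iff_of_nonzero' f hf).1 h g

lemma IsSpherical.brick {X : C} (h : IsSpherical X) (f : X ⟶ X) : f = 0 ∨ IsIso f := by
  by_cases h0 : IsZero X
  · exact Or.inl (h0.eq_of_src _ _)
  have hi : Module.finrank ℂ (X ⟶ X) = 1 := by
    rw [← h.finrank_zero]
    exact LinearEquiv.finrank_eq (Linear.homCongr ℂ ((shiftFunctorZero C ℤ).app X).symm
      (Iso.refl X))
  obtain ⟨c, rfl⟩ := exists_smul_eq hi (fun h1 => h0 ((IsZero.iff_id_eq_zero _).2 h1)) f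
  by_cases hc : c = 0
  · left; rw [hc, zero_smul]
  · right
    exact ⟨c⁻¹ • 𝟙 X, by simp [smul_smul, hc], by simp [smul_smul, hc]⟩

lemma IsSpherical.not_isZero {X : C} (h : IsSpherical X) : ¬ IsZero X := fun h0 => by
  have := Module.nontrivial_of_finrank_eq_succ (n := 0) h.finrank_zero
  obtain ⟨f, hf⟩ := exists_ne (0 : X⟦(0 : ℤ)⟧ ⟶ X)
  exact hf (h0.eq_of_tgt _ _)

lemma isEmpty_of_forall_eq_zero {ι : Type} {V : Type*} [AddCommGroup V] [Module ℂ V]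
    (b : Module.Basis ι ℂ V) (h : ∀ v : V, v = 0) : IsEmpty ι :=
  ⟨fun i => b.ne_zero i (h _)⟩

lemma nonempty_unique_of_finrank {ι : Type} {V : Type*} [AddCommGroup V] [Module ℂ V]
    (b : Module.Basis ι ℂ V) (h : Module.finrank ℂ V = 1) : Nonempty (Unique ι) := by
  have := Module.nontrivial_of_finrank_eq_succ (n := 0) h
  have := Module.finite_of_finrank_eq_succ (n := 0) h
  have := Module.Finite.finite_basis b
  have := Fintype.ofFinite ι
  rw [Module.finrank_eq_card_basis b, Fintype.card_eq_one_iff_nonempty_unique] at h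
  exact h

/-- The twist of an object with a single morphism from the shifts of the spherical object. -/
lemma IsTwist.exists_triangle {X Y : C} {Φ : C ⥤ C} (hΦ : IsTwist X Φ) {m : ℤ}
    (h : IsHomLine X Y m) : ∃ (f : X⟦m⟧ ⟶ Y) (g : Y ⟶ Φ.obj Y) (δ : Φ.obj Y ⟶ X⟦m⟧⟦(1 : ℤ)⟧),
      f ≠ 0 ∧ Triangle.mk f g δ ∈ distTriang C := by
  obtain ⟨η, hη⟩ := hΦ
  obtain ⟨ι, b, c, ev, δ, ⟨hc⟩, hev, hT⟩ := hη Y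
  obtain ⟨_⟩ := nonempty_unique_of_finrank (b m) h.finrank
  have hι {n : ℤ} (i : ι n) : n = m := by
    by_contra hn
    exact (isEmpty_of_forall_eq_zero (b n) (h.eq_zero n hn)).false i
  let p₀ : Σ n, ι n := ⟨m, default⟩
  have hp (p : Σ n, ι n) : p = p₀ := by
    obtain ⟨n, i⟩ := p
    obtain rfl := hι i
    rw [Unique.eq_default i]
  let r : c.pt ⟶ X⟦m⟧ := Cofan.IsColimit.desc hc fun p => eqToHom (by rw [hp p])
  have hr : c.inj p₀ ≫ r = 𝟙 _ := Cofan.IsColimit.fac hc _ _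
  let e : X⟦m⟧ ≅ c.pt :=
    { hom := c.inj p₀
      inv := r
      hom_inv_id := hr
      inv_hom_id := Cofan.IsColimit.hom_ext hc _ _ fun p => by
        obtain rfl := hp p
        rw [← Category.assoc, hr, Category.id_comp, Category.comp_id] }
  refine ⟨b m default, η.app Y, δ ≫ e.inv⟦(1 : ℤ)⟧', (b m).ne_zero _, ?_⟩
  refine isomorphic_distinguished _ hT _ (Triangle.isoMk _ _ e (Iso.refl _) (Iso.refl _) ?_ ?_ ?_)
  · exact (Category.comp_id _).trans (hev p₀).symm
  · exact (Category.comp_id _).trans (Category.id_comp _).symm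
  · change (δ ≫ e.inv⟦(1 : ℤ)⟧') ≫ e.hom⟦(1 : ℤ)⟧' = 𝟙 _ ≫ δ
    rw [Category.assoc, ← Functor.map_comp, e.inv_hom_id, CategoryTheory.Functor.map_id,
      Category.comp_id, Category.id_comp]

/-- The twist of the spherical object itself. -/
lemma IsTwist.nonempty_iso {X : C} {Φ : C ⥤ C} (hΦ : IsTwist X Φ) (h : IsSpherical X) :
    Nonempty (Φ.obj X ≅ X⟦(-2 : ℤ)⟧) := by
  obtain ⟨η, hη⟩ := hΦ
  obtain ⟨ι, b, c, ev, δ, ⟨hc⟩, hev, hT⟩ := hη X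
  obtain ⟨_⟩ := nonempty_unique_of_finrank (b 0) h.finrank_zero
  obtain ⟨_⟩ := nonempty_unique_of_finrank (b (-3)) h.finrank_neg_three
  have hι {n : ℤ} (i : ι n) : n = 0 ∨ n = -3 := by
    by_contra! hn
    exact (isEmpty_of_forall_eq_zero (b n) (h.eq_zero n hn.1 hn.2)).false i
  let p₀ : Σ n, ι n := ⟨0, default⟩
  let p₁ : Σ n, ι n := ⟨-3, default⟩
  have hp (p : Σ n, ι n) : p = p₀ ∨ p = p₁ := by
    obtain ⟨n, i⟩ := p
    obtain rfl | rfl := hι i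
    · left; rw [Unique.eq_default i]
    · right; rw [Unique.eq_default i]
  let r : c.pt ⟶ X⟦(-3 : ℤ)⟧ := Cofan.IsColimit.desc hc fun p =>
    if hn : p.1 = -3 then eqToHom (by rw [hn]) else 0
  have hr₀ : c.inj p₀ ≫ r = 0 := (Cofan.IsColimit.fac hc _ _).trans (dif_neg (by simp [p₀]))
  have hr₁ : c.inj p₁ ≫ r = 𝟙 _ := (Cofan.IsColimit.fac hc _ _).trans (dif_pos rfl)
  let i₀ : X ⟶ X⟦(0 : ℤ)⟧ := ((shiftFunctorZero C ℤ).app X).inv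
  have : IsIso (i₀ ≫ b 0 default) := (h.brick _).resolve_left fun h0 => (b 0).ne_zero default (by
    rw [← cancel_epi i₀, h0, comp_zero])
  have : IsIso (b 0 default) := IsIso.of_isIso_comp_left i₀ _
  let s : X ⟶ c.pt := inv (b 0 default) ≫ c.inj p₀
  let φ : X⟦(-3 : ℤ)⟧ ⟶ c.pt := c.inj p₁ - (b (-3) default) ≫ s
  have hs : s ≫ ev = 𝟙 X := by
    rw [Category.assoc, hev]; exact IsIso.inv_hom_id _
  have hs' : s ≫ r = 0 := by rw [Category.assoc, hr₀, comp_zero]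
  have hT' : Triangle.mk φ ev (0 : X ⟶ X⟦(-3 : ℤ)⟧⟦(1 : ℤ)⟧) ∈ distTriang C := by
    refine distinguished_of_split (r := r) (s := s) ?_ hs ?_ hs' ?_
    · rw [Preadditive.sub_comp, hr₁, Category.assoc, hs', comp_zero, sub_zero]
    · rw [Preadditive.sub_comp, hev, Category.assoc, hs, Category.comp_id]; exact sub_self _
    · refine Cofan.IsColimit.hom_ext hc _ _ fun p => ?_
      rw [Preadditive.comp_add, ← Category.assoc (c.inj p) ev s, hev, ← Category.assoc (c.inj p) r,
        Category.comp_id]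
      obtain rfl | rfl := hp p
      · rw [hr₀, zero_comp, add_zero]
        exact IsIso.hom_inv_id_assoc (b 0 default) (c.inj p₀)
      · rw [hr₁, Category.id_comp]
        exact add_sub_cancel _ _
  obtain ⟨j⟩ := nonempty_iso_shift_shift X (show (-3 : ℤ) + 1 = -2 by lia)
  exact ⟨Triangle.π₃.mapIso (isoTriangleOfIso₁₂ _ _ hT (rot_of_distTriang _ hT')
    (Iso.refl _) (Iso.refl _) ((Category.comp_id _).trans (Category.id_comp _).symm)) ≪≫ j⟩

end

section

open Triangulated

variable {C : Type*} [Category C] [Preadditive C] [HasZeroObject C] [HasShift C ℤ]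
  [∀ n : ℤ, (shiftFunctor C n).Additive] [Pretriangulated C] [Linear ℂ C]

/-- The autoequivalence `g` sends `X` to an object isomorphic to `Y`. -/
def Acts (g : AutD C) (X Y : C) : Prop :=
  ∃ e : ExactAutoequivalence C, e.toAut = g ∧ Nonempty (e.equiv.functor.obj X ≅ Y)

namespace Acts

variable {g h : AutD C} {X Y Z : C}

lemma nonempty_iso {e : ExactAutoequivalence C} (h : Acts e.toAut X Y) :
    Nonempty (e.equiv.functor.obj X ≅ Y) := by
  obtain ⟨e', he, ⟨i⟩⟩ := h
  obtain ⟨j⟩ : Nonempty (e'.equiv.functor ≅ e.equiv.functor) := _root_.Quotient.exact he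
  exact ⟨(j.app X).symm ≪≫ i⟩

lemma exists_rep (g : AutD C) : ∃ e : ExactAutoequivalence C, e.toAut = g :=
  _root_.Quotient.exists_rep g

lemma of_iso (H : Acts g X Y) (i : Y ≅ Z) : Acts g X Z := by
  obtain ⟨e, he, ⟨j⟩⟩ := H
  exact ⟨e, he, ⟨j ≪≫ i⟩⟩

lemma mul (H : Acts g Y Z) (H' : Acts h X Y) : Acts (g * h) X Z := by
  obtain ⟨e, rfl, ⟨i⟩⟩ := H
  obtain ⟨e', rfl, ⟨i'⟩⟩ := H'
  exact ⟨e.comp e', rfl, ⟨e.equiv.functor.mapIso i' ≪≫ i⟩⟩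

lemma shift (H : Acts g X Y) (n : ℤ) : Acts g (X⟦n⟧) (Y⟦n⟧) := by
  obtain ⟨e, he, ⟨i⟩⟩ := H
  obtain ⟨j⟩ := nonempty_map_shift e.exact n X
  exact ⟨e, he, ⟨j ≪≫ (shiftFunctor C n).mapIso i⟩⟩

lemma shift_shift {m : ℤ} (H : Acts g X (Y⟦m⟧)) (n k : ℤ) (hk : m + n = k) :
    Acts g (X⟦n⟧) (Y⟦k⟧) :=
  (H.shift n).of_iso (nonempty_iso_shift_shift Y hk).some

lemma of_shift_zero (H : Acts g X (Y⟦(0 : ℤ)⟧)) : Acts g X Y :=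
  H.of_iso ((shiftFunctorZero C ℤ).app Y)

lemma shift_zero (H : Acts g X Y) : Acts g X (Y⟦(0 : ℤ)⟧) :=
  H.of_iso ((shiftFunctorZero C ℤ).symm.app Y)

/-- The action of an autoequivalence on a cone. -/
lemma cone {X Y Z X' Y' Z' : C} {f : X ⟶ Y} {u : Y ⟶ Z}
    {δ : Z ⟶ X⟦(1 : ℤ)⟧} (hT : Triangle.mk f u δ ∈ distTriang C) {f' : X' ⟶ Y'} {u' : Y' ⟶ Z'}
    {δ' : Z' ⟶ X'⟦(1 : ℤ)⟧} (hT' : Triangle.mk f' u' δ' ∈ distTriang C) {n : ℤ}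
    (H : Acts g X' (X⟦n⟧)) (H' : Acts g Y' (Y⟦n⟧)) (hf' : f' ≠ 0)
    (hf : ∀ v : X ⟶ Y, v ≠ 0 → ∃ (a : X ≅ X) (b : Y ≅ Y), v ≫ b.hom = a.hom ≫ f) :
    Acts g Z' (Z⟦n⟧) := by
  obtain ⟨e, rfl⟩ := exists_rep g
  obtain ⟨i⟩ := H.nonempty_iso
  obtain ⟨j⟩ := H'.nonempty_iso
  obtain ⟨_, _⟩ := e.exact
  refine ⟨e, rfl, nonempty_iso_shift_of_distinguished hT
    (e.equiv.functor.map_distinguished _ hT') i j (fun h0 => hf' ?_) hf⟩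
  exact e.equiv.functor.map_injective (h0.trans (Functor.map_zero _ _ _).symm)

end Acts

lemma AutD.IsShift.acts_pow {σ : AutD C} (hσ : σ.IsShift) (X : C) (n : ℕ) :
    Acts (σ ^ n) X (X⟦(n : ℤ)⟧) := by
  induction n with
  | zero => exact ⟨ExactAutoequivalence.refl, rfl, ⟨((shiftFunctorZero C ℤ).app X).symm⟩⟩
  | succ n ih =>
    obtain ⟨e, rfl, ⟨i⟩⟩ := hσ
    rw [pow_succ']
    exact Acts.mul ⟨e, rfl, ⟨i.app _ ≪≫ (nonempty_iso_shift_shift X (by simp)).some⟩⟩ ih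

lemma Acts.pow_mul {σ g : AutD C} (hσ : σ.IsShift) {X Y : C} {m : ℤ} (H : Acts g X (Y⟦m⟧)) (n : ℕ)
    (k : ℤ) (hk : m + n = k) : Acts (σ ^ n * g) X (Y⟦k⟧) :=
  ((hσ.acts_pow _ n).mul H).of_iso (nonempty_iso_shift_shift Y hk).some

/-- `E` is a nontrivial extension of `S` by `T`. -/
def IsExtension (S T E : C) : Prop :=
  ∃ (f : S⟦(-1 : ℤ)⟧ ⟶ T) (i : T ⟶ E) (δ : E ⟶ S⟦(-1 : ℤ)⟧⟦(1 : ℤ)⟧),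
    f ≠ 0 ∧ Triangle.mk f i δ ∈ distTriang C

variable {S T E : C} {A₀ B : Heart C}

lemma IsExtension.exists_triangle (h : IsExtension S T E) :
    ∃ (i : T ⟶ E) (p : E ⟶ S) (δ : S ⟶ T⟦(1 : ℤ)⟧), δ ≠ 0 ∧ Triangle.mk i p δ ∈ distTriang C := by
  obtain ⟨f, i, δ, hf, hT⟩ := h
  let j : S⟦(-1 : ℤ)⟧⟦(1 : ℤ)⟧ ≅ S := (shiftFunctorCompIsoId C (-1 : ℤ) 1 (by lia)).app S
  refine ⟨i, δ ≫ j.hom, j.inv ≫ (-f⟦(1 : ℤ)⟧'), fun h0 => hf ?_, ?_⟩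
  · apply (shiftFunctor C (1 : ℤ)).map_injective
    rw [Functor.map_zero, ← neg_eq_zero, ← cancel_epi j.inv, h0, comp_zero]
  · refine isomorphic_distinguished _ (rot_of_distTriang _ hT) _
      (Triangle.isoMk _ _ (Iso.refl _) (Iso.refl _) j.symm ?_ ?_ ?_)
    · exact (Category.comp_id _).trans (Category.id_comp _).symm
    · change (δ ≫ j.hom) ≫ j.inv = 𝟙 _ ≫ δ
      simp
    · change (j.inv ≫ (-f⟦(1 : ℤ)⟧')) ≫ (𝟙 T)⟦(1 : ℤ)⟧' = j.inv ≫ (-f⟦(1 : ℤ)⟧')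
      rw [CategoryTheory.Functor.map_id, Category.comp_id]

lemma isSimplePair_of_isSpherical (hS : IsSpherical S) (hT : IsSpherical T)
    (hST : IsHomLine S T (-1)) (hTS : IsHomLine T S (-2)) (h₁ : A₀.prop S) (h₂ : A₀.prop T)
    (hle : A₀.prop ≤ (copies T).extensionProduct (copies S)) : IsSimplePair A₀ S T where
  left := h₁
  right := h₂
  le := hle
  not_isZero_left := hS.not_isZero
  not_isZero_right := hT.not_isZero
  brick_left := hS.brick
  brick_right := hT.brick
  hom_left f := by
    rw [← cancel_epi ((shiftFunctorZero C ℤ).app S).hom, comp_zero]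
    exact hST.eq_zero 0 (by lia) _
  hom_right f := by
    rw [← cancel_epi ((shiftFunctorZero C ℤ).app T).hom, comp_zero]
    exact hTS.eq_zero 0 (by lia) _
  exists_ext := by
    have := Module.nontrivial_of_finrank_eq_succ (n := 0) hST.finrank
    obtain ⟨f, hf⟩ := exists_ne (0 : S⟦(-1 : ℤ)⟧ ⟶ T)
    let j := (shiftFunctorCompIsoId C (-1 : ℤ) 1 (by lia)).app S
    refine ⟨j.inv ≫ f⟦(1 : ℤ)⟧', fun h0 => hf ?_⟩
    apply (shiftFunctor C (1 : ℤ)).map_injective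
    rw [Functor.map_zero, ← cancel_epi j.inv, h0, comp_zero]
  ext_right f := by
    let j := (shiftFunctorCompIsoId C (1 : ℤ) (-1) (by lia)).app S
    apply (shiftFunctor C (-1 : ℤ)).map_injective
    rw [Functor.map_zero, ← cancel_mono j.hom, zero_comp]
    exact hTS.eq_zero (-1) (by lia) _

namespace IsSimplePair

variable (h : IsSimplePair A₀ S T)

include h

lemma prop_of_isExtension (hE : IsExtension S T E) : A₀.prop E := by
  obtain ⟨i, p, δ, hδ, hT⟩ := hE.exists_triangle
  exact A₀.prop_of_distTriang hT h.right h.left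

lemma from_isExtension_eq_zero (hE : IsExtension S T E) (f : E ⟶ T) : f = 0 := by
  obtain ⟨i, p, δ, hδ, hT⟩ := hE.exists_triangle
  obtain h0 | h0 := h.brick_right (i ≫ f)
  · obtain ⟨u, hu⟩ : ∃ u : S ⟶ T, f = p ≫ u := Triangle.yoneda_exact₂ _ hT f h0
    rw [hu, h.hom_left u, comp_zero]
  · have h1 : δ ≫ i⟦(1 : ℤ)⟧' = 0 := comp_distTriang_mor_zero₃₁ _ hT
    have h2 : i⟦(1 : ℤ)⟧' ≫ (f ≫ inv (i ≫ f))⟦(1 : ℤ)⟧' = 𝟙 _ := by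
      rw [← Functor.map_comp, ← Category.assoc, IsIso.hom_inv_id, CategoryTheory.Functor.map_id]
    exact absurd (by rw [← Category.comp_id δ, ← h2, ← Category.assoc, h1, zero_comp]) hδ

lemma to_isExtension_eq_zero (hE : IsExtension S T E) (f : S ⟶ E) : f = 0 := by
  obtain ⟨i, p, δ, hδ, hT⟩ := hE.exists_triangle
  obtain h0 | h0 := h.brick_left (f ≫ p)
  · obtain ⟨u, hu⟩ : ∃ u : S ⟶ T, f = u ≫ i := Triangle.coyoneda_exact₂ _ hT f h0
    rw [hu, h.hom_left u, zero_comp]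
  · have h1 : p ≫ δ = 0 := comp_distTriang_mor_zero₂₃ _ hT
    exact absurd (by
      rw [← Category.id_comp δ, ← IsIso.inv_hom_id (f ≫ p), Category.assoc, Category.assoc, h1,
        comp_zero, comp_zero]) hδ

lemma exists_iso_comp_mor₁ {i : T ⟶ E} {p : E ⟶ S} {δ : S ⟶ T⟦(1 : ℤ)⟧}
    (hT : Triangle.mk i p δ ∈ distTriang C) (v : T ⟶ E) (hv : v ≠ 0) :
    ∃ (a : T ≅ T) (b : E ≅ E), v ≫ b.hom = a.hom ≫ i := by
  obtain ⟨u, hu⟩ : ∃ u : T ⟶ T, v = u ≫ i :=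
    Triangle.coyoneda_exact₂ _ hT v (h.hom_right _)
  have : IsIso u := (h.brick_right u).resolve_left fun h0 => hv (by rw [hu, h0, zero_comp])
  exact ⟨asIso u, Iso.refl _, (Category.comp_id _).trans hu⟩

lemma exists_iso_comp_mor₂ {i : T ⟶ E} {p : E ⟶ S} {δ : S ⟶ T⟦(1 : ℤ)⟧}
    (hT : Triangle.mk i p δ ∈ distTriang C) (v : E ⟶ S) (hv : v ≠ 0) :
    ∃ (a : E ≅ E) (b : S ≅ S), v ≫ b.hom = a.hom ≫ p := by
  obtain ⟨u, hu⟩ : ∃ u : S ⟶ S, v = p ≫ u :=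
    Triangle.yoneda_exact₂ _ hT v (h.hom_right _)
  have : IsIso u := (h.brick_left u).resolve_left fun h0 => hv (by rw [hu, h0, comp_zero])
  exact ⟨Iso.refl _, (asIso u).symm, by simp [hu]⟩

/-- The hearts adjacent to a heart of type `A₂`. -/
lemma prop_of_adj (hE : IsExtension S T E) (hB : (exchangeGraph C).Adj A₀ B) :
    (B.prop (T⟦(1 : ℤ)⟧) ∧ B.prop E) ∨ (B.prop E ∧ B.prop (S⟦(-1 : ℤ)⟧)) ∨
      (B.prop T ∧ B.prop (S⟦(1 : ℤ)⟧)) ∨ (B.prop (T⟦(-1 : ℤ)⟧) ∧ B.prop S) := by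
  obtain ⟨W, rfl | rfl, hW | hW⟩ := h.exists_containsTilt hB
  · exact Or.inr (Or.inl ⟨hW.prop _ (h.prop_of_isExtension hE) (h.to_isExtension_eq_zero hE),
      hW.shift⟩)
  · exact Or.inr (Or.inr (Or.inl ⟨hW.prop _ h.right h.hom_right, hW.shift⟩))
  · exact Or.inr (Or.inr (Or.inr ⟨hW.shift, hW.prop _ h.left h.hom_right⟩))
  · exact Or.inl ⟨hW.shift, hW.prop _ (h.prop_of_isExtension hE) (h.from_isExtension_eq_zero hE)⟩

/-- A heart is determined by its simple objects. -/
lemma smul_eq {g : AutD C} {X Y : C} (hX : Acts g S X) (hY : Acts g T Y) (hX' : B.prop X)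
    (hY' : B.prop Y) : g • A₀ = B := by
  obtain ⟨e, rfl⟩ := Acts.exists_rep g
  obtain ⟨i⟩ := hX.nonempty_iso
  obtain ⟨j⟩ := hY.nonempty_iso
  have := additive_of_isExact e.exact
  refine Heart.eq_of_le fun Z hZ => B.prop_of_iso (e.equiv.counitIso.app Z) ?_
  obtain ⟨_, _, _, _, _, hT, h₁, h₃⟩ := extensionProduct_map e.exact
    (fun X hX => B.prop_copies (B.prop_of_iso j.symm hY') (copies_map hX e.equiv.functor))
    (fun X hX => B.prop_copies (B.prop_of_iso i.symm hX') (copies_map hX e.equiv.functor))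
    (h.le _ hZ)
  exact B.prop_of_distTriang hT h₁ h₃

/-- An autoequivalence which fixes a heart of type `A₂` fixes its simple objects. -/
lemma acts_of_smul_eq {k : AutD C} (hk : k • A₀ = A₀) : Acts k S S ∧ Acts k T T := by
  obtain ⟨e, rfl⟩ := Acts.exists_rep k
  have hk' : A₀.prop.inverseImage e.equiv.inverse = A₀.prop := congrArg Heart.prop hk
  have key (P : ObjectProperty C) (hP : P = A₀.prop) (X : P.FullSubcategory) (hX : Simple X) :
      ∃ W, (W = S ∨ W = T) ∧ Nonempty (X.obj ≅ W) := by
    subst hP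
    exact h.nonempty_iso_of_simple hX
  have key' (W : C) (hW : W = S ∨ W = T) :
      Nonempty (e.equiv.functor.obj W ≅ S) ∨ Nonempty (e.equiv.functor.obj W ≅ T) := by
    have hs : Simple (⟨W, h.prop_of_eq hW⟩ : A₀.prop.FullSubcategory) := h.simple hW
    obtain ⟨W, rfl | rfl, hW⟩ := key _ hk' _ (simple_inverseImage hs e.exact
      (A₀.prop_of_iso (e.equiv.unitIso.app W) (h.prop_of_eq hW)))
    exacts [Or.inl hW, Or.inr hW]
  have := additive_of_isExact e.exact
  have hne (i : e.equiv.functor.obj S ≅ e.equiv.functor.obj T) : False := by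
    refine h.not_isZero_left ((IsZero.iff_id_eq_zero _).2 ?_)
    rw [← (e.equiv.functor.preimageIso i).hom_inv_id, h.hom_left (e.equiv.functor.preimageIso i).hom, zero_comp]
  obtain hi | hi := key' S (Or.inl rfl) <;> obtain hj | hj := key' T (Or.inr rfl) <;>
    obtain ⟨i⟩ := hi <;> obtain ⟨j⟩ := hj
  · exact (hne (i ≪≫ j.symm)).elim
  · exact ⟨⟨e, rfl, ⟨i⟩⟩, ⟨e, rfl, ⟨j⟩⟩⟩
  · obtain ⟨f, hf⟩ := h.exists_ext
    obtain ⟨l⟩ := nonempty_map_shift e.exact 1 T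
    refine absurd (e.equiv.functor.map_injective ?_) hf
    rw [Functor.map_zero, ← cancel_epi i.inv,
      ← cancel_mono (l ≪≫ (shiftFunctor C (1 : ℤ)).mapIso j).hom, h.ext_right ((i.inv ≫ e.equiv.functor.map f) ≫ _), comp_zero, zero_comp]
  · exact (hne (i ≪≫ j.symm)).elim

lemma acts_isExtension (hST : IsHomLine S T (-1)) (hE : IsExtension S T E) {k : AutD C}
    (hS : Acts k S S) (hT : Acts k T T) : Acts k E E := by
  obtain ⟨f, i, δ, hf, hE⟩ := hE
  refine (Acts.cone (n := 0) hE hE (hS.shift (-1)).shift_zero hT.shift_zero hf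
    fun v hv => ?_).of_shift_zero
  obtain ⟨c, hc⟩ := exists_smul_eq hST.finrank hv f
  have hc0 : c ≠ 0 := fun h0 => hf (by rw [← hc, h0, zero_smul])
  exact ⟨Iso.refl _, ⟨c • 𝟙 T, c⁻¹ • 𝟙 T, by simp [smul_smul, hc0], by simp [smul_smul, hc0]⟩,
    by simp [hc]⟩

lemma exists_acts (hST : IsHomLine S T (-1)) (hTS : IsHomLine T S (-2)) (hS : IsSpherical S)
    (hT : IsSpherical T) {φS φT : AutD C} (hφS : φS.IsTwist S) (hφT : φT.IsTwist T) :
    ∃ E, IsExtension S T E ∧ Acts φS S (S⟦(-2 : ℤ)⟧) ∧ Acts φS T E ∧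
      Acts (φS * φT) S (T⟦(-1 : ℤ)⟧) ∧ Acts (φS * φT) T (E⟦(-2 : ℤ)⟧) ∧
      Acts (φS * φT) E (S⟦(-2 : ℤ)⟧) := by
  obtain ⟨eS, rfl, hφS⟩ := hφS
  obtain ⟨eT, rfl, hφT⟩ := hφT
  obtain ⟨f, i, δ, hf, hTf⟩ := hφS.exists_triangle hST
  obtain ⟨f', i', δ', hf', hTf'⟩ := hφT.exists_triangle hTS
  have hE : IsExtension S T (eS.equiv.functor.obj T) := ⟨f, i, δ, hf, hTf⟩
  obtain ⟨i₁, p, δ₁, -, hTp⟩ := hE.exists_triangle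
  have h₁ : Acts eS.toAut S (S⟦(-2 : ℤ)⟧) := ⟨eS, rfl, hφS.nonempty_iso hS⟩
  have h₂ : Acts eS.toAut T (eS.equiv.functor.obj T) := ⟨eS, rfl, ⟨Iso.refl _⟩⟩
  have h₃ : Acts eT.toAut T (T⟦(-2 : ℤ)⟧) := ⟨eT, rfl, hφT.nonempty_iso hT⟩
  have h₄ : Acts eT.toAut S (eT.equiv.functor.obj S) := ⟨eT, rfl, ⟨Iso.refl _⟩⟩
  have h₅ : Acts eS.toAut (eT.equiv.functor.obj S) (T⟦(-1 : ℤ)⟧) :=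
    (Acts.cone (rot_of_distTriang _ hTp) hTf' (h₂.shift (-2)) h₁ hf'
      (h.exists_iso_comp_mor₂ hTp)).of_iso (nonempty_iso_shift_shift T (by lia)).some
  have h₆ : Acts (eS.toAut * eT.toAut) S (T⟦(-1 : ℤ)⟧) := h₅.mul h₄
  have h₇ := (h₂.shift (-2)).mul h₃
  exact ⟨_, hE, h₁, h₂, h₆, h₇, Acts.cone hTp hTf (h₆.shift_shift (-1) (-2) (by lia)) h₇ hf
    (h.exists_iso_comp_mor₁ hTp)⟩

lemma acts_of_adj (hST : IsHomLine S T (-1)) (hTS : IsHomLine T S (-2)) (hS : IsSpherical S)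
    (hT : IsSpherical T) {φS φT σ : AutD C} (hφS : φS.IsTwist S) (hφT : φT.IsTwist T)
    (hσ : σ.IsShift) (hB : (exchangeGraph C).Adj A₀ B) :
    ∃ X Y, B.prop X ∧ B.prop Y ∧
      (∃ g ∈ Subgroup.closure {φS, φT, σ}, Acts g S X ∧ Acts g T Y) ∧
      ∀ k, Acts k S S → Acts k T T → Acts k X X ∧ Acts k Y Y := by
  obtain ⟨E, hE, h₁, h₂, h₃, h₄, h₅⟩ := h.exists_acts hST hTS hS hT hφS hφT
  have hφS' : φS ∈ Subgroup.closure {φS, φT, σ} := Subgroup.subset_closure (by simp)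
  have hφT' : φT ∈ Subgroup.closure {φS, φT, σ} := Subgroup.subset_closure (by simp)
  have hσ' (n : ℕ) : σ ^ n ∈ Subgroup.closure {φS, φT, σ} :=
    pow_mem (Subgroup.subset_closure (by simp)) n
  have hρ := mul_mem hφS' hφT'
  obtain ⟨hX, hY⟩ | ⟨hX, hY⟩ | ⟨hX, hY⟩ | ⟨hX, hY⟩ := h.prop_of_adj hE hB
  · exact ⟨_, _, hX, hY, ⟨_, mul_mem (hσ' 2) hρ, h₃.pow_mul hσ 2 1 (by lia),
      (h₄.pow_mul hσ 2 0 (by lia)).of_shift_zero⟩,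
      fun k hk hk' => ⟨hk'.shift 1, h.acts_isExtension hST hE hk hk'⟩⟩
  · exact ⟨_, _, hX, hY, ⟨_, mul_mem (hσ' 3) (mul_mem hρ hρ),
      ((((h₄.shift_shift (-1) (-3) (by lia)).mul h₃).pow_mul hσ 3 0 (by lia))).of_shift_zero,
      ((h₅.shift_shift (-2) (-4) (by lia)).mul h₄).pow_mul hσ 3 (-1) (by lia)⟩,
      fun k hk hk' => ⟨h.acts_isExtension hST hE hk hk', hk.shift (-1)⟩⟩
  · exact ⟨_, _, hX, hY, ⟨_, mul_mem (hσ' 3) (mul_mem hρ hφS'),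
      (((h₃.shift_shift (-2) (-3) (by lia)).mul h₁).pow_mul hσ 3 0 (by lia)).of_shift_zero,
      (h₅.mul h₂).pow_mul hσ 3 1 (by lia)⟩,
      fun k hk hk' => ⟨hk', hk.shift 1⟩⟩
  · exact ⟨_, _, hX, hY, ⟨_, mul_mem (hσ' 2) (mul_mem hρ hφS'),
      ((h₃.shift_shift (-2) (-3) (by lia)).mul h₁).pow_mul hσ 2 (-1) (by lia),
      ((h₅.mul h₂).pow_mul hσ 2 0 (by lia)).of_shift_zero⟩,
      fun k hk hk' => ⟨hk'.shift (-1), hk⟩⟩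

end IsSimplePair

section

variable {H : Subgroup (AutD C)}

lemma exists_smul_of_mem_EG0
    (hH : ∀ B, (exchangeGraph C).Adj A₀ B → ∃ g ∈ H, B = g • A₀) {A : Heart C} (hA : A ∈ EG0 A₀) :
    ∃ g ∈ H, A = g • A₀ := by
  obtain ⟨w⟩ : (exchangeGraph C).Reachable A₀ A := hA
  have key {A B : Heart C} (w : (exchangeGraph C).Walk A B) (hw : ∃ g ∈ H, A = g • A₀) :
      ∃ g ∈ H, B = g • A₀ := by
    induction w with
    | nil => exact hw
    | cons hadj _ ih =>
      obtain ⟨g, hg, rfl⟩ := hw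
      have h1 := exchangeGraph_adj_smul g⁻¹ hadj
      rw [inv_smul_smul] at h1
      obtain ⟨g', hg', h2⟩ := hH _ h1
      exact ih ⟨g * g', mul_mem hg hg', by rw [mul_smul, ← h2, smul_inv_smul]⟩
  exact key w ⟨1, one_mem _, (one_smul _ _).symm⟩

lemma mem_preserving {g : AutD C} (hg : g • A₀ ∈ EG0 A₀) : g ∈ preserving A₀ := by
  have hg' : (exchangeGraph C).Reachable A₀ (g • A₀) := hg
  intro A
  constructor
  · intro hA
    have h1 := reachable_smul g⁻¹ (hg'.symm.trans hA)
    rwa [inv_smul_smul, inv_smul_smul] at h1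
  · intro hA
    exact hg'.trans (reachable_smul g hA)

lemma smul_eq_of_mem_EG0 (hH : ∀ B, (exchangeGraph C).Adj A₀ B → ∃ g ∈ H, B = g • A₀)
    (hfix : ∀ k : AutD C, k • A₀ = A₀ → ∀ B, (exchangeGraph C).Adj A₀ B → k • B = B)
    {k : AutD C} {A B : Heart C} (hA : A ∈ EG0 A₀) (hk : k • A = A) (hB : B ∈ EG0 A₀) :
    k • B = B := by
  have hA' : (exchangeGraph C).Reachable A₀ A := hA
  obtain ⟨w⟩ := hA'.symm.trans hB
  clear hB hA'
  induction w with
  | nil => exact hk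
  | @cons A A' _ hadj _ ih =>
    have hA' : A' ∈ EG0 A₀ := SimpleGraph.Reachable.trans hA hadj.reachable
    refine ih hA' ?_
    obtain ⟨g, -, rfl⟩ := exists_smul_of_mem_EG0 hH hA
    have h1 := exchangeGraph_adj_smul g⁻¹ hadj
    rw [inv_smul_smul] at h1
    have h2 := hfix (g⁻¹ * k * g) (by rw [mul_smul, mul_smul, hk, inv_smul_smul]) _ h1
    rw [mul_smul, mul_smul, smul_inv_smul] at h2
    exact MulAction.injective g⁻¹ h2

lemma existsUnique_smul_eq (hH : ∀ B, (exchangeGraph C).Adj A₀ B → ∃ g ∈ H, B = g • A₀)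
    (hfix : ∀ k : AutD C, k • A₀ = A₀ → ∀ B, (exchangeGraph C).Adj A₀ B → k • B = B)
    (A B : EG0 A₀) : ∃! g : Aut0 A₀, g • A = B := by
  have hp {A : Heart C} (hA : A ∈ EG0 A₀) : ∃ g ∈ preserving A₀, A = g • A₀ := by
    obtain ⟨g, -, rfl⟩ := exists_smul_of_mem_EG0 hH hA
    exact ⟨g, mem_preserving hA, rfl⟩
  obtain ⟨g, hg, hgA⟩ := hp A.2
  obtain ⟨g', hg', hgB⟩ := hp B.2
  let k : preserving A₀ := ⟨g', hg'⟩ * ⟨g, hg⟩⁻¹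
  have hk : k • A = B := Subtype.ext (by
    change (g' * g⁻¹) • A.1 = B.1
    rw [hgA, hgB, mul_smul, inv_smul_smul])
  refine ⟨(k : Aut0 A₀), hk, ?_⟩
  intro q hq
  induction q using QuotientGroup.induction_on with
  | H q =>
    have hq' : q • A = B := hq
    symm
    rw [QuotientGroup.eq, MonoidHom.mem_ker]
    refine Equiv.ext fun X => Subtype.ext ?_
    refine smul_eq_of_mem_EG0 (k := k⁻¹ * q) hH hfix A.2 ?_ X.2
    have h1 : (k⁻¹ * q) • A = A := by rw [mul_smul, hq', ← hk, inv_smul_smul]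
    exact congrArg Subtype.val h1

end

/-- The exchange graph of a heart of type `A₂`. -/
theorem IsSimplePair.exchangeGraph_torsor (h : IsSimplePair A₀ S T) (hST : IsHomLine S T (-1))
    (hTS : IsHomLine T S (-2)) (hS : IsSpherical S) (hT : IsSpherical T)
    (hex : ∃ φS φT σ : AutD C, φS.IsTwist S ∧ φT.IsTwist T ∧ σ.IsShift) :
    (∀ φS φT σ : AutD C, φS.IsTwist S → φT.IsTwist T → σ.IsShift →
      ∀ A ∈ EG0 A₀, ∃ g ∈ Subgroup.closure {φS, φT, σ}, A = g • A₀) ∧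
    Nonempty (EG0 A₀) ∧ ∀ A B : EG0 A₀, ∃! g : Aut0 A₀, g • A = B := by
  have key {φS φT σ : AutD C} (hφS : φS.IsTwist S) (hφT : φT.IsTwist T) (hσ : σ.IsShift)
      (B : Heart C) (hB : (exchangeGraph C).Adj A₀ B) :
      ∃ g ∈ Subgroup.closure {φS, φT, σ}, B = g • A₀ := by
    obtain ⟨X, Y, hX, hY, ⟨g, hg, h₁, h₂⟩, -⟩ := h.acts_of_adj hST hTS hS hT hφS hφT hσ hB
    exact ⟨g, hg, (h.smul_eq h₁ h₂ hX hY).symm⟩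
  refine ⟨fun φS φT σ hφS hφT hσ A hA => exists_smul_of_mem_EG0 (key hφS hφT hσ) hA,
    ⟨⟨A₀, SimpleGraph.Reachable.refl _⟩⟩, ?_⟩
  obtain ⟨φS, φT, σ, hφS, hφT, hσ⟩ := hex
  refine existsUnique_smul_eq (key hφS hφT hσ) fun k hk B hB => ?_
  obtain ⟨X, Y, hX, hY, ⟨g, hg, h₁, h₂⟩, h₃⟩ := h.acts_of_adj hST hTS hS hT hφS hφT hσ hB
  obtain ⟨hkS, hkT⟩ := h.acts_of_smul_eq hk
  obtain ⟨hkX, hkY⟩ := h₃ k hkS hkT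
  rw [← h.smul_eq h₁ h₂ hX hY, ← mul_smul, h.smul_eq (hkX.mul h₁) (hkY.mul h₂) hX hY,
    h.smul_eq h₁ h₂ hX hY]

end

section

open Triangulated

variable (C : Type*) [Category C] [Preadditive C] [HasZeroObject C] [HasShift C ℤ]
  [∀ n : ℤ, (shiftFunctor C n).Additive] [Pretriangulated C]

/-- The commutation of the shift with the shifts, up to a sign. -/
noncomputable def shiftCommShiftIso (n : ℤ) :
    shiftFunctor C n ⋙ shiftFunctor C (1 : ℤ) ≅ shiftFunctor C (1 : ℤ) ⋙ shiftFunctor C n where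
  hom := n.negOnePow • (shiftFunctorComm C 1 n).inv
  inv := n.negOnePow • (shiftFunctorComm C 1 n).hom
  hom_inv_id := by
    rw [Linear.units_smul_comp, Linear.comp_units_smul, smul_smul, Int.units_mul_self,
      one_smul, Iso.inv_hom_id]
  inv_hom_id := by
    rw [Linear.units_smul_comp, Linear.comp_units_smul, smul_smul, Int.units_mul_self,
      one_smul, Iso.hom_inv_id]

lemma shiftCommShiftIso_hom_app (n : ℤ) (X : C) :
    (shiftCommShiftIso C n).hom.app X = n.negOnePow • (shiftFunctorComm C 1 n).inv.app X :=
  rfl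

lemma shiftCommShiftIso_inv_app (n : ℤ) (X : C) :
    (shiftCommShiftIso C n).inv.app X = n.negOnePow • (shiftFunctorComm C 1 n).hom.app X :=
  rfl

/-- The shift functor commutes with the shifts, up to the sign which makes it exact. -/
@[reducible]
noncomputable def shiftCommShift : (shiftFunctor C (1 : ℤ)).CommShift ℤ where
  commShiftIso := shiftCommShiftIso C
  commShiftIso_zero := by
    refine Iso.ext_inv (NatTrans.ext (funext fun X => ?_))
    rw [shiftCommShiftIso_inv_app, Functor.CommShift.isoZero_inv_app, Int.negOnePow_zero, one_smul]
    exact shiftFunctorComm_zero_hom_app (C := C) (X := X) (1 : ℤ)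
  commShiftIso_add a b := by
    refine Iso.ext_inv (NatTrans.ext (funext fun X => ?_))
    have h := shiftFunctorComm_hom_app_comp_shift_shiftFunctorAdd_hom_app (1 : ℤ) a b X
    have h' : (shiftFunctorComm C (1 : ℤ) (a + b)).hom.app X =
        (shiftFunctorAdd C a b).hom.app (X⟦(1 : ℤ)⟧) ≫
        ((shiftFunctorComm C (1 : ℤ) a).hom.app X)⟦b⟧' ≫
        (shiftFunctorComm C (1 : ℤ) b).hom.app (X⟦a⟧) ≫
        ((shiftFunctorAdd C a b).inv.app X)⟦(1 : ℤ)⟧' := by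
      rw [← cancel_mono (((shiftFunctorAdd C a b).hom.app X)⟦(1 : ℤ)⟧'), h]
      simp only [Category.assoc, ← Functor.map_comp, Iso.inv_hom_id_app]
      simp
    rw [Functor.CommShift.isoAdd_inv_app, shiftCommShiftIso_inv_app, shiftCommShiftIso_inv_app,
      shiftCommShiftIso_inv_app, h', Functor.map_units_smul, Linear.units_smul_comp,
      Linear.units_smul_comp, Linear.comp_units_smul, Linear.comp_units_smul,
      Linear.comp_units_smul, smul_smul, Int.negOnePow_add, mul_comm]

lemma isExact_shiftFunctor : IsExact (shiftFunctor C (1 : ℤ)) := by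
  let := shiftCommShift C
  refine ⟨this, ⟨fun T hT => ?_⟩⟩
  let e : T.obj₂⟦(1 : ℤ)⟧ ≅ T.obj₂⟦(1 : ℤ)⟧ :=
    { hom := -𝟙 _, inv := -𝟙 _, hom_inv_id := by simp, inv_hom_id := by simp }
  refine isomorphic_distinguished _ (Triangle.shift_distinguished _ hT 1) _
    (Triangle.isoMk _ _ (Iso.refl _) e (Iso.refl _) ?_ ?_ ?_)
  · change T.mor₁⟦(1 : ℤ)⟧' ≫ (-𝟙 _) = 𝟙 _ ≫ ((1 : ℤ).negOnePow • T.mor₁⟦(1 : ℤ)⟧')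
    simp
  · change T.mor₂⟦(1 : ℤ)⟧' ≫ 𝟙 _ = (-𝟙 _) ≫ ((1 : ℤ).negOnePow • T.mor₂⟦(1 : ℤ)⟧')
    simp
  · change (T.mor₃⟦(1 : ℤ)⟧' ≫ (shiftCommShiftIso C 1).hom.app T.obj₁) ≫ (𝟙 _)⟦(1 : ℤ)⟧' =
      𝟙 _ ≫ ((1 : ℤ).negOnePow • T.mor₃⟦(1 : ℤ)⟧' ≫ (shiftFunctorComm C 1 1).hom.app T.obj₁)
    rw [CategoryTheory.Functor.map_id]
    refine (Category.comp_id _).trans (Eq.trans ?_ (Category.id_comp _).symm)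
    rw [shiftCommShiftIso_hom_app, Linear.comp_units_smul, shiftFunctorComm_eq_refl]
    rfl

end

lemma AutD.exists_isShift {C : Type*} [Category C] [Preadditive C] [HasZeroObject C] [HasShift C ℤ]
    [∀ n : ℤ, (shiftFunctor C n).Additive] [Pretriangulated C] [Linear ℂ C]
    [(shiftFunctor C (1 : ℤ)).Linear ℂ] : ∃ σ : AutD C, σ.IsShift :=
  ⟨ExactAutoequivalence.toAut ⟨shiftEquiv C (1 : ℤ), isExact_shiftFunctor C, ‹_›⟩, _, rfl,
    ⟨Iso.refl _⟩⟩

namespace Ginzburg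

lemma isSpherical_simple (i : Fin 2) : IsSpherical (simple i) where
  eq_zero _ h0 h3 f := simple_hom_eq_zero_self i h0 h3 f
  finrank_zero := finrank_simple_self_zero i
  finrank_neg_three := finrank_simple_self_neg_three i

lemma isHomLine_S_T : IsHomLine S T (-1) where
  eq_zero _ hn f := simple_hom_eq_zero (by decide) (by simpa [α, Gen.deg] using hn) f
  finrank := finrank_simple (i := 0) (by decide)

lemma isHomLine_T_S : IsHomLine T S (-2) where
  eq_zero _ hn f := simple_hom_eq_zero (by decide) (by simpa [α, Gen.deg] using hn) f
  finrank := finrank_simple (i := 1) (by decide)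

lemma standardHeart_simple (i : Fin 2) : standardHeart (simple i) := by
  refine ⟨simpleModule i, ⟨Iso.refl _⟩, fun n hn m hm _ => ⟨0, ?_⟩⟩
  change m ∈ simpleGr n at hm
  rw [simpleGr, if_neg hn, Submodule.mem_bot] at hm
  rw [hm, map_zero]

instance : (shiftFunctor (DGDerivedCategory dgAlgebra) (1 : ℤ)).Linear ℂ :=
  Shift.linear_of_localization ℂ (DGDerivedCategory.Qh dgAlgebra)
    (DGHomotopyCategory.acyclic dgAlgebra).trW 1

instance : (shiftFunctor Dfd (1 : ℤ)).Linear ℂ where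
  map_smul {X Y} f c := by
    let L := (DGDerivedCategory.finiteDimensional dgAlgebra).ι
    apply L.map_injective
    rw [← cancel_mono ((L.commShiftIso (1 : ℤ)).hom.app Y), L.map_smul, Linear.smul_comp,
      L.commShiftIso_hom_naturality, L.commShiftIso_hom_naturality, L.map_smul, Functor.map_smul,
      Linear.comp_smul]

end Ginzburg

theorem mainTheorem5 :
    ∃ A₀ : Heart Ginzburg.Dfd, A₀.prop = Ginzburg.standardHeart ∧
      (∃ φS φT σ : AutD Ginzburg.Dfd,
        AutD.IsTwist Ginzburg.S φS ∧ AutD.IsTwist Ginzburg.T φT ∧ AutD.IsShift σ) ∧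
      (∀ φS φT σ : AutD Ginzburg.Dfd,
        AutD.IsTwist Ginzburg.S φS → AutD.IsTwist Ginzburg.T φT → AutD.IsShift σ →
        ∀ A ∈ EG0 A₀, ∃ g ∈ Subgroup.closure {φS, φT, σ}, A = g • A₀) ∧
      Nonempty (EG0 A₀) ∧ ∀ A B : EG0 A₀, ∃! g : Aut0 A₀, g • A = B := by
  have h01 : (0 : Fin 2) ≠ 1 := by decide
  obtain ⟨σ, hσ⟩ := AutD.exists_isShift (C := Ginzburg.Dfd)
  have hex : ∃ φS φT σ : AutD Ginzburg.Dfd,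
      AutD.IsTwist Ginzburg.S φS ∧ AutD.IsTwist Ginzburg.T φT ∧ AutD.IsShift σ :=
    ⟨(Ginzburg.twist h01).toAut, (Ginzburg.twist h01.symm).toAut, σ,
      ⟨_, rfl, Ginzburg.isTwist_twist h01⟩, ⟨_, rfl, Ginzburg.isTwist_twist h01.symm⟩, hσ⟩
  refine ⟨⟨_, Ginzburg.isHeart_standardHeart⟩, rfl, hex, ?_⟩
  exact (isSimplePair_of_isSpherical (Ginzburg.isSpherical_simple 0) (Ginzburg.isSpherical_simple 1)
    Ginzburg.isHomLine_S_T Ginzburg.isHomLine_T_S (Ginzburg.standardHeart_simple 0)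
    (Ginzburg.standardHeart_simple 1) Ginzburg.standardHeart_le).exchangeGraph_torsor
    Ginzburg.isHomLine_S_T Ginzburg.isHomLine_T_S (Ginzburg.isSpherical_simple 0)
    (Ginzburg.isSpherical_simple 1) hex
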